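/- **Setting.** Let $G$ be a graded Lie group: a simply connected Lie group whose Lie algebra $\mathfrak g$ has a vector space grading $\mathfrak g=\bigoplus_{j\ge 1}\mathfrak g_j$ with $[\mathfrak g_j,\mathfrak g_k]\subseteq\mathfrak g_{j+k}$. Identify $G$ with $\mathbb R^n$ by exponential coordinates with respect to a homogeneous basis $X_1,\dots,X_n$ of degrees $q_1,\dots,q_n\in\mathbb N_{\ge1}$, and let $\alpha_\lambda(v)=(\lambda^{q_1}v_1,\dots,\lambda^{q_n}v_n)$; the unit is $0$, and $v^{-1}=-v$. Let $\mathsf X=\mathbb R^d$ with dilations $\beta_\lambda(x)=(\lambda^{r_1}x_1,\dots,\lambda^{r_d}x_d)$, $r_j\in\mathbb N_{\ge1}$. Let $\theta^1$ be a *Shubin action*: a right action $(x,v)\mapsto\theta^1_v(x)$ of $G$ on $\mathsf X$ which is polynomial in $(x,v)$ and such that $(x,t,v)\mapsto\theta^t_v(x)$, where $\theta^t_v=\beta_t\circ\theta^1_{\alpha_t(v)}\circ\beta_{t^{-1}}$ for $t\ne0$, extends to a smooth map on $\mathsf X\times\mathbb R\times G$. Each $\theta^t$, $t\in\mathbb R$,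 is then an action; let $\mathsf X\rtimes^tG$ be its action groupoid, with arrow space $\mathsf X\times G$, range $r(x,v)=x$, source $\theta^t_v(x)$ and inversion $I(x,v)=(\theta^t_v(x),v^{-1})$. Let $\Gamma=(\mathsf X\times\mathbb R)\rtimes G$ be the action groupoid of $((x,t),v)\mapsto(\theta^t_v(x),t)$. **Fibred distributions.** Let $\mathcal O_M(\mathbb R^k)$ be the space of slowly increasing functions (smooth $\varphi\colon\mathbb R^k\to\mathbb C$ such that $f\,\partial^b\varphi$ is bounded for every Schwartz function $f$ and every multi-index $b$), with the seminorms $\sup|f\,\partial^b\varphi|$. For an action groupoid $\mathcal G=N\rtimes G$ with $N=\mathbb R^k$, let $\mathcal O_r'(\mathcal G)$ be the space of continuous linear maps $u\colon\mathcal O_M(N\times G)\to\mathcal O_M(N)$ with $u(r^*f\cdot\varphi)=f\cdot u(\varphi)$ for all $f\in\mathcal O_M(N)$. Schwartz functions embed as $f\mapsto u_f$, $u_f(\varphi)(x)=\int_Gf(x,v)\varphi(x,v)\,dv$; write $\mathcal S(\mathcal G)\subseteq\mathcal O_r'(\mathcal G)$ for the image. * *Convolution*: $(u*w)(\varphi)=u(g)$,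 where $g(x,a)=w\big((y,v)\mapsto\varphi(x,av)\big)(x\cdot a)$. * *Transpose and adjoint*: for $u\in\mathcal O'_r(\mathcal G)$ let $\int_r u$ be the distribution $\varphi\mapsto\int_Nu(\varphi)(x)\,dx$ on $N\times G$, where $\varphi$ is a test function. Then $u^t,u^*\in\mathcal O_r'(\mathcal G)$ are, if they exist, the elements with $\int_r(u^t)=I_*\int_ru$ and $\int_r(u^*)=\overline{I_*\int_ru}$. They are unique. * *Evaluation*: for $\mathbb P\in\mathcal O'_r(\Gamma)$ and $t\in\mathbb R$, $\mathbb P_t\in\mathcal O_r'(\mathsf X\rtimes^tG)$ is given by $\mathbb P_t(\varphi)(x)=\mathbb P\big((y,s,v)\mapsto\varphi(y,v)\big)(x,t)$. **Calculus.** For $\lambda>0$ put $\tau_\lambda(x,t,v)=(\beta_{\lambda^{-1}}(x),\lambda^{-1}t,\alpha_\lambda(v))$ and $(\tau_{\lambda*}\mathbb P)(\varphi)(x,t)=\mathbb P(\varphi\circ\tau_\lambda)(\beta_\lambda(x),\lambda t)$; omitting $t$ gives $\tau_{\lambda*}$ on $\mathcal O_r'(\mathsf X\rtimes^0G)$. For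 $m\in\mathbb R$ let $$\mathbb\Psi^m_\Gamma=\{\mathbb P\in\mathcal O'_r(\Gamma):\lambda^m\mathbb P-\tau_{\lambda*}\mathbb P\in\mathcal S(\Gamma)\ \ \forall\lambda>0\},\qquad\Psi_\Gamma^m=\{\mathbb P_1:\mathbb P\in\mathbb\Psi_\Gamma^m\}\subseteq\mathcal O_r'(\mathsf X\rtimes^1G),$$ $$\mathrm{Ess}^m_\Gamma=\{u\in\mathcal O_r'(\mathsf X\rtimes^0G):\lambda^mu-\tau_{\lambda*}u\in\mathcal S(\mathsf X\rtimes^0G)\ \ \forall\lambda>0\},\qquad\Sigma_\Gamma^m=\mathrm{Ess}_\Gamma^m/\mathcal S(\mathsf X\rtimes^0G).$$ The principal cosymbol of $P=\mathbb P_1\in\Psi^m_\Gamma$ is $\sigma_m(P)=[\mathbb P_0]\in\Sigma^m_\Gamma$, for any $\mathbb P\in\mathbb\Psi_\Gamma^m$ with $\mathbb P_1=P$. On cosymbols, $[u]*[w]=[u*w]$, $[u]^*=[u^*]$ and $[u]^t=[u^t]$, with the operations of $\mathsf X\rtimes^0G$. **Theorem.** Let $\ell,m\in\mathbb R$. 0.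 $\sigma_m\colon\Psi_\Gamma^m\to\Sigma_\Gamma^m$ is well defined, i.e. independent of the extension $\mathbb P$. 1. If $P\in\Psi_\Gamma^\ell$ and $Q\in\Psi_\Gamma^m$, then $P*Q\in\Psi_\Gamma^{\ell+m}$ and $\sigma_{\ell+m}(P*Q)=\sigma_\ell(P)*\sigma_m(Q)$. 2. If $P\in\Psi_\Gamma^m$, then $P^*$ and $P^t$ exist and lie in $\Psi_\Gamma^m$, and $\sigma_m(P^*)=\sigma_m(P)^*$ and $\sigma_m(P^t)=\sigma_m(P)^t$. In 1 and 2, the operations on the cosymbols concerned are well defined: for all representatives $u,w\in\mathrm{Ess}$ of these cosymbols, $u*w$, $u^*$ and $u^t$ exist, lie in $\mathrm{Ess}$ of the respective order, and their classes do not depend on the representatives. -/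

import Mathlib

open MeasureTheory
open scoped ContDiff SchwartzMap Convolution

namespace Shubin

/-! ### Slowly increasing functions -/

section Domination

variable {E : Type} [NormedAddCommGroup E] [NormedSpace ℝ E]

/-- Convolutions of a rapidly decreasing function with a test function decrease rapidly,
together with all derivatives. -/
lemma exists_bound_convolution [MeasurableSpace E] [BorelSpace E] [FiniteDimensional ℝ E]
    (μ : Measure E) [μ.IsAddHaarMeasure] {H : E → ℝ} (hH : LocallyIntegrable H μ)
    (hdec : ∀ j : ℕ, ∃ C : ℝ, ∀ t, (1 + ‖t‖) ^ j * |H t| ≤ C) (k : ℕ) :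
    ∀ {F : Type} [NormedAddCommGroup F] [NormedSpace ℝ F] [CompleteSpace F] (ρ : E → F),
      ContDiff ℝ ∞ ρ → HasCompactSupport ρ → Function.support ρ ⊆ Metric.closedBall 0 1 →
      ∀ j : ℕ, ∃ C : ℝ, ∀ x, ‖x‖ ^ j *
        ‖iteratedFDeriv ℝ k (H ⋆[ContinuousLinearMap.lsmul ℝ ℝ, μ] ρ) x‖ ≤ C := by
  induction k with
  | zero =>
    intro F _ _ _ ρ hρ hc hs j
    obtain ⟨C, hC⟩ := hdec j
    have hint : Integrable (fun t => ‖ρ t‖) μ := (hρ.continuous.integrable_of_hasCompactSupport hc).norm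
    refine ⟨∫ t, C * ‖ρ t‖ ∂μ, fun x => ?_⟩
    rw [norm_iteratedFDeriv_zero, convolution_def]
    have h1 : ‖x‖ ^ j * ‖∫ t, (ContinuousLinearMap.lsmul ℝ ℝ) (H t) (ρ (x - t)) ∂μ‖
        = ‖∫ t, ‖x‖ ^ j • (ContinuousLinearMap.lsmul ℝ ℝ) (H t) (ρ (x - t)) ∂μ‖ := by
      rw [integral_smul, norm_smul]; simp
    rw [h1, ← integral_sub_left_eq_self (fun t => C * ‖ρ t‖) μ x]
    refine norm_integral_le_of_norm_le ((hint.const_mul C).comp_sub_left x) ?_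
    refine Filter.Eventually.of_forall fun t => ?_
    simp only [ContinuousLinearMap.lsmul_apply, norm_smul, norm_pow, Real.norm_eq_abs]
    by_cases ht : x - t ∈ Function.support ρ
    · have h2 := hs ht
      rw [mem_closedBall_zero_iff] at h2
      have h3 : ‖x‖ ≤ 1 + ‖t‖ := by
        have := norm_add_le (x - t) t
        rw [sub_add_cancel] at this
        linarith
      rw [← mul_assoc]
      refine mul_le_mul_of_nonneg_right (le_trans ?_ (hC t)) (norm_nonneg _)
      rw [abs_norm]
      gcongr
    · rw [Function.notMem_support] at ht
      simp [ht]
  | succ k ih =>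
    intro F _ _ _ ρ hρ hc hs j
    have hd : fderiv ℝ (H ⋆[ContinuousLinearMap.lsmul ℝ ℝ, μ] ρ)
        = H ⋆[ContinuousLinearMap.lsmul ℝ ℝ, μ] (fderiv ℝ ρ) := by
      ext1 x
      exact (hc.hasFDerivAt_convolution_right (ContinuousLinearMap.lsmul ℝ ℝ) hH
        (hρ.of_le (by simp)) x).fderiv
    have hs' : Function.support (fderiv ℝ ρ) ⊆ Metric.closedBall 0 1 :=
      (support_fderiv_subset ℝ).trans (closure_minimal hs Metric.isClosed_closedBall)
    obtain ⟨C, hC⟩ := ih (fderiv ℝ ρ) (hρ.fderiv_right (by simp)) (hc.fderiv ℝ) hs' j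
    refine ⟨C, fun x => ?_⟩
    rw [← norm_iteratedFDeriv_fderiv, hd]
    exact hC x

/-- A rapidly decreasing function is dominated by a Schwartz function. -/
lemma exists_schwartz_dominating [FiniteDimensional ℝ E] {h : E → ℝ} (h0 : ∀ x, 0 ≤ h x)
    (hdec : ∀ j : ℕ, ∃ C : ℝ, ∀ x, (1 + ‖x‖) ^ j * h x ≤ C) :
    ∃ g : 𝓢(E, ℂ), ∀ x, h x ≤ ‖g x‖ := by
  let _ : MeasurableSpace E := borel E
  have _ : BorelSpace E := ⟨rfl⟩
  let μ : Measure E := Measure.addHaar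
  obtain ⟨C0, hC0⟩ := hdec 0
  simp only [pow_zero, one_mul] at hC0
  let S : ℝ → Set ℝ := fun s => insert 0 (h '' {y | s - 1 ≤ ‖y‖})
  let Hr : ℝ → ℝ := fun s => sSup (S s)
  have hbd : ∀ s, BddAbove (S s) := by
    intro s
    refine ⟨max 0 C0, ?_⟩
    rintro _ (rfl | ⟨y, -, rfl⟩)
    · exact le_max_left _ _
    · exact (hC0 y).trans (le_max_right _ _)
  have hanti : Antitone Hr := by
    intro s t hst
    refine csSup_le_csSup (hbd s) ⟨0, Set.mem_insert _ _⟩ ?_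
    refine Set.insert_subset_insert (Set.image_mono ?_)
    intro y hy
    simp only [Set.mem_ofPred_eq] at hy ⊢
    linarith
  have hHr0 : ∀ s, 0 ≤ Hr s := fun s => le_csSup (hbd s) (Set.mem_insert _ _)
  let H : E → ℝ := fun t => Hr ‖t‖
  have hHdec : ∀ j : ℕ, ∃ C : ℝ, ∀ t, (1 + ‖t‖) ^ j * |H t| ≤ C := by
    intro j
    obtain ⟨C, hC⟩ := hdec j
    refine ⟨2 ^ j * max 0 C, fun t => ?_⟩
    rw [abs_of_nonneg (hHr0 _), mul_comm, ← le_div_iff₀ (by positivity)]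
    refine csSup_le ⟨0, Set.mem_insert _ _⟩ ?_
    rintro _ (rfl | ⟨y, hy, rfl⟩)
    · positivity
    · rw [le_div_iff₀ (by positivity)]
      simp only [Set.mem_ofPred_eq] at hy
      calc h y * (1 + ‖t‖) ^ j ≤ h y * (2 * (1 + ‖y‖)) ^ j := by
            have := h0 y
            gcongr
            linarith [norm_nonneg y]
        _ = 2 ^ j * ((1 + ‖y‖) ^ j * h y) := by rw [mul_pow]; ring
        _ ≤ 2 ^ j * max 0 C := by
            gcongr
            exact (hC y).trans (le_max_right _ _)
  have hHmeas : Measurable H := hanti.measurable.comp measurable_norm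
  have hHloc : LocallyIntegrable H μ := by
    have hc : LocallyIntegrable (fun _ : E => Hr 0) μ := locallyIntegrable_const _
    refine hc.mono hHmeas.aestronglyMeasurable (Filter.Eventually.of_forall fun t => ?_)
    rw [Real.norm_of_nonneg (hHr0 _), Real.norm_of_nonneg (hHr0 _)]
    exact hanti (norm_nonneg _)
  let φ : ContDiffBump (0 : E) := ⟨1 / 2, 1, by norm_num, by norm_num⟩
  let ρ : E → ℂ := fun x => (φ.normed μ x : ℂ)
  have hρ : ContDiff ℝ ∞ ρ := Complex.ofRealCLM.contDiff.comp φ.contDiff_normed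
  have hρs : Function.support ρ ⊆ Metric.ball 0 1 := by
    intro x hx
    have h2 : x ∈ Function.support (φ.normed μ) := by
      simpa [ρ, Function.mem_support] using hx
    rwa [φ.support_normed_eq] at h2
  have hρc : HasCompactSupport ρ :=
    HasCompactSupport.of_support_subset_isCompact (isCompact_closedBall (0 : E) 1)
      (hρs.trans Metric.ball_subset_closedBall)
  let g : 𝓢(E, ℂ) :=
    { toFun := H ⋆[ContinuousLinearMap.lsmul ℝ ℝ, μ] ρ
      smooth' := hρc.contDiff_convolution_right _ hHloc hρ
      decay' := fun j k => exists_bound_convolution μ hHloc hHdec k ρ hρ hρc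
        (hρs.trans Metric.ball_subset_closedBall) j }
  refine ⟨g, fun x => ?_⟩
  have hg : g x = ((∫ t, H t * φ.normed μ (x - t) ∂μ : ℝ) : ℂ) := by
    change (H ⋆[ContinuousLinearMap.lsmul ℝ ℝ, μ] ρ) x = _
    rw [convolution_def, ← integral_complex_ofReal]
    simp [ρ]
  have hi : Integrable (fun t => φ.normed μ (x - t)) μ := φ.integrable_normed.comp_sub_left x
  have hint : Integrable (fun t => H t * φ.normed μ (x - t)) μ := by
    refine Integrable.bdd_mul (c := Hr 0) hi hHmeas.aestronglyMeasurable ?_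
    refine Filter.Eventually.of_forall fun t => ?_
    rw [Real.norm_of_nonneg (hHr0 _)]
    exact hanti (norm_nonneg _)
  rw [hg, Complex.norm_real]
  refine le_trans ?_ (le_abs_self _)
  have h1 : h x = ∫ t, h x * φ.normed μ (x - t) ∂μ := by
    rw [integral_const_mul, integral_sub_left_eq_self (fun t => φ.normed μ t), φ.integral_normed,
      mul_one]
  rw [h1]
  refine integral_mono (hi.const_mul _) hint fun t => ?_
  by_cases ht : x - t ∈ Function.support (φ.normed μ)
  · refine mul_le_mul_of_nonneg_right ?_ (φ.nonneg_normed _)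
    rw [φ.support_normed_eq, mem_ball_zero_iff] at ht
    refine le_csSup (hbd _) (Set.mem_insert_of_mem _ ⟨x, ?_, rfl⟩)
    have h2 := norm_sub_le x (x - t)
    rw [sub_sub_cancel] at h2
    have h3 : ‖x - t‖ < 1 := ht
    simp only [Set.mem_ofPred_eq]
    linarith
  · rw [Function.notMem_support] at ht
    simp [ht]

end Domination

section SlowlyIncreasing

variable (E : Type) [NormedAddCommGroup E] [NormedSpace ℝ E]

/-- The algebra of slowly increasing functions: smooth functions all of whose derivatives are
polynomially bounded. -/
def slowlyIncreasing : Subalgebra ℂ (E → ℂ) where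
  carrier := {φ | φ.HasTemperateGrowth}
  mul_mem' hf hg := Function.HasTemperateGrowth.mul hf hg
  add_mem' hf hg := Function.HasTemperateGrowth.add hf hg
  algebraMap_mem' c := Function.HasTemperateGrowth.const c

/-- The locally convex algebra `𝓞_M(E)` of slowly increasing functions. -/
def OM : Type := slowlyIncreasing E

noncomputable instance : CommRing (OM E) := inferInstanceAs (CommRing (slowlyIncreasing E))

noncomputable instance : Algebra ℂ (OM E) := inferInstanceAs (Algebra ℂ (slowlyIncreasing E))

instance : FunLike (OM E) E ℂ where
  coe φ := φ.1
  coe_injective _ _ h := Subtype.ext h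

variable {E}

lemma OM.hasTemperateGrowth (φ : OM E) : Function.HasTemperateGrowth (φ : E → ℂ) := φ.2

@[simp] lemma OM.add_apply (φ ψ : OM E) (x : E) : (φ + ψ) x = φ x + ψ x := rfl
@[simp] lemma OM.mul_apply (φ ψ : OM E) (x : E) : (φ * ψ) x = φ x * ψ x := rfl
@[simp] lemma OM.smul_apply (c : ℂ) (φ : OM E) (x : E) : (c • φ) x = c * φ x := rfl
@[simp] lemma OM.zero_apply (x : E) : (0 : OM E) x = 0 := rfl
@[simp] lemma OM.sub_apply (φ ψ : OM E) (x : E) : (φ - ψ) x = φ x - ψ x := rfl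

@[ext] lemma OM.ext {φ ψ : OM E} (h : ∀ x, φ x = ψ x) : φ = ψ := DFunLike.ext _ _ h

lemma OM.bddAbove (φ : OM E) (f : 𝓢(E, ℂ)) (k : ℕ) :
    BddAbove (Set.range fun x => ‖f x‖ * ‖iteratedFDeriv ℝ k φ x‖) := by
  obtain ⟨l, C, hC⟩ := φ.hasTemperateGrowth.2 k
  let B : ℝ := 2 ^ l * ((Finset.Iic (l, 0)).sup fun m => SchwartzMap.seminorm ℂ m.1 m.2) f
  refine ⟨|C| * B, ?_⟩
  rintro _ ⟨x, rfl⟩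
  have h1 : (1 + ‖x‖) ^ l * ‖f x‖ ≤ B := by
    simpa using SchwartzMap.one_add_le_sup_seminorm_apply (𝕜 := ℂ) (m := (l, 0)) (k := l) (n := 0)
      le_rfl le_rfl f x
  calc ‖f x‖ * ‖iteratedFDeriv ℝ k φ x‖ ≤ ‖f x‖ * (|C| * (1 + ‖x‖) ^ l) := by
        gcongr
        exact (hC x).trans (by gcongr; exact le_abs_self C)
    _ = |C| * ((1 + ‖x‖) ^ l * ‖f x‖) := by ring
    _ ≤ |C| * B := by gcongr

variable (E) in
/-- The seminorms `φ ↦ sup_x |f(x)| ‖Dᵏφ(x)‖`, for a Schwartz function `f` and `k ∈ ℕ`. -/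
noncomputable def OM.seminormFamily : SeminormFamily ℂ (OM E) (𝓢(E, ℂ) × ℕ) := fun p =>
  Seminorm.of (fun φ => ⨆ x, ‖p.1 x‖ * ‖iteratedFDeriv ℝ p.2 φ x‖)
    (fun φ ψ => by
      refine ciSup_le fun x => ?_
      have h : iteratedFDeriv ℝ p.2 (φ + ψ : OM E) x
          = iteratedFDeriv ℝ p.2 φ x + iteratedFDeriv ℝ p.2 ψ x :=
        iteratedFDeriv_add_apply (φ.hasTemperateGrowth.1.contDiffAt.of_le (mod_cast le_top))
          (ψ.hasTemperateGrowth.1.contDiffAt.of_le (mod_cast le_top))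
      rw [h]
      calc ‖p.1 x‖ * ‖iteratedFDeriv ℝ p.2 φ x + iteratedFDeriv ℝ p.2 ψ x‖
          ≤ ‖p.1 x‖ * ‖iteratedFDeriv ℝ p.2 φ x‖ + ‖p.1 x‖ * ‖iteratedFDeriv ℝ p.2 ψ x‖ := by
            rw [← mul_add]; gcongr; exact norm_add_le _ _
        _ ≤ _ := add_le_add (le_ciSup (φ.bddAbove p.1 p.2) x) (le_ciSup (ψ.bddAbove p.1 p.2) x))
    (fun c φ => by
      have h : ∀ x, iteratedFDeriv ℝ p.2 (c • φ : OM E) x = c • iteratedFDeriv ℝ p.2 φ x :=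
        fun x => iteratedFDeriv_const_smul_apply
          (φ.hasTemperateGrowth.1.contDiffAt.of_le (mod_cast le_top))
      simp only [h, norm_smul]
      rw [Real.mul_iSup_of_nonneg (norm_nonneg c)]
      congr 1
      ext x
      ring)

/-- The locally convex topology of `𝓞_M(E)`. -/
noncomputable instance : TopologicalSpace (OM E) := (OM.seminormFamily E).moduleFilterBasis.topology

lemma OM.withSeminorms : WithSeminorms (OM.seminormFamily E) := ⟨rfl⟩

instance : IsTopologicalAddGroup (OM E) := OM.withSeminorms.topologicalAddGroup
instance : ContinuousSMul ℂ (OM E) := OM.withSeminorms.continuousSMul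

lemma OM.le_seminorm (φ : OM E) (f : 𝓢(E, ℂ)) (k : ℕ) (x : E) :
    ‖f x‖ * ‖iteratedFDeriv ℝ k φ x‖ ≤ OM.seminormFamily E (f, k) φ :=
  le_ciSup (φ.bddAbove f k) x

variable {E' : Type} [NormedAddCommGroup E'] [NormedSpace ℝ E'] [FiniteDimensional ℝ E']

/-- The continuous pull-back `φ ↦ φ ∘ ψ` along a map `ψ` of temperate growth. -/
noncomputable def OM.pullback (ψ : E → E') (hψ : ψ.HasTemperateGrowth) : OM E' →L[ℂ] OM E where
  toFun φ := ⟨φ ∘ ψ, φ.hasTemperateGrowth.comp hψ⟩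
  map_add' _ _ := rfl
  map_smul' _ _ := rfl
  cont := by
    let L : OM E' →ₗ[ℂ] OM E :=
      { toFun := fun φ => ⟨φ ∘ ψ, φ.hasTemperateGrowth.comp hψ⟩
        map_add' := fun _ _ => rfl
        map_smul' := fun _ _ => rfl }
    refine WithSeminorms.continuous_of_isBounded OM.withSeminorms OM.withSeminorms L
      (Seminorm.IsBounded.of_real ?_)
    rintro ⟨f, k⟩
    classical
    obtain ⟨l, C, hC0, hC⟩ := hψ.norm_iteratedFDeriv_le_uniform k
    let D : E → ℝ := fun x => (1 + C) * (1 + ‖x‖) ^ l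
    have hD1 : ∀ x, 1 ≤ D x := fun x => one_le_mul_of_one_le_of_one_le (by linarith)
      (one_le_pow₀ (by linarith [norm_nonneg x]))
    have hψD : ∀ i, i ≤ k → ∀ x, ‖iteratedFDeriv ℝ i ψ x‖ ≤ D x := fun i hi x =>
      (hC i hi x).trans (by simp only [D]; gcongr; linarith)
    let w : E → ℝ := fun x => ‖f x‖ * ((k.factorial : ℝ) * D x ^ k)
    have hw0 : ∀ x, 0 ≤ w x := fun x => by
      have := hD1 x
      positivity
    have hwdec : ∀ j : ℕ, ∃ B : ℝ, 0 ≤ B ∧ ∀ x, (1 + ‖ψ x‖) ^ j * w x ≤ B := by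
      intro j
      let m := l * (j + k)
      let B0 : ℝ := 2 ^ m * ((Finset.Iic (m, 0)).sup fun m => SchwartzMap.seminorm ℂ m.1 m.2) f
      have hB0 : ∀ x, (1 + ‖x‖) ^ m * ‖f x‖ ≤ B0 := fun x => by
        simpa using SchwartzMap.one_add_le_sup_seminorm_apply (𝕜 := ℂ) (m := (m, 0)) (k := m)
          (n := 0) le_rfl le_rfl f x
      have hB00 : 0 ≤ B0 := le_trans (by positivity) (hB0 0)
      refine ⟨2 ^ j * (1 + C) ^ (j + k) * (k.factorial : ℝ) * B0, by positivity, fun x => ?_⟩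
      have h1 : ‖ψ x‖ ≤ D x := by simpa using hψD 0 (Nat.zero_le _) x
      have h2 : 1 + ‖ψ x‖ ≤ 2 * D x := by linarith [hD1 x]
      calc (1 + ‖ψ x‖) ^ j * w x ≤ (2 * D x) ^ j * w x := by
            have := hw0 x
            gcongr
        _ = 2 ^ j * (1 + C) ^ (j + k) * (k.factorial : ℝ) * ((1 + ‖x‖) ^ m * ‖f x‖) := by
            simp only [w, D, m]
            rw [mul_pow, mul_pow, mul_pow, ← pow_mul, ← pow_mul, mul_add, pow_add, pow_add]
            ring
        _ ≤ _ := by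
            gcongr
            exact hB0 x
    let S : E' → Set ℝ := fun y => insert 0 (w '' (ψ ⁻¹' {y}))
    have hne : ∀ y, (S y).Nonempty := fun y => ⟨0, Set.mem_insert _ _⟩
    have hbd : ∀ y, BddAbove (S y) := by
      intro y
      obtain ⟨B, hB0, hB⟩ := hwdec 0
      refine ⟨B, ?_⟩
      rintro _ (rfl | ⟨x, -, rfl⟩)
      · exact hB0
      · simpa using hB x
    obtain ⟨g, hg⟩ := exists_schwartz_dominating (h := fun y => sSup (S y))
      (fun y => le_csSup (hbd y) (Set.mem_insert _ _)) (by
        intro j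
        obtain ⟨B, hB0, hB⟩ := hwdec j
        refine ⟨B, fun y => ?_⟩
        rw [mul_comm, ← le_div_iff₀ (by positivity)]
        refine csSup_le (hne y) ?_
        rintro _ (rfl | ⟨x, hx, rfl⟩)
        · positivity
        · rw [le_div_iff₀ (by positivity), mul_comm]
          have hx' : ψ x = y := hx
          rw [← hx']
          exact hB x)
    have hwg : ∀ x, w x ≤ ‖g (ψ x)‖ := fun x =>
      (le_csSup (hbd _) (Set.mem_insert_of_mem _ ⟨x, rfl, rfl⟩)).trans (hg (ψ x))
    let s : Finset (𝓢(E', ℂ) × ℕ) := (Finset.range (k + 1)).image fun i => (g, i)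
    refine ⟨s, 1, fun φ => ?_⟩
    rw [one_mul]
    refine ciSup_le fun x => ?_
    let P := s.sup (OM.seminormFamily E') φ
    have hP : ∀ i ≤ k, ‖g (ψ x)‖ * ‖iteratedFDeriv ℝ i φ (ψ x)‖ ≤ P := fun i hi =>
      (φ.le_seminorm g i (ψ x)).trans (Seminorm.le_finset_sup_apply
        (Finset.mem_image.2 ⟨i, Finset.mem_range.2 (by omega), rfl⟩))
    let M := (Finset.range (k + 1)).sup' ⟨0, by simp⟩ fun i => ‖iteratedFDeriv ℝ i φ (ψ x)‖
    have hM : ∀ i, i ≤ k → ‖iteratedFDeriv ℝ i φ (ψ x)‖ ≤ M := fun i hi =>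
      Finset.le_sup' (fun i => ‖iteratedFDeriv ℝ i φ (ψ x)‖) (Finset.mem_range.2 (by omega))
    have hcomp : ‖iteratedFDeriv ℝ k (φ ∘ ψ) x‖ ≤ (k.factorial : ℝ) * M * D x ^ k :=
      norm_iteratedFDeriv_comp_le φ.hasTemperateGrowth.1 hψ.1 (mod_cast le_top) x hM
        fun i hi hi' => (hψD i hi' x).trans (le_self_pow₀ (hD1 x) (by omega))
    obtain ⟨i, hi, hiM⟩ := Finset.exists_mem_eq_sup' (s := Finset.range (k + 1)) ⟨0, by simp⟩
      fun i => ‖iteratedFDeriv ℝ i φ (ψ x)‖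
    calc ‖f x‖ * ‖iteratedFDeriv ℝ k (φ ∘ ψ) x‖ ≤ ‖f x‖ * ((k.factorial : ℝ) * M * D x ^ k) := by gcongr
      _ = w x * M := by simp only [w]; ring
      _ ≤ ‖g (ψ x)‖ * M := by
          have : 0 ≤ M := (norm_nonneg _).trans (hM 0 (Nat.zero_le _))
          gcongr
          exact hwg x
      _ ≤ P := by
          have h3 : M = ‖iteratedFDeriv ℝ i φ (ψ x)‖ := hiM
          rw [h3]
          exact hP i (by have := Finset.mem_range.1 hi; omega)

@[simp] lemma OM.pullback_apply (ψ : E → E') (hψ : ψ.HasTemperateGrowth) (φ : OM E') (x : E) :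
    OM.pullback ψ hψ φ x = φ (ψ x) := rfl

end SlowlyIncreasing

/-! ### Fibred distributions -/

section Fibred

variable (N G : Type) [NormedAddCommGroup N] [NormedSpace ℝ N] [FiniteDimensional ℝ N]
  [NormedAddCommGroup G] [NormedSpace ℝ G] [FiniteDimensional ℝ G]

variable {N G} in
lemma hasTemperateGrowth_fst : Function.HasTemperateGrowth (Prod.fst : N × G → N) :=
  (ContinuousLinearMap.fst ℝ N G).hasTemperateGrowth

/-- The space `𝓞'_r(N × G)` of distributions fibred along the range map `r(x, v) = x`: continuous
linear maps `u : 𝓞_M(N × G) → 𝓞_M(N)` which are `𝓞_M(N)`-linear, `u (r^*f · φ) = f · u φ`. -/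
noncomputable def rFibred : Submodule ℂ (OM (N × G) →L[ℂ] OM N) where
  carrier := {u | ∀ (f : OM N) (φ : OM (N × G)),
    u (OM.pullback Prod.fst hasTemperateGrowth_fst f * φ) = f * u φ}
  add_mem' hu hw f φ := by
    simp only [add_apply, hu f φ, hw f φ, mul_add]
  zero_mem' f φ := by simp
  smul_mem' c u hu f φ := by
    simp only [smul_apply, hu f φ, mul_smul_comm]

def FibredDist : Type := rFibred N G

noncomputable instance : AddCommGroup (FibredDist N G) :=
  inferInstanceAs (AddCommGroup (rFibred N G))

noncomputable instance : Module ℂ (FibredDist N G) := inferInstanceAs (Module ℂ (rFibred N G))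

variable {N G}

noncomputable instance : FunLike (FibredDist N G) (OM (N × G)) (OM N) where
  coe u := u.1
  coe_injective _ _ h := Subtype.ext (DFunLike.coe_injective h)

@[simp] lemma FibredDist.add_apply (u w : FibredDist N G) (φ : OM (N × G)) :
    (u + w) φ = u φ + w φ := rfl
@[simp] lemma FibredDist.sub_apply (u w : FibredDist N G) (φ : OM (N × G)) :
    (u - w) φ = u φ - w φ := rfl
@[simp] lemma FibredDist.smul_apply (c : ℂ) (u : FibredDist N G) (φ : OM (N × G)) :
    (c • u) φ = c • u φ := rfl
@[simp] lemma FibredDist.zero_apply (φ : OM (N × G)) : (0 : FibredDist N G) φ = 0 := rfl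

@[ext] lemma FibredDist.ext {u w : FibredDist N G} (h : ∀ φ x, u φ x = w φ x) : u = w :=
  DFunLike.ext _ _ fun φ => OM.ext (h φ)

lemma FibredDist.map_mul (u : FibredDist N G) (f : OM N) (φ : OM (N × G)) :
    u (OM.pullback Prod.fst hasTemperateGrowth_fst f * φ) = f * u φ :=
  u.2 f φ

lemma hasTemperateGrowth_prodMap {A B C D : Type} [NormedAddCommGroup A] [NormedSpace ℝ A]
    [NormedAddCommGroup B] [NormedSpace ℝ B] [NormedAddCommGroup C] [NormedSpace ℝ C]
    [NormedAddCommGroup D] [NormedSpace ℝ D] {a : A → B} {c : C → D}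
    (ha : a.HasTemperateGrowth) (hc : c.HasTemperateGrowth) :
    (Prod.map a c).HasTemperateGrowth := by
  have h : Prod.map a c = fun p => ContinuousLinearMap.inl ℝ B D (a p.1)
      + ContinuousLinearMap.inr ℝ B D (c p.2) := by
    ext p <;> simp
  rw [h]
  exact ((ContinuousLinearMap.inl ℝ B D).hasTemperateGrowth.comp
      (ha.comp (ContinuousLinearMap.fst ℝ A C).hasTemperateGrowth)).add
    ((ContinuousLinearMap.inr ℝ B D).hasTemperateGrowth.comp
      (hc.comp (ContinuousLinearMap.snd ℝ A C).hasTemperateGrowth))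

variable {N' G' : Type} [NormedAddCommGroup N'] [NormedSpace ℝ N'] [FiniteDimensional ℝ N']
  [NormedAddCommGroup G'] [NormedSpace ℝ G'] [FiniteDimensional ℝ G']

/-- For `a : N → N'` with right inverse `b : N' → N` and `c : G → G'`, the push-forward
`τ_* u = b^* ∘ u ∘ τ^*` of fibred distributions along `τ = a × c`. -/
noncomputable def FibredDist.push (a : N → N') (b : N' → N) (c : G → G')
    (ha : a.HasTemperateGrowth) (hb : b.HasTemperateGrowth) (hc : c.HasTemperateGrowth)
    (hab : ∀ x, a (b x) = x) : FibredDist N G →ₗ[ℂ] FibredDist N' G' where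
  toFun u := ⟨(OM.pullback b hb).comp (u.1.comp
      (OM.pullback (Prod.map a c) (hasTemperateGrowth_prodMap ha hc))), fun f φ => by
    have h : OM.pullback (Prod.map a c) (hasTemperateGrowth_prodMap ha hc)
          (OM.pullback Prod.fst hasTemperateGrowth_fst f * φ)
        = OM.pullback Prod.fst hasTemperateGrowth_fst
            (OM.pullback a ha f)
          * OM.pullback (Prod.map a c) (hasTemperateGrowth_prodMap ha hc) φ := by
      ext p; simp
    ext x
    simp only [ContinuousLinearMap.comp_apply, h, OM.pullback_apply, OM.mul_apply]
    rw [u.2]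
    simp [hab]⟩
  map_add' u w := rfl
  map_smul' c u := rfl

lemma FibredDist.push_apply (a : N → N') (b : N' → N) (c : G → G')
    (ha : a.HasTemperateGrowth) (hb : b.HasTemperateGrowth) (hc : c.HasTemperateGrowth)
    (hab : ∀ x, a (b x) = x) (u : FibredDist N G) (φ : OM (N' × G')) (x : N') :
    FibredDist.push a b c ha hb hc hab u φ x
      = u (OM.pullback (Prod.map a c) (hasTemperateGrowth_prodMap ha hc) φ) (b x) := rfl

variable [MeasureSpace G] [BorelSpace G] [(volume : Measure G).IsAddHaarMeasure]

lemma integrable_schwartz_mul (f : 𝓢(N × G, ℂ)) (φ : OM (N × G)) (x : N) :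
    Integrable fun v : G => f (x, v) * φ (x, v) := by
  have hx : (fun v : G => (x, v)).HasTemperateGrowth := by
    have h : (fun v : G => (x, v)) = fun v =>
        ((x, 0) : N × G) + ContinuousLinearMap.inr ℝ N G v := by
      ext v <;> simp
    rw [h]
    exact (Function.HasTemperateGrowth.const _).add
      (ContinuousLinearMap.inr ℝ N G).hasTemperateGrowth
  have h := (SchwartzMap.compCLM ℂ hx ⟨1, 1, fun v => by
    have := le_max_right ‖x‖ ‖v‖
    rw [one_mul, pow_one, Prod.norm_def]
    simp only
    linarith⟩ (SchwartzMap.smulLeftCLM ℂ (φ : N × G → ℂ) f)).integrable (μ := volume)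
  refine h.congr (Filter.Eventually.of_forall fun v => ?_)
  simp [SchwartzMap.smulLeftCLM_apply_apply φ.hasTemperateGrowth, mul_comm]

variable (N G) in
/-- The Schwartz functions on `N × G`, seen as fibred distributions
`u_f(φ)(x) = ∫_G f(x, v) φ(x, v) dv`. -/
noncomputable def schwartzDist : Submodule ℂ (FibredDist N G) where
  carrier := {u | ∃ f : 𝓢(N × G, ℂ), ∀ φ x, u φ x = ∫ v : G, f (x, v) * φ (x, v)}
  add_mem' := by
    rintro u w ⟨f, hf⟩ ⟨g, hg⟩
    refine ⟨f + g, fun φ x => ?_⟩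
    rw [FibredDist.add_apply, OM.add_apply, hf, hg,
      ← integral_add (integrable_schwartz_mul f φ x) (integrable_schwartz_mul g φ x)]
    simp [add_mul]
  zero_mem' := ⟨0, fun φ x => by simp⟩
  smul_mem' := by
    rintro c u ⟨f, hf⟩
    refine ⟨c • f, fun φ x => ?_⟩
    rw [FibredDist.smul_apply, OM.smul_apply, hf, ← integral_const_mul]
    simp [mul_assoc]

end Fibred

/-! ### Graded Lie groups and action groupoids -/

/-- The dilation `v ↦ (s^{q_1} v_1, …, s^{q_n} v_n)`, for `s ∈ ℝ`. -/
def dilation {n : ℕ} (q : Fin n → ℕ) (s : ℝ) : (Fin n → ℝ) →L[ℝ] (Fin n → ℝ) :=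
  ContinuousLinearMap.pi fun i => s ^ q i • ContinuousLinearMap.proj i

@[simp] lemma dilation_apply {n : ℕ} (q : Fin n → ℕ) (s : ℝ) (v : Fin n → ℝ) (i : Fin n) :
    dilation q s v i = s ^ q i * v i := rfl

lemma dilation_dilation_inv {n : ℕ} (q : Fin n → ℕ) {s : ℝ} (hs : s ≠ 0) (v : Fin n → ℝ) :
    dilation q s (dilation q s⁻¹ v) = v := by
  ext i
  rw [dilation_apply, dilation_apply, ← mul_assoc, ← mul_pow, mul_inv_cancel₀ hs, one_pow, one_mul]

/-- A graded Lie group of dimension `n` in standard (exponential) coordinates, i.e. `ℝⁿ` with a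
smooth group law such that the exponential map is the identity (the lines `t ↦ t v` are
one-parameter subgroups) and such that the dilations with positive integer weights `q_1, …, q_n`
act by group automorphisms, equivalently the basis vectors `X_1, …, X_n` of the Lie algebra being
homogeneous of degrees `q_1, …, q_n` defines a grading of the Lie algebra.
The unit is `0` and the inverse of `v` is `-v`. -/
structure GradedLieGroup (n : ℕ) where
  weight : Fin n → ℕ
  weight_pos : ∀ i, 0 < weight i
  mul : (Fin n → ℝ) → (Fin n → ℝ) → (Fin n → ℝ)
  mul_assoc : ∀ u v w, mul (mul u v) w = mul u (mul v w)
  zero_mul : ∀ v, mul 0 v = v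
  mul_zero : ∀ v, mul v 0 = v
  smul_mul_smul : ∀ (s t : ℝ) (v : Fin n → ℝ), mul (s • v) (t • v) = (s + t) • v
  contDiff_mul : ContDiff ℝ ∞ fun p : (Fin n → ℝ) × (Fin n → ℝ) => mul p.1 p.2
  dilation_mul : ∀ s : ℝ, 0 < s → ∀ v w,
    dilation weight s (mul v w) = mul (dilation weight s v) (dilation weight s w)

namespace GradedLieGroup

variable {n : ℕ} (G : GradedLieGroup n)

/-- The dilations `α_s` of the group. -/
abbrev dil (s : ℝ) : (Fin n → ℝ) →L[ℝ] (Fin n → ℝ) := dilation G.weight s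

/-- The group law has temperate growth, since it is smooth and homogeneous. -/
lemma hasTemperateGrowth_mul :
    Function.HasTemperateGrowth fun p : (Fin n → ℝ) × (Fin n → ℝ) => G.mul p.1 p.2 := by
  let f : (Fin n → ℝ) × (Fin n → ℝ) → (Fin n → ℝ) := fun p => G.mul p.1 p.2
  have hf : ContDiff ℝ ∞ f := G.contDiff_mul
  refine ⟨hf, fun k => ?_⟩
  let Q := ∑ i, G.weight i
  have hQ : ∀ i, G.weight i ≤ Q := fun i =>
    Finset.single_le_sum (f := G.weight) (fun _ _ => Nat.zero_le _) (Finset.mem_univ i)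
  obtain ⟨C, hC⟩ := (isCompact_closedBall (0 : (Fin n → ℝ) × (Fin n → ℝ)) 1).exists_bound_of_continuousOn
    (hf.continuous_iteratedFDeriv (m := k) (mod_cast le_top)).continuousOn
  have hdn : ∀ s : ℝ, 0 ≤ s → s ≤ 1 → ∀ v, ‖G.dil s v‖ ≤ s * ‖v‖ := by
    intro s h0 h1 v
    refine (pi_norm_le_iff_of_nonneg (by positivity)).2 fun i => ?_
    rw [dilation_apply, norm_mul, norm_pow, Real.norm_of_nonneg h0]
    gcongr
    · exact pow_le_of_le_one h0 h1 (G.weight_pos i).ne'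
    · exact norm_le_pi_norm v i
  refine ⟨Q, C, fun p => ?_⟩
  let r : ℝ := 1 + ‖p‖
  have hr1 : 1 ≤ r := by simp [r]
  have hr0 : 0 < r := by linarith
  let L : (Fin n → ℝ) × (Fin n → ℝ) →L[ℝ] (Fin n → ℝ) × (Fin n → ℝ) :=
    (G.dil r⁻¹).prodMap (G.dil r⁻¹)
  have hLn : ∀ p, ‖L p‖ ≤ r⁻¹ * ‖p‖ := by
    intro p
    have hri : r⁻¹ ≤ 1 := inv_le_one_of_one_le₀ hr1
    have h1 := hdn r⁻¹ (by positivity) hri p.1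
    have h2 := hdn r⁻¹ (by positivity) hri p.2
    change max _ _ ≤ _
    refine max_le (h1.trans ?_) (h2.trans ?_)
    · gcongr; exact norm_fst_le p
    · gcongr; exact norm_snd_le p
  have hLop : ‖L‖ ≤ 1 := L.opNorm_le_bound zero_le_one fun p =>
    (hLn p).trans (by gcongr; exact inv_le_one_of_one_le₀ hr1)
  have hfL : f = (G.dil r) ∘ (f ∘ L) := by
    funext p
    have h := G.dilation_mul r⁻¹ (by positivity) p.1 p.2
    change G.mul p.1 p.2 = dilation G.weight r (G.mul (dilation G.weight r⁻¹ p.1)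
      (dilation G.weight r⁻¹ p.2))
    rw [← h, dilation_dilation_inv _ hr0.ne']
  have hdr : ‖G.dil r‖ ≤ r ^ Q := by
    refine ContinuousLinearMap.opNorm_le_bound _ (by positivity) fun v => ?_
    refine (pi_norm_le_iff_of_nonneg (by positivity)).2 fun i => ?_
    rw [dilation_apply, norm_mul, norm_pow, Real.norm_of_nonneg hr0.le]
    gcongr
    · exact hQ i
    · exact norm_le_pi_norm v i
  have hLp : L p ∈ Metric.closedBall (0 : (Fin n → ℝ) × (Fin n → ℝ)) 1 := by
    rw [mem_closedBall_zero_iff]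
    refine (hLn p).trans ?_
    rw [inv_mul_le_iff₀ hr0]
    simp [r]
  have hC0 : 0 ≤ C := (norm_nonneg _).trans (hC _ hLp)
  calc ‖iteratedFDeriv ℝ k f p‖ = ‖iteratedFDeriv ℝ k ((G.dil r) ∘ (f ∘ L)) p‖ := by rw [← hfL]
    _ ≤ ‖G.dil r‖ * ‖iteratedFDeriv ℝ k (f ∘ L) p‖ :=
        (G.dil r).norm_iteratedFDeriv_comp_left
          ((hf.comp L.contDiff).contDiffAt) (mod_cast le_top)
    _ = ‖G.dil r‖ * ‖(iteratedFDeriv ℝ k f (L p)).compContinuousLinearMap fun _ => L‖ := by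
        rw [L.iteratedFDeriv_comp_right hf p (mod_cast le_top)]
    _ ≤ r ^ Q * (C * 1 ^ k) := by
        gcongr
        refine (ContinuousMultilinearMap.norm_compContinuousLinearMap_le _ _).trans ?_
        rw [Finset.prod_const, Finset.card_univ, Fintype.card_fin]
        gcongr
        exact hC _ hLp
    _ = C * (1 + ‖p‖) ^ Q := by simp only [r]; ring

lemma hasTemperateGrowth_translate {N : Type} [NormedAddCommGroup N] [NormedSpace ℝ N]
    (y : N) (w : Fin n → ℝ) :
    Function.HasTemperateGrowth fun p : N × (Fin n → ℝ) => (y, G.mul w p.2) := by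
  have h1 : Function.HasTemperateGrowth fun v : Fin n → ℝ => (w, v) := by
    have h : (fun v : Fin n → ℝ => (w, v)) = fun v =>
        ((w, 0) : (Fin n → ℝ) × (Fin n → ℝ)) + ContinuousLinearMap.inr ℝ _ _ v := by
      ext v <;> simp
    rw [h]
    exact (Function.HasTemperateGrowth.const _).add (ContinuousLinearMap.hasTemperateGrowth _)
  have h2 := hasTemperateGrowth_prodMap (Function.HasTemperateGrowth.const (E := N) y)
    (G.hasTemperateGrowth_mul.comp h1)
  exact h2

variable {N : Type} [NormedAddCommGroup N] [NormedSpace ℝ N] [FiniteDimensional ℝ N]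

/-- `R = P * Q` for the convolution of fibred distributions on the action groupoid `N ⋊ G` of the
right action `act`: with `P_x`, `Q_x` denoting the restrictions to the range fibre of `x`,
`(P * Q)(φ)(x) = ⟨P_x(w), ⟨Q_{x·w}(v), φ(x, w v)⟩⟩`.
The function `g` here is `(y, w) ↦ ⟨Q_{y·w}(v), φ(y, w v)⟩`. -/
def IsConvolution (act : N → (Fin n → ℝ) → N) (P Q R : FibredDist N (Fin n → ℝ)) : Prop :=
  ∀ φ : OM (N × (Fin n → ℝ)), ∃ g : OM (N × (Fin n → ℝ)),
    (∀ y w, g (y, w)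
      = Q (OM.pullback (fun p : N × (Fin n → ℝ) => (y, G.mul w p.2))
          (G.hasTemperateGrowth_translate y w) φ) (act y w)) ∧
    R φ = P g

/-- The convolution is determined by its factors. -/
lemma IsConvolution.unique {act : N → (Fin n → ℝ) → N} {P Q R R' : FibredDist N (Fin n → ℝ)}
    (h : G.IsConvolution act P Q R) (h' : G.IsConvolution act P Q R') : R = R' := by
  refine FibredDist.ext fun φ x => ?_
  obtain ⟨g, hg, hR⟩ := h φ
  obtain ⟨g', hg', hR'⟩ := h' φ
  have hgg : g = g' := OM.ext fun p => by rw [← p.eta, hg, hg']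
  rw [hR, hR', hgg]

end GradedLieGroup

section Adjoint

variable {n : ℕ} {N : Type} [NormedAddCommGroup N] [NormedSpace ℝ N] [FiniteDimensional ℝ N]
  [MeasureSpace N]

/-- `R = Pᵗ`, i.e. `∫_r R = I_* ∫_r P` as distributions on `N × G`. Here
`I(x, v) = (x·v, v⁻¹)` is the inversion of the action groupoid, `v⁻¹ = -v`, and
`⟨∫_r P, φ⟩ = ∫_N P(φ)(x) dx` for test functions `φ`; the function `ψ` is `φ ∘ I`. -/
def IsTranspose (act : N → (Fin n → ℝ) → N) (P R : FibredDist N (Fin n → ℝ)) : Prop :=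
  ∀ φ : OM (N × (Fin n → ℝ)), HasCompactSupport φ →
    ∃ ψ : OM (N × (Fin n → ℝ)), (∀ x v, ψ (x, v) = φ (act x v, -v)) ∧
      ∫ x, R φ x = ∫ x, P ψ x

/-- `R = P^*`, i.e. `∫_r R` is the complex conjugate of the distribution `I_* ∫_r P`, where
`⟨conj T, φ⟩ = conj ⟨T, conj φ⟩`; the function `ψ` is the complex conjugate of `φ ∘ I`. -/
def IsAdjoint (act : N → (Fin n → ℝ) → N) (P R : FibredDist N (Fin n → ℝ)) : Prop :=
  ∀ φ : OM (N × (Fin n → ℝ)), HasCompactSupport φ →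
    ∃ ψ : OM (N × (Fin n → ℝ)),
      (∀ x v, ψ (x, v) = (starRingEnd ℂ) (φ (act x v, -v))) ∧
      ∫ x, R φ x = (starRingEnd ℂ) (∫ x, P ψ x)

end Adjoint

/-! ### Shubin actions and the calculus -/

/-- A Shubin action of the graded Lie group `G` on the graded vector space `X = ℝᵈ` with dilations
`β` of positive integer weights: a polynomial right action `θ¹` such that
`θᵗ_v = β_t ∘ θ¹_{α_t(v)} ∘ β_{t⁻¹}`, `t ≠ 0`, extends smoothly to `t = 0`. The extended map is
`act t x v = θᵗ_v(x)`; it is determined by `θ¹`. -/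
structure ShubinAction (d : ℕ) {n : ℕ} (G : GradedLieGroup n) where
  weight : Fin d → ℕ
  weight_pos : ∀ i, 0 < weight i
  act : ℝ → (Fin d → ℝ) → (Fin n → ℝ) → (Fin d → ℝ)
  act_zero : ∀ x, act 1 x 0 = x
  act_mul : ∀ x v w, act 1 x (G.mul v w) = act 1 (act 1 x v) w
  polynomial : ∀ j, ∃ p : MvPolynomial (Fin d ⊕ Fin n) ℝ,
    ∀ x v, act 1 x v j = MvPolynomial.eval (Sum.elim x v) p
  act_deform : ∀ t : ℝ, t ≠ 0 → ∀ x v,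
    act t x v = dilation weight t (act 1 (dilation weight t⁻¹ x) (G.dil t v))
  contDiff_act : ContDiff ℝ ∞
    fun p : ((Fin d → ℝ) × ℝ) × (Fin n → ℝ) => act p.1.2 p.1.1 p.2

namespace ShubinAction

variable {d n : ℕ} {G : GradedLieGroup n} (A : ShubinAction d G)

/-- The dilations `β_s` of `X`. -/
abbrev dil (s : ℝ) : (Fin d → ℝ) →L[ℝ] (Fin d → ℝ) := dilation A.weight s

/-- Fibred distributions on `X ⋊ᵗ G`. As a vector space, this does not depend on `t`. -/
abbrev _root_.Shubin.Dist (d n : ℕ) : Type := FibredDist (Fin d → ℝ) (Fin n → ℝ)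

/-- Fibred distributions on the tangent groupoid, with arrow space `(X × ℝ) × G ∋ ((x, t), v)` and
range map `((x, t), v) ↦ (x, t)`. -/
abbrev _root_.Shubin.TangentDist (d n : ℕ) : Type := FibredDist ((Fin d → ℝ) × ℝ) (Fin n → ℝ)

lemma hasTemperateGrowth_slice (t : ℝ) :
    Function.HasTemperateGrowth fun x : Fin d → ℝ => (x, t) := by
  have h : (fun x : Fin d → ℝ => (x, t)) = fun x =>
      ContinuousLinearMap.inl ℝ (Fin d → ℝ) ℝ x + ((0, t) : (Fin d → ℝ) × ℝ) := by
    ext x <;> simp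
  rw [h]
  exact (ContinuousLinearMap.hasTemperateGrowth _).add (Function.HasTemperateGrowth.const _)

/-- The evaluation `P ↦ P_t`, given by `P_t(φ)(x) = P((x, t, v) ↦ φ(x, v))(x, t)`. -/
noncomputable def _root_.Shubin.ev (t : ℝ) : TangentDist d n →ₗ[ℂ] Dist d n :=
  FibredDist.push Prod.fst (fun x => (x, t)) id
    hasTemperateGrowth_fst (hasTemperateGrowth_slice t)
    Function.HasTemperateGrowth.id fun _ => rfl

/-- Push-forward `(τ_s)_*` along the zoom action `τ_s(x, t, v) = (β_{s⁻¹}(x), s⁻¹ t, α_s(v))`,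
`s > 0`: `(τ_s)_*P (φ)(x, t) = P(φ ∘ τ_s)(β_s(x), s t)`. -/
noncomputable def zoom (s : ℝ) (hs : 0 < s) : TangentDist d n →ₗ[ℂ] TangentDist d n :=
  FibredDist.push ((A.dil s⁻¹).prodMap (s⁻¹ • ContinuousLinearMap.id ℝ ℝ))
    ((A.dil s).prodMap (s • ContinuousLinearMap.id ℝ ℝ)) (G.dil s)
    (ContinuousLinearMap.hasTemperateGrowth _) (ContinuousLinearMap.hasTemperateGrowth _)
    (ContinuousLinearMap.hasTemperateGrowth _) (by
      rintro ⟨x, t⟩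
      have h := dilation_dilation_inv A.weight (inv_ne_zero hs.ne') x
      rw [inv_inv] at h
      ext i
      · exact congrFun h i
      · simp [hs.ne'])

/-- The restriction of `(τ_s)_*` to `t = 0`: `(τ_s)_*u (φ)(x) = u(φ ∘ τ_s)(β_s(x))` with
`τ_s(x, v) = (β_{s⁻¹}(x), α_s(v))`. -/
noncomputable def zoomZero (s : ℝ) (hs : 0 < s) : Dist d n →ₗ[ℂ] Dist d n :=
  FibredDist.push (A.dil s⁻¹) (A.dil s) (G.dil s)
    (ContinuousLinearMap.hasTemperateGrowth _) (ContinuousLinearMap.hasTemperateGrowth _)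
    (ContinuousLinearMap.hasTemperateGrowth _) (by
      intro x
      have h := dilation_dilation_inv A.weight (inv_ne_zero hs.ne') x
      rwa [inv_inv] at h)

/-- The fibred distributions `P` on the tangent groupoid which are essentially homogeneous of order
`m`: `s^m P - (τ_s)_*P` is Schwartz for all `s > 0`. -/
noncomputable def EssTangent (m : ℝ) : Submodule ℂ (TangentDist d n) where
  carrier := {P | ∀ (s : ℝ) (hs : 0 < s), ((s ^ m : ℝ) : ℂ) • P - A.zoom s hs P
    ∈ schwartzDist ((Fin d → ℝ) × ℝ) (Fin n → ℝ)}
  add_mem' hP hQ s hs := by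
    rw [map_add, smul_add, add_sub_add_comm]
    exact add_mem (hP s hs) (hQ s hs)
  zero_mem' s hs := by
    rw [map_zero, smul_zero, sub_zero]
    exact zero_mem _
  smul_mem' c P hP s hs := by
    rw [map_smul, smul_comm, ← smul_sub]
    exact Submodule.smul_mem _ c (hP s hs)

/-- The space `Ψ^m` of pseudodifferential fibred distributions of order `m`: fibred distributions
on `X ⋊¹ G` which extend to the tangent groupoid essentially homogeneously of order `m`. -/
noncomputable def Psi (m : ℝ) : Submodule ℂ (Dist d n) := (A.EssTangent m).map (ev 1)

/-- The space `Ess^m` of fibred distributions on `X ⋊⁰ G` essentially homogeneous of order `m`. -/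
noncomputable def Ess (m : ℝ) : Submodule ℂ (Dist d n) where
  carrier := {u | ∀ (s : ℝ) (hs : 0 < s), ((s ^ m : ℝ) : ℂ) • u - A.zoomZero s hs u
    ∈ schwartzDist (Fin d → ℝ) (Fin n → ℝ)}
  add_mem' hP hQ s hs := by
    rw [map_add, smul_add, add_sub_add_comm]
    exact add_mem (hP s hs) (hQ s hs)
  zero_mem' s hs := by
    rw [map_zero, smul_zero, sub_zero]
    exact zero_mem _
  smul_mem' c P hP s hs := by
    rw [map_smul, smul_comm, ← smul_sub]
    exact Submodule.smul_mem _ c (hP s hs)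

lemma mem_EssTangent {m : ℝ} {P : TangentDist d n} : P ∈ A.EssTangent m ↔ ∀ (s : ℝ) (hs : 0 < s),
    ((s ^ m : ℝ) : ℂ) • P - A.zoom s hs P ∈ schwartzDist ((Fin d → ℝ) × ℝ) (Fin n → ℝ) := Iff.rfl

lemma mem_Ess {m : ℝ} {u : Dist d n} : u ∈ A.Ess m ↔ ∀ (s : ℝ) (hs : 0 < s),
    ((s ^ m : ℝ) : ℂ) • u - A.zoomZero s hs u ∈ schwartzDist (Fin d → ℝ) (Fin n → ℝ) := Iff.rfl

lemma ev_mem_schwartzDist (t : ℝ) {P : TangentDist d n}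
    (hP : P ∈ schwartzDist ((Fin d → ℝ) × ℝ) (Fin n → ℝ)) :
    ev t P ∈ schwartzDist (Fin d → ℝ) (Fin n → ℝ) := by
  obtain ⟨f, hf⟩ := hP
  have hg : Function.HasTemperateGrowth (Prod.map (fun x : Fin d → ℝ => (x, t))
      (id : (Fin n → ℝ) → (Fin n → ℝ))) :=
    hasTemperateGrowth_prodMap (hasTemperateGrowth_slice t) Function.HasTemperateGrowth.id
  refine ⟨SchwartzMap.compCLM ℂ hg ⟨1, 1, fun p => ?_⟩ f, fun φ x => ?_⟩
  · rw [one_mul, pow_one]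
    have h1 : ‖p‖ ≤ ‖Prod.map (fun x : Fin d → ℝ => (x, t))
        (id : (Fin n → ℝ) → (Fin n → ℝ)) p‖ := by
      change max _ _ ≤ max (max _ _) _
      exact max_le_max (le_max_left _ _) le_rfl
    linarith
  · rw [ev, FibredDist.push_apply, hf]
    rfl

lemma ev_mem_Ess {m : ℝ} {P : TangentDist d n} (hP : P ∈ A.EssTangent m) : ev 0 P ∈ A.Ess m := by
  rw [mem_Ess]
  intro s hs
  have h := ev_mem_schwartzDist 0 ((A.mem_EssTangent.1 hP) s hs)
  have hz : ev 0 (A.zoom s hs P) = A.zoomZero s hs (ev 0 P) := by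
    ext φ x
    simp only [ev, zoom, zoomZero, FibredDist.push_apply]
    have h0 : ((A.dil s).prodMap (s • ContinuousLinearMap.id ℝ ℝ)) (x, (0 : ℝ))
        = (A.dil s x, 0) := by simp
    rw [h0]
    rfl
  rwa [map_sub, map_smul, hz] at h

/-- The space `Σ^m = Ess^m / 𝓢(X ⋊⁰ G)` of principal cosymbols of order `m`. -/
abbrev Cosymbol (m : ℝ) : Type :=
  A.Ess m ⧸ (schwartzDist (Fin d → ℝ) (Fin n → ℝ)).submoduleOf (A.Ess m)

/-- The class `[u] ∈ Σ^m` of `u ∈ Ess^m`. -/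
noncomputable def cls {m : ℝ} (u : A.Ess m) : A.Cosymbol m := Submodule.Quotient.mk u

/-- The principal cosymbol `σ_m(P_1) = [P_0]`, where `P` is a chosen essentially homogeneous
extension of `P_1`. -/
noncomputable def sigma (m : ℝ) (P : A.Psi m) : A.Cosymbol m :=
  A.cls ⟨ev 0 P.2.choose, A.ev_mem_Ess P.2.choose_spec.1⟩

/-- `c = a * b` for the product of principal cosymbols induced by the convolution on `X ⋊⁰ G`:
for all representatives `u` and `v`, the convolution `u * v` represents `c`. -/
def IsCosymbolProduct {l m k : ℝ} (a : A.Cosymbol l) (b : A.Cosymbol m) (c : A.Cosymbol k) : Prop :=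
  ∀ (u : A.Ess l) (v : A.Ess m), A.cls u = a → A.cls v = b →
    ∃ w : A.Ess k, G.IsConvolution (A.act 0) u.1 v.1 w.1 ∧ A.cls w = c

/-- `b = a^*` for principal cosymbols: for all representatives `u` of `a`, `u^*` represents `b`. -/
def IsCosymbolAdjoint {m : ℝ} (a b : A.Cosymbol m) : Prop :=
  ∀ u : A.Ess m, A.cls u = a → ∃ w : A.Ess m, IsAdjoint (A.act 0) u.1 w.1 ∧ A.cls w = b

/-- `b = aᵗ` for principal cosymbols: for all representatives `u` of `a`, `uᵗ` represents `b`. -/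
def IsCosymbolTranspose {m : ℝ} (a b : A.Cosymbol m) : Prop :=
  ∀ u : A.Ess m, A.cls u = a → ∃ w : A.Ess m, IsTranspose (A.act 0) u.1 w.1 ∧ A.cls w = b

end ShubinAction

end Shubin

open scoped Topology

set_option linter.unusedSectionVars false

namespace Shubin

/-! ### Recognizing slowly increasing functions and Schwartz functions -/

section Calculus

variable {E : Type} [NormedAddCommGroup E] [NormedSpace ℝ E] [FiniteDimensional ℝ E]

/-! All operations are performed on the tangent groupoid and then evaluated at `t = 1` and `t = 0`.
The zoom action is by automorphisms of the tangent groupoid, and evaluation at `t = 0` intertwines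
it with the zoom on `X ⋊⁰ G`. So it suffices to show that the spaces `EssTangent` are stable under
convolution, transposition and conjugation, and that evaluation at `0` modulo Schwartz functions
depends only on evaluation at `1`. Arbitrary representatives of cosymbols cause no trouble: each
representative of `[P_0]` is `(P + S)_0` with `S` Schwartz on the tangent groupoid
(`exists_extension`), and Schwartz perturbations only produce Schwartz errors.

The engine is the dyadic decomposition `exists_decomposition`. The symbol of a fibred distribution
is its value on the characters `exp(-2πi ξ·v)`, that is, a partial Fourier transform. Let `P - 2^m
(τ_{1/2})_* P` be Schwartz. Cutting off the symbol near the origin gives a Schwartz function `S`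
such that `P - S` is flat: applied to any polynomial in `v` it vanishes to infinite order at the
base point `0` (`FlatOp`). Telescoping yields `P = S + Σ_j 2^{mj} (τ_{2^{-j}})_* F`, where `F` is
Schwartz and flat. Flatness makes the rescalings by `ε` vanish to infinite order at `ε = 0`
(`fam_mem_flat`), so the series converges geometrically for every real `m`, with all derivatives.
Statements about `P` are thus reduced to statements about rescaled Schwartz functions that can be
summed termwise.

Well-definedness (`ev_zero_mem_schwartzDist`): if `P_1 = 0`, the symbol `a(ξ, x, t)` vanishes at `t
= 1`, and `2^m a` minus the dilate of `a` by `2` is Schwartz. Iterating this relation from `t =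
2^{-k}` up to `t = 1` bounds `a(·, 2^{-k})` with a polynomial weight uniformly in `k`; the same
applies to derivatives and coordinate multiples, hence `a(·, 0)` is Schwartz (`isSchwartz_of_zoom`).
A dyadic series with Schwartz symbol is itself Schwartz (`flatDist_mem_schwartzDist`).

Transposes (`exists_transpose`): the deformed actions are polynomial jointly in `(x, t, v)`
(`polyMap_act`). Their Jacobian is a polynomial with polynomial reciprocal, hence constant, and it
equals `1` at the unit. So volume is preserved, Schwartz functions are transposed by pull-back along
the inversion, and the dyadic series is transposed termwise; flatness survives because the inversion
is polynomial and fixes the base point `0`. Essential homogeneity of the transpose follows from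
uniqueness of transposes. Adjoints are conjugates of transposes.

Convolution (`conv_mem_EssTangent`): applying `Q` with parameters is a continuous operation (`bc`),
so products exist in the whole of `𝓞'_r`. By the decomposition, the product of an essentially
homogeneous distribution with a Schwartz function, in either order, is Schwartz. The defect of
homogeneity of `P * Q` is a sum of two such products.

Smoothness, temperate growth, rapid decay and continuity are mostly proved by one device: a class of
functions or operators is exhibited that is closed under derivatives up to linear combinations, so
that only a zeroth order bound remains (`temperate_of_closed`, `schwartz_of_closed`,
`OM.continuous_of_closed`). -/

lemma clm_eq_sum_basis {F : Type} [NormedAddCommGroup F] [NormedSpace ℝ F] (A : E →L[ℝ] F) :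
    A = ∑ i, ContinuousLinearMap.smulRightL ℝ E F
      (LinearMap.toContinuousLinearMap ((Module.finBasis ℝ E).coord i))
        (A (Module.finBasis ℝ E i)) := by
  ext x
  conv_lhs => rw [← (Module.finBasis ℝ E).sum_repr x, map_sum]
  simp

/-- Expanding `fderiv ℝ φ` in a basis trades one order of differentiation for finitely many scalar
functions `∂_i φ`. Inductions on the order can then stay within complex-valued functions, with a
constant depending only on `E`. -/
lemma exists_iteratedFDeriv_succ_le (E : Type) [NormedAddCommGroup E] [NormedSpace ℝ E]
    [FiniteDimensional ℝ E] : ∃ C : ℝ, 0 ≤ C ∧ ∀ φ : E → ℂ, ContDiff ℝ ∞ φ → ∀ k x,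
    ‖iteratedFDeriv ℝ (k + 1) φ x‖
      ≤ C * ∑ i, ‖iteratedFDeriv ℝ k (fun y => fderiv ℝ φ y (Module.finBasis ℝ E i)) x‖ := by
  let L := fun i => ContinuousLinearMap.smulRightL ℝ E ℂ
      (LinearMap.toContinuousLinearMap ((Module.finBasis ℝ E).coord i))
  refine ⟨∑ i, ‖L i‖, Finset.sum_nonneg fun i _ => by positivity, fun φ hφ k x => ?_⟩
  have h1 : fderiv ℝ φ = fun y => ∑ i, (L i ∘ fun y => fderiv ℝ φ y (Module.finBasis ℝ E i)) y := by
    ext1 y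
    exact clm_eq_sum_basis _
  have hd : ∀ i, ContDiff ℝ ∞ fun y => fderiv ℝ φ y (Module.finBasis ℝ E i) := fun i =>
    (hφ.fderiv_right (m := ∞) (by simp)).clm_apply contDiff_const
  have h2 : iteratedFDeriv ℝ k (fderiv ℝ φ) x = ∑ i, iteratedFDeriv ℝ k
      (L i ∘ fun y => fderiv ℝ φ y (Module.finBasis ℝ E i)) x := by
    rw [← iteratedFDeriv_fun_sum_apply (fun i _ =>
      (((L i).contDiff.comp (hd i)).of_le (mod_cast le_top)).contDiffAt), ← h1]
  rw [← norm_iteratedFDeriv_fderiv, h2, Finset.sum_mul]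
  refine (norm_sum_le _ _).trans (Finset.sum_le_sum fun i hi => ?_)
  refine ((L i).norm_iteratedFDeriv_comp_left (hd i).contDiffAt (mod_cast le_top)).trans ?_
  gcongr
  exact Finset.single_le_sum (f := fun i => ‖iteratedFDeriv ℝ k (fun y => fderiv ℝ φ y
    (Module.finBasis ℝ E i)) x‖) (fun _ _ => norm_nonneg _) hi

/-- A class of polynomially bounded differentiable functions whose directional derivatives are
again in the linear span of the class consists of slowly increasing functions. -/
lemma temperate_of_closed {S : Set (E → ℂ)}
    (hb : ∀ f ∈ S, ∃ (k : ℕ) (c : ℝ), ∀ x, ‖f x‖ ≤ c * (1 + ‖x‖) ^ k)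
    (hd : ∀ f ∈ S, ∃ f' : E → E →L[ℝ] ℂ, (∀ x, HasFDerivAt f (f' x) x) ∧
      ∀ e, (fun x => f' x e) ∈ Submodule.span ℂ S) :
    ∀ f ∈ S, f.HasTemperateGrowth := by
  -- Both hypotheses pass from the class to its linear span. The span is stable under directional
  -- derivatives, so the inductions on the order run over it.
  have hb' : ∀ f ∈ Submodule.span ℂ S, ∃ (k : ℕ) (c : ℝ), ∀ x, ‖f x‖ ≤ c * (1 + ‖x‖) ^ k := by
    intro f hf
    induction hf using Submodule.span_induction with
    | mem f hf => exact hb f hf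
    | zero => exact ⟨0, 0, fun x => by simp⟩
    | add f g _ _ hf hg =>
      obtain ⟨k, c, h⟩ := hf
      obtain ⟨k', c', h'⟩ := hg
      refine ⟨k + k', |c| + |c'|, fun x => ?_⟩
      have h1 : 1 ≤ 1 + ‖x‖ := by linarith [norm_nonneg x]
      calc ‖f x + g x‖ ≤ ‖f x‖ + ‖g x‖ := norm_add_le _ _
        _ ≤ |c| * (1 + ‖x‖) ^ (k + k') + |c'| * (1 + ‖x‖) ^ (k + k') := by
          gcongr
          · refine (h x).trans (mul_le_mul (le_abs_self c) ?_ (by positivity) (by positivity))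
            exact pow_le_pow_right₀ h1 (by omega)
          · refine (h' x).trans (mul_le_mul (le_abs_self c') ?_ (by positivity) (by positivity))
            exact pow_le_pow_right₀ h1 (by omega)
        _ = _ := by ring
    | smul a f _ hf =>
      obtain ⟨k, c, h⟩ := hf
      refine ⟨k, ‖a‖ * c, fun x => ?_⟩
      rw [Pi.smul_apply, norm_smul, mul_assoc]
      gcongr
      exact h x
  have hd' : ∀ f ∈ Submodule.span ℂ S, ∃ f' : E → E →L[ℝ] ℂ, (∀ x, HasFDerivAt f (f' x) x) ∧
      ∀ e, (fun x => f' x e) ∈ Submodule.span ℂ S := by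
    intro f hf
    induction hf using Submodule.span_induction with
    | mem f hf => exact hd f hf
    | zero => exact ⟨0, fun x => hasFDerivAt_const 0 x, fun e => Submodule.zero_mem _⟩
    | add f g _ _ hf hg =>
      obtain ⟨f', h, h1⟩ := hf
      obtain ⟨g', h', h1'⟩ := hg
      exact ⟨f' + g', fun x => (h x).add (h' x), fun e => Submodule.add_mem _ (h1 e) (h1' e)⟩
    | smul a f _ hf =>
      obtain ⟨f', h, h1⟩ := hf
      exact ⟨a • f', fun x => (h x).const_smul a, fun e => Submodule.smul_mem _ a (h1 e)⟩
  -- The derivative is `C^n` as soon as all directional derivatives are, and these lie in the span.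
  have hc : ∀ n : ℕ, ∀ f ∈ Submodule.span ℂ S, ContDiff ℝ n f := by
    intro n
    induction n with
    | zero =>
      intro f hf
      obtain ⟨f', h, -⟩ := hd' f hf
      exact contDiff_zero.2 (continuous_iff_continuousAt.2 fun x => (h x).continuousAt)
    | succ n ih =>
      intro f hf
      obtain ⟨f', h, h1⟩ := hd' f hf
      have hff : fderiv ℝ f = f' := funext fun x => (h x).fderiv
      push_cast
      refine contDiff_succ_iff_hasFDerivAt.2
        ⟨f', contDiff_clm_apply_iff.2 fun e => ih _ (h1 e), h⟩
  obtain ⟨C, hC0, hC⟩ := exists_iteratedFDeriv_succ_le E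
  suffices h : ∀ n : ℕ, ∀ f ∈ Submodule.span ℂ S, ∃ (k : ℕ) (c : ℝ), ∀ x,
      ‖iteratedFDeriv ℝ n f x‖ ≤ c * (1 + ‖x‖) ^ k by
    intro f hf
    have hf' := Submodule.subset_span (R := ℂ) hf
    exact ⟨contDiff_infty.2 fun n => hc n f hf', fun n => h n f hf'⟩
  intro n
  induction n with
  | zero =>
    intro f hf
    simp only [norm_iteratedFDeriv_zero]
    exact hb' f hf
  | succ n ih =>
    intro f hf
    obtain ⟨f', h, h1⟩ := hd' f hf
    have hff : fderiv ℝ f = f' := funext fun x => (h x).fderiv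
    choose k c hkc using fun i => ih _ (h1 (Module.finBasis ℝ E i))
    refine ⟨∑ i, k i, C * ∑ i, |c i|, fun x => ?_⟩
    have h1 : 1 ≤ 1 + ‖x‖ := by linarith [norm_nonneg x]
    refine (hC f (contDiff_infty.2 fun n => hc n f hf) n x).trans ?_
    rw [mul_assoc, Finset.sum_mul]
    gcongr with i hi
    rw [hff]
    refine (hkc i x).trans (mul_le_mul (le_abs_self _) ?_ (by positivity) (by positivity))
    exact pow_le_pow_right₀ h1 (Finset.single_le_sum (fun _ _ => Nat.zero_le _) hi)

/-- A class of bounded differentiable functions whose directional derivatives and whose products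
with linear functionals are again in the linear span of the class consists of Schwartz functions. -/
lemma schwartz_of_closed {S : Set (E → ℂ)}
    (hb : ∀ f ∈ S, ∃ c : ℝ, ∀ x, ‖f x‖ ≤ c)
    (hd : ∀ f ∈ S, ∃ f' : E → E →L[ℝ] ℂ, (∀ x, HasFDerivAt f (f' x) x) ∧
      ∀ e, (fun x => f' x e) ∈ Submodule.span ℂ S)
    (hm : ∀ f ∈ S, ∀ ℓ : E →L[ℝ] ℝ, (fun x => (ℓ x : ℂ) * f x) ∈ Submodule.span ℂ S) :
    ∀ f ∈ S, ∃ F : 𝓢(E, ℂ), ∀ x, F x = f x := by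
  have ht := temperate_of_closed (S := S)
    (fun f hf => (hb f hf).elim fun c hc => ⟨0, c, fun x => by simpa using hc x⟩) hd
  have hb' : ∀ f ∈ Submodule.span ℂ S, ∃ c : ℝ, ∀ x, ‖f x‖ ≤ c := by
    intro f hf
    induction hf using Submodule.span_induction with
    | mem f hf => exact hb f hf
    | zero => exact ⟨0, fun x => by simp⟩
    | add f g _ _ hf hg =>
      obtain ⟨c, h⟩ := hf
      obtain ⟨c', h'⟩ := hg
      exact ⟨c + c', fun x => (norm_add_le _ _).trans (add_le_add (h x) (h' x))⟩
    | smul a f _ hf =>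
      obtain ⟨c, h⟩ := hf
      refine ⟨‖a‖ * c, fun x => ?_⟩
      rw [Pi.smul_apply, norm_smul]
      gcongr
      exact h x
  have ht' : ∀ f ∈ Submodule.span ℂ S, ContDiff ℝ ∞ f := by
    intro f hf
    induction hf using Submodule.span_induction with
    | mem f hf => exact (ht f hf).1
    | zero => exact contDiff_const
    | add f g _ _ hf hg => exact hf.add hg
    | smul a f _ hf => exact hf.const_smul a
  have hd' : ∀ f ∈ Submodule.span ℂ S, ∀ e, (fun x => fderiv ℝ f x e) ∈ Submodule.span ℂ S := by
    intro f hf e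
    induction hf using Submodule.span_induction with
    | mem f hf =>
      obtain ⟨f', h, h1⟩ := hd f hf
      have hff : fderiv ℝ f = f' := funext fun x => (h x).fderiv
      rw [hff]
      exact h1 e
    | zero => convert Submodule.zero_mem (Submodule.span ℂ S) using 1; ext x; simp
    | add f g hf0 hg0 hf hg =>
      convert Submodule.add_mem _ hf hg using 1
      ext x
      rw [fderiv_add ((ht' f hf0).differentiable (by simp) x)
        ((ht' g hg0).differentiable (by simp) x)]
      rfl
    | smul a f hf0 hf =>
      convert Submodule.smul_mem _ a hf using 1
      ext x
      rw [fderiv_const_smul ((ht' f hf0).differentiable (by simp) x)]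
      rfl
  have hm' : ∀ f ∈ Submodule.span ℂ S, ∀ ℓ : E →L[ℝ] ℝ,
      (fun x => (ℓ x : ℂ) * f x) ∈ Submodule.span ℂ S := by
    intro f hf ℓ
    induction hf using Submodule.span_induction with
    | mem f hf => exact hm f hf ℓ
    | zero => convert Submodule.zero_mem (Submodule.span ℂ S) using 1; ext x; simp
    | add f g _ _ hf hg => convert Submodule.add_mem _ hf hg using 1; ext x; simp [mul_add]
    | smul a f _ hf => convert Submodule.smul_mem _ a hf using 1; ext x; simp; ring
  -- The norm is dominated by the coordinates, so a factor `‖x‖` costs no more than multiplication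
  -- by finitely many linear functionals.
  have hx : ∀ x : E, ‖x‖ ≤ ∑ i, ‖Module.finBasis ℝ E i‖ * |(Module.finBasis ℝ E).coord i x| := by
    intro x
    conv_lhs => rw [← (Module.finBasis ℝ E).sum_repr x]
    refine (norm_sum_le _ _).trans (Finset.sum_le_sum fun i _ => ?_)
    rw [norm_smul, mul_comm]
    rfl
  have hdec0 : ∀ j : ℕ, ∀ f ∈ Submodule.span ℂ S, ∃ c : ℝ, ∀ x, ‖x‖ ^ j * ‖f x‖ ≤ c := by
    intro j
    induction j with
    | zero => simpa using hb'
    | succ j ih =>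
      intro f hf
      choose c hc using fun i => ih _ (hm' f hf
        (LinearMap.toContinuousLinearMap ((Module.finBasis ℝ E).coord i)))
      refine ⟨∑ i, ‖Module.finBasis ℝ E i‖ * c i, fun x => ?_⟩
      calc ‖x‖ ^ (j + 1) * ‖f x‖ = ‖x‖ * (‖x‖ ^ j * ‖f x‖) := by ring
        _ ≤ (∑ i, ‖Module.finBasis ℝ E i‖ * |(Module.finBasis ℝ E).coord i x|)
            * (‖x‖ ^ j * ‖f x‖) := by
          gcongr
          exact hx x
        _ = ∑ i, ‖Module.finBasis ℝ E i‖ *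
            (‖x‖ ^ j * (|(Module.finBasis ℝ E).coord i x| * ‖f x‖)) := by
          rw [Finset.sum_mul]
          exact Finset.sum_congr rfl fun i _ => by ring
        _ ≤ _ := by
          gcongr with i
          have := hc i x
          rwa [norm_mul, Complex.norm_real, Real.norm_eq_abs] at this
  obtain ⟨C, hC0, hC⟩ := exists_iteratedFDeriv_succ_le E
  have hdec : ∀ n j : ℕ, ∀ f ∈ Submodule.span ℂ S, ∃ c : ℝ, ∀ x,
      ‖x‖ ^ j * ‖iteratedFDeriv ℝ n f x‖ ≤ c := by
    intro n j
    induction n with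
    | zero =>
      intro f hf
      simp only [norm_iteratedFDeriv_zero]
      exact hdec0 j f hf
    | succ n ih =>
      intro f hf
      choose c hc using fun i => ih _ (hd' f hf (Module.finBasis ℝ E i))
      refine ⟨C * ∑ i, c i, fun x => ?_⟩
      calc _ ≤ ‖x‖ ^ j * (C * ∑ i, ‖iteratedFDeriv ℝ n
              (fun y => fderiv ℝ f y (Module.finBasis ℝ E i)) x‖) := by
            gcongr
            exact hC f (ht' f hf) n x
        _ = C * ∑ i, ‖x‖ ^ j * ‖iteratedFDeriv ℝ n
              (fun y => fderiv ℝ f y (Module.finBasis ℝ E i)) x‖ := by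
            rw [Finset.mul_sum, Finset.mul_sum, Finset.mul_sum]
            exact Finset.sum_congr rfl fun i _ => by ring
        _ ≤ _ := by
            gcongr with i
            exact hc i x
  intro f hf
  have hf' := Submodule.subset_span (R := ℂ) hf
  exact ⟨⟨f, ht' f hf', fun j n => hdec n j f hf'⟩, fun x => rfl⟩

/-- A function which is bounded after multiplication with any Schwartz function is polynomially
bounded. -/
lemma exists_poly_bound {c : E → ℂ} (hc : ∀ g : 𝓢(E, ℂ), ∃ B : ℝ, ∀ x, ‖g x‖ * ‖c x‖ ≤ B) :
    ∃ (k : ℕ) (C : ℝ), ∀ x, ‖c x‖ ≤ C * (1 + ‖x‖) ^ k := by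
  by_contra! hcon
  choose x hx using fun k : ℕ => hcon k k
  have hpos : ∀ y : E, 0 < 1 + ‖y‖ := fun y => by linarith [norm_nonneg y]
  have hone : ∀ y : E, 1 ≤ 1 + ‖y‖ := fun y => by linarith [norm_nonneg y]
  -- If `c` violates every bound, say `‖c (x k)‖ > k (1 + ‖x k‖) ^ k`, the envelope with value at
  -- least `(1 + ‖x k‖)^{-k}` at `x k` contradicts the hypothesis, provided it decreases rapidly.
  -- The inserted `0` is the value at points that are not of the form `x k`.
  let T : E → Set ℝ := fun y => insert 0 {r | ∃ k, x k = y ∧ r = ((1 + ‖y‖) ^ k)⁻¹}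
  have hbd : ∀ y, BddAbove (T y) := by
    refine fun y => ⟨1, ?_⟩
    rintro _ (rfl | ⟨k, -, rfl⟩)
    · exact zero_le_one
    · exact inv_le_one_of_one_le₀ (one_le_pow₀ (hone y))
  obtain ⟨g, hg⟩ := exists_schwartz_dominating (h := fun y => sSup (T y))
    (fun y => le_csSup (hbd y) (Set.mem_insert _ _)) (by
      intro j
      refine ⟨1 + ∑ k ∈ Finset.range j, (1 + ‖x k‖) ^ j, fun y => ?_⟩
      have h0 : 0 ≤ 1 + ∑ k ∈ Finset.range j, (1 + ‖x k‖) ^ j :=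
        add_nonneg zero_le_one (Finset.sum_nonneg fun k _ => by positivity)
      rw [mul_comm, ← le_div_iff₀ (pow_pos (hpos y) j)]
      refine csSup_le ⟨0, Set.mem_insert _ _⟩ ?_
      rintro _ (rfl | ⟨k, hk, rfl⟩)
      · positivity
      · rw [le_div_iff₀ (pow_pos (hpos y) j), inv_mul_le_iff₀ (pow_pos (hpos y) k)]
        -- Indices `k ≥ j` satisfy the decay bound of order `j` by themselves; the finitely many `k
        -- < j` are covered by the sum in the constant.
        rcases le_or_gt j k with hjk | hjk
        · calc (1 + ‖y‖) ^ j ≤ (1 + ‖y‖) ^ k * 1 := by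
                rw [mul_one]; exact pow_le_pow_right₀ (hone y) hjk
            _ ≤ _ := by
                gcongr
                linarith [Finset.sum_nonneg fun k (_ : k ∈ Finset.range j) =>
                  (pow_pos (hpos (x k)) j).le]
        · have h1 : (1 + ‖x k‖) ^ j ≤ ∑ k ∈ Finset.range j, (1 + ‖x k‖) ^ j :=
            Finset.single_le_sum (f := fun k => (1 + ‖x k‖) ^ j)
              (fun _ _ => by positivity) (Finset.mem_range.2 hjk)
          rw [hk] at h1
          calc (1 + ‖y‖) ^ j ≤ 1 * (1 + ∑ k ∈ Finset.range j, (1 + ‖x k‖) ^ j) := by linarith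
            _ ≤ _ := by
                gcongr
                exact one_le_pow₀ (hone y))
  obtain ⟨B, hB⟩ := hc g
  obtain ⟨k, hk⟩ := exists_nat_gt B
  have h1 : ((1 + ‖x k‖) ^ k)⁻¹ ≤ ‖g (x k)‖ :=
    (le_csSup (hbd (x k)) (Set.mem_insert_of_mem _ ⟨k, rfl, rfl⟩)).trans (hg (x k))
  have h2 : (k : ℝ) ≤ ‖g (x k)‖ * ‖c (x k)‖ := by
    have hp := pow_pos (hpos (x k)) k
    calc (k : ℝ) = ((1 + ‖x k‖) ^ k)⁻¹ * (k * (1 + ‖x k‖) ^ k) := by field_simp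
      _ ≤ _ := by
        gcongr
        exact (hx k).le
  linarith [hB (x k)]

end Calculus
end Shubin

namespace Shubin

/-! ### Schwartz functions as a predicate, and their closure properties. -/

section SchwartzPredicate

lemma hasTemperateGrowth_ofReal_clm {E : Type} [NormedAddCommGroup E] [NormedSpace ℝ E]
    (ℓ : E →L[ℝ] ℝ) : Function.HasTemperateGrowth fun x => (ℓ x : ℂ) :=
  (Complex.ofRealCLM.comp ℓ).hasTemperateGrowth

variable {E F : Type} [NormedAddCommGroup E] [NormedSpace ℝ E] [NormedAddCommGroup F]
  [NormedSpace ℝ F]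

/-- The function `f` is a Schwartz function. -/
def IsSchwartz (f : E → ℂ) : Prop := ∃ F : 𝓢(E, ℂ), ⇑F = f

lemma _root_.SchwartzMap.isSchwartz (f : 𝓢(E, ℂ)) : IsSchwartz f := ⟨f, rfl⟩

namespace IsSchwartz

lemma temperate {f : E → ℂ} (hf : IsSchwartz f) : f.HasTemperateGrowth := by
  obtain ⟨F, rfl⟩ := hf
  exact F.hasTemperateGrowth

lemma contDiff {f : E → ℂ} (hf : IsSchwartz f) : ContDiff ℝ ∞ f := hf.temperate.1

lemma continuous {f : E → ℂ} (hf : IsSchwartz f) : Continuous f := hf.contDiff.continuous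

lemma differentiable {f : E → ℂ} (hf : IsSchwartz f) : Differentiable ℝ f :=
  hf.contDiff.differentiable (by simp)

lemma sub {f g : E → ℂ} (hf : IsSchwartz f) (hg : IsSchwartz g) : IsSchwartz (f - g) := by
  obtain ⟨F, rfl⟩ := hf
  obtain ⟨G, rfl⟩ := hg
  exact ⟨F - G, rfl⟩

lemma const_smul {f : E → ℂ} (hf : IsSchwartz f) (c : ℂ) : IsSchwartz (c • f) := by
  obtain ⟨F, rfl⟩ := hf
  exact ⟨c • F, rfl⟩

lemma temperate_mul {a f : E → ℂ} (hf : IsSchwartz f) (ha : a.HasTemperateGrowth) :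
    IsSchwartz fun x => a x * f x := by
  obtain ⟨F, rfl⟩ := hf
  exact ⟨SchwartzMap.smulLeftCLM ℂ a F, by
    ext x; simp [SchwartzMap.smulLeftCLM_apply_apply ha]⟩

lemma fderiv_apply {f : E → ℂ} (hf : IsSchwartz f) (e : E) :
    IsSchwartz fun x => fderiv ℝ f x e := by
  obtain ⟨F, rfl⟩ := hf
  exact ⟨LineDeriv.lineDerivOp e F, by ext x; exact SchwartzMap.lineDerivOp_apply_eq_fderiv e F x⟩

/-- A temperate left inverse `g` gives `‖x‖ = ‖g (h x)‖ ≤ C (1 + ‖h x‖) ^ k`, which is the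
properness needed for pulling back rapid decay along `h`. -/
lemma comp {f : F → ℂ} (hf : IsSchwartz f) {h : E → F} (hh : h.HasTemperateGrowth) {g : F → E}
    (hg : g.HasTemperateGrowth) (hgh : ∀ x, g (h x) = x) : IsSchwartz fun x => f (h x) := by
  obtain ⟨F, rfl⟩ := hf
  obtain ⟨k, C, hC⟩ := hg.2 0
  refine ⟨SchwartzMap.compCLM ℂ hh ⟨k, C, fun x => ?_⟩ F, rfl⟩
  simpa [hgh] using hC (h x)

lemma decay {f : E → ℂ} (hf : IsSchwartz f) (k : ℕ) :
    ∃ C, 0 ≤ C ∧ ∀ x, (1 + ‖x‖) ^ k * ‖f x‖ ≤ C := by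
  obtain ⟨F, rfl⟩ := hf
  have h : ∀ x, (1 + ‖x‖) ^ k * ‖F x‖
      ≤ 2 ^ k * ((Finset.Iic (k, 0)).sup fun m => SchwartzMap.seminorm ℂ m.1 m.2) F := fun x => by
    simpa using SchwartzMap.one_add_le_sup_seminorm_apply (𝕜 := ℂ) (m := (k, 0)) (k := k)
      (n := 0) le_rfl le_rfl F x
  exact ⟨_, le_trans (by positivity) (h 0), h⟩

lemma conj {f : E → ℂ} (hf : IsSchwartz f) : IsSchwartz fun x => (starRingEnd ℂ) (f x) := by
  obtain ⟨F, rfl⟩ := hf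
  exact ⟨SchwartzMap.postcompCLM (𝕜 := ℝ) Complex.conjCLE.toContinuousLinearMap F, by ext x; rfl⟩

lemma integrable [MeasurableSpace E] [BorelSpace E] [FiniteDimensional ℝ E] {f : E → ℂ}
    (hf : IsSchwartz f) (μ : Measure E) [μ.HasTemperateGrowth] : Integrable f μ := by
  obtain ⟨F, rfl⟩ := hf
  exact F.integrable

lemma of_hasCompactSupport {f : E → ℂ} (hf : HasCompactSupport f) (hs : ContDiff ℝ ∞ f) :
    IsSchwartz f := ⟨hf.toSchwartzMap hs, rfl⟩

variable [FiniteDimensional ℝ E] [FiniteDimensional ℝ F]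

/-- By the Leibniz rule, and by splitting a functional on `E × F` into its restrictions to the two
factors, the span of all tensor products satisfies the closure criterion. -/
lemma tensor {f : E → ℂ} {g : F → ℂ} (hf : IsSchwartz f) (hg : IsSchwartz g) :
    IsSchwartz fun p : E × F => f p.1 * g p.2 := by
  let S : Set (E × F → ℂ) := {h | ∃ f g, IsSchwartz f ∧ IsSchwartz g ∧ h = fun p => f p.1 * g p.2}
  suffices h : ∀ h ∈ S, ∃ H : 𝓢(E × F, ℂ), ∀ x, H x = h x by
    obtain ⟨H, hH⟩ := h _ ⟨f, g, hf, hg, rfl⟩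
    exact ⟨H, funext hH⟩
  refine schwartz_of_closed ?_ ?_ ?_
  · rintro _ ⟨f, g, hf, hg, rfl⟩
    obtain ⟨C, hC0, hC⟩ := hf.decay 0
    obtain ⟨D, hD0, hD⟩ := hg.decay 0
    refine ⟨C * D, fun x => ?_⟩
    rw [norm_mul]
    gcongr
    · simpa using hC x.1
    · simpa using hD x.2
  · rintro _ ⟨f, g, hf, hg, rfl⟩
    refine ⟨fun p => f p.1 • ((fderiv ℝ g p.2).comp (ContinuousLinearMap.snd ℝ E F))
      + g p.2 • ((fderiv ℝ f p.1).comp (ContinuousLinearMap.fst ℝ E F)), fun p => ?_, fun e => ?_⟩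
    · exact ((hf.differentiable p.1).hasFDerivAt.comp p hasFDerivAt_fst).mul
        ((hg.differentiable p.2).hasFDerivAt.comp p hasFDerivAt_snd)
    · refine Submodule.add_mem _ (Submodule.subset_span ?_) (Submodule.subset_span ?_)
      · exact ⟨f, fun y => fderiv ℝ g y e.2, hf, hg.fderiv_apply e.2, rfl⟩
      · refine ⟨fun y => fderiv ℝ f y e.1, g, hf.fderiv_apply e.1, hg, ?_⟩
        ext p
        exact mul_comm _ _
  · rintro _ ⟨f, g, hf, hg, rfl⟩ ℓ
    have h : (fun x : E × F => (ℓ x : ℂ) * (f x.1 * g x.2))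
        = (fun x => ((ℓ.comp (ContinuousLinearMap.inl ℝ E F) x.1 : ℝ) : ℂ) * f x.1 * g x.2)
        + (fun x => f x.1 * (((ℓ.comp (ContinuousLinearMap.inr ℝ E F) x.2 : ℝ) : ℂ) * g x.2)) := by
      ext x
      have h1 : ℓ x = ℓ (x.1, 0) + ℓ (0, x.2) := by rw [← map_add]; simp
      simp only [Pi.add_apply, ContinuousLinearMap.comp_apply, ContinuousLinearMap.inl_apply,
        ContinuousLinearMap.inr_apply, h1]
      push_cast
      ring
    rw [h]
    refine Submodule.add_mem _ (Submodule.subset_span ?_) (Submodule.subset_span ?_)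
    · exact ⟨_, g, hf.temperate_mul (hasTemperateGrowth_ofReal_clm
        (ℓ.comp (ContinuousLinearMap.inl ℝ E F))), hg, rfl⟩
    · exact ⟨f, _, hf, hg.temperate_mul (hasTemperateGrowth_ofReal_clm
        (ℓ.comp (ContinuousLinearMap.inr ℝ E F))), rfl⟩

end IsSchwartz

lemma isSchwartz_of_closed [FiniteDimensional ℝ E] {S : Set (E → ℂ)}
    (hb : ∀ f ∈ S, ∃ c : ℝ, ∀ x, ‖f x‖ ≤ c)
    (hd : ∀ f ∈ S, ∃ f' : E → E →L[ℝ] ℂ, (∀ x, HasFDerivAt f (f' x) x) ∧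
      ∀ e, (fun x => f' x e) ∈ Submodule.span ℂ S)
    (hm : ∀ f ∈ S, ∀ ℓ : E →L[ℝ] ℝ, (fun x => (ℓ x : ℂ) * f x) ∈ Submodule.span ℂ S) :
    ∀ f ∈ S, IsSchwartz f := fun f hf =>
  (schwartz_of_closed hb hd hm f hf).imp fun _ h => funext h

/-- Around each point there is a Schwartz function, in fact a bump function, which is constant
one. -/
lemma exists_schwartz_eq_one [FiniteDimensional ℝ E] (x : E) :
    ∃ g : 𝓢(E, ℂ), HasCompactSupport g ∧ ∀ᶠ y in nhds x, g y = 1 := by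
  let φ : ContDiffBump x := ⟨1, 2, by norm_num, by norm_num⟩
  have h : HasCompactSupport fun y => (φ y : ℂ) :=
    φ.hasCompactSupport.comp_left (g := fun r : ℝ => (r : ℂ)) Complex.ofReal_zero
  refine ⟨h.toSchwartzMap (Complex.ofRealCLM.contDiff.comp φ.contDiff), h, ?_⟩
  filter_upwards [φ.eventuallyEq_one] with y hy
  change ((φ y : ℝ) : ℂ) = 1
  rw [hy]
  simp

/-- Two rapidly decreasing functions: their tensor product is dominated by a Schwartz function. -/
lemma exists_schwartz_dominating_mul [FiniteDimensional ℝ E] [FiniteDimensional ℝ F]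
    (f : 𝓢(E, ℂ)) (g : 𝓢(F, ℂ)) : ∃ h : 𝓢(E × F, ℂ), ∀ x y, ‖f x‖ * ‖g y‖ = ‖h (x, y)‖ := by
  obtain ⟨h, hh⟩ := f.isSchwartz.tensor g.isSchwartz
  exact ⟨h, fun x y => by rw [hh, norm_mul]⟩

/-- A Schwartz function on a product is dominated by a tensor product of Schwartz functions. -/
lemma exists_schwartz_mul_dominating [FiniteDimensional ℝ E] [FiniteDimensional ℝ F]
    (h : 𝓢(E × F, ℂ)) :
    ∃ (f : 𝓢(E, ℂ)) (g : 𝓢(F, ℂ)), ∀ x y, ‖h (x, y)‖ ≤ ‖f x‖ * ‖g y‖ := by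
  obtain ⟨B, hB0, hB⟩ := h.isSchwartz.decay 0
  simp only [pow_zero, one_mul] at hB
  have hbx : ∀ x, BddAbove (Set.range fun y => ‖h (x, y)‖) := fun x =>
    ⟨B, by rintro _ ⟨y, rfl⟩; exact hB _⟩
  have hby : ∀ y, BddAbove (Set.range fun x => ‖h (x, y)‖) := fun y =>
    ⟨B, by rintro _ ⟨x, rfl⟩; exact hB _⟩
  -- The two partial suprema of `‖h‖` both dominate `‖h (x, y)‖`, hence so does the product of their
  -- square roots. The square root is paid for by using decay of order `2 * j` of `h`.
  obtain ⟨f, hf⟩ := exists_schwartz_dominating (h := fun x => √(⨆ y, ‖h (x, y)‖))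
    (fun x => Real.sqrt_nonneg _) (by
      intro j
      obtain ⟨C, hC0, hC⟩ := h.isSchwartz.decay (2 * j)
      refine ⟨√C, fun x => ?_⟩
      refine Real.le_sqrt_of_sq_le ?_
      rw [mul_pow, Real.sq_sqrt (Real.iSup_nonneg fun _ => norm_nonneg _), ← pow_mul,
        Real.mul_iSup_of_nonneg (by positivity)]
      refine ciSup_le fun y => le_trans ?_ (hC (x, y))
      rw [mul_comm j 2]
      gcongr
      exact norm_fst_le (x, y))
  obtain ⟨g, hg⟩ := exists_schwartz_dominating (h := fun y => √(⨆ x, ‖h (x, y)‖))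
    (fun x => Real.sqrt_nonneg _) (by
      intro j
      obtain ⟨C, hC0, hC⟩ := h.isSchwartz.decay (2 * j)
      refine ⟨√C, fun y => ?_⟩
      refine Real.le_sqrt_of_sq_le ?_
      rw [mul_pow, Real.sq_sqrt (Real.iSup_nonneg fun _ => norm_nonneg _), ← pow_mul,
        Real.mul_iSup_of_nonneg (by positivity)]
      refine ciSup_le fun x => le_trans ?_ (hC (x, y))
      rw [mul_comm j 2]
      gcongr
      exact norm_snd_le (x, y))
  refine ⟨f, g, fun x y => ?_⟩
  calc ‖h (x, y)‖ = √‖h (x, y)‖ * √‖h (x, y)‖ := (Real.mul_self_sqrt (norm_nonneg _)).symm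
    _ ≤ √(⨆ y, ‖h (x, y)‖) * √(⨆ x, ‖h (x, y)‖) := by
      gcongr
      · exact le_ciSup (hbx x) y
      · exact le_ciSup (hby y) x
    _ ≤ _ := by
      gcongr
      · exact hf x
      · exact hg y

end SchwartzPredicate

end Shubin

namespace Shubin

/-! ### Continuous operators on `𝓞_M` and criteria for continuity. -/

section Operators

variable {E : Type} [NormedAddCommGroup E] [NormedSpace ℝ E]

/-- A function of temperate growth as an element of `𝓞_M(E)`. -/
def OM.mk (f : E → ℂ) (hf : f.HasTemperateGrowth) : OM E := ⟨f, hf⟩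

@[simp] lemma OM.mk_apply (f : E → ℂ) (hf : f.HasTemperateGrowth) (x : E) : OM.mk f hf x = f x :=
  rfl

lemma OM.contDiff (φ : OM E) : ContDiff ℝ ∞ φ := φ.hasTemperateGrowth.1

lemma OM.differentiable (φ : OM E) : Differentiable ℝ φ := φ.contDiff.differentiable (by simp)

lemma OM.continuous (φ : OM E) : Continuous φ := φ.contDiff.continuous

lemma OM.exists_bound (φ : OM E) : ∃ (k : ℕ) (C : ℝ), 0 ≤ C ∧ ∀ x, ‖φ x‖ ≤ C * (1 + ‖x‖) ^ k := by
  obtain ⟨k, C, hC0, hC⟩ := φ.hasTemperateGrowth.norm_iteratedFDeriv_le_uniform 0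
  exact ⟨k, C, hC0, fun x => by simpa using hC 0 le_rfl x⟩

lemma hasTemperateGrowth_fderiv_apply {f : E → ℂ} (hf : f.HasTemperateGrowth) (e : E) :
    Function.HasTemperateGrowth fun x => fderiv ℝ f x e := by
  have hc : ContDiff ℝ ∞ (fderiv ℝ f) := hf.1.fderiv_right (by simp)
  refine ⟨hc.clm_apply contDiff_const, fun n => ?_⟩
  obtain ⟨k, C, hC⟩ := hf.2 (n + 1)
  refine ⟨k, ‖ContinuousLinearMap.apply ℝ ℂ e‖ * C, fun x => ?_⟩
  have h := (ContinuousLinearMap.apply ℝ ℂ e).norm_iteratedFDeriv_comp_left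
    (hc.contDiffAt (x := x)) (N := ∞) (n := n) (mod_cast le_top)
  rw [norm_iteratedFDeriv_fderiv] at h
  refine h.trans ?_
  rw [mul_assoc]
  gcongr
  exact hC x

lemma OM.seminorm_zero_le {φ : OM E} {f : 𝓢(E, ℂ)} {B : ℝ} (h : ∀ x, ‖f x‖ * ‖φ x‖ ≤ B) :
    OM.seminormFamily E (f, 0) φ ≤ B := by
  refine ciSup_le fun x => ?_
  rw [norm_iteratedFDeriv_zero]
  exact h x

lemma OM.le_seminorm_zero (φ : OM E) (f : 𝓢(E, ℂ)) (x : E) :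
    ‖f x‖ * ‖φ x‖ ≤ OM.seminormFamily E (f, 0) φ := by
  simpa using φ.le_seminorm f 0 x

/-- The directional derivative `φ ↦ ∂_e φ` as a continuous operator on `𝓞_M(E)`. -/
noncomputable def OM.deriv (e : E) : OM E →L[ℂ] OM E where
  toFun φ := OM.mk (fun x => fderiv ℝ φ x e) (hasTemperateGrowth_fderiv_apply φ.hasTemperateGrowth e)
  map_add' φ ψ := by
    ext x
    have h : fderiv ℝ (φ + ψ : OM E) x = fderiv ℝ φ x + fderiv ℝ ψ x :=
      fderiv_add (φ.differentiable x) (ψ.differentiable x)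
    simp [h]
  map_smul' c φ := by
    ext x
    have h : fderiv ℝ (c • φ : OM E) x = c • fderiv ℝ φ x :=
      fderiv_const_smul (φ.differentiable x) c
    simp [h]
  cont := by
    let L : OM E →ₗ[ℂ] OM E :=
      { toFun := fun φ => OM.mk (fun x => fderiv ℝ φ x e)
          (hasTemperateGrowth_fderiv_apply φ.hasTemperateGrowth e)
        map_add' := fun φ ψ => by
          ext x
          have h : fderiv ℝ (φ + ψ : OM E) x = fderiv ℝ φ x + fderiv ℝ ψ x :=
            fderiv_add (φ.differentiable x) (ψ.differentiable x)
          simp [h]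
        map_smul' := fun c φ => by
          ext x
          have h : fderiv ℝ (c • φ : OM E) x = c • fderiv ℝ φ x :=
            fderiv_const_smul (φ.differentiable x) c
          simp [h] }
    refine WithSeminorms.continuous_of_isBounded OM.withSeminorms OM.withSeminorms L
      (Seminorm.IsBounded.of_real ?_)
    rintro ⟨f, k⟩
    refine ⟨{(f, k + 1)}, ‖ContinuousLinearMap.apply ℝ ℂ e‖, fun φ => ?_⟩
    rw [Finset.sup_singleton]
    refine ciSup_le fun x => ?_
    have hc : ContDiff ℝ ∞ (fderiv ℝ φ) := φ.contDiff.fderiv_right (by simp)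
    have h := (ContinuousLinearMap.apply ℝ ℂ e).norm_iteratedFDeriv_comp_left
      (hc.contDiffAt (x := x)) (N := ∞) (n := k) (mod_cast le_top)
    rw [norm_iteratedFDeriv_fderiv] at h
    calc _ ≤ ‖f x‖ * (‖ContinuousLinearMap.apply ℝ ℂ e‖ * ‖iteratedFDeriv ℝ (k + 1) φ x‖) := by
          gcongr
          exact h
      _ = ‖ContinuousLinearMap.apply ℝ ℂ e‖ * (‖f x‖ * ‖iteratedFDeriv ℝ (k + 1) φ x‖) := by ring
      _ ≤ _ := by
          gcongr
          exact φ.le_seminorm f (k + 1) x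

lemma OM.deriv_apply (e : E) (φ : OM E) (x : E) : OM.deriv e φ x = fderiv ℝ φ x e := rfl

/-- Iterated directional derivatives. -/
noncomputable def OM.derivs : List E → (OM E →L[ℂ] OM E)
  | [] => ContinuousLinearMap.id ℂ _
  | e :: es => (OM.derivs es).comp (OM.deriv e)

lemma OM.continuous_seminorm (f : 𝓢(E, ℂ)) (k : ℕ) : Continuous (OM.seminormFamily E (f, k)) :=
  OM.withSeminorms.continuous_seminorm (f, k)

lemma OM.deriv_mul (e : E) (g φ : OM E) :
    OM.deriv e (g * φ) = OM.deriv e g * φ + g * OM.deriv e φ := by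
  ext x
  have h : fderiv ℝ (g * φ : OM E) x = g x • fderiv ℝ φ x + φ x • fderiv ℝ g x :=
    fderiv_mul (g.differentiable x) (φ.differentiable x)
  simp [OM.deriv_apply, h]
  ring

section Criteria

variable [FiniteDimensional ℝ E]

lemma OM.exists_seminorm_succ_le (E : Type) [NormedAddCommGroup E] [NormedSpace ℝ E]
    [FiniteDimensional ℝ E] : ∃ C : ℝ, 0 ≤ C ∧ ∀ (f : 𝓢(E, ℂ)) (k : ℕ) (φ : OM E),
      OM.seminormFamily E (f, k + 1) φ
        ≤ C * ∑ i, OM.seminormFamily E (f, k) (OM.deriv (Module.finBasis ℝ E i) φ) := by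
  obtain ⟨C, hC0, hC⟩ := exists_iteratedFDeriv_succ_le E
  refine ⟨C, hC0, fun f k φ => ciSup_le fun x => ?_⟩
  calc _ ≤ ‖f x‖ * (C * ∑ i, ‖iteratedFDeriv ℝ k
        (fun y => fderiv ℝ φ y (Module.finBasis ℝ E i)) x‖) := by
        gcongr
        exact hC φ φ.contDiff k x
    _ = C * ∑ i, ‖f x‖ * ‖iteratedFDeriv ℝ k
        (fun y => fderiv ℝ φ y (Module.finBasis ℝ E i)) x‖ := by
        rw [mul_left_comm, Finset.mul_sum]
    _ ≤ _ := by
        gcongr with i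
        exact (OM.deriv (Module.finBasis ℝ E i) φ).le_seminorm f k x

/-- Iterating the basis expansion leaves only seminorms of order zero of scalar derivatives, which
can be estimated pointwise and are compatible with restriction to slices. -/
lemma OM.exists_seminorm_le_derivs (k : ℕ) : ∃ (ι : Type) (_ : Fintype ι) (D : ι → List E) (C : ℝ),
    0 ≤ C ∧ ∀ (f : 𝓢(E, ℂ)) (φ : OM E), OM.seminormFamily E (f, k) φ
      ≤ C * ∑ i, OM.seminormFamily E (f, 0) (OM.derivs (D i) φ) := by
  induction k with
  | zero => exact ⟨Unit, inferInstance, fun _ => [], 1, zero_le_one, fun f φ => by simp [OM.derivs]⟩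
  | succ k ih =>
    obtain ⟨ι, hι, D, C, hC0, hC⟩ := ih
    obtain ⟨C', hC0', hC'⟩ := OM.exists_seminorm_succ_le E
    refine ⟨Fin (Module.finrank ℝ E) × ι, inferInstance,
      fun p => Module.finBasis ℝ E p.1 :: D p.2, C' * C, by positivity, fun f φ => ?_⟩
    refine (hC' f k φ).trans ?_
    rw [mul_assoc, Fintype.sum_prod_type, Finset.mul_sum (a := C)]
    gcongr with i
    exact hC f (OM.deriv (Module.finBasis ℝ E i) φ)

/-- Continuous seminorms on `𝓞_M(E)` are dominated by finite sums of seminorms of the form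
`φ ↦ sup |g| |∂_{e_1} ⋯ ∂_{e_k} φ|`. -/
lemma OM.exists_bound_of_continuous {p : Seminorm ℂ (OM E)} (hp : Continuous p) :
    ∃ (ι : Type) (_ : Fintype ι) (g : ι → 𝓢(E, ℂ)) (D : ι → List E) (C : ℝ), 0 ≤ C ∧
      ∀ φ, p φ ≤ C * ∑ i, OM.seminormFamily E (g i, 0) (OM.derivs (D i) φ) := by
  obtain ⟨s, C, -, hs⟩ := Seminorm.bound_of_continuous OM.withSeminorms p hp
  choose ι hι D C' hC0 hC using fun k => OM.exists_seminorm_le_derivs (E := E) k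
  refine ⟨Σ i : s, ι i.1.2, inferInstance, fun i => i.1.1.1, fun i => D i.1.1.2 i.2,
    C * ∑ i : s, C' i.1.2,
    mul_nonneg C.2 (Finset.sum_nonneg fun i _ => hC0 _), fun φ => ?_⟩
  refine (hs φ).trans ?_
  rw [_root_.smul_apply, NNReal.smul_def, smul_eq_mul, mul_assoc]
  gcongr
  refine (Seminorm.finset_sup_le_sum _ s φ).trans ?_
  rw [_root_.sum_apply, ← Finset.sum_coe_sort, Fintype.sum_sigma, Finset.sum_mul]
  refine Finset.sum_le_sum fun i _ => (hC i.1.2 i.1.1 φ).trans ?_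
  refine mul_le_mul_of_nonneg_left ?_ (hC0 _)
  exact Finset.single_le_sum (f := fun i : s => ∑ j, OM.seminormFamily E (i.1.1, 0)
    (OM.derivs (D i.1.2 j) φ)) (fun i _ => Finset.sum_nonneg fun _ _ => apply_nonneg _ _)
    (Finset.mem_univ i)

/-- A class of linear maps into `𝓞_M(E)`, closed up to linear combinations under directional
derivatives, consists of continuous maps if it does so for the topology given by the suprema
`sup |f| |φ|`. -/
lemma OM.continuous_of_closed {V : Type} [AddCommGroup V] [Module ℂ V] [TopologicalSpace V]
    [IsTopologicalAddGroup V] [ContinuousConstSMul ℂ V] {S : Set (V →ₗ[ℂ] OM E)}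
    (h0 : ∀ L ∈ S, ∀ f : 𝓢(E, ℂ), ∃ p : Seminorm ℂ V, Continuous p ∧
      ∀ φ x, ‖f x‖ * ‖L φ x‖ ≤ p φ)
    (h1 : ∀ L ∈ S, ∀ e, (OM.deriv e).toLinearMap ∘ₗ L ∈ Submodule.span ℂ S) :
    ∀ L ∈ S, Continuous L := by
  have h0' : ∀ L ∈ Submodule.span ℂ S, ∀ f : 𝓢(E, ℂ), ∃ p : Seminorm ℂ V, Continuous p ∧
      ∀ φ x, ‖f x‖ * ‖L φ x‖ ≤ p φ := by
    intro L hL f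
    induction hL using Submodule.span_induction with
    | mem L hL => exact h0 L hL f
    | zero => exact ⟨0, continuous_const, fun φ x => by simp⟩
    | add L M _ _ hL hM =>
      obtain ⟨p, hp, hpL⟩ := hL
      obtain ⟨q, hq, hqM⟩ := hM
      refine ⟨p + q, hp.add hq, fun φ x => ?_⟩
      calc _ ≤ ‖f x‖ * (‖L φ x‖ + ‖M φ x‖) := by
            gcongr
            exact norm_add_le _ _
        _ ≤ p φ + q φ := by rw [mul_add]; exact add_le_add (hpL φ x) (hqM φ x)
    | smul a L _ hL =>
      obtain ⟨p, hp, hpL⟩ := hL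
      refine ⟨‖a‖₊ • p, hp.const_smul _, fun φ x => ?_⟩
      calc _ = ‖a‖ * (‖f x‖ * ‖L φ x‖) := by
            rw [LinearMap.smul_apply, OM.smul_apply, norm_mul]; ring
        _ ≤ ‖a‖ * p φ := by gcongr; exact hpL φ x
  have h1' : ∀ L ∈ Submodule.span ℂ S, ∀ e,
      (OM.deriv e).toLinearMap ∘ₗ L ∈ Submodule.span ℂ S := by
    intro L hL e
    induction hL using Submodule.span_induction with
    | mem L hL => exact h1 L hL e
    | zero => rw [LinearMap.comp_zero]; exact Submodule.zero_mem _
    | add L M _ _ hL hM => rw [LinearMap.comp_add]; exact Submodule.add_mem _ hL hM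
    | smul a L _ hL => rw [LinearMap.comp_smul]; exact Submodule.smul_mem _ a hL
  obtain ⟨C, hC0, hC⟩ := OM.exists_seminorm_succ_le E
  have h2 : ∀ (k : ℕ) (f : 𝓢(E, ℂ)), ∀ L ∈ Submodule.span ℂ S,
      Continuous ((OM.seminormFamily E (f, k)).comp L) := by
    intro k f
    induction k with
    | zero =>
      intro L hL
      obtain ⟨p, hp, hpL⟩ := h0' L hL f
      exact Seminorm.continuous_of_le hp fun φ => OM.seminorm_zero_le (hpL φ)
    | succ k ih =>
      intro L hL
      have hq : Continuous (C.toNNReal • ∑ i, (OM.seminormFamily E (f, k)).comp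
          ((OM.deriv (Module.finBasis ℝ E i)).toLinearMap ∘ₗ L) : Seminorm ℂ V) := by
        have h : Continuous fun φ => C * ∑ i, (OM.seminormFamily E (f, k)).comp
          ((OM.deriv (Module.finBasis ℝ E i)).toLinearMap ∘ₗ L) φ :=
          continuous_const.mul (continuous_finsetSum _ fun i _ => ih _ (h1' L hL _))
        convert h using 1
        ext φ
        rw [_root_.smul_apply, _root_.sum_apply, NNReal.smul_def, Real.coe_toNNReal C hC0]
        rfl
      refine Seminorm.continuous_of_le hq fun φ => ?_
      refine (hC f k (L φ)).trans (le_of_eq ?_)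
      rw [_root_.smul_apply, _root_.sum_apply, NNReal.smul_def, Real.coe_toNNReal C hC0]
      rfl
  intro L hL
  refine (WithSeminorms.continuous_iff_continuous_comp OM.withSeminorms L).2 fun i => ?_
  exact h2 i.2 i.1 L (Submodule.subset_span hL)

/-- Multiplication by a fixed element of `𝓞_M(E)` as a continuous operator. -/
noncomputable def OM.mulL (g : OM E) : OM E →L[ℂ] OM E where
  toLinearMap := LinearMap.mulLeft ℂ g
  cont := by
    -- Composition with an arbitrary continuous `D` is included since the Leibniz rule produces
    -- terms in which the derivative falls on the argument.
    let S : Set (OM E →ₗ[ℂ] OM E) :=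
      {L | ∃ (g : OM E) (D : OM E →L[ℂ] OM E), L = LinearMap.mulLeft ℂ g ∘ₗ D.toLinearMap}
    refine OM.continuous_of_closed (S := S) ?_ ?_ _ ⟨g, ContinuousLinearMap.id ℂ _, rfl⟩
    · rintro _ ⟨g, D, rfl⟩ f
      obtain ⟨h, hh⟩ := f.isSchwartz.temperate_mul g.hasTemperateGrowth
      refine ⟨(OM.seminormFamily E (h, 0)).comp D.toLinearMap,
        (OM.continuous_seminorm h 0).comp D.continuous, fun φ x => ?_⟩
      refine le_trans (le_of_eq ?_) ((D φ).le_seminorm_zero h x)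
      simp [hh]
      ring
    · rintro _ ⟨g, D, rfl⟩ e
      have h : (OM.deriv e).toLinearMap ∘ₗ LinearMap.mulLeft ℂ g ∘ₗ D.toLinearMap
          = LinearMap.mulLeft ℂ (OM.deriv e g) ∘ₗ D.toLinearMap
          + LinearMap.mulLeft ℂ g ∘ₗ ((OM.deriv e).comp D).toLinearMap := by
        ext1 φ
        exact OM.deriv_mul e g (D φ)
      rw [h]
      exact Submodule.add_mem _ (Submodule.subset_span ⟨_, _, rfl⟩)
        (Submodule.subset_span ⟨_, _, rfl⟩)

@[simp] lemma OM.mulL_apply (g φ : OM E) : OM.mulL g φ = g * φ := rfl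

end Criteria

/-- Evaluation at a point is continuous. -/
noncomputable def OM.eval [FiniteDimensional ℝ E] (x : E) : OM E →L[ℂ] ℂ where
  toFun φ := φ x
  map_add' _ _ := rfl
  map_smul' _ _ := rfl
  cont := by
    obtain ⟨g, -, hg⟩ := exists_schwartz_eq_one x
    let L : OM E →ₗ[ℂ] ℂ := { toFun := fun φ => φ x, map_add' := fun _ _ => rfl, map_smul' := fun _ _ => rfl }
    refine WithSeminorms.continuous_normedSpace_rng ℂ OM.withSeminorms L ?_
    refine ⟨{(g, 0)}, 1, fun φ => ?_⟩
    rw [Finset.sup_singleton, one_smul]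
    have h := φ.le_seminorm_zero g x
    rwa [hg.self_of_nhds, norm_one, one_mul] at h

@[simp] lemma OM.eval_apply [FiniteDimensional ℝ E] (x : E) (φ : OM E) : OM.eval x φ = φ x := rfl

end Operators

end Shubin

namespace Shubin

/-! ### Base change: applying an operator to functions with parameters. -/

section BaseChange

lemma exists_seminorm_sum {V ι : Type} [AddCommGroup V] [Module ℂ V] [TopologicalSpace V]
    [Fintype ι] (p : ι → Seminorm ℂ V) (hp : ∀ i, Continuous (p i)) {C : ℝ} (hC : 0 ≤ C) :
    ∃ P : Seminorm ℂ V, Continuous P ∧ ∀ φ, P φ = C * ∑ i, p i φ := by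
  have h1 : ∀ φ, (C.toNNReal • ∑ i, p i : Seminorm ℂ V) φ = C * ∑ i, p i φ := fun φ => by
    rw [_root_.smul_apply, _root_.sum_apply, NNReal.smul_def, Real.coe_toNNReal C hC]
    rfl
  refine ⟨C.toNNReal • ∑ i, p i, ?_, h1⟩
  have h : Continuous fun φ => C * ∑ i, p i φ :=
    continuous_const.mul (continuous_finsetSum _ fun i _ => hp i)
  convert h using 1
  exact funext h1

variable {Z E N : Type} [NormedAddCommGroup Z] [NormedSpace ℝ Z]
  [NormedAddCommGroup E] [NormedSpace ℝ E]
  [NormedAddCommGroup N] [NormedSpace ℝ N]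

lemma OM.deriv_comm (e e' : E) (φ : OM E) :
    OM.deriv e (OM.deriv e' φ) = OM.deriv e' (OM.deriv e φ) := by
  have hc : ContDiff ℝ ∞ (fderiv ℝ φ) := φ.contDiff.fderiv_right (by simp)
  have h : ∀ e' x, fderiv ℝ (fun y => fderiv ℝ φ y e') x = (fderiv ℝ (fderiv ℝ φ) x).flip e' := by
    intro e' x
    rw [fderiv_clm_apply (hc.differentiable (by simp) x) (differentiableAt_const _)]
    simp
  have hd : ∀ e e' x, OM.deriv e (OM.deriv e' φ) x = fderiv ℝ (fderiv ℝ φ) x e e' := by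
    intro e e' x
    change fderiv ℝ (fun y => fderiv ℝ φ y e') x e = _
    rw [h]
    rfl
  ext x
  rw [hd, hd]
  exact (φ.contDiff.contDiffAt.isSymmSndFDerivAt
    (by simp only [minSmoothness_of_isRCLikeNormedField]; exact ENat.LEInfty.out)) e e'

lemma hasTemperateGrowth_mk_left (z : Z) : Function.HasTemperateGrowth fun e : E => (z, e) := by
  have h : (fun e : E => (z, e)) = fun e => ((z, 0) : Z × E) + ContinuousLinearMap.inr ℝ Z E e := by
    ext e <;> simp
  rw [h]
  exact (Function.HasTemperateGrowth.const _).add (ContinuousLinearMap.inr ℝ Z E).hasTemperateGrowth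

variable [FiniteDimensional ℝ Z] [FiniteDimensional ℝ E] [FiniteDimensional ℝ N]

/-- The restriction `φ(z, ·)`. -/
noncomputable def OM.slice (z : Z) : OM (Z × E) →L[ℂ] OM E :=
  OM.pullback (fun e : E => (z, e)) (hasTemperateGrowth_mk_left z)

@[simp] lemma OM.slice_apply (z : Z) (φ : OM (Z × E)) (e : E) : OM.slice z φ e = φ (z, e) := rfl

lemma OM.deriv_slice (z : Z) (e : E) (φ : OM (Z × E)) :
    OM.deriv e (OM.slice z φ) = OM.slice z (OM.deriv (0, e) φ) := by
  ext x
  have h : HasFDerivAt (fun e : E => φ (z, e)) _ x :=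
    (φ.differentiable (z, x)).hasFDerivAt.comp x (hasFDerivAt_prodMk_right z x)
  change fderiv ℝ (fun e : E => φ (z, e)) x e = fderiv ℝ φ (z, x) (0, e)
  rw [h.fderiv]
  simp

lemma OM.derivs_slice (z : Z) (D : List E) (φ : OM (Z × E)) :
    OM.derivs D (OM.slice z φ) = OM.slice z (OM.derivs (D.map fun e => (0, e)) φ) := by
  induction D generalizing φ with
  | nil => rfl
  | cons e D ih =>
    change OM.derivs D (OM.deriv e (OM.slice z φ)) = _
    rw [OM.deriv_slice, ih]
    rfl

lemma OM.derivs_deriv (D : List E) (e : E) (φ : OM E) :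
    OM.derivs D (OM.deriv e φ) = OM.deriv e (OM.derivs D φ) := by
  induction D generalizing φ with
  | nil => rfl
  | cons e' D ih =>
    change OM.derivs D (OM.deriv e' (OM.deriv e φ)) = OM.deriv e (OM.derivs D (OM.deriv e' φ))
    rw [OM.deriv_comm, ih]

/-- The product of `f` with each Schwartz weight occurring in a bound for `p` is a Schwartz weight
on `Z × E`. So the `p`-seminorms of the slices are controlled uniformly in `z` once weighted by `f`.
-/
lemma OM.exists_seminorm_slice_le {p : Seminorm ℂ (OM E)} (hp : Continuous p) (f : 𝓢(Z, ℂ)) :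
    ∃ P : Seminorm ℂ (OM (Z × E)), Continuous P ∧ ∀ φ z, ‖f z‖ * p (OM.slice z φ) ≤ P φ := by
  obtain ⟨ι, hι, g, D, C, hC0, hC⟩ := OM.exists_bound_of_continuous hp
  choose h hh using fun i => exists_schwartz_dominating_mul f (g i)
  obtain ⟨P, hP, hPe⟩ := exists_seminorm_sum (fun i => (OM.seminormFamily (Z × E) (h i, 0)).comp
    (OM.derivs ((D i).map fun e => ((0 : Z), e))).toLinearMap) (fun i =>
      (OM.continuous_seminorm _ _).comp (OM.derivs _).continuous) hC0
  refine ⟨P, hP, fun φ z => ?_⟩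
  rw [hPe]
  calc _ ≤ ‖f z‖ * (C * ∑ i, OM.seminormFamily E (g i, 0) (OM.derivs (D i) (OM.slice z φ))) := by
        gcongr
        exact hC _
    _ = C * ∑ i, ‖f z‖ * OM.seminormFamily E (g i, 0) (OM.derivs (D i) (OM.slice z φ)) := by
        rw [mul_left_comm, Finset.mul_sum]
    _ ≤ _ := by
        gcongr with i
        rw [OM.derivs_slice]
        change ‖f z‖ * (⨆ x, _) ≤ _
        rw [Real.mul_iSup_of_nonneg (norm_nonneg _)]
        refine ciSup_le fun e => ?_
        rw [norm_iteratedFDeriv_zero, ← mul_assoc, hh]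
        exact OM.le_seminorm_zero _ (h i) (z, e)

/-- Continuous seminorms only involve Schwartz weights, which absorb polynomial growth in `e`.
Estimates in `𝓞_M(E)` as `ζ → 0` thus reduce to pointwise estimates of the derivatives. -/
lemma OM.exists_seminorm_family_le {p : Seminorm ℂ (OM E)} (hp : Continuous p) {χ : Z → OM E}
    (j : ℕ) (hχ : ∀ D, ∃ (k : ℕ) (C : ℝ), ∀ ζ, ‖ζ‖ ≤ 1 → ∀ e,
      ‖OM.derivs D (χ ζ) e‖ ≤ C * (1 + ‖e‖) ^ k * ‖ζ‖ ^ j) :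
    ∃ C, 0 ≤ C ∧ ∀ ζ, ‖ζ‖ ≤ 1 → p (χ ζ) ≤ C * ‖ζ‖ ^ j := by
  obtain ⟨ι, hι, g, D, C, hC0, hC⟩ := OM.exists_bound_of_continuous hp
  choose k C' hC' using fun i => hχ (D i)
  choose B hB0 hB using fun i => (g i).isSchwartz.decay (k i)
  refine ⟨C * ∑ i, B i * |C' i|, mul_nonneg hC0 (Finset.sum_nonneg fun i _ =>
    mul_nonneg (hB0 i) (abs_nonneg _)), fun ζ hζ => (hC _).trans ?_⟩
  rw [mul_assoc, Finset.sum_mul]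
  gcongr with i
  refine OM.seminorm_zero_le fun e => ?_
  calc _ ≤ ‖g i e‖ * (|C' i| * (1 + ‖e‖) ^ k i * ‖ζ‖ ^ j) := by
        gcongr
        refine (hC' i ζ hζ e).trans ?_
        gcongr
        exact le_abs_self _
    _ = ((1 + ‖e‖) ^ k i * ‖g i e‖) * |C' i| * ‖ζ‖ ^ j := by ring
    _ ≤ _ := by
        gcongr
        exact hB i e

lemma OM.exists_bound_iteratedFDeriv_ball (φ : OM (Z × E)) (i : ℕ) (z : Z) : ∃ (k : ℕ) (C : ℝ), 0 ≤ C ∧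
    ∀ e, ∀ y ∈ Metric.closedBall (z, e) 1, ‖iteratedFDeriv ℝ i φ y‖ ≤ C * (1 + ‖e‖) ^ k := by
  obtain ⟨k, C, hC0, hC⟩ := φ.hasTemperateGrowth.norm_iteratedFDeriv_le_uniform i
  refine ⟨k, C * (2 + ‖z‖) ^ k, by positivity, fun e y hy => (hC i le_rfl y).trans ?_⟩
  rw [mul_assoc, ← mul_pow]
  gcongr
  rw [mem_closedBall_iff_norm] at hy
  have h1 : ‖y‖ ≤ 1 + ‖(z, e)‖ := by
    have := norm_add_le (y - (z, e)) (z, e)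
    rw [sub_add_cancel] at this
    linarith
  have h2 : ‖(z, e)‖ ≤ ‖z‖ + ‖e‖ := by
    rw [Prod.norm_def]
    exact max_le_add_of_nonneg (norm_nonneg _) (norm_nonneg _)
  nlinarith [norm_nonneg z, norm_nonneg e, mul_nonneg (norm_nonneg z) (norm_nonneg e)]

lemma OM.exists_slice_sub_le {p : Seminorm ℂ (OM E)} (hp : Continuous p) (φ : OM (Z × E)) (z : Z) :
    ∃ C, 0 ≤ C ∧ ∀ ζ, ‖ζ‖ ≤ 1 → p (OM.slice (z + ζ) φ - OM.slice z φ) ≤ C * ‖ζ‖ ^ 1 := by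
  refine OM.exists_seminorm_family_le hp 1 fun D => ?_
  obtain ⟨k, C, hC0, hC⟩ := OM.exists_bound_iteratedFDeriv_ball
    (OM.derivs (D.map fun e => ((0 : Z), e)) φ) 1 z
  refine ⟨k, C, fun ζ hζ e => ?_⟩
  rw [map_sub, OM.derivs_slice, OM.derivs_slice]
  set ψ := OM.derivs (D.map fun e => ((0 : Z), e)) φ
  have h := (convex_closedBall (z, e) 1).norm_image_sub_le_of_norm_fderiv_le (𝕜 := ℝ) (f := ψ)
    (fun y _ => ψ.differentiable y) (C := C * (1 + ‖e‖) ^ k) (fun y hy => by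
      have := hC e y hy
      rwa [norm_iteratedFDeriv_one] at this)
    (x := (z, e)) (y := (z + ζ, e)) (Metric.mem_closedBall_self zero_le_one) (by
      rw [mem_closedBall_iff_norm]
      simpa [Prod.norm_def] using hζ)
  simpa [Prod.norm_def] using h

/-- This is Taylor's formula with quadratic remainder for `z ↦ φ(z, ·)` as a map into `𝓞_M(E)`. It
is what allows derivatives in `z` to pass through continuous linear maps. -/
lemma OM.exists_slice_sub_sub_le {p : Seminorm ℂ (OM E)} (hp : Continuous p) (φ : OM (Z × E))
    (z : Z) : ∃ C, 0 ≤ C ∧ ∀ ζ, ‖ζ‖ ≤ 1 →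
      p (OM.slice (z + ζ) φ - OM.slice z φ - OM.slice z (OM.deriv (ζ, 0) φ)) ≤ C * ‖ζ‖ ^ 2 := by
  refine OM.exists_seminorm_family_le hp 2 fun D => ?_
  obtain ⟨k, C, hC0, hC⟩ := OM.exists_bound_iteratedFDeriv_ball
    (OM.derivs (D.map fun e => ((0 : Z), e)) φ) 2 z
  refine ⟨k, C, fun ζ hζ e => ?_⟩
  rw [map_sub, map_sub, OM.derivs_slice, OM.derivs_slice, OM.derivs_slice, OM.derivs_deriv]
  set ψ := OM.derivs (D.map fun e => ((0 : Z), e)) φ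
  have hc : ContDiff ℝ ∞ (fderiv ℝ ψ) := ψ.contDiff.fderiv_right (by simp)
  have hsub : Metric.closedBall (z, e) ‖ζ‖ ⊆ Metric.closedBall (z, e) 1 :=
    Metric.closedBall_subset_closedBall hζ
  -- The ball has radius `‖ζ‖`, not `1`: on it the first derivative varies by `O(‖ζ‖)`, and the
  -- second application of the mean value inequality contributes the other factor `‖ζ‖`.
  have h1 : ∀ y ∈ Metric.closedBall (z, e) ‖ζ‖,
      ‖fderiv ℝ ψ y - fderiv ℝ ψ (z, e)‖ ≤ C * (1 + ‖e‖) ^ k * ‖ζ‖ := by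
    intro y hy
    have h := (convex_closedBall (z, e) ‖ζ‖).norm_image_sub_le_of_norm_fderiv_le (𝕜 := ℝ)
      (f := fderiv ℝ ψ) (fun y _ => hc.differentiable (by simp) y) (C := C * (1 + ‖e‖) ^ k)
      (fun y hy => by
        have := hC e y (hsub hy)
        rwa [← norm_iteratedFDeriv_fderiv, norm_iteratedFDeriv_one] at this)
      (Metric.mem_closedBall_self (norm_nonneg _)) hy
    refine h.trans ?_
    gcongr
    exact mem_closedBall_iff_norm.1 hy
  have h := (convex_closedBall (z, e) ‖ζ‖).norm_image_sub_le_of_norm_fderiv_le' (𝕜 := ℝ) (f := ψ)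
    (φ := fderiv ℝ ψ (z, e)) (fun y _ => ψ.differentiable y) h1
    (x := (z, e)) (y := (z + ζ, e)) (Metric.mem_closedBall_self (norm_nonneg _)) (by
      rw [mem_closedBall_iff_norm]
      simp [Prod.norm_def])
  have h2 : ((z + ζ, e) : Z × E) - (z, e) = (ζ, 0) := by simp
  rw [h2] at h
  have h3 : ‖((ζ, 0) : Z × E)‖ = ‖ζ‖ := by simp [Prod.norm_def]
  rw [h3] at h
  rw [pow_two, ← mul_assoc]
  exact h

lemma OM.tendsto_seminorm_slice {p : Seminorm ℂ (OM E)} (hp : Continuous p) (φ : OM (Z × E))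
    (z : Z) : Filter.Tendsto (fun z' => p (OM.slice z' φ - OM.slice z φ)) (𝓝 z) (𝓝 0) := by
  obtain ⟨C, hC0, hC⟩ := OM.exists_slice_sub_le hp φ z
  have h1 : Filter.Tendsto (fun z' => C * ‖z' - z‖ ^ 1) (𝓝 z) (𝓝 0) := by
    have : Continuous fun z' => C * ‖z' - z‖ ^ 1 := by fun_prop
    simpa using this.tendsto z
  refine squeeze_zero' (Filter.Eventually.of_forall fun _ => apply_nonneg _ _) ?_ h1
  filter_upwards [Metric.closedBall_mem_nhds z one_pos] with z' hz'
  have h2 := hC (z' - z) (mem_closedBall_iff_norm.1 hz')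
  rwa [add_sub_cancel] at h2

/-- The function `(z, x) ↦ v(φ(z, ·))(x)`. -/
noncomputable def bcFun (v : OM E →L[ℂ] OM N) (φ : OM (Z × E)) : Z × N → ℂ :=
  fun p => v (OM.slice p.1 φ) p.2

/-- A Schwartz function equal to one near `p.2` turns a seminorm estimate for `v(φ(z, ·) - φ(p.1,
·))` into an estimate uniform near `p.2`. What is left is the continuity of the single function
`v(φ(p.1, ·))`. -/
lemma continuous_bcFun (v : OM E →L[ℂ] OM N) (φ : OM (Z × E)) : Continuous (bcFun v φ) := by
  refine continuous_iff_continuousAt.2 fun p => ?_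
  obtain ⟨g, -, hg⟩ := exists_schwartz_eq_one p.2
  have hp : Continuous ((OM.seminormFamily N (g, 0)).comp v.toLinearMap) :=
    (OM.continuous_seminorm g 0).comp v.continuous
  have h1 := (OM.tendsto_seminorm_slice hp φ p.1).comp (continuous_fst.tendsto p)
  have h2 : Filter.Tendsto (fun q : Z × N => v (OM.slice q.1 φ - OM.slice p.1 φ) q.2) (𝓝 p)
      (𝓝 0) := by
    refine squeeze_zero_norm' ?_ h1
    filter_upwards [continuous_snd.tendsto p hg] with q hq
    have h3 := (v (OM.slice q.1 φ - OM.slice p.1 φ)).le_seminorm_zero g q.2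
    have hq' : g q.2 = 1 := hq
    rwa [hq', norm_one, one_mul] at h3
  have h4 : Filter.Tendsto (fun q : Z × N => v (OM.slice p.1 φ) q.2) (𝓝 p)
      (𝓝 (v (OM.slice p.1 φ) p.2)) :=
    ((v (OM.slice p.1 φ)).continuous.comp continuous_snd).tendsto p
  have h5 := h2.add h4
  rw [zero_add] at h5
  refine h5.congr fun q => ?_
  rw [map_sub, OM.sub_apply, sub_add_cancel]
  rfl

/-- The derivative `ζ ↦ v(∂_ζ φ(z, ·))(x)` of `bcFun v φ` in the direction of `Z`. -/
noncomputable def bcFDeriv (v : OM E →L[ℂ] OM N) (φ : OM (Z × E)) (z : Z) (x : N) : Z →L[ℝ] ℂ :=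
  LinearMap.toContinuousLinearMap
    { toFun := fun ζ => bcFun v (OM.deriv (ζ, 0) φ) (z, x)
      map_add' := fun ζ ζ' => by
        have h : OM.deriv (ζ + ζ', 0) φ = OM.deriv (ζ, 0) φ + OM.deriv (ζ', (0 : E)) φ := by
          ext y
          rw [OM.add_apply, OM.deriv_apply, OM.deriv_apply, OM.deriv_apply, ← map_add]
          simp
        simp [bcFun, h]
      map_smul' := fun c ζ => by
        have h : OM.deriv (c • ζ, (0 : E)) φ = (c : ℂ) • OM.deriv (ζ, 0) φ := by
          ext y
          have h1 : ((c • ζ, 0) : Z × E) = c • (ζ, 0) := by simp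
          rw [OM.smul_apply, OM.deriv_apply, OM.deriv_apply, h1, map_smul]
          simp
        simp only [bcFun, h, map_smul, OM.smul_apply, RingHom.id_apply, Complex.real_smul] }

lemma bcFDeriv_apply (v : OM E →L[ℂ] OM N) (φ : OM (Z × E)) (z : Z) (x : N) (ζ : Z) :
    bcFDeriv v φ z x ζ = bcFun v (OM.deriv (ζ, 0) φ) (z, x) := rfl

lemma hasFDerivAt_bcFun_left (v : OM E →L[ℂ] OM N) (φ : OM (Z × E)) (z : Z) (x : N) :
    HasFDerivAt (fun z => bcFun v φ (z, x)) (bcFDeriv v φ z x) z := by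
  have hp : Continuous ((normSeminorm ℂ ℂ).comp ((OM.eval x).comp v).toLinearMap) :=
    continuous_norm.comp ((OM.eval x).comp v).continuous
  obtain ⟨C, hC0, hC⟩ := OM.exists_slice_sub_sub_le hp φ z
  rw [hasFDerivAt_iff_isLittleO_nhds_zero]
  have h1 : (fun ζ => bcFun v φ (z + ζ, x) - bcFun v φ (z, x) - bcFDeriv v φ z x ζ)
      =O[𝓝 0] fun ζ => ‖ζ‖ ^ 2 := by
    refine Asymptotics.IsBigO.of_bound C ?_
    filter_upwards [Metric.closedBall_mem_nhds (0 : Z) one_pos] with ζ hζ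
    have h2 := hC ζ (mem_closedBall_zero_iff.1 hζ)
    rw [norm_pow, norm_norm]
    refine le_trans (le_of_eq ?_) h2
    simp [bcFDeriv_apply, bcFun]
  exact h1.trans_isLittleO (Asymptotics.isLittleO_norm_pow_id one_lt_two)

/-- Both partial derivatives are given by functions of the same kind, with `φ` replaced by `∂_ζ φ`
or `v` by `∂_η ∘ v`. They are therefore jointly continuous, and a function with continuous partial
derivatives is differentiable. -/
lemma hasFDerivAt_bcFun (v : OM E →L[ℂ] OM N) (φ : OM (Z × E)) (p : Z × N) :
    HasFDerivAt (bcFun v φ)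
      ((bcFDeriv v φ p.1 p.2).coprod (fderiv ℝ (v (OM.slice p.1 φ)) p.2)) p := by
  refine HasStrictFDerivAt.hasFDerivAt ?_
  refine hasStrictFDerivAt_uncurry_coprod (f := fun z x => bcFun v φ (z, x))
    (f₁ := fun z x => bcFDeriv v φ z x) (f₂ := fun z x => fderiv ℝ (v (OM.slice z φ)) x) ?_ ?_ ?_ ?_
  · exact Filter.Eventually.of_forall fun q => hasFDerivAt_bcFun_left v φ q.1 q.2
  · exact Filter.Eventually.of_forall fun q => ((v (OM.slice q.1 φ)).differentiable q.2).hasFDerivAt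
  · refine Continuous.continuousAt (continuous_clm_apply.2 fun ζ => ?_)
    exact continuous_bcFun v (OM.deriv (ζ, 0) φ)
  · refine Continuous.continuousAt (continuous_clm_apply.2 fun η => ?_)
    exact continuous_bcFun ((OM.deriv η).comp v) φ

lemma exists_seminorm_bcFun_le (v : OM E →L[ℂ] OM N) (h : 𝓢(Z × N, ℂ)) :
    ∃ P : Seminorm ℂ (OM (Z × E)), Continuous P ∧ ∀ φ q, ‖h q‖ * ‖bcFun v φ q‖ ≤ P φ := by
  obtain ⟨f, g, hfg⟩ := exists_schwartz_mul_dominating h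
  have hp : Continuous ((OM.seminormFamily N (g, 0)).comp v.toLinearMap) :=
    (OM.continuous_seminorm g 0).comp v.continuous
  obtain ⟨P, hP, hPle⟩ := OM.exists_seminorm_slice_le hp f
  refine ⟨P, hP, fun φ q => le_trans ?_ (hPle φ q.1)⟩
  calc _ ≤ ‖f q.1‖ * ‖g q.2‖ * ‖bcFun v φ q‖ := by
        gcongr
        exact hfg q.1 q.2
    _ = ‖f q.1‖ * (‖g q.2‖ * ‖bcFun v φ q‖) := mul_assoc _ _ _
    _ ≤ _ := by
        gcongr
        exact OM.le_seminorm_zero _ g q.2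

lemma hasTemperateGrowth_bcFun (v : OM E →L[ℂ] OM N) (φ : OM (Z × E)) :
    (bcFun v φ).HasTemperateGrowth := by
  -- Both `v` and `φ` vary in the class, as a derivative on `Z × N` acts on one or the other.
  refine temperate_of_closed (S := {c | ∃ (v : OM E →L[ℂ] OM N) (φ : OM (Z × E)), c = bcFun v φ})
    ?_ ?_ _ ⟨v, φ, rfl⟩
  · rintro _ ⟨v, φ, rfl⟩
    refine exists_poly_bound fun g => ?_
    obtain ⟨P, -, hP⟩ := exists_seminorm_bcFun_le (Z := Z) v g
    exact ⟨P φ, hP φ⟩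
  · rintro _ ⟨v, φ, rfl⟩
    refine ⟨_, hasFDerivAt_bcFun v φ, fun e => ?_⟩
    exact Submodule.add_mem _ (Submodule.subset_span ⟨v, OM.deriv (e.1, 0) φ, rfl⟩)
      (Submodule.subset_span ⟨(OM.deriv e.2).comp v, φ, rfl⟩)

variable (Z) in
/-- The base change `(z, x) ↦ v(φ(z, ·))(x)` of a continuous linear map `v : 𝓞_M(E) → 𝓞_M(N)`, as
a linear map. -/
noncomputable def bcLin (v : OM E →L[ℂ] OM N) : OM (Z × E) →ₗ[ℂ] OM (Z × N) where
  toFun φ := OM.mk (bcFun v φ) (hasTemperateGrowth_bcFun v φ)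
  map_add' φ ψ := by ext p; simp [bcFun]
  map_smul' c φ := by ext p; simp [bcFun]

lemma deriv_bcLin (v : OM E →L[ℂ] OM N) (ζ : Z) (η : N) (φ : OM (Z × E)) :
    OM.deriv (ζ, η) (bcLin Z v φ)
      = bcLin Z v (OM.deriv (ζ, 0) φ) + bcLin Z ((OM.deriv η).comp v) φ := by
  ext p
  change fderiv ℝ (bcFun v φ) p (ζ, η) = _
  rw [(hasFDerivAt_bcFun v φ p).fderiv]
  rfl

variable (Z) in
/-- The base change of a continuous linear map `v : 𝓞_M(E) → 𝓞_M(N)`, given by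
`(z, x) ↦ v(φ(z, ·))(x)`. -/
noncomputable def bc (v : OM E →L[ℂ] OM N) : OM (Z × E) →L[ℂ] OM (Z × N) where
  toLinearMap := bcLin Z v
  cont := by
    refine OM.continuous_of_closed (S := {L | ∃ (v : OM E →L[ℂ] OM N)
      (D : OM (Z × E) →L[ℂ] OM (Z × E)), L = bcLin Z v ∘ₗ D.toLinearMap}) ?_ ?_ _
      ⟨v, ContinuousLinearMap.id ℂ _, rfl⟩
    · rintro _ ⟨v, D, rfl⟩ h
      obtain ⟨P, hP, hPle⟩ := exists_seminorm_bcFun_le v h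
      exact ⟨P.comp D.toLinearMap, hP.comp D.continuous, fun φ q => hPle (D φ) q⟩
    · rintro _ ⟨v, D, rfl⟩ e
      have h : (OM.deriv e).toLinearMap ∘ₗ bcLin Z v ∘ₗ D.toLinearMap
          = bcLin Z v ∘ₗ ((OM.deriv (e.1, 0)).comp D).toLinearMap
          + bcLin Z ((OM.deriv e.2).comp v) ∘ₗ D.toLinearMap := by
        ext1 φ
        exact deriv_bcLin v e.1 e.2 (D φ)
      rw [h]
      exact Submodule.add_mem _ (Submodule.subset_span ⟨_, _, rfl⟩)
        (Submodule.subset_span ⟨_, _, rfl⟩)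

lemma bc_apply (v : OM E →L[ℂ] OM N) (φ : OM (Z × E)) (z : Z) (x : N) :
    bc Z v φ (z, x) = v (OM.slice z φ) x := rfl

lemma deriv_bc (v : OM E →L[ℂ] OM N) (ζ : Z) (η : N) (φ : OM (Z × E)) :
    OM.deriv (ζ, η) (bc Z v φ) = bc Z v (OM.deriv (ζ, 0) φ) + bc Z ((OM.deriv η).comp v) φ :=
  deriv_bcLin v ζ η φ

end BaseChange

end Shubin

namespace Shubin

/-! ### Integrable weights and partial integrals of Schwartz functions. -/

section Weight

variable {G : Type} [NormedAddCommGroup G] [NormedSpace ℝ G] [FiniteDimensional ℝ G]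

variable (G) in
/-- An exponent `k` such that `(1 + ‖v‖)^{-k}` is integrable. -/
noncomputable def wexp : ℕ := Module.finrank ℝ G + 1

/-- The integrable weight `(1 + ‖v‖)^{-k}`. -/
noncomputable def wt (v : G) : ℝ := ((1 + ‖v‖) ^ wexp G)⁻¹

lemma wt_nonneg (v : G) : 0 ≤ wt v := by unfold wt; positivity

lemma le_wt {v : G} {r C : ℝ} (h : (1 + ‖v‖) ^ wexp G * r ≤ C) : r ≤ C * wt v := by
  rw [wt, ← div_eq_mul_inv, le_div_iff₀ (by positivity), mul_comm]
  exact h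

lemma integrable_wt [MeasurableSpace G] [BorelSpace G] (μ : Measure G) [μ.IsAddHaarMeasure] :
    Integrable (wt : G → ℝ) μ := by
  have h : (Module.finrank ℝ G : ℝ) < (wexp G : ℝ) := by unfold wexp; push_cast; linarith
  refine (integrable_one_add_norm (μ := μ) h).congr (Filter.Eventually.of_forall fun v => ?_)
  simp only [wt]
  rw [Real.rpow_neg (by positivity), Real.rpow_natCast]

end Weight

section PartialIntegral

variable {A G : Type} [NormedAddCommGroup A] [NormedSpace ℝ A]
  [NormedAddCommGroup G] [NormedSpace ℝ G]

lemma IsSchwartz.decay_fderiv {f : A → ℂ} (hf : IsSchwartz f) (k : ℕ) :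
    ∃ C, 0 ≤ C ∧ ∀ x, (1 + ‖x‖) ^ k * ‖fderiv ℝ f x‖ ≤ C := by
  obtain ⟨F, rfl⟩ := hf
  have h : ∀ x, (1 + ‖x‖) ^ k * ‖fderiv ℝ F x‖
      ≤ 2 ^ k * ((Finset.Iic (k, 1)).sup fun m => SchwartzMap.seminorm ℂ m.1 m.2) F := fun x => by
    simpa [norm_iteratedFDeriv_one] using
      SchwartzMap.one_add_le_sup_seminorm_apply (𝕜 := ℂ) (m := (k, 1)) (k := k)
        (n := 1) le_rfl le_rfl F x
  exact ⟨_, le_trans (by positivity) (h 0), h⟩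

lemma one_add_norm_snd_pow_le (k : ℕ) (p : A × G) : (1 + ‖p.2‖) ^ k ≤ (1 + ‖p‖) ^ k := by
  gcongr
  exact norm_snd_le p

variable [FiniteDimensional ℝ A] [FiniteDimensional ℝ G]

lemma IsSchwartz.le_wt_snd {f : A × G → ℂ} (hf : IsSchwartz f) :
    ∃ C, 0 ≤ C ∧ ∀ a v, ‖f (a, v)‖ ≤ C * wt v := by
  obtain ⟨C, hC0, hC⟩ := hf.decay (wexp G)
  refine ⟨C, hC0, fun a v => le_wt (le_trans ?_ (hC (a, v)))⟩
  gcongr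
  exact norm_snd_le (a, v)

lemma IsSchwartz.fderiv_le_wt_snd {f : A × G → ℂ} (hf : IsSchwartz f) :
    ∃ C, 0 ≤ C ∧ ∀ a v, ‖fderiv ℝ f (a, v)‖ ≤ C * wt v := by
  obtain ⟨C, hC0, hC⟩ := hf.decay_fderiv (wexp G)
  refine ⟨C, hC0, fun a v => le_wt (le_trans ?_ (hC (a, v)))⟩
  gcongr
  exact norm_snd_le (a, v)

variable [MeasureSpace G] [BorelSpace G] [(volume : Measure G).IsAddHaarMeasure]

lemma integrable_of_le_wt {f : G → ℂ} (hf : Continuous f) {C : ℝ} (h : ∀ v, ‖f v‖ ≤ C * wt v) :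
    Integrable f :=
  ((integrable_wt volume).const_mul C).mono' hf.aestronglyMeasurable
    (Filter.Eventually.of_forall h)

lemma IsSchwartz.integrable_snd {f : A × G → ℂ} (hf : IsSchwartz f) (a : A) :
    Integrable fun v : G => f (a, v) := by
  obtain ⟨C, -, hC⟩ := hf.le_wt_snd
  exact integrable_of_le_wt (hf.continuous.comp (by fun_prop)) (hC a)

lemma IsSchwartz.hasFDerivAt_integral {f : A × G → ℂ} (hf : IsSchwartz f) (a : A) :
    HasFDerivAt (fun a => ∫ v : G, f (a, v))
      (∫ v : G, (fderiv ℝ f (a, v)).comp (ContinuousLinearMap.inl ℝ A G)) a := by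
  obtain ⟨C, hC0, hC⟩ := hf.fderiv_le_wt_snd
  have hc : Continuous (fderiv ℝ f) := hf.contDiff.continuous_fderiv (by simp)
  refine hasFDerivAt_integral_of_dominated_of_fderiv_le (s := Set.univ) (bound := fun v => C * wt v)
    (F' := fun a v => (fderiv ℝ f (a, v)).comp (ContinuousLinearMap.inl ℝ A G))
    Filter.univ_mem (Filter.Eventually.of_forall fun a =>
      (hf.integrable_snd a).aestronglyMeasurable) (hf.integrable_snd a) ?_ ?_
    ((integrable_wt volume).const_mul C) ?_
  · refine Continuous.aestronglyMeasurable ?_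
    have : Continuous fun v : G => fderiv ℝ f (a, v) := hc.comp (by fun_prop)
    exact this.clm_comp continuous_const
  · refine Filter.Eventually.of_forall fun v a _ => ?_
    calc _ ≤ ‖fderiv ℝ f (a, v)‖ * ‖ContinuousLinearMap.inl ℝ A G‖ :=
          ContinuousLinearMap.opNorm_comp_le _ _
      _ ≤ ‖fderiv ℝ f (a, v)‖ * 1 := by
          gcongr
          exact ContinuousLinearMap.norm_inl_le_one ℝ A G
      _ ≤ _ := by rw [mul_one]; exact hC a v
  · refine Filter.Eventually.of_forall fun v a _ => ?_
    exact (hf.differentiable (a, v)).hasFDerivAt.comp a (hasFDerivAt_prodMk_left a v)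

lemma IsSchwartz.fderiv_integral {f : A × G → ℂ} (hf : IsSchwartz f) (a e : A) :
    fderiv ℝ (fun a => ∫ v : G, f (a, v)) a e = ∫ v : G, fderiv ℝ f (a, v) (e, 0) := by
  obtain ⟨C, hC0, hC⟩ := hf.fderiv_le_wt_snd
  have hc : Continuous (fderiv ℝ f) := hf.contDiff.continuous_fderiv (by simp)
  have hc' : Continuous fun v : G => fderiv ℝ f (a, v) := hc.comp (by fun_prop)
  rw [(hf.hasFDerivAt_integral a).fderiv, ContinuousLinearMap.integral_apply]
  · rfl
  · refine ((integrable_wt volume).const_mul C).mono'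
      (hc'.clm_comp continuous_const).aestronglyMeasurable (Filter.Eventually.of_forall fun v => ?_)
    calc _ ≤ ‖fderiv ℝ f (a, v)‖ * ‖ContinuousLinearMap.inl ℝ A G‖ :=
          ContinuousLinearMap.opNorm_comp_le _ _
      _ ≤ ‖fderiv ℝ f (a, v)‖ * 1 := by
          gcongr
          exact ContinuousLinearMap.norm_inl_le_one ℝ A G
      _ ≤ _ := by rw [mul_one]; exact hC a v

/-- Partial integrals of Schwartz functions are Schwartz functions. -/
lemma IsSchwartz.integral_right {f : A × G → ℂ} (hf : IsSchwartz f) :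
    IsSchwartz fun a => ∫ v : G, f (a, v) := by
  refine isSchwartz_of_closed (S := {h | ∃ f : A × G → ℂ, IsSchwartz f ∧
    h = fun a => ∫ v : G, f (a, v)}) ?_ ?_ ?_ _ ⟨f, hf, rfl⟩
  · rintro _ ⟨f, hf, rfl⟩
    obtain ⟨C, hC0, hC⟩ := hf.le_wt_snd
    exact ⟨∫ v : G, C * wt v, fun a => norm_integral_le_of_norm_le
      ((integrable_wt volume).const_mul C) (Filter.Eventually.of_forall (hC a))⟩
  · rintro _ ⟨f, hf, rfl⟩
    refine ⟨fun a => fderiv ℝ (fun a => ∫ v : G, f (a, v)) a, fun a =>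
      (hf.hasFDerivAt_integral a).differentiableAt.hasFDerivAt, fun e => Submodule.subset_span
        ⟨_, hf.fderiv_apply (e, 0), ?_⟩⟩
    ext a
    exact hf.fderiv_integral a e
  · rintro _ ⟨f, hf, rfl⟩ ℓ
    refine Submodule.subset_span ⟨_, hf.temperate_mul
      (hasTemperateGrowth_ofReal_clm (ℓ.comp (ContinuousLinearMap.fst ℝ A G))), ?_⟩
    ext a
    exact (integral_const_mul _ _).symm

end PartialIntegral

/-! ### Schwartz functions as fibred distributions. -/

section SchwartzDistributions

variable {N G : Type} [NormedAddCommGroup N] [NormedSpace ℝ N] [FiniteDimensional ℝ N]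
  [NormedAddCommGroup G] [NormedSpace ℝ G] [FiniteDimensional ℝ G]
  [MeasureSpace G] [BorelSpace G] [(volume : Measure G).IsAddHaarMeasure]

lemma IsSchwartz.mul_OM {E : Type} [NormedAddCommGroup E] [NormedSpace ℝ E] {f : E → ℂ}
    (hf : IsSchwartz f) (φ : OM E) : IsSchwartz fun x => f x * φ x := by
  simpa only [mul_comm] using hf.temperate_mul φ.hasTemperateGrowth

/-- The linear map `φ ↦ (x ↦ ∫ f(x, v) φ(x, v) dv)`. -/
noncomputable def schwartzLin (f : 𝓢(N × G, ℂ)) : OM (N × G) →ₗ[ℂ] OM N where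
  toFun φ := OM.mk (fun x => ∫ v : G, f (x, v) * φ (x, v))
    (f.isSchwartz.mul_OM φ).integral_right.temperate
  map_add' φ ψ := by
    ext x
    simp only [OM.mk_apply, OM.add_apply, mul_add]
    exact integral_add (integrable_schwartz_mul f φ x) (integrable_schwartz_mul f ψ x)
  map_smul' c φ := by
    ext x
    simp only [OM.mk_apply, OM.smul_apply, mul_left_comm _ c, RingHom.id_apply]
    exact integral_const_mul _ _

lemma schwartzLin_apply (f : 𝓢(N × G, ℂ)) (φ : OM (N × G)) (x : N) :
    schwartzLin f φ x = ∫ v : G, f (x, v) * φ (x, v) := rfl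

-- The product rule under the integral keeps the maps `schwartzLin f ∘ D` closed under derivatives,
-- up to sums; this yields continuity of `schwartzLin f`.
open LineDeriv in
lemma deriv_schwartzLin (f : 𝓢(N × G, ℂ)) (φ : OM (N × G)) (e : N) :
    OM.deriv e (schwartzLin f φ)
      = schwartzLin (lineDerivOp (e, (0 : G)) f) φ + schwartzLin f (OM.deriv (e, 0) φ) := by
  ext x
  rw [OM.deriv_apply, OM.add_apply, schwartzLin_apply, schwartzLin_apply,
    ← integral_add (integrable_schwartz_mul _ _ x) (integrable_schwartz_mul _ _ x)]
  refine ((f.isSchwartz.mul_OM φ).fderiv_integral x e).trans (integral_congr_ae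
    (Filter.Eventually.of_forall fun v => ?_))
  have h : fderiv ℝ (fun p => f p * φ p) (x, v)
      = f (x, v) • fderiv ℝ φ (x, v) + φ (x, v) • fderiv ℝ f (x, v) :=
    fderiv_mul (f.isSchwartz.differentiable _) (φ.differentiable _)
  simp only [h, SchwartzMap.lineDerivOp_apply_eq_fderiv, OM.deriv_apply, add_apply, smul_apply,
    smul_eq_mul]
  ring

/-- A power of `1 + ‖v‖` is split off: its product with `f` is still rapidly decreasing and serves
as weight of a seminorm, while its inverse is integrable over the fibre. -/
lemma exists_seminorm_schwartzLin_le (f : 𝓢(N × G, ℂ)) (g : 𝓢(N, ℂ)) :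
    ∃ p : Seminorm ℂ (OM (N × G)), Continuous p ∧ ∀ φ x, ‖g x‖ * ‖schwartzLin f φ x‖ ≤ p φ := by
  obtain ⟨h, hh⟩ := exists_schwartz_dominating (E := N × G)
    (h := fun q => (1 + ‖q.2‖) ^ wexp G * ‖f q‖) (fun q => by positivity) (fun j => by
      obtain ⟨C, -, hC⟩ := f.isSchwartz.decay (j + wexp G)
      refine ⟨C, fun q => le_trans ?_ (hC q)⟩
      rw [← mul_assoc, pow_add]
      gcongr
      exact norm_snd_le q)
  obtain ⟨B, hB0, hB⟩ := g.isSchwartz.decay 0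
  obtain ⟨P, hP, hPe⟩ := exists_seminorm_sum (fun _ : Unit => OM.seminormFamily (N × G) (h, 0))
    (fun _ => OM.continuous_seminorm h 0) (C := B * ∫ v : G, wt v)
    (mul_nonneg hB0 (integral_nonneg wt_nonneg))
  refine ⟨P, hP, fun φ x => ?_⟩
  rw [hPe, mul_assoc]
  have hb := hB x
  rw [pow_zero, one_mul] at hb
  refine mul_le_mul hb ?_ (norm_nonneg _) hB0
  simp only [Finset.univ_unique, Finset.sum_const, Finset.card_singleton, one_smul]
  rw [mul_comm, ← integral_const_mul]
  refine norm_integral_le_of_norm_le ((integrable_wt volume).const_mul _)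
    (Filter.Eventually.of_forall fun v => le_wt ?_)
  rw [norm_mul, ← mul_assoc]
  refine le_trans ?_ (OM.le_seminorm_zero φ h (x, v))
  gcongr
  exact hh (x, v)

/-- The fibred distribution `u_f(φ)(x) = ∫ f(x, v) φ(x, v) dv` of a Schwartz function `f`. -/
noncomputable def ofSchwartz (f : 𝓢(N × G, ℂ)) : FibredDist N G :=
  ⟨{ toLinearMap := schwartzLin f
     cont := by
      refine OM.continuous_of_closed (S := {L | ∃ (f : 𝓢(N × G, ℂ))
        (D : OM (N × G) →L[ℂ] OM (N × G)), L = schwartzLin f ∘ₗ D.toLinearMap}) ?_ ?_ _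
        ⟨f, ContinuousLinearMap.id ℂ _, rfl⟩
      · rintro _ ⟨f, D, rfl⟩ g
        obtain ⟨P, hP, hPle⟩ := exists_seminorm_schwartzLin_le f g
        exact ⟨P.comp D.toLinearMap, hP.comp D.continuous, fun φ q => hPle (D φ) q⟩
      · rintro _ ⟨f, D, rfl⟩ e
        have h : (OM.deriv e).toLinearMap ∘ₗ schwartzLin f ∘ₗ D.toLinearMap
            = schwartzLin (LineDeriv.lineDerivOp (e, (0 : G)) f) ∘ₗ D.toLinearMap
            + schwartzLin f ∘ₗ ((OM.deriv (e, 0)).comp D).toLinearMap := by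
          ext1 φ
          exact deriv_schwartzLin f (D φ) e
        rw [h]
        exact Submodule.add_mem _ (Submodule.subset_span ⟨_, _, rfl⟩)
          (Submodule.subset_span ⟨_, _, rfl⟩) }, fun f' φ => by
    ext x
    change ∫ v : G, f (x, v) * (f' x * φ (x, v)) = f' x * ∫ v : G, f (x, v) * φ (x, v)
    simp only [mul_left_comm _ (f' x)]
    exact integral_const_mul _ _⟩

lemma ofSchwartz_apply (f : 𝓢(N × G, ℂ)) (φ : OM (N × G)) (x : N) :
    ofSchwartz f φ x = ∫ v : G, f (x, v) * φ (x, v) := rfl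

lemma ofSchwartz_mem (f : 𝓢(N × G, ℂ)) : ofSchwartz f ∈ schwartzDist N G := ⟨f, fun _ _ => rfl⟩

lemma mem_schwartzDist_iff {u : FibredDist N G} :
    u ∈ schwartzDist N G ↔ ∃ f : 𝓢(N × G, ℂ), u = ofSchwartz f := by
  refine ⟨fun ⟨f, hf⟩ => ⟨f, FibredDist.ext hf⟩, ?_⟩
  rintro ⟨f, rfl⟩
  exact ofSchwartz_mem f

end SchwartzDistributions

/-! ### Fibred distributions are local over the base. -/

section Locality

variable {N G : Type} [NormedAddCommGroup N] [NormedSpace ℝ N] [FiniteDimensional ℝ N]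
  [NormedAddCommGroup G] [NormedSpace ℝ G] [FiniteDimensional ℝ G]

/-- A fibred distribution as a continuous linear operator. -/
def FibredDist.op (u : FibredDist N G) : OM (N × G) →L[ℂ] OM N := u.1

@[simp] lemma FibredDist.op_apply (u : FibredDist N G) (φ : OM (N × G)) : u.op φ = u φ := rfl

lemma HasTemperateGrowth.prodMk {A B C : Type} [NormedAddCommGroup A] [NormedSpace ℝ A]
    [NormedAddCommGroup B] [NormedSpace ℝ B] [NormedAddCommGroup C] [NormedSpace ℝ C]
    {f : A → B} {g : A → C} (hf : f.HasTemperateGrowth) (hg : g.HasTemperateGrowth) :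
    Function.HasTemperateGrowth fun x => (f x, g x) := by
  have h : (fun x => (f x, g x)) = fun x => ContinuousLinearMap.inl ℝ B C (f x)
      + ContinuousLinearMap.inr ℝ B C (g x) := by
    ext p <;> simp
  rw [h]
  exact ((ContinuousLinearMap.inl ℝ B C).hasTemperateGrowth.comp hf).add
    ((ContinuousLinearMap.inr ℝ B C).hasTemperateGrowth.comp hg)

lemma hasTemperateGrowth_snd : Function.HasTemperateGrowth (Prod.snd : N × G → G) :=
  (ContinuousLinearMap.snd ℝ N G).hasTemperateGrowth

lemma OM.hasDerivAt_left {E : Type} [NormedAddCommGroup E] [NormedSpace ℝ E] (Φ : OM (ℝ × E))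
    (t : ℝ) (e : E) : HasDerivAt (fun s => Φ (s, e)) (OM.deriv (1, 0) Φ (t, e)) t := by
  have h : HasFDerivAt (fun s => Φ (s, e)) _ t :=
    (Φ.differentiable (t, e)).hasFDerivAt.comp t (hasFDerivAt_prodMk_left t e)
  simpa [OM.deriv_apply] using h.hasDerivAt

/-- The homotopy `y ↦ x + s (y - x)` deforms `φ` (at `s = 1`) into the function `(y, v) ↦ φ(x, v) =
0` (at `s = 0`). The `s`-derivative of the deformed function is a sum of terms with a factor `y_i -
x_i`. By linearity over `𝓞_M(N)` this factor can be taken out of `u`, and it vanishes at `x`. So the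
value at `x` does not depend on `s`. -/
lemma FibredDist.apply_eq_zero (u : FibredDist N G) {φ : OM (N × G)} {x : N}
    (h : ∀ v, φ (x, v) = 0) : u φ x = 0 := by
  have hc : Function.HasTemperateGrowth fun p : ℝ × (N × G) => (x + p.1 • (p.2.1 - x), p.2.2) := by
    refine HasTemperateGrowth.prodMk ?_ ?_
    · exact (Function.HasTemperateGrowth.const x).add
        (hasTemperateGrowth_fst.smul ((hasTemperateGrowth_fst.comp hasTemperateGrowth_snd).sub
          (Function.HasTemperateGrowth.const x)))
    · exact hasTemperateGrowth_snd.comp hasTemperateGrowth_snd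
  let Φ : OM (ℝ × (N × G)) := OM.pullback _ hc φ
  have h0 : bc ℝ u.op Φ (0, x) = 0 := by
    have : OM.slice 0 Φ = 0 := by
      ext q
      simp [Φ, h]
    rw [bc_apply, this, map_zero, OM.zero_apply]
  have h1 : bc ℝ u.op Φ (1, x) = u φ x := by
    have : OM.slice 1 Φ = φ := by
      ext q
      simp [Φ]
    rw [bc_apply, this]
    rfl
  have hd : ∀ s, OM.deriv (1, 0) (bc ℝ u.op Φ) (s, x) = 0 := by
    intro s
    have h2 : (OM.deriv (0 : N)).comp u.op = 0 := by
      ext φ y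
      simp [OM.deriv_apply]
    have h3 : bc ℝ (0 : OM (N × G) →L[ℂ] OM N) Φ = 0 := by
      ext p
      rfl
    rw [deriv_bc, h2, h3, add_zero, bc_apply]
    let b := Module.finBasis ℝ N
    -- The coordinates of `y - x`, which vanish at `y = x`.
    let ℓ : Fin (Module.finrank ℝ N) → OM N := fun i => OM.mk _
      ((hasTemperateGrowth_ofReal_clm (LinearMap.toContinuousLinearMap (b.coord i))).sub
        (Function.HasTemperateGrowth.const ((b.coord i x : ℝ) : ℂ)))
    have h4 : OM.slice s (OM.deriv ((1 : ℝ), (0 : N × G)) Φ)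
        = ∑ i, OM.pullback Prod.fst hasTemperateGrowth_fst (ℓ i)
          * OM.slice s (OM.pullback _ hc (OM.deriv (b i, (0 : G)) φ)) := by
      ext q
      have hq : HasDerivAt (fun t : ℝ => (x + t • (q.1 - x), q.2)) ((q.1 - x, 0) : N × G) s := by
        refine HasDerivAt.prodMk ?_ (hasDerivAt_const _ _)
        simpa using ((hasDerivAt_id s).smul_const (q.1 - x)).const_add x
      have h5 : HasDerivAt (fun t => Φ (t, q))
          (fderiv ℝ φ (x + s • (q.1 - x), q.2) (q.1 - x, 0)) s :=
        (φ.differentiable (x + s • (q.1 - x), q.2)).hasFDerivAt.comp_hasDerivAt s hq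
      rw [OM.slice_apply, (OM.hasDerivAt_left Φ s q).unique h5]
      have h6 : ((q.1 - x, 0) : N × G) = ∑ i, b.coord i (q.1 - x) • ((b i, 0) : N × G) := by
        have := b.sum_repr (q.1 - x)
        refine Prod.ext ?_ ?_
        · rw [Prod.fst_sum]
          exact this.symm
        · rw [Prod.snd_sum]
          simp
      rw [h6, map_sum]
      have h7 : ∀ (s : Finset (Fin (Module.finrank ℝ N))) (g : Fin (Module.finrank ℝ N) → OM (N × G)),
          (∑ i ∈ s, g i) q = ∑ i ∈ s, g i q := fun s g => map_sum (OM.eval q) g s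
      rw [h7]
      refine Finset.sum_congr rfl fun i _ => ?_
      rw [map_smul]
      simp [ℓ, OM.deriv_apply]
    rw [h4, map_sum]
    have h7 : ∀ (s : Finset (Fin (Module.finrank ℝ N))) (g : Fin (Module.finrank ℝ N) → OM N),
        (∑ i ∈ s, g i) x = ∑ i ∈ s, g i x := fun s g => map_sum (OM.eval x) g s
    rw [h7]
    refine Finset.sum_eq_zero fun i _ => ?_
    rw [FibredDist.op_apply, FibredDist.map_mul]
    simp [ℓ]
  have hconst := is_const_of_deriv_eq_zero (f := fun s => bc ℝ u.op Φ (s, x))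
    (fun s => (OM.hasDerivAt_left _ s x).differentiableAt)
    (fun s => (OM.hasDerivAt_left _ s x).deriv.trans (hd s)) 1 0
  rw [← h1, ← h0]
  exact hconst

lemma FibredDist.apply_congr (u : FibredDist N G) {φ ψ : OM (N × G)} {x : N}
    (h : ∀ v, φ (x, v) = ψ (x, v)) : u φ x = u ψ x := by
  have h1 := u.apply_eq_zero (φ := φ - ψ) (x := x) fun v => by simp [h]
  have h2 : u (φ - ψ) = u φ - u ψ := map_sub u.op φ ψ
  rw [h2, OM.sub_apply] at h1
  exact sub_eq_zero.1 h1

/-- A fibred distribution is determined by its values on the functions `1 ⊗ ψ` with `ψ` of compact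
support. -/
lemma FibredDist.ext_compact {u w : FibredDist N G}
    (h : ∀ ψ : OM G, HasCompactSupport ψ → ∀ x, u (OM.pullback Prod.snd hasTemperateGrowth_snd ψ) x
      = w (OM.pullback Prod.snd hasTemperateGrowth_snd ψ) x) : u = w := by
  refine FibredDist.ext fun φ x => ?_
  let ψ : OM G := OM.slice x φ
  suffices hψ : u (OM.pullback Prod.snd hasTemperateGrowth_snd ψ) x
      = w (OM.pullback Prod.snd hasTemperateGrowth_snd ψ) x by
    rw [u.apply_congr (φ := φ) (ψ := OM.pullback Prod.snd hasTemperateGrowth_snd ψ) fun v => rfl,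
      hψ]
    exact w.apply_congr fun v => rfl
  obtain ⟨χ, hχ, hχ1⟩ := exists_schwartz_eq_one (0 : G)
  have hc : Function.HasTemperateGrowth fun p : ℝ × (N × G) => p.1 • p.2.2 :=
    hasTemperateGrowth_fst.smul (hasTemperateGrowth_snd.comp hasTemperateGrowth_snd)
  -- The truncations `χ(s v) ψ(v)` have compact support for `s ≠ 0` and equal `ψ` at `s = 0`. By
  -- base change in `s`, the values of `u` and `w` on them are continuous in `s`, so equality
  -- extends to `s = 0`.
  let Φ : OM (ℝ × (N × G)) := OM.pullback _ hc (OM.mk χ χ.hasTemperateGrowth)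
    * OM.pullback _ (hasTemperateGrowth_snd.comp hasTemperateGrowth_snd) ψ
  have h0 : OM.slice 0 Φ = OM.pullback Prod.snd hasTemperateGrowth_snd ψ := by
    ext q
    simp [Φ, hχ1.self_of_nhds]
  have hs : ∀ s ∈ ({0}ᶜ : Set ℝ), u (OM.slice s Φ) x = w (OM.slice s Φ) x := by
    intro s hs
    have hs0 : s ≠ 0 := hs
    have hcs : Function.HasTemperateGrowth fun v : G => s • v :=
      (s • ContinuousLinearMap.id ℝ G).hasTemperateGrowth
    let ψs : OM G := OM.pullback _ hcs (OM.mk χ χ.hasTemperateGrowth) * ψ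
    have h1 : OM.slice s Φ = OM.pullback Prod.snd hasTemperateGrowth_snd ψs := by
      ext q
      simp [Φ, ψs]
    rw [h1]
    refine h ψs ?_ x
    refine HasCompactSupport.mul_right (f := fun v => χ (s • v)) (f' := ψ) ?_
    exact hχ.comp_homeomorph (Homeomorph.smulOfNeZero s hs0)
  have hcont : ∀ u : FibredDist N G, Continuous fun s => u (OM.slice s Φ) x := fun u =>
    (bc ℝ u.op Φ).continuous.comp (Continuous.prodMk_left x)
  have h2 := congrFun (Continuous.ext_on (dense_compl_singleton (0 : ℝ)) (hcont u) (hcont w) hs) 0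
  simp only [h0] at h2
  exact h2

end Locality

end Shubin

namespace Shubin

/-! ### Flat functions and their dyadic sums. -/

section Flat

variable {A : Type} [NormedAddCommGroup A] [NormedSpace ℝ A] [FiniteDimensional ℝ A]

lemma exists_norm_clm_le (A : Type) [NormedAddCommGroup A] [NormedSpace ℝ A]
    [FiniteDimensional ℝ A] :
    ∃ C : ℝ, 0 ≤ C ∧ ∀ L : A →L[ℝ] ℂ, ‖L‖ ≤ C * ∑ i, ‖L (Module.finBasis ℝ A i)‖ := by
  let c := fun i => ContinuousLinearMap.smulRightL ℝ A ℂ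
      (LinearMap.toContinuousLinearMap ((Module.finBasis ℝ A).coord i))
  refine ⟨∑ i, ‖c i‖, Finset.sum_nonneg fun i _ => by positivity, fun L => ?_⟩
  conv_lhs => rw [clm_eq_sum_basis L]
  refine (norm_sum_le _ _).trans ?_
  rw [Finset.mul_sum]
  gcongr with i
  refine ((c i).le_opNorm _).trans ?_
  gcongr
  exact Finset.single_le_sum (f := fun i => ‖c i‖) (fun i _ => by positivity) (Finset.mem_univ i)

lemma exists_schwartz_eq_one_of_abs_le :
    ∃ χ : 𝓢(ℝ, ℂ), HasCompactSupport χ ∧ ∀ s, |s| ≤ 1 → χ s = 1 := by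
  let φ : ContDiffBump (0 : ℝ) := ⟨1, 2, by norm_num, by norm_num⟩
  have h : HasCompactSupport fun y => (φ y : ℂ) :=
    φ.hasCompactSupport.comp_left (g := fun r : ℝ => (r : ℂ)) Complex.ofReal_zero
  refine ⟨h.toSchwartzMap (Complex.ofRealCLM.contDiff.comp φ.contDiff), h, fun s hs => ?_⟩
  have : φ s = 1 := φ.one_of_mem_closedBall (by simpa using hs)
  change ((φ s : ℝ) : ℂ) = 1
  rw [this, Complex.ofReal_one]

variable (A) in
/-- The functions on `ℝ × A` which vanish to infinite order on `{0} × A`. -/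
noncomputable def OM.flat : Submodule ℂ (OM (ℝ × A)) where
  carrier := {Θ | ∀ (k : ℕ) (a : A), ((OM.deriv ((1 : ℝ), (0 : A))) ^ k) Θ (0, a) = 0}
  add_mem' h h' k a := by rw [map_add, OM.add_apply, h k a, h' k a, add_zero]
  zero_mem' k a := by rw [map_zero, OM.zero_apply]
  smul_mem' c Θ h k a := by rw [map_smul, OM.smul_apply, h k a, mul_zero]

lemma OM.deriv_mem_flat {Θ : OM (ℝ × A)} (h : Θ ∈ OM.flat A) :
    OM.deriv (1, 0) Θ ∈ OM.flat A := fun k a => by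
  have := h (k + 1) a
  rwa [pow_succ] at this

lemma OM.flat_apply_zero {Θ : OM (ℝ × A)} (h : Θ ∈ OM.flat A) (a : A) : Θ (0, a) = 0 := h 0 a

/-- A class of functions vanishing at `ε = 0` and closed under `∂_ε` consists of flat functions. -/
lemma OM.flat_of_closed {S : Set (OM (ℝ × A))} (h0 : ∀ Θ ∈ S, ∀ a, Θ (0, a) = 0)
    (h1 : ∀ Θ ∈ S, OM.deriv (1, 0) Θ ∈ Submodule.span ℂ S) : ∀ Θ ∈ S, Θ ∈ OM.flat A := by
  have h0' : ∀ Θ ∈ Submodule.span ℂ S, ∀ a, Θ (0, a) = 0 := by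
    intro Θ hΘ a
    induction hΘ using Submodule.span_induction with
    | mem Θ h => exact h0 Θ h a
    | zero => rfl
    | add _ _ _ _ h h' => rw [OM.add_apply, h, h', add_zero]
    | smul c _ _ h => rw [OM.smul_apply, h, mul_zero]
  have h1' : ∀ Θ ∈ Submodule.span ℂ S, OM.deriv (1, 0) Θ ∈ Submodule.span ℂ S := by
    intro Θ hΘ
    induction hΘ using Submodule.span_induction with
    | mem Θ h => exact h1 Θ h
    | zero => rw [map_zero]; exact zero_mem _
    | add _ _ _ _ h h' => rw [map_add]; exact add_mem h h'
    | smul c _ _ h => rw [map_smul]; exact Submodule.smul_mem _ c h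
  have h2 : ∀ k : ℕ, ∀ Θ ∈ Submodule.span ℂ S, ∀ a,
      ((OM.deriv ((1 : ℝ), (0 : A))) ^ k) Θ (0, a) = 0 := by
    intro k
    induction k with
    | zero => exact h0'
    | succ k ih =>
      intro Θ hΘ a
      rw [pow_succ]
      exact ih _ (h1' Θ hΘ) a
  exact fun Θ hΘ k a => h2 k Θ (Submodule.subset_span hΘ) a

lemma OM.mul_mem_flat (g : OM (ℝ × A)) {Θ : OM (ℝ × A)} (h : Θ ∈ OM.flat A) :
    g * Θ ∈ OM.flat A := by
  refine OM.flat_of_closed (S := {Φ | ∃ g, ∃ Θ ∈ OM.flat A, Φ = g * Θ}) ?_ ?_ _ ⟨g, Θ, h, rfl⟩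
  · rintro _ ⟨g, Θ, h, rfl⟩ a
    rw [OM.mul_apply, OM.flat_apply_zero h, mul_zero]
  · rintro _ ⟨g, Θ, h, rfl⟩
    rw [OM.deriv_mul]
    exact add_mem (Submodule.subset_span ⟨_, _, h, rfl⟩)
      (Submodule.subset_span ⟨_, _, OM.deriv_mem_flat h, rfl⟩)

lemma OM.deriv_right_mem_flat {Θ : OM (ℝ × A)} (h : Θ ∈ OM.flat A) (e : A) :
    OM.deriv (0, e) Θ ∈ OM.flat A := by
  refine OM.flat_of_closed (S := {Φ | ∃ Θ ∈ OM.flat A, Φ = OM.deriv (0, e) Θ}) ?_ ?_ _ ⟨Θ, h, rfl⟩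
  · rintro _ ⟨Θ, h, rfl⟩ a
    have h1 : OM.slice 0 Θ = 0 := by
      ext a
      exact OM.flat_apply_zero h a
    have h2 := OM.deriv_slice 0 e Θ
    rw [h1, map_zero] at h2
    exact (congrArg (fun φ : OM A => φ a) h2).symm
  · rintro _ ⟨Θ, h, rfl⟩
    rw [OM.deriv_comm]
    exact Submodule.subset_span ⟨_, OM.deriv_mem_flat h, rfl⟩

/-- Integrating the `M`-th derivative back from `ε = 0`, where all derivatives vanish, gains one
factor `|s|` per step. The weight `c` and the restriction to `|s| ≤ 1` are carried along so that a
single seminorm on `𝓞_M(ℝ × A)` can supply `B`. -/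
lemma OM.norm_le_of_flat (M : ℕ) : ∀ {Θ : OM (ℝ × A)}, Θ ∈ OM.flat A → ∀ {a : A} {c B : ℝ}, 0 ≤ c →
    (∀ s, |s| ≤ 1 → c * ‖((OM.deriv ((1 : ℝ), (0 : A))) ^ M) Θ (s, a)‖ ≤ B) →
    ∀ s, |s| ≤ 1 → c * ‖Θ (s, a)‖ ≤ B * |s| ^ M := by
  induction M with
  | zero =>
    intro Θ _ a c B _ h s hs
    simpa using h s hs
  | succ M ih =>
    intro Θ hΘ a c B hc h s hs
    have h1 := ih (OM.deriv_mem_flat hΘ) (a := a) (B := B) hc fun s hs => by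
      have := h s hs
      rwa [pow_succ] at this
    have hB : 0 ≤ B := le_trans (by positivity) (h 0 (by simp))
    have h2 := (convex_closedBall (0 : ℝ) |s|).norm_image_sub_le_of_norm_hasDerivWithin_le
      (f := fun t => (c : ℂ) * Θ (t, a)) (f' := fun t => (c : ℂ) * OM.deriv (1, 0) Θ (t, a))
      (C := B * |s| ^ M) (x := 0) (y := s)
      (fun t _ => ((OM.hasDerivAt_left Θ t a).const_mul (c : ℂ)).hasDerivWithinAt) (fun t ht => by
        rw [mem_closedBall_zero_iff, Real.norm_eq_abs] at ht
        rw [norm_mul, Complex.norm_real, Real.norm_of_nonneg hc]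
        refine (h1 t (ht.trans hs)).trans ?_
        gcongr) (by simp) (by simp)
    rw [OM.flat_apply_zero hΘ, mul_zero, sub_zero, sub_zero, norm_mul, Complex.norm_real,
      Real.norm_of_nonneg hc, Real.norm_eq_abs] at h2
    rw [pow_succ, ← mul_assoc]
    exact h2

/-- The term `2^{mj} Θ(2^{-j}, a)` of a dyadic sum. -/
noncomputable def dyadic (m : ℝ) (Θ : ℝ × A → ℂ) (a : A) (j : ℕ) : ℂ :=
  ((((2 : ℝ) ^ m) ^ j : ℝ) : ℂ) * Θ ((1 / 2 : ℝ) ^ j, a)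

/-- An order of differentiation which controls dyadic sums with exponent `m`. -/
noncomputable def dyadicOrder (m : ℝ) : ℕ := ⌈m⌉₊ + 1

lemma OM.dyadic_le (m : ℝ) {Θ : OM (ℝ × A)} (hΘ : Θ ∈ OM.flat A) {a : A} {c B : ℝ} (hc : 0 ≤ c)
    (h : ∀ s, |s| ≤ 1 →
      c * ‖((OM.deriv ((1 : ℝ), (0 : A))) ^ dyadicOrder m) Θ (s, a)‖ ≤ B) (j : ℕ) :
    c * ‖dyadic m Θ a j‖ ≤ B * (1 / 2 : ℝ) ^ j := by
  have h1 := OM.norm_le_of_flat _ hΘ hc h ((1 / 2 : ℝ) ^ j) (by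
    rw [abs_of_nonneg (by positivity)]
    exact pow_le_one₀ (by norm_num) (by norm_num))
  have hB : 0 ≤ B := le_trans (by positivity) (h 0 (by simp))
  -- The order `⌈m⌉₊` compensates the growth of `2 ^ (m j)`; the one extra derivative leaves the
  -- geometric ratio `1 / 2`.
  have h2 : (2 : ℝ) ^ m * (1 / 2 : ℝ) ^ dyadicOrder m ≤ 1 / 2 := by
    have h3 : (2 : ℝ) ^ m ≤ 2 ^ ⌈m⌉₊ := by
      rw [← Real.rpow_natCast]
      exact Real.rpow_le_rpow_of_exponent_le (by norm_num) (Nat.le_ceil m)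
    calc _ ≤ (2 : ℝ) ^ ⌈m⌉₊ * (1 / 2 : ℝ) ^ dyadicOrder m := by gcongr
      _ = ((2 : ℝ) * (1 / 2)) ^ ⌈m⌉₊ * (1 / 2) := by rw [dyadicOrder, pow_succ, mul_pow]; ring
      _ = 1 / 2 := by norm_num
  rw [abs_of_nonneg (by positivity)] at h1
  rw [dyadic, norm_mul, Complex.norm_real, Real.norm_of_nonneg (by positivity)]
  calc _ = ((2 : ℝ) ^ m) ^ j * (c * ‖Θ ((1 / 2 : ℝ) ^ j, a)‖) := by ring
    _ ≤ ((2 : ℝ) ^ m) ^ j * (B * ((1 / 2 : ℝ) ^ j) ^ dyadicOrder m) := by gcongr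
    _ = B * ((2 : ℝ) ^ m * (1 / 2 : ℝ) ^ dyadicOrder m) ^ j := by
        rw [mul_pow, ← pow_mul, ← pow_mul, mul_comm j]; ring
    _ ≤ _ := by gcongr

lemma OM.exists_dyadic_le (m : ℝ) {Θ : OM (ℝ × A)} (hΘ : Θ ∈ OM.flat A) :
    ∃ (k : ℕ) (C : ℝ), 0 ≤ C ∧ ∀ a j, ‖dyadic m Θ a j‖ ≤ C * (1 + ‖a‖) ^ k * (1 / 2 : ℝ) ^ j := by
  obtain ⟨k, C, hC0, hC⟩ :=
    OM.exists_bound (((OM.deriv ((1 : ℝ), (0 : A))) ^ dyadicOrder m) Θ)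
  refine ⟨k, C * 2 ^ k, by positivity, fun a j => ?_⟩
  have h := OM.dyadic_le m hΘ (a := a) (B := C * 2 ^ k * (1 + ‖a‖) ^ k) zero_le_one (fun s hs => by
    rw [one_mul, mul_assoc, ← mul_pow]
    refine (hC (s, a)).trans ?_
    gcongr
    rw [Prod.norm_def]
    have h1 : max ‖s‖ ‖a‖ ≤ 1 + ‖a‖ := max_le (by
      rw [Real.norm_eq_abs]; linarith [norm_nonneg a]) (by linarith)
    simp only
    linarith [norm_nonneg a]) j
  rwa [one_mul] at h

lemma IsSchwartz.pow_deriv {E : Type} [NormedAddCommGroup E] [NormedSpace ℝ E] (e : E) (k : ℕ) :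
    ∀ {Θ : OM E}, IsSchwartz Θ → IsSchwartz (((OM.deriv e) ^ k) Θ) := by
  induction k with
  | zero => exact id
  | succ k ih =>
    intro Θ h
    rw [pow_succ]
    exact ih (Θ := OM.deriv e Θ) (h.fderiv_apply e)

lemma IsSchwartz.exists_dyadic_le (m : ℝ) {Θ : OM (ℝ × A)} (hS : IsSchwartz Θ)
    (hΘ : Θ ∈ OM.flat A) (k : ℕ) :
    ∃ C : ℝ, 0 ≤ C ∧ ∀ a j, (1 + ‖a‖) ^ k * ‖dyadic m Θ a j‖ ≤ C * (1 / 2 : ℝ) ^ j := by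
  obtain ⟨C, hC0, hC⟩ := (IsSchwartz.pow_deriv ((1 : ℝ), (0 : A)) (dyadicOrder m) hS).decay k
  refine ⟨C, hC0, fun a j => OM.dyadic_le m hΘ (by positivity) (fun s _ => ?_) j⟩
  refine le_trans ?_ (hC (s, a))
  gcongr
  exact norm_snd_le (s, a)

lemma summable_half_pow : Summable fun j : ℕ => (1 / 2 : ℝ) ^ j :=
  summable_geometric_of_lt_one (by norm_num) (by norm_num)

lemma OM.summable_dyadic (m : ℝ) {Θ : OM (ℝ × A)} (hΘ : Θ ∈ OM.flat A) (a : A) :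
    Summable (dyadic m Θ a) := by
  obtain ⟨k, C, -, hC⟩ := OM.exists_dyadic_le m hΘ
  exact Summable.of_norm_bounded (summable_half_pow.mul_left _) (hC a)

lemma OM.norm_tsum_dyadic_le (m : ℝ) {Θ : OM (ℝ × A)} (hΘ : Θ ∈ OM.flat A) {a : A} {c B : ℝ}
    (hc : 0 ≤ c) (h : ∀ s, |s| ≤ 1 →
      c * ‖((OM.deriv ((1 : ℝ), (0 : A))) ^ dyadicOrder m) Θ (s, a)‖ ≤ B) :
    c * ‖∑' j, dyadic m Θ a j‖ ≤ B * 2 := by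
  have h1 : c * ‖∑' j, dyadic m Θ a j‖ = ‖∑' j, (c : ℂ) * dyadic m Θ a j‖ := by
    rw [tsum_mul_left, norm_mul, Complex.norm_real, Real.norm_of_nonneg hc]
  rw [h1]
  have h2 : HasSum (fun j : ℕ => B * (1 / 2 : ℝ) ^ j) (B * 2) := hasSum_geometric_two.mul_left B
  refine tsum_of_norm_bounded h2 fun j => ?_
  rw [norm_mul, Complex.norm_real, Real.norm_of_nonneg hc]
  exact OM.dyadic_le m hΘ hc h j

/-- Derivatives along `A` of flat functions are flat, so the differentiated series converges
geometrically, uniformly on unit balls, and termwise differentiation is justified. -/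
lemma OM.hasFDerivAt_tsum_dyadic (m : ℝ) {Θ : OM (ℝ × A)} (hΘ : Θ ∈ OM.flat A) (a : A) :
    ∃ L : A →L[ℝ] ℂ, HasFDerivAt (fun a => ∑' j, dyadic m Θ a j) L a ∧
      ∀ e, L e = ∑' j, dyadic m (OM.deriv (0, e) Θ) a j := by
  let f' : ℕ → A → A →L[ℝ] ℂ := fun j a => ((((2 : ℝ) ^ m) ^ j : ℝ) : ℂ) •
    (fderiv ℝ Θ ((1 / 2 : ℝ) ^ j, a)).comp (ContinuousLinearMap.inr ℝ ℝ A)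
  have hf : ∀ j a, HasFDerivAt (fun a => dyadic m Θ a j) (f' j a) a := by
    intro j a
    have h : HasFDerivAt (fun a => Θ ((1 / 2 : ℝ) ^ j, a)) _ a :=
      (Θ.differentiable ((1 / 2 : ℝ) ^ j, a)).hasFDerivAt.comp a
        (hasFDerivAt_prodMk_right ((1 / 2 : ℝ) ^ j) a)
    exact h.const_smul ((((2 : ℝ) ^ m) ^ j : ℝ) : ℂ)
  have hfe : ∀ j a e, f' j a e = dyadic m (OM.deriv (0, e) Θ) a j := fun j a e => rfl
  obtain ⟨C0, hC0, hL⟩ := exists_norm_clm_le A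
  choose k C hC hle using fun i => OM.exists_dyadic_le m
    (OM.deriv_right_mem_flat hΘ (Module.finBasis ℝ A i))
  -- On the unit ball around `a` one has `1 + ‖y‖ ≤ 2 + ‖a‖`.
  let u : ℕ → ℝ := fun j => C0 * ∑ i, C i * (2 + ‖a‖) ^ k i * (1 / 2 : ℝ) ^ j
  have hu : Summable u := (summable_sum fun i _ => summable_half_pow.mul_left _).mul_left _
  have hb : ∀ j, ∀ y ∈ Metric.ball a 1, ‖f' j y‖ ≤ u j := by
    intro j y hy
    refine (hL _).trans ?_
    simp only [u]
    gcongr with i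
    rw [hfe]
    refine (hle i y j).trans ?_
    have hy' : ‖y‖ ≤ 1 + ‖a‖ := by
      have h1 := norm_add_le (y - a) a
      rw [sub_add_cancel] at h1
      have h2 := mem_ball_iff_norm.1 hy
      linarith
    have hy1 : 1 + ‖y‖ ≤ 2 + ‖a‖ := by linarith
    have := hC i
    gcongr
  refine ⟨∑' j, f' j a, hasFDerivAt_tsum_of_isPreconnected hu Metric.isOpen_ball
    (convex_ball a 1).isPreconnected (fun j y _ => hf j y) hb (Metric.mem_ball_self one_pos)
    (OM.summable_dyadic m hΘ a) (Metric.mem_ball_self one_pos), fun e => ?_⟩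
  have hs : Summable fun j => f' j a :=
    Summable.of_norm_bounded hu fun j => hb j a (Metric.mem_ball_self one_pos)
  exact (ContinuousLinearMap.apply ℝ ℂ e).map_tsum hs

lemma OM.hasTemperateGrowth_tsum_dyadic (m : ℝ) {Θ : OM (ℝ × A)} (hΘ : Θ ∈ OM.flat A) :
    Function.HasTemperateGrowth fun a => ∑' j, dyadic m Θ a j := by
  refine temperate_of_closed (S := {f | ∃ Θ ∈ OM.flat A, f = fun a => ∑' j, dyadic m Θ a j})
    ?_ ?_ _ ⟨Θ, hΘ, rfl⟩
  · rintro _ ⟨Θ, hΘ, rfl⟩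
    obtain ⟨k, C, hC0, hC⟩ := OM.exists_dyadic_le m hΘ
    refine ⟨k, C * 2, fun a => ?_⟩
    have h2 := hasSum_geometric_two.mul_left (C * (1 + ‖a‖) ^ k)
    refine (tsum_of_norm_bounded h2 (hC a)).trans (le_of_eq ?_)
    ring
  · rintro _ ⟨Θ, hΘ, rfl⟩
    choose L hL hLe using fun a => OM.hasFDerivAt_tsum_dyadic m hΘ a
    refine ⟨L, hL, fun e => Submodule.subset_span ⟨_, OM.deriv_right_mem_flat hΘ e, ?_⟩⟩
    ext a
    exact hLe a e

/-- The dyadic sum `Σ_j 2^{mj} Θ(2^{-j}, ·)` of a flat function. -/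
noncomputable def flatSum (m : ℝ) : OM.flat A →ₗ[ℂ] OM A where
  toFun Θ := OM.mk (fun a => ∑' j, dyadic m Θ a j) (OM.hasTemperateGrowth_tsum_dyadic m Θ.2)
  map_add' Θ Θ' := by
    ext a
    simp only [OM.mk_apply, OM.add_apply]
    rw [← (OM.summable_dyadic m Θ.2 a).tsum_add (OM.summable_dyadic m Θ'.2 a)]
    refine tsum_congr fun j => ?_
    simp [dyadic, mul_add]
  map_smul' c Θ := by
    ext a
    simp only [OM.mk_apply, OM.smul_apply, RingHom.id_apply]
    rw [← tsum_mul_left]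
    refine tsum_congr fun j => ?_
    simp [dyadic, mul_left_comm]

lemma flatSum_apply (m : ℝ) (Θ : OM.flat A) (a : A) : flatSum m Θ a = ∑' j, dyadic m Θ a j := rfl

lemma hasSum_flatSum (m : ℝ) (Θ : OM.flat A) (a : A) :
    HasSum (dyadic m Θ a) (flatSum m Θ a) := (OM.summable_dyadic m Θ.2 a).hasSum

lemma deriv_flatSum (m : ℝ) (Θ : OM.flat A) (e : A) :
    OM.deriv e (flatSum m Θ) = flatSum m ⟨_, OM.deriv_right_mem_flat Θ.2 e⟩ := by
  ext a
  obtain ⟨L, hL, hLe⟩ := OM.hasFDerivAt_tsum_dyadic m Θ.2 a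
  rw [OM.deriv_apply]
  have : fderiv ℝ (flatSum m Θ) a = L := hL.fderiv
  rw [this, hLe]
  rfl

/-- Dyadic summation commutes with derivatives along `A` and with multiplication by functionals on
`A`, and both preserve flat Schwartz functions. The closure criterion therefore needs only a uniform
bound, which is a geometric series. -/
lemma IsSchwartz.flatSum (m : ℝ) {Θ : OM.flat A} (hS : IsSchwartz (Θ : OM (ℝ × A))) :
    IsSchwartz (flatSum m Θ) := by
  refine isSchwartz_of_closed (S := {f | ∃ Θ : OM.flat A, IsSchwartz (Θ : OM (ℝ × A)) ∧
    f = Shubin.flatSum m Θ}) ?_ ?_ ?_ _ ⟨Θ, hS, rfl⟩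
  · rintro _ ⟨Θ, hS, rfl⟩
    obtain ⟨C, hC0, hC⟩ := hS.exists_dyadic_le m Θ.2 0
    simp only [pow_zero, one_mul] at hC
    exact ⟨C * 2, fun a => tsum_of_norm_bounded (hasSum_geometric_two.mul_left C) (hC a)⟩
  · rintro _ ⟨Θ, hS, rfl⟩
    refine ⟨fderiv ℝ (Shubin.flatSum m Θ), fun a =>
      ((Shubin.flatSum m Θ).differentiable a).hasFDerivAt, fun e => Submodule.subset_span
        ⟨⟨_, OM.deriv_right_mem_flat Θ.2 e⟩, hS.fderiv_apply (0, e), ?_⟩⟩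
    rw [← deriv_flatSum]
    rfl
  · rintro _ ⟨Θ, hS, rfl⟩ ℓ
    have hℓ := hasTemperateGrowth_ofReal_clm (ℓ.comp (ContinuousLinearMap.snd ℝ ℝ A))
    refine Submodule.subset_span ⟨⟨_, OM.mul_mem_flat (OM.mk _ hℓ) Θ.2⟩, hS.temperate_mul hℓ, ?_⟩
    ext a
    rw [flatSum_apply, flatSum_apply, ← tsum_mul_left]
    refine tsum_congr fun j => ?_
    simp [dyadic, mul_left_comm]

variable {V : Type} [AddCommGroup V] [Module ℂ V] [TopologicalSpace V] [IsTopologicalAddGroup V]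
  [ContinuousConstSMul ℂ V]

/-- The operator `φ ↦ Σ_j 2^{mj} (T φ)(2^{-j}, ·)` for an operator `T` with flat values. -/
noncomputable def flatSumOp (m : ℝ) (T : V →L[ℂ] OM (ℝ × A)) (hT : ∀ φ, T φ ∈ OM.flat A) :
    V →L[ℂ] OM A where
  toLinearMap := flatSum m ∘ₗ T.toLinearMap.codRestrict (OM.flat A) hT
  cont := by
    refine OM.continuous_of_closed (S := {L | ∃ (T : V →L[ℂ] OM (ℝ × A))
      (hT : ∀ φ, T φ ∈ OM.flat A), L = flatSum m ∘ₗ T.toLinearMap.codRestrict (OM.flat A) hT})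
      ?_ ?_ _ ⟨T, hT, rfl⟩
    · rintro _ ⟨T, hT, rfl⟩ f
      -- Only `|s| ≤ 1` matters, so multiplying `f` by a cutoff in `s` gives a Schwartz weight on `ℝ
      -- × A` which agrees there with `f`.
      obtain ⟨χ, -, hχ⟩ := exists_schwartz_eq_one_of_abs_le
      obtain ⟨h, hh⟩ := exists_schwartz_dominating_mul χ f
      let D := (OM.deriv ((1 : ℝ), (0 : A))) ^ dyadicOrder m
      obtain ⟨P, hP, hPe⟩ := exists_seminorm_sum (fun _ : Unit =>
        (OM.seminormFamily (ℝ × A) (h, 0)).comp (D.comp T).toLinearMap) (fun _ =>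
          (OM.continuous_seminorm h 0).comp (D.comp T).continuous) (C := 2) (by norm_num)
      refine ⟨P, hP, fun φ a => ?_⟩
      rw [hPe, mul_comm (2 : ℝ)]
      simp only [Finset.univ_unique, Finset.sum_const, Finset.card_singleton, one_smul]
      refine OM.norm_tsum_dyadic_le m (hT φ) (norm_nonneg _) fun s hs => ?_
      refine le_trans (le_of_eq ?_) (OM.le_seminorm_zero _ h (s, a))
      rw [← hh, hχ s hs, norm_one, one_mul]
      rfl
    · rintro _ ⟨T, hT, rfl⟩ e
      refine Submodule.subset_span ⟨(OM.deriv (0, e)).comp T,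
        fun φ => OM.deriv_right_mem_flat (hT φ) e, ?_⟩
      ext1 φ
      exact deriv_flatSum m ⟨T φ, hT φ⟩ e

lemma flatSumOp_apply (m : ℝ) (T : V →L[ℂ] OM (ℝ × A)) (hT : ∀ φ, T φ ∈ OM.flat A) (φ : V) :
    flatSumOp m T hT φ = flatSum m ⟨T φ, hT φ⟩ := rfl

end Flat

end Shubin

/-! ### Dilations, flat operators and dyadic series of rescalings. -/

namespace Shubin

/-- A one-parameter family of dilations `δ_s`, `s ∈ ℝ`, depending temperately on `s`. -/
structure Dilations (E : Type) [NormedAddCommGroup E] [NormedSpace ℝ E] where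
  δ : ℝ → E →L[ℝ] E
  temperate : δ.HasTemperateGrowth
  zero : δ 0 = 0
  one : δ 1 = ContinuousLinearMap.id ℝ E
  mul : ∀ s t, δ (s * t) = (δ s).comp (δ t)

section Fam

variable {N G A : Type} [NormedAddCommGroup N] [NormedSpace ℝ N] [FiniteDimensional ℝ N]
  [NormedAddCommGroup G] [NormedSpace ℝ G] [FiniteDimensional ℝ G]
  [NormedAddCommGroup A] [NormedSpace ℝ A] [FiniteDimensional ℝ A]

lemma hasTemperateGrowth_clm_apply {X E F : Type} [NormedAddCommGroup X] [NormedSpace ℝ X]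
    [NormedAddCommGroup E] [NormedSpace ℝ E] [NormedAddCommGroup F] [NormedSpace ℝ F]
    {L : X → E →L[ℝ] F} {f : X → E} (hL : L.HasTemperateGrowth) (hf : f.HasTemperateGrowth) :
    Function.HasTemperateGrowth fun x => L x (f x) :=
  (ContinuousLinearMap.id ℝ (E →L[ℝ] F)).bilinear_hasTemperateGrowth (𝕜 := ℝ) hL hf

lemma OM.sum_apply {E ι : Type} [NormedAddCommGroup E] [NormedSpace ℝ E] [FiniteDimensional ℝ E]
    (s : Finset ι) (g : ι → OM E) (x : E) : (∑ i ∈ s, g i) x = ∑ i ∈ s, g i x :=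
  map_sum (OM.eval x) g s

@[simp] lemma OM.one_apply {E : Type} [NormedAddCommGroup E] [NormedSpace ℝ E] (x : E) :
    (1 : OM E) x = 1 := rfl

/-- A linear functional as an element of `𝓞_M`. -/
noncomputable def OM.ofClm {E : Type} [NormedAddCommGroup E] [NormedSpace ℝ E] (ℓ : E →L[ℝ] ℝ) :
    OM E := OM.mk _ (hasTemperateGrowth_ofReal_clm ℓ)

@[simp] lemma OM.ofClm_apply {E : Type} [NormedAddCommGroup E] [NormedSpace ℝ E] (ℓ : E →L[ℝ] ℝ)
    (x : E) : OM.ofClm ℓ x = (ℓ x : ℂ) := rfl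

variable (N) in
/-- Multiplication by a linear functional `ℓ(v)` on `N × G`. -/
noncomputable def mulSnd (ℓ : G →L[ℝ] ℝ) : OM (N × G) →L[ℂ] OM (N × G) :=
  OM.mulL (OM.ofClm (ℓ.comp (ContinuousLinearMap.snd ℝ N G)))

lemma mulSnd_apply (ℓ : G →L[ℝ] ℝ) (φ : OM (N × G)) (p : N × G) :
    mulSnd N ℓ φ p = (ℓ p.2 : ℂ) * φ p := rfl

variable (N) in
/-- The monomial `∏ ℓ_i(v)` on `N × G`. -/
noncomputable def mono (L : List (G →L[ℝ] ℝ)) : OM (N × G) :=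
  (L.map fun ℓ => OM.ofClm (ℓ.comp (ContinuousLinearMap.snd ℝ N G))).prod

lemma mono_cons (ℓ : G →L[ℝ] ℝ) (L : List (G →L[ℝ] ℝ)) :
    mono N (ℓ :: L) = mulSnd N ℓ (mono N L) := rfl

/-- The operators `v` such that all functions `v(p)`, `p` a polynomial on `G`, vanish to infinite
order at `0`. -/
def FlatOp (v : OM (N × G) →L[ℂ] OM N) : Prop :=
  ∀ (D : List N) (L : List (G →L[ℝ] ℝ)), OM.derivs D (v (mono N L)) 0 = 0

lemma FlatOp.deriv {v : OM (N × G) →L[ℂ] OM N} (hv : FlatOp v) (e : N) :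
    FlatOp ((OM.deriv e).comp v) := fun D L => hv (e :: D) L

lemma FlatOp.mulSnd {v : OM (N × G) →L[ℂ] OM N} (hv : FlatOp v) (ℓ : G →L[ℝ] ℝ) :
    FlatOp (v.comp (mulSnd N ℓ)) := fun D L => hv D (ℓ :: L)

lemma FlatOp.apply_one {v : OM (N × G) →L[ℂ] OM N} (hv : FlatOp v) : v 1 0 = 0 := hv [] []

variable (δ : Dilations N) (α : Dilations G)

lemma hasTemperateGrowth_famMap :
    Function.HasTemperateGrowth fun p : (ℝ × A) × (N × G) => (p.1.2, α.δ p.1.1 p.2.2) :=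
  HasTemperateGrowth.prodMk (hasTemperateGrowth_snd.comp hasTemperateGrowth_fst)
    (hasTemperateGrowth_clm_apply
      (α.temperate.comp (hasTemperateGrowth_fst.comp hasTemperateGrowth_fst))
      (hasTemperateGrowth_snd.comp hasTemperateGrowth_snd))

lemma hasTemperateGrowth_famBase {π : A → N} (hπ : π.HasTemperateGrowth) :
    Function.HasTemperateGrowth fun q : ℝ × A => δ.δ q.1 (π q.2) :=
  hasTemperateGrowth_clm_apply (δ.temperate.comp hasTemperateGrowth_fst)
    (hπ.comp hasTemperateGrowth_snd)

lemma hasTemperateGrowth_famGraph {π : A → N} (hπ : π.HasTemperateGrowth) :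
    Function.HasTemperateGrowth fun q : ℝ × A => (q, δ.δ q.1 (π q.2)) :=
  HasTemperateGrowth.prodMk .id' (hasTemperateGrowth_famBase δ hπ)

/-- The rescaled function `(n, v) ↦ φ(a, α_ε v)`. -/
noncomputable def rescale (α : Dilations G) :
    OM (A × G) →L[ℂ] OM ((ℝ × A) × (N × G)) :=
  OM.pullback _ (hasTemperateGrowth_famMap α)

/-- The family `(ε, a) ↦ v(φ(a, α_ε ·))(δ_ε π(a))` of rescalings of an operator `v`. -/
noncomputable def fam (v : OM (N × G) →L[ℂ] OM N) (π : A → N) (hπ : π.HasTemperateGrowth) :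
    OM (A × G) →L[ℂ] OM (ℝ × A) :=
  (OM.pullback _ (hasTemperateGrowth_famGraph δ hπ)).comp ((bc (ℝ × A) v).comp (rescale α))

lemma fam_apply (v : OM (N × G) →L[ℂ] OM N) (π : A → N) (hπ : π.HasTemperateGrowth)
    (φ : OM (A × G)) (ε : ℝ) (a : A) :
    fam δ α v π hπ φ (ε, a) = v (OM.slice (ε, a) (rescale α φ)) (δ.δ ε (π a)) := rfl

lemma slice_rescale_apply (φ : OM (A × G)) (ε : ℝ) (a : A) (p : N × G) :
    OM.slice (ε, a) (rescale α φ) p = φ (a, α.δ ε p.2) := rfl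

lemma hasTemperateGrowth_deriv {F : Type} [NormedAddCommGroup F] [NormedSpace ℝ F] {f : ℝ → F}
    (hf : f.HasTemperateGrowth) : (_root_.deriv f).HasTemperateGrowth := by
  have h1 : (fderiv ℝ f).HasTemperateGrowth := by
    refine ⟨hf.1.fderiv_right (by simp), fun n => ?_⟩
    obtain ⟨k, C, hC⟩ := hf.2 (n + 1)
    exact ⟨k, C, fun x => by rw [norm_iteratedFDeriv_fderiv]; exact hC x⟩
  have h2 := hasTemperateGrowth_clm_apply h1 (Function.HasTemperateGrowth.const (1 : ℝ))
  exact h2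

lemma Dilations.hasDerivAt (x : N) (s : ℝ) :
    HasDerivAt (fun s => δ.δ s x) (_root_.deriv δ.δ s x) s := by
  have h := ((δ.temperate.1.differentiable (by simp)) s).hasDerivAt.clm_apply (hasDerivAt_const s x)
  simpa using h

lemma hasTemperateGrowth_deriv_coord {f : A → N}
    (hf : f.HasTemperateGrowth) (i : Fin (Module.finrank ℝ N)) :
    Function.HasTemperateGrowth fun p : ℝ × A =>
      (((Module.finBasis ℝ N).coord i (_root_.deriv δ.δ p.1 (f p.2)) : ℝ) : ℂ) := by
  have h1 := hasTemperateGrowth_deriv δ.temperate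
  have h2 := hasTemperateGrowth_clm_apply (h1.comp (hasTemperateGrowth_fst (N := ℝ) (G := A)))
    (hf.comp hasTemperateGrowth_snd)
  exact (hasTemperateGrowth_ofReal_clm
    (LinearMap.toContinuousLinearMap ((Module.finBasis ℝ N).coord i))).comp h2

/-- The coefficient `i`-th coordinate of `∂_ε δ_ε f(a)`. -/
noncomputable def dcoef (f : A → N) (hf : f.HasTemperateGrowth) (i : Fin (Module.finrank ℝ N)) :
    OM (ℝ × A) := OM.mk _ (hasTemperateGrowth_deriv_coord δ hf i)

/-- Since `∂_ε α_ε v` is linear in `v`, the chain rule gives first derivatives of `φ` multiplied by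
coordinates of `v`, with coefficients depending on `ε` alone. -/
lemma deriv_rescale (φ : OM (A × G)) (ε : ℝ) (a : A) :
    OM.slice (ε, a) (OM.deriv (((1 : ℝ), (0 : A)), (0 : N × G)) (rescale α φ))
      = ∑ i, ∑ j, (((Module.finBasis ℝ G).coord i (_root_.deriv α.δ ε (Module.finBasis ℝ G j)) : ℝ) : ℂ)
        • mulSnd N (LinearMap.toContinuousLinearMap ((Module.finBasis ℝ G).coord j))
          (OM.slice (ε, a) (rescale α (OM.deriv (0, Module.finBasis ℝ G i) φ))) := by
  let b := Module.finBasis ℝ G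
  ext p
  have h1 : HasDerivAt (fun s => rescale (N := N) α φ ((s, a), p))
      (fderiv ℝ (rescale (N := N) α φ) ((ε, a), p) ((1, 0), 0)) ε := by
    have hc : HasDerivAt (fun s : ℝ => ((s, a), p)) (((1 : ℝ), (0 : A)), (0 : N × G)) ε :=
      ((hasDerivAt_id ε).prodMk (hasDerivAt_const ε a)).prodMk (hasDerivAt_const ε p)
    exact ((rescale (N := N) α φ).differentiable ((ε, a), p)).hasFDerivAt.comp_hasDerivAt ε hc
  have h2 : HasDerivAt (fun s => rescale (N := N) α φ ((s, a), p))
      (fderiv ℝ φ (a, α.δ ε p.2) (0, _root_.deriv α.δ ε p.2)) ε := by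
    have hc : HasDerivAt (fun s : ℝ => (a, α.δ s p.2)) ((0 : A), _root_.deriv α.δ ε p.2) ε :=
      (hasDerivAt_const ε a).prodMk (α.hasDerivAt p.2 ε)
    exact (φ.differentiable (a, α.δ ε p.2)).hasFDerivAt.comp_hasDerivAt ε hc
  have h3 : (((0 : A), _root_.deriv α.δ ε p.2) : A × G)
      = ∑ i, ∑ j, (b.coord i (_root_.deriv α.δ ε (b j)) * b.coord j p.2) • ((0 : A), b i) := by
    refine Prod.ext ?_ ?_
    · simp [Prod.fst_sum]
    · simp only [Prod.snd_sum, Prod.smul_snd]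
      rw [Finset.sum_comm]
      conv_lhs => rw [← b.sum_repr p.2, map_sum]
      refine Finset.sum_congr rfl fun j _ => ?_
      rw [map_smul]
      conv_lhs => rw [← b.sum_repr (_root_.deriv α.δ ε (b j)), Finset.smul_sum]
      refine Finset.sum_congr rfl fun i _ => ?_
      rw [smul_smul, mul_comm]
      rfl
  rw [OM.slice_apply, OM.deriv_apply, h1.unique h2, h3, map_sum, OM.sum_apply]
  refine Finset.sum_congr rfl fun i _ => ?_
  rw [map_sum, OM.sum_apply]
  refine Finset.sum_congr rfl fun j _ => ?_
  rw [map_smul, OM.smul_apply, mulSnd_apply, slice_rescale_apply, OM.deriv_apply,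
    Complex.real_smul, Complex.ofReal_mul, mul_assoc]
  rfl

/-- The parameter `ε` enters twice. Through the base point `δ_ε π(a)` the derivative falls on the
output of `v`; through `α_ε` it composes `v` with multiplication by a coordinate and differentiates
`φ`. Both modifications of `v` preserve flatness. -/
lemma deriv_fam (v : OM (N × G) →L[ℂ] OM N) (π : A → N) (hπ : π.HasTemperateGrowth)
    (φ : OM (A × G)) : OM.deriv (1, 0) (fam δ α v π hπ φ)
      = ∑ i, dcoef δ π hπ i * fam δ α ((OM.deriv (Module.finBasis ℝ N i)).comp v) π hπ φ
        + ∑ i, ∑ j, dcoef α (fun _ : A => Module.finBasis ℝ G j) (Function.HasTemperateGrowth.const _) i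
          * fam δ α (v.comp (mulSnd N
              (LinearMap.toContinuousLinearMap ((Module.finBasis ℝ G).coord j)))) π hπ
            (OM.deriv (0, Module.finBasis ℝ G i) φ) := by
  let b := Module.finBasis ℝ N
  ext ⟨ε, a⟩
  let B := bc (ℝ × A) v (rescale α φ)
  have h1 : HasDerivAt (fun s => fam δ α v π hπ φ (s, a))
      (fderiv ℝ B ((ε, a), δ.δ ε (π a)) ((1, 0), _root_.deriv δ.δ ε (π a))) ε := by
    have hc : HasDerivAt (fun s : ℝ => ((s, a), δ.δ s (π a)))
        (((1 : ℝ), (0 : A)), _root_.deriv δ.δ ε (π a)) ε :=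
      ((hasDerivAt_id ε).prodMk (hasDerivAt_const ε a)).prodMk (δ.hasDerivAt (π a) ε)
    exact (B.differentiable ((ε, a), δ.δ ε (π a))).hasFDerivAt.comp_hasDerivAt ε hc
  rw [(OM.hasDerivAt_left (fam δ α v π hπ φ) ε a).unique h1]
  have h2 : ((((1 : ℝ), (0 : A)), _root_.deriv δ.δ ε (π a)) : (ℝ × A) × N)
      = ∑ i, b.coord i (_root_.deriv δ.δ ε (π a)) • (0, b i) + ((1, 0), 0) := by
    refine Prod.ext ?_ ?_
    · simp [Prod.fst_sum]
    · simp only [Prod.snd_sum, Prod.smul_snd, Prod.snd_add, add_zero]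
      exact (b.sum_repr _).symm
  have h0 : (OM.deriv (0 : N)).comp v = 0 := by
    ext φ y
    simp [OM.deriv_apply]
  have h0' : OM.deriv ((0 : ℝ × A), (0 : N × G)) (rescale α φ) = 0 := by
    ext q
    exact map_zero (fderiv ℝ (rescale α φ) q)
  have hz : bc (ℝ × A) (0 : OM (N × G) →L[ℂ] OM N) (rescale α φ) = 0 := by
    ext p
    rfl
  have h3 : ∀ i, fderiv ℝ B ((ε, a), δ.δ ε (π a)) (0, b i)
      = fam δ α ((OM.deriv (b i)).comp v) π hπ φ (ε, a) := fun i => by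
    have := congrArg (fun ψ : OM ((ℝ × A) × N) => ψ ((ε, a), δ.δ ε (π a)))
      (deriv_bc v (0 : ℝ × A) (b i) (rescale α φ))
    rw [h0', map_zero, zero_add] at this
    exact this
  have h4 : fderiv ℝ B ((ε, a), δ.δ ε (π a)) ((1, 0), 0)
      = v (OM.slice (ε, a) (OM.deriv (((1 : ℝ), (0 : A)), (0 : N × G)) (rescale α φ)))
        (δ.δ ε (π a)) := by
    have := congrArg (fun ψ : OM ((ℝ × A) × N) => ψ ((ε, a), δ.δ ε (π a)))
      (deriv_bc v ((1 : ℝ), (0 : A)) (0 : N) (rescale α φ))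
    rw [h0, hz, add_zero] at this
    exact this
  rw [h2, map_add, map_sum, h4, deriv_rescale, OM.add_apply, OM.sum_apply, OM.sum_apply, map_sum,
    OM.sum_apply]
  congr 1
  · refine Finset.sum_congr rfl fun i _ => ?_
    rw [map_smul, h3, OM.mul_apply, Complex.real_smul]
    rfl
  · refine Finset.sum_congr rfl fun i _ => ?_
    rw [map_sum, OM.sum_apply, OM.sum_apply]
    refine Finset.sum_congr rfl fun j _ => ?_
    rw [map_smul, OM.smul_apply, OM.mul_apply]
    rfl

/-- By `deriv_fam`, the families of flat operators with coefficients in `𝓞_M` are closed under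
`∂_ε`, up to sums. At `ε = 0` the rescaled function is the constant `φ(a, 0)` and the base point is
`0`, so the value is a multiple of `v(1)(0) = 0`. -/
lemma fam_mem_flat {v : OM (N × G) →L[ℂ] OM N} (hv : FlatOp v) (π : A → N)
    (hπ : π.HasTemperateGrowth) (φ : OM (A × G)) : fam δ α v π hπ φ ∈ OM.flat A := by
  refine OM.flat_of_closed (S := {Θ | ∃ (v : OM (N × G) →L[ℂ] OM N) (_ : FlatOp v)
    (c : OM (ℝ × A)) (φ : OM (A × G)), Θ = c * fam δ α v π hπ φ}) ?_ ?_ _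
    ⟨v, hv, 1, φ, (one_mul _).symm⟩
  · rintro _ ⟨v, hv, c, φ, rfl⟩ a
    have h : OM.slice ((0 : ℝ), a) (rescale α φ) = φ (a, 0) • (1 : OM (N × G)) := by
      ext p
      rw [slice_rescale_apply, α.zero]
      simp
    rw [OM.mul_apply, fam_apply, h, δ.zero, map_smul, OM.smul_apply]
    simp [hv.apply_one]
  · rintro _ ⟨v, hv, c, φ, rfl⟩
    rw [OM.deriv_mul, deriv_fam, mul_add, Finset.mul_sum, Finset.mul_sum]
    refine add_mem (Submodule.subset_span ⟨_, hv, _, _, rfl⟩) (add_mem ?_ ?_)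
    · refine sum_mem fun i _ => ?_
      rw [← mul_assoc]
      exact Submodule.subset_span ⟨_, hv.deriv _, _, _, rfl⟩
    · refine sum_mem fun i _ => ?_
      rw [Finset.mul_sum]
      refine sum_mem fun j _ => ?_
      rw [← mul_assoc]
      exact Submodule.subset_span ⟨_, hv.mulSnd _, _, _, rfl⟩

/-- The fibred distribution `Σ_j 2^{mj} (τ_{2^{-j}})_* v`. -/
noncomputable def flatDist (m : ℝ) (v : OM (N × G) →L[ℂ] OM N) (hv : FlatOp v) : FibredDist N G :=
  ⟨flatSumOp m (fam δ α v id .id) (fam_mem_flat δ α hv id .id), fun f φ => by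
    ext a
    rw [flatSumOp_apply, OM.mul_apply, flatSumOp_apply, flatSum_apply, flatSum_apply,
      ← tsum_mul_left]
    refine tsum_congr fun j => ?_
    have h : ∀ ε, OM.slice (ε, a) (rescale (N := N) α
        (OM.pullback Prod.fst hasTemperateGrowth_fst f * φ))
        = f a • OM.slice (ε, a) (rescale α φ) := fun ε => by
      ext p
      rw [slice_rescale_apply, OM.smul_apply, slice_rescale_apply]
      rfl
    simp only [dyadic, fam_apply, h, map_smul, OM.smul_apply]
    ring⟩

lemma hasSum_flatDist (m : ℝ) (v : OM (N × G) →L[ℂ] OM N) (hv : FlatOp v) (φ : OM (N × G)) (a : N) :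
    HasSum (dyadic m (fam δ α v id .id φ) a) (flatDist δ α m v hv φ a) :=
  hasSum_flatSum m ⟨fam δ α v id .id φ, fam_mem_flat δ α hv id .id φ⟩ a

lemma fam_one (v : OM (N × G) →L[ℂ] OM N) (π : A → N) (hπ : π.HasTemperateGrowth)
    (φ : OM (A × G)) (a : A) : fam δ α v π hπ φ (1, a)
      = v (OM.pullback Prod.snd hasTemperateGrowth_snd (OM.slice a φ)) (π a) := by
  rw [fam_apply, δ.one]
  congr 2
  ext p
  rw [slice_rescale_apply, α.one]
  rfl

/-- Dyadic decomposition of an operator `v` in terms of `w = v - 2^m (τ_{1/2})_* v`. -/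
lemma hasSum_dyadic_fam (m : ℝ) {v w : OM (N × G) →L[ℂ] OM N} (hv : FlatOp v)
    (hw : ∀ φ x, w φ x = v φ x - ((2 : ℝ) ^ m : ℝ) * v (OM.pullback
      (Prod.map (δ.δ 2) (α.δ (1 / 2))) (hasTemperateGrowth_prodMap
        (ContinuousLinearMap.hasTemperateGrowth _) (ContinuousLinearMap.hasTemperateGrowth _)) φ)
        (δ.δ (1 / 2) x))
    (π : A → N) (hπ : π.HasTemperateGrowth) (φ : OM (A × G)) (a : A) :
    HasSum (dyadic m (fam δ α w π hπ φ) a)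
      (v (OM.pullback Prod.snd hasTemperateGrowth_snd (OM.slice a φ)) (π a)) := by
  have h1 : ∀ ε, fam δ α w π hπ φ (ε, a) = fam δ α v π hπ φ (ε, a)
      - ((2 : ℝ) ^ m : ℝ) * fam δ α v π hπ φ (1 / 2 * ε, a) := by
    intro ε
    rw [fam_apply, fam_apply, hw, fam_apply]
    congr 3
    · congr 1
      ext p
      rw [OM.pullback_apply, slice_rescale_apply, slice_rescale_apply, mul_comm (1 / 2) ε, α.mul]
      rfl
    · rw [δ.mul]
      rfl
  let T := dyadic m (fam δ α v π hπ φ) a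
  have hT : Summable T := OM.summable_dyadic m (fam_mem_flat δ α hv π hπ φ) a
  -- Halving `ε` shifts the index by one, so the series telescopes to `T 0`. Its tail disappears
  -- because flatness of `v` makes `T` summable.
  have h2 : dyadic m (fam δ α w π hπ φ) a = fun j => T j - T (j + 1) := by
    ext j
    simp only [T, dyadic, h1, pow_succ', Complex.ofReal_mul]
    ring
  have h3 : T 0 = v (OM.pullback Prod.snd hasTemperateGrowth_snd (OM.slice a φ)) (π a) := by
    rw [← fam_one δ α v π hπ]
    simp [T, dyadic]
  rw [h2, ← h3]
  have h4 := (hasSum_nat_add_iff' 1).2 hT.hasSum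
  have h5 := hT.hasSum.sub h4
  simpa using h5

end Fam

end Shubin

namespace Shubin

/-! ### Characters and symbols of operators. -/

section Character

/-- The character `exp(-2πit)`. -/
noncomputable def expi (t : ℝ) : ℂ := Complex.exp (((-2 * Real.pi * t : ℝ) : ℂ) * Complex.I)

/-- The constant `-2πi`. -/
noncomputable def cI : ℂ := ((-2 * Real.pi : ℝ) : ℂ) * Complex.I

lemma cI_ne_zero : cI ≠ 0 :=
  mul_ne_zero (Complex.ofReal_ne_zero.2 (by have := Real.pi_pos; linarith)) Complex.I_ne_zero

@[simp] lemma expi_zero : expi 0 = 1 := by simp [expi]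

lemma norm_expi (t : ℝ) : ‖expi t‖ = 1 := Complex.norm_exp_ofReal_mul_I _

lemma hasDerivAt_expi (t : ℝ) : HasDerivAt expi (cI * expi t) t := by
  have h1 : HasDerivAt (fun t : ℝ => ((-2 * Real.pi * t : ℝ) : ℂ) * Complex.I) cI t := by
    have h2 : HasDerivAt (fun t : ℝ => -2 * Real.pi * t) (-2 * Real.pi) t := by
      simpa using (hasDerivAt_id t).const_mul (-2 * Real.pi)
    exact h2.ofReal_comp.mul_const Complex.I
  rw [mul_comm]
  exact h1.cexp

lemma hasTemperateGrowth_expi : expi.HasTemperateGrowth := by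
  refine temperate_of_closed (S := {expi}) ?_ ?_ _ rfl
  · rintro _ rfl
    exact ⟨0, 1, fun x => by simp [norm_expi]⟩
  · rintro _ rfl
    refine ⟨_, fun x => (hasDerivAt_expi x).hasFDerivAt, fun e => ?_⟩
    have h : (fun x => (ContinuousLinearMap.toSpanSingleton ℝ (cI * expi x)) e) = (e * cI) • expi := by
      ext x
      simp [mul_assoc]
    rw [h]
    exact Submodule.smul_mem _ _ (Submodule.subset_span rfl)

variable {n : ℕ}

/-- The linear functional `v ↦ ξ · v`. -/
noncomputable def dotL (ξ : Fin n → ℝ) : (Fin n → ℝ) →L[ℝ] ℝ :=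
  ∑ i, ξ i • ContinuousLinearMap.proj i

@[simp] lemma dotL_apply (ξ v : Fin n → ℝ) : dotL ξ v = ξ ⬝ᵥ v := by
  simp [dotL, dotProduct, _root_.sum_apply]

lemma hasTemperateGrowth_dot :
    Function.HasTemperateGrowth fun p : (Fin n → ℝ) × (Fin n → ℝ) => p.1 ⬝ᵥ p.2 := by
  have h : ∀ i, Function.HasTemperateGrowth fun p : (Fin n → ℝ) × (Fin n → ℝ) => p.1 i * p.2 i :=
    fun i => Function.HasTemperateGrowth.mul
      ((ContinuousLinearMap.proj (R := ℝ) (φ := fun _ : Fin n => ℝ) i).comp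
        (ContinuousLinearMap.fst ℝ _ (Fin n → ℝ))).hasTemperateGrowth
      ((ContinuousLinearMap.proj (R := ℝ) (φ := fun _ : Fin n => ℝ) i).comp
        (ContinuousLinearMap.snd ℝ (Fin n → ℝ) _)).hasTemperateGrowth
  exact Function.HasTemperateGrowth.sum (s := Finset.univ) fun i _ => h i

lemma OM.deriv_eq_of_hasDerivAt {E : Type} [NormedAddCommGroup E] [NormedSpace ℝ E] (φ : OM E)
    (p e : E) {c : ℂ} (h : HasDerivAt (fun t : ℝ => φ (p + t • e)) c 0) : OM.deriv e φ p = c := by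
  have h1 : HasDerivAt (fun t : ℝ => p + t • e) e 0 := by
    simpa using ((hasDerivAt_id (0 : ℝ)).smul_const e).const_add p
  have h2 : HasFDerivAt φ (fderiv ℝ φ p) (p + (0 : ℝ) • e) := by
    rw [zero_smul, add_zero]
    exact (φ.differentiable p).hasFDerivAt
  exact (h2.comp_hasDerivAt 0 h1).unique h

variable {N : Type} [NormedAddCommGroup N] [NormedSpace ℝ N] [FiniteDimensional ℝ N]

lemma hasTemperateGrowth_echar {A : Type} [NormedAddCommGroup A] [NormedSpace ℝ A]
    {f g : A → Fin n → ℝ} (hf : f.HasTemperateGrowth) (hg : g.HasTemperateGrowth) :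
    Function.HasTemperateGrowth fun p => expi (f p ⬝ᵥ g p) :=
  hasTemperateGrowth_expi.comp (hasTemperateGrowth_dot.comp (HasTemperateGrowth.prodMk hf hg))

variable (n N) in
/-- The function `(ξ, (x, v)) ↦ exp(-2πi ξ·v)`. -/
noncomputable def echar : OM ((Fin n → ℝ) × (N × (Fin n → ℝ))) :=
  OM.mk _ (hasTemperateGrowth_echar hasTemperateGrowth_fst
    (hasTemperateGrowth_snd.comp hasTemperateGrowth_snd))

lemma echar_apply (ξ : Fin n → ℝ) (p : N × (Fin n → ℝ)) : echar n N (ξ, p) = expi (ξ ⬝ᵥ p.2) := rfl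

lemma hasDerivAt_expi_line (a b : ℝ) :
    HasDerivAt (fun t : ℝ => expi (a + t * b)) (b * (cI * expi a)) 0 := by
  have h1 : HasDerivAt (fun t : ℝ => a + t * b) b 0 := by
    simpa using ((hasDerivAt_id (0 : ℝ)).mul_const b).const_add a
  have h2 : HasDerivAt expi (cI * expi a) (a + 0 * b) := by
    simpa using hasDerivAt_expi a
  have h3 := h2.scomp (0 : ℝ) h1
  rw [Complex.real_smul] at h3
  exact h3

lemma slice_deriv_echar (ξ η : Fin n → ℝ) :
    OM.slice ξ (OM.deriv (η, 0) (echar n N)) = cI • mulSnd N (dotL η) (OM.slice ξ (echar n N)) := by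
  ext p
  rw [OM.slice_apply, OM.smul_apply, mulSnd_apply, OM.slice_apply]
  refine OM.deriv_eq_of_hasDerivAt _ _ _ ?_
  have h := hasDerivAt_expi_line (ξ ⬝ᵥ p.2) (η ⬝ᵥ p.2)
  rw [dotL_apply, mul_left_comm]
  refine h.congr_of_eventuallyEq (Filter.Eventually.of_forall fun t => ?_)
  simp only [Prod.smul_mk, Prod.mk_add_mk, smul_zero, add_zero, echar_apply, add_dotProduct,
    smul_dotProduct, smul_eq_mul]

lemma deriv_slice_echar (ξ w : Fin n → ℝ) (e : N) :
    OM.deriv (e, w) (OM.slice ξ (echar n N)) = (cI * (ξ ⬝ᵥ w : ℝ)) • OM.slice ξ (echar n N) := by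
  ext p
  rw [OM.smul_apply, OM.slice_apply]
  refine OM.deriv_eq_of_hasDerivAt _ _ _ ?_
  have h := hasDerivAt_expi_line (ξ ⬝ᵥ p.2) (ξ ⬝ᵥ w)
  rw [mul_comm cI, mul_assoc]
  refine h.congr_of_eventuallyEq (Filter.Eventually.of_forall fun t => ?_)
  change expi (ξ ⬝ᵥ (p.2 + t • w)) = expi (ξ ⬝ᵥ p.2 + t * (ξ ⬝ᵥ w))
  rw [dotProduct_add, dotProduct_smul, smul_eq_mul]

/-- The symbol `(ξ, x) ↦ v(e_ξ)(x)`, `e_ξ(v) = exp(-2πi ξ·v)`, of an operator `v`. -/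
noncomputable def sym (v : OM (N × (Fin n → ℝ)) →L[ℂ] OM N) : OM ((Fin n → ℝ) × N) :=
  bc (Fin n → ℝ) v (echar n N)

lemma sym_apply (v : OM (N × (Fin n → ℝ)) →L[ℂ] OM N) (ξ : Fin n → ℝ) (x : N) :
    sym v (ξ, x) = v (OM.slice ξ (echar n N)) x := rfl

lemma sym_zero_apply (v : OM (N × (Fin n → ℝ)) →L[ℂ] OM N) (x : N) : sym v (0, x) = v 1 x := by
  have h : OM.slice 0 (echar n N) = 1 := by
    ext p
    simp [echar_apply]
  rw [sym_apply, h]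

/-- Differentiating the character in `ξ` brings down a linear factor in `v`. The `ξ`-derivatives of
the symbol at `ξ = 0` thus encode the values of the operator on polynomials. -/
lemma deriv_sym_left (v : OM (N × (Fin n → ℝ)) →L[ℂ] OM N) (η : Fin n → ℝ) :
    OM.deriv (η, 0) (sym v) = cI • sym (v.comp (mulSnd N (dotL η))) := by
  have h0 : (OM.deriv (0 : N)).comp v = 0 := by
    ext φ y
    simp [OM.deriv_apply]
  ext ⟨ξ, x⟩
  rw [sym, deriv_bc, h0, OM.add_apply, bc_apply, slice_deriv_echar, map_smul, OM.smul_apply]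
  exact add_zero _

lemma deriv_sym_right (v : OM (N × (Fin n → ℝ)) →L[ℂ] OM N) (e : N) :
    OM.deriv (0, e) (sym v) = sym ((OM.deriv e).comp v) := by
  have h0 : OM.deriv ((0 : Fin n → ℝ), (0 : N × (Fin n → ℝ))) (echar n N) = 0 := by
    ext q
    exact map_zero (fderiv ℝ (echar n N) q)
  rw [sym, deriv_bc, h0, map_zero, zero_add]
  rfl

lemma clm_eq_dotL (ℓ : (Fin n → ℝ) →L[ℝ] ℝ) : ℓ = dotL fun i => ℓ (Pi.single i 1) := by
  ext v
  conv_lhs => rw [pi_eq_sum_univ' v, map_sum]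
  simp only [map_smul, smul_eq_mul, dotL_apply, dotProduct]
  refine Finset.sum_congr rfl fun i _ => ?_
  rw [mul_comm]

/-- Operators whose symbols vanish near `(0, 0)` are flat. -/
lemma flatOp_of_sym {v : OM (N × (Fin n → ℝ)) →L[ℂ] OM N}
    (hv : ∀ᶠ p in 𝓝 ((0 : Fin n → ℝ), (0 : N)), sym v p = 0) : FlatOp v := by
  -- Vanishing on a neighbourhood, unlike vanishing at the origin alone, is inherited by
  -- derivatives.
  have hderiv : ∀ (φ : OM ((Fin n → ℝ) × N)) e, (∀ᶠ p in 𝓝 ((0 : Fin n → ℝ), (0 : N)), φ p = 0) →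
      ∀ᶠ p in 𝓝 ((0 : Fin n → ℝ), (0 : N)), OM.deriv e φ p = 0 := by
    intro φ e h
    have h1 : φ =ᶠ[𝓝 ((0 : Fin n → ℝ), (0 : N))] fun _ => 0 := h
    filter_upwards [h1.fderiv (𝕜 := ℝ)] with p hp
    rw [OM.deriv_apply, hp]
    simp
  intro D L
  induction L generalizing v with
  | nil =>
    induction D generalizing v with
    | nil =>
      have h := hv.self_of_nhds
      rw [sym_zero_apply] at h
      exact h
    | cons e D ih =>
      refine ih (v := (OM.deriv e).comp v) ?_
      rw [← deriv_sym_right]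
      exact hderiv _ _ hv
  | cons ℓ L ih =>
    refine ih (v := v.comp (mulSnd N ℓ)) ?_
    have h := hderiv _ ((fun i => ℓ (Pi.single i 1), 0)) hv
    rw [deriv_sym_left, ← clm_eq_dotL] at h
    filter_upwards [h] with p hp
    rw [OM.smul_apply] at hp
    exact (mul_eq_zero.1 hp).resolve_left cI_ne_zero

end Character

/-! ### The partial Fourier transform of Schwartz functions. -/

section FourierSchwartz

variable {n : ℕ} {N : Type} [NormedAddCommGroup N] [NormedSpace ℝ N] [FiniteDimensional ℝ N]

lemma sym_ofSchwartz_apply (f : 𝓢(N × (Fin n → ℝ), ℂ)) (ξ : Fin n → ℝ) (x : N) :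
    sym (ofSchwartz f).op (ξ, x) = ∫ v, f (x, v) * expi (ξ ⬝ᵥ v) := rfl

/-- The partial Fourier transform exchanges, up to constants, multiplication by coordinates of `v`
with derivatives in `ξ`, and derivatives in `v` with multiplication by coordinates of `ξ`. So the
symbols of all Schwartz functions form a class to which the closure criterion applies. -/
lemma isSchwartz_sym_ofSchwartz (f : 𝓢(N × (Fin n → ℝ), ℂ)) : IsSchwartz (sym (ofSchwartz f).op) := by
  have hmul : ∀ (f : 𝓢(N × (Fin n → ℝ), ℂ)) (ℓ : N × (Fin n → ℝ) →L[ℝ] ℝ),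
      ∃ F : 𝓢(N × (Fin n → ℝ), ℂ), ∀ p, F p = (ℓ p : ℂ) * f p := fun f ℓ => by
    obtain ⟨F, hF⟩ := f.isSchwartz.temperate_mul (hasTemperateGrowth_ofReal_clm ℓ)
    exact ⟨F, fun p => congrFun hF p⟩
  have hderiv : ∀ (f : 𝓢(N × (Fin n → ℝ), ℂ)) (e : N) φ, OM.deriv e ((ofSchwartz f).op φ)
      = (ofSchwartz (LineDeriv.lineDerivOp (e, (0 : Fin n → ℝ)) f)).op φ
        + (ofSchwartz f).op (OM.deriv (e, 0) φ) := fun f e φ => deriv_schwartzLin f φ e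
  refine isSchwartz_of_closed (S := {h | ∃ f : 𝓢(N × (Fin n → ℝ), ℂ), h = sym (ofSchwartz f).op})
    ?_ ?_ ?_ _ ⟨f, rfl⟩
  · rintro _ ⟨f, rfl⟩
    obtain ⟨C, hC0, hC⟩ := f.isSchwartz.le_wt_snd
    refine ⟨∫ v : Fin n → ℝ, C * wt v, fun p => norm_integral_le_of_norm_le
      ((integrable_wt volume).const_mul C) (Filter.Eventually.of_forall fun v => ?_)⟩
    have : ‖f (p.2, v) * expi (p.1 ⬝ᵥ v)‖ = ‖f (p.2, v)‖ := by rw [norm_mul, norm_expi, mul_one]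
    exact this.le.trans (hC p.2 v)
  · rintro _ ⟨f, rfl⟩
    refine ⟨fderiv ℝ (sym (ofSchwartz f).op), fun p =>
      ((sym (ofSchwartz f).op).differentiable p).hasFDerivAt, ?_⟩
    rintro ⟨η, e⟩
    have h : (fun p => fderiv ℝ (sym (ofSchwartz f).op) p (η, e))
        = OM.deriv (η, 0) (sym (ofSchwartz f).op) + OM.deriv (0, e) (sym (ofSchwartz f).op) := by
      ext p
      rw [Pi.add_apply, OM.deriv_apply, OM.deriv_apply, ← map_add]
      simp
    rw [h]
    refine add_mem ?_ (Submodule.subset_span ⟨LineDeriv.lineDerivOp (e, (0 : Fin n → ℝ)) f, ?_⟩)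
    · obtain ⟨F, hF⟩ := hmul f ((dotL η).comp (ContinuousLinearMap.snd ℝ _ _))
      have h2 : ⇑(OM.deriv (η, 0) (sym (ofSchwartz f).op)) = cI • ⇑(sym (ofSchwartz F).op) := by
        ext ⟨ξ, x⟩
        rw [deriv_sym_left, OM.smul_apply, Pi.smul_apply, smul_eq_mul, sym_ofSchwartz_apply]
        congr 1
        refine integral_congr_ae (Filter.Eventually.of_forall fun v => ?_)
        change f (x, v) * ((dotL η v : ℝ) * expi (ξ ⬝ᵥ v)) = F (x, v) * expi (ξ ⬝ᵥ v)
        rw [hF]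
        simp only [ContinuousLinearMap.comp_apply, ContinuousLinearMap.coe_snd']
        ring
      rw [h2]
      exact Submodule.smul_mem _ _ (Submodule.subset_span ⟨F, rfl⟩)
    · ext ⟨ξ, x⟩
      rw [deriv_sym_right, sym_apply, ContinuousLinearMap.comp_apply, hderiv, deriv_slice_echar]
      have h0 : (cI * (ξ ⬝ᵥ (0 : Fin n → ℝ) : ℝ)) • OM.slice ξ (echar n N) = 0 := by simp
      rw [h0, map_zero, add_zero]
      rfl
  · rintro _ ⟨f, rfl⟩ ℓ
    have h : (fun p : (Fin n → ℝ) × N => (ℓ p : ℂ) * sym (ofSchwartz f).op p)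
        = (fun p => (ℓ (p.1, 0) : ℂ) * sym (ofSchwartz f).op p)
          + fun p => (ℓ (0, p.2) : ℂ) * sym (ofSchwartz f).op p := by
      ext p
      rw [Pi.add_apply, ← add_mul, ← Complex.ofReal_add, ← map_add]
      simp
    rw [h]
    refine add_mem ?_ (Submodule.subset_span ?_)
    · let w : Fin n → ℝ := fun i => ℓ (Pi.single i 1, 0)
      have h2 : (fun p : (Fin n → ℝ) × N => (ℓ (p.1, 0) : ℂ) * sym (ofSchwartz f).op p)
          = (-cI⁻¹) • ⇑(sym (ofSchwartz (LineDeriv.lineDerivOp ((0 : N), w) f)).op) := by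
        ext ⟨ξ, x⟩
        have hw : ℓ (ξ, 0) = ξ ⬝ᵥ w := by
          have := congrArg (fun ℓ => ℓ ξ) (clm_eq_dotL (ℓ.comp (ContinuousLinearMap.inl ℝ (Fin n → ℝ) N)))
          simp only [dotL_apply] at this
          rw [dotProduct_comm]
          exact this
        have h3 : ∀ g : 𝓢(N × (Fin n → ℝ), ℂ), Integrable fun v => g (x, v) * expi (ξ ⬝ᵥ v) :=
          fun g => integrable_schwartz_mul g (OM.slice ξ (echar n N)) x
        have hf' : ∀ v, fderiv ℝ (fun v => f (x, v)) v w = LineDeriv.lineDerivOp ((0 : N), w) f (x, v) := by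
          intro v
          have h4 : HasFDerivAt (fun v => f (x, v)) _ v :=
            (f.isSchwartz.differentiable (x, v)).hasFDerivAt.comp v (hasFDerivAt_prodMk_right x v)
          rw [h4.fderiv, SchwartzMap.lineDerivOp_apply_eq_fderiv]
          simp
        let E : OM (Fin n → ℝ) := OM.mk _ (hasTemperateGrowth_echar
          (Function.HasTemperateGrowth.const ξ) .id')
        have hE : ∀ v, fderiv ℝ E v w = cI * (ξ ⬝ᵥ w : ℝ) * expi (ξ ⬝ᵥ v) := by
          intro v
          refine OM.deriv_eq_of_hasDerivAt E v w ?_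
          have h5 := hasDerivAt_expi_line (ξ ⬝ᵥ v) (ξ ⬝ᵥ w)
          rw [mul_comm cI, mul_assoc]
          refine h5.congr_of_eventuallyEq (Filter.Eventually.of_forall fun t => ?_)
          simp [E]
        -- Integration by parts in the direction `w`, where `w` represents the `ξ`-part of `ℓ`.
        have h6 := integral_mul_fderiv_eq_neg_fderiv_mul_of_integrable (𝕜 := ℂ) (μ := volume)
          (f := fun v => f (x, v)) (g := E) (v := w) (by simp only [hf']; exact h3 _)
          (by
            simp only [hE]
            refine ((h3 f).const_mul (cI * (ξ ⬝ᵥ w : ℝ))).congr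
              (Filter.Eventually.of_forall fun v => ?_)
            simp only
            ring) (h3 f)
          (fun v _ => (f.isSchwartz.differentiable (x, v)).comp v
            (hasFDerivAt_prodMk_right x v).differentiableAt) (fun v _ => E.differentiable v)
        simp only [hf', hE] at h6
        rw [Pi.smul_apply, smul_eq_mul, sym_ofSchwartz_apply, sym_ofSchwartz_apply, neg_mul,
          ← mul_neg]
        have h7 : -∫ v, LineDeriv.lineDerivOp ((0 : N), w) f (x, v) * expi (ξ ⬝ᵥ v)
            = cI * ((ξ ⬝ᵥ w : ℝ) * ∫ v, f (x, v) * expi (ξ ⬝ᵥ v)) := by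
          refine h6.symm.trans ?_
          rw [← integral_const_mul, ← integral_const_mul]
          refine integral_congr_ae (Filter.Eventually.of_forall fun v => ?_)
          simp only
          ring
        rw [h7, inv_mul_cancel_left₀ cI_ne_zero, hw]
      rw [h2]
      exact Submodule.smul_mem _ _ (Submodule.subset_span ⟨_, rfl⟩)
    · obtain ⟨F, hF⟩ := hmul f ((ℓ.comp (ContinuousLinearMap.inr ℝ _ _)).comp
        (ContinuousLinearMap.fst ℝ _ _))
      refine ⟨F, ?_⟩
      ext ⟨ξ, x⟩
      rw [sym_ofSchwartz_apply, sym_ofSchwartz_apply, ← integral_const_mul]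
      refine integral_congr_ae (Filter.Eventually.of_forall fun v => ?_)
      simp only [hF, ContinuousLinearMap.comp_apply, ContinuousLinearMap.coe_fst',
        ContinuousLinearMap.inr_apply]
      ring

open FourierTransform in
/-- Fourier inversion on `ℝⁿ`. -/
lemma fourier_inversion {g : (Fin n → ℝ) → ℂ} (hg : IsSchwartz g) (η : Fin n → ℝ) :
    ∫ v : Fin n → ℝ, (∫ ξ : Fin n → ℝ, g ξ * expi (-(ξ ⬝ᵥ v))) * expi (η ⬝ᵥ v) = g η := by
  -- Fourier inversion is transported from Euclidean space; the identification with `Fin n → ℝ`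
  -- preserves volume and turns the inner product into the dot product.
  let e := EuclideanSpace.equiv (Fin n) ℝ
  have hmp := EuclideanSpace.volume_preserving_symm_measurableEquiv_toLp (Fin n)
  have hint : ∀ h : (Fin n → ℝ) → ℂ, ∫ w : EuclideanSpace ℝ (Fin n), h (e w) = ∫ v, h v := fun h =>
    hmp.integral_comp' (f := (MeasurableEquiv.toLp 2 (Fin n → ℝ)).symm) h
  obtain ⟨F, hF⟩ := hg.comp (h := e) e.toContinuousLinearMap.hasTemperateGrowth (g := e.symm)
    e.symm.toContinuousLinearMap.hasTemperateGrowth e.symm_apply_apply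
  have hF' : ∀ w, F w = g (e w) := fun w => congrFun hF w
  have hinner : ∀ v w : EuclideanSpace ℝ (Fin n), inner ℝ v w = e v ⬝ᵥ e w := by
    intro v w
    rw [PiLp.inner_apply]
    simp only [dotProduct, RCLike.inner_apply, conj_trivial, mul_comm]
    rfl
  have h1 : 𝓕 (𝓕⁻ F) = F := fourier_fourierInv_eq F
  have h2 := congrArg (fun f : 𝓢(EuclideanSpace ℝ (Fin n), ℂ) => f (e.symm η)) h1
  simp only [SchwartzMap.fourier_coe, SchwartzMap.fourierInv_coe] at h2
  rw [Real.fourier_eq'] at h2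
  simp only [Real.fourierInv_eq', hinner, hF', smul_eq_mul] at h2
  rw [e.apply_symm_apply] at h2
  rw [← h2]
  have h3 : ∀ v, ∫ w : EuclideanSpace ℝ (Fin n), Complex.exp (((2 * Real.pi * (e w ⬝ᵥ v) : ℝ) : ℂ)
      * Complex.I) * g (e w) = ∫ ξ : Fin n → ℝ, g ξ * expi (-(ξ ⬝ᵥ v)) := by
    intro v
    rw [hint fun ξ => Complex.exp (((2 * Real.pi * (ξ ⬝ᵥ v) : ℝ) : ℂ) * Complex.I) * g ξ]
    refine integral_congr_ae (Filter.Eventually.of_forall fun ξ => ?_)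
    simp only [expi, mul_neg, neg_mul, neg_neg]
    ring
  simp only [h3]
  rw [hint fun v => Complex.exp (((-2 * Real.pi * (v ⬝ᵥ η) : ℝ) : ℂ) * Complex.I)
    * ∫ ξ : Fin n → ℝ, g ξ * expi (-(ξ ⬝ᵥ v))]
  refine integral_congr_ae (Filter.Eventually.of_forall fun v => ?_)
  simp only [expi, dotProduct_comm v η]
  ring

/-- Every Schwartz function is the symbol of a Schwartz function. -/
lemma exists_sym_eq {a : (Fin n → ℝ) × N → ℂ} (ha : IsSchwartz a) :
    ∃ f : 𝓢(N × (Fin n → ℝ), ℂ), ⇑(sym (ofSchwartz f).op) = a := by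
  have hsw : IsSchwartz fun p : N × (Fin n → ℝ) => a (p.2, p.1) :=
    ha.comp (HasTemperateGrowth.prodMk hasTemperateGrowth_snd hasTemperateGrowth_fst)
      (g := fun p => (p.2, p.1))
      (HasTemperateGrowth.prodMk hasTemperateGrowth_snd hasTemperateGrowth_fst) fun _ => rfl
  obtain ⟨a', ha'⟩ := hsw
  have hc : Function.HasTemperateGrowth fun p : N × (Fin n → ℝ) => (-p.2, p.1) :=
    HasTemperateGrowth.prodMk hasTemperateGrowth_snd.neg hasTemperateGrowth_fst
  -- The inverse transform is the transform with the variable reflected, so it is Schwartz for the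
  -- same reason.
  obtain ⟨f, hf⟩ := (isSchwartz_sym_ofSchwartz a').comp hc (g := fun p => (p.2, -p.1))
    (HasTemperateGrowth.prodMk hasTemperateGrowth_snd hasTemperateGrowth_fst.neg) (by simp)
  refine ⟨f, ?_⟩
  ext ⟨η, x⟩
  have hx : IsSchwartz fun ξ => a (ξ, x) := by
    refine ha.comp (h := fun ξ => (ξ, x)) (HasTemperateGrowth.prodMk .id' (.const x))
      (g := Prod.fst) hasTemperateGrowth_fst fun _ => rfl
  rw [sym_ofSchwartz_apply, ← fourier_inversion hx η]
  refine integral_congr_ae (Filter.Eventually.of_forall fun v => ?_)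
  simp only
  rw [congrFun hf (x, v), sym_ofSchwartz_apply]
  simp only [congrFun ha' _, neg_dotProduct, dotProduct_comm v]

end FourierSchwartz

end Shubin

namespace Shubin

/-! ### Stability of flat operators. -/

section FlatOpClosure

variable {N G : Type} [NormedAddCommGroup N] [NormedSpace ℝ N] [FiniteDimensional ℝ N]
  [NormedAddCommGroup G] [NormedSpace ℝ G] [FiniteDimensional ℝ G]

lemma FlatOp.sub {v w : OM (N × G) →L[ℂ] OM N} (hv : FlatOp v) (hw : FlatOp w) :
    FlatOp (v - w) := fun D L => by
  have h : (v - w) (mono N L) = v (mono N L) - w (mono N L) := rfl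
  rw [h, map_sub, OM.sub_apply, hv, hw, sub_zero]

lemma FlatOp.const_smul {v : OM (N × G) →L[ℂ] OM N} (hv : FlatOp v) (c : ℂ) :
    FlatOp (c • v) := fun D L => by
  have h : (c • v) (mono N L) = c • v (mono N L) := rfl
  rw [h, map_smul, OM.smul_apply, hv, mul_zero]

lemma OM.deriv_pullback_clm {E E' : Type} [NormedAddCommGroup E] [NormedSpace ℝ E]
    [NormedAddCommGroup E'] [NormedSpace ℝ E'] [FiniteDimensional ℝ E'] (Λ : E →L[ℝ] E') (e : E)
    (φ : OM E') : OM.deriv e (OM.pullback Λ Λ.hasTemperateGrowth φ)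
      = OM.pullback Λ Λ.hasTemperateGrowth (OM.deriv (Λ e) φ) := by
  ext x
  have h : HasFDerivAt (fun x => φ (Λ x)) _ x :=
    (φ.differentiable (Λ x)).hasFDerivAt.comp x Λ.hasFDerivAt
  change fderiv ℝ (fun x => φ (Λ x)) x e = fderiv ℝ φ (Λ x) (Λ e)
  rw [h.fderiv]
  rfl

lemma OM.derivs_pullback_clm {E E' : Type} [NormedAddCommGroup E] [NormedSpace ℝ E]
    [NormedAddCommGroup E'] [NormedSpace ℝ E'] [FiniteDimensional ℝ E'] (Λ : E →L[ℝ] E')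
    (D : List E) (φ : OM E') : OM.derivs D (OM.pullback Λ Λ.hasTemperateGrowth φ)
      = OM.pullback Λ Λ.hasTemperateGrowth (OM.derivs (D.map Λ) φ) := by
  induction D generalizing φ with
  | nil => rfl
  | cons e D ih =>
    change OM.derivs D (OM.deriv e (OM.pullback Λ _ φ)) = _
    rw [OM.deriv_pullback_clm, ih]
    rfl

lemma pullback_mono (Λ : N →L[ℝ] N) (β : G →L[ℝ] G) (L : List (G →L[ℝ] ℝ)) :
    OM.pullback (Prod.map Λ β) (hasTemperateGrowth_prodMap Λ.hasTemperateGrowth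
      β.hasTemperateGrowth) (mono N L) = mono N (L.map fun ℓ => ℓ.comp β) := by
  induction L with
  | nil => rfl
  | cons ℓ L ih =>
    rw [List.map_cons, mono_cons, mono_cons, ← ih]
    rfl

/-- Linear rescalings turn monomials into monomials and fix the base point `0`. -/
lemma FlatOp.zoom {v : OM (N × G) →L[ℂ] OM N} (hv : FlatOp v) (Λ Λ' : N →L[ℝ] N) (β : G →L[ℝ] G) :
    FlatOp ((OM.pullback Λ' Λ'.hasTemperateGrowth).comp (v.comp (OM.pullback (Prod.map Λ β)
      (hasTemperateGrowth_prodMap Λ.hasTemperateGrowth β.hasTemperateGrowth)))) := fun D L => by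
  rw [ContinuousLinearMap.comp_apply, ContinuousLinearMap.comp_apply, pullback_mono,
    OM.derivs_pullback_clm, OM.pullback_apply, map_zero]
  exact hv _ _

end FlatOpClosure

/-! ### Dyadic decomposition of essentially homogeneous distributions. -/

section Decomposition

variable {n : ℕ} {N : Type} [NormedAddCommGroup N] [NormedSpace ℝ N] [FiniteDimensional ℝ N]

/-- Linear change of variables. The value of the Jacobian constant is irrelevant: it is absorbed
into a Schwartz function or appears on both sides of an identity. -/
lemma exists_integral_comp_eq {G : Type} [NormedAddCommGroup G] [NormedSpace ℝ G]
    [FiniteDimensional ℝ G] [MeasureSpace G] [BorelSpace G]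
    [(volume : Measure G).IsAddHaarMeasure] (L : G →L[ℝ] G) (L' : G →L[ℝ] G)
    (h : ∀ x, L (L' x) = x) : ∃ c : ℝ, ∀ g : G → ℂ, ∫ v, g v = c * ∫ v, g (L v) := by
  have hinj : Function.Injective L := by
    have : Function.Surjective (L : G →ₗ[ℝ] G) := fun x => ⟨L' x, h x⟩
    exact LinearMap.injective_iff_surjective.2 this
  let e : G ≃L[ℝ] G := ContinuousLinearEquiv.equivOfInverse L L' (fun x => hinj (h (L x))) h
  have hdet : (L : G →ₗ[ℝ] G).det ≠ 0 := (LinearEquiv.isUnit_det' e.toLinearEquiv).ne_zero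
  have h1 := Measure.map_linearMap_addHaar_eq_smul_addHaar (μ := (volume : Measure G)) hdet
  refine ⟨|(L : G →ₗ[ℝ] G).det|, fun g => ?_⟩
  have h2 : ∫ v, g (L v) = ∫ v, g v ∂(Measure.map L volume) :=
    (integral_map_equiv e.toHomeomorph.toMeasurableEquiv g).symm
  have h3 : Measure.map L (volume : Measure G)
      = ENNReal.ofReal |((L : G →ₗ[ℝ] G).det)⁻¹| • volume := h1
  rw [h2, h3, integral_smul_measure, ENNReal.toReal_ofReal (abs_nonneg _), abs_inv,
    Complex.real_smul, ← mul_assoc, ← Complex.ofReal_mul, mul_inv_cancel₀ (abs_ne_zero.2 hdet)]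
  simp

/-- The rescaling of a Schwartz distribution is a Schwartz distribution. -/
lemma push_mem_schwartzDist {G : Type} [NormedAddCommGroup G] [NormedSpace ℝ G]
    [FiniteDimensional ℝ G] [MeasureSpace G] [BorelSpace G]
    [(volume : Measure G).IsAddHaarMeasure] (Λ Λ' : N →L[ℝ] N) (β β' : G →L[ℝ] G)
    (hΛ : ∀ x, Λ (Λ' x) = x) (hβ : ∀ x, β' (β x) = x) {u : FibredDist N G}
    (hu : u ∈ schwartzDist N G) :
    FibredDist.push Λ Λ' β Λ.hasTemperateGrowth Λ'.hasTemperateGrowth β.hasTemperateGrowth hΛ u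
      ∈ schwartzDist N G := by
  obtain ⟨f, rfl⟩ := mem_schwartzDist_iff.1 hu
  have hβ' : ∀ x, β (β' x) = x := by
    have hinj : Function.Injective β' := by
      have : Function.Surjective (β' : G →ₗ[ℝ] G) := fun x => ⟨β x, hβ x⟩
      exact LinearMap.injective_iff_surjective.2 this
    exact fun x => hinj (hβ (β' x))
  obtain ⟨c, hc⟩ := exists_integral_comp_eq β' β hβ
  obtain ⟨F, hF⟩ := (f.isSchwartz.comp (h := Prod.map Λ' β') (hasTemperateGrowth_prodMap
    Λ'.hasTemperateGrowth β'.hasTemperateGrowth) (g := Prod.map Λ β) (hasTemperateGrowth_prodMap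
      Λ.hasTemperateGrowth β.hasTemperateGrowth) (by
        rintro ⟨x, v⟩
        simp [hΛ, hβ'])).const_smul c
  refine ⟨F, fun φ x => ?_⟩
  rw [FibredDist.push_apply, ofSchwartz_apply, hc, ← integral_const_mul]
  refine integral_congr_ae (Filter.Eventually.of_forall fun v => ?_)
  simp only [hF, Pi.smul_apply, smul_eq_mul, OM.pullback_apply, Prod.map_apply, hΛ, hβ']
  ring

lemma Dilations.inv_apply {E : Type} [NormedAddCommGroup E] [NormedSpace ℝ E] (δ : Dilations E)
    {s : ℝ} (hs : s ≠ 0) (x : E) : δ.δ s⁻¹ (δ.δ s x) = x := by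
  rw [← ContinuousLinearMap.comp_apply, ← δ.mul, inv_mul_cancel₀ hs, δ.one]
  rfl

variable (δ : Dilations N) (α : Dilations (Fin n → ℝ))

/-- Dyadic decomposition of a fibred distribution which is essentially homogeneous under
dilation by `2`. -/
lemma exists_decomposition (m : ℝ) {P : FibredDist N (Fin n → ℝ)} {h : 𝓢(N × (Fin n → ℝ), ℂ)}
    (hP : ∀ φ x, P φ x - ((2 : ℝ) ^ m : ℝ) * P (OM.pullback
      (Prod.map (δ.δ 2) (α.δ (1 / 2))) (hasTemperateGrowth_prodMap
        (ContinuousLinearMap.hasTemperateGrowth _) (ContinuousLinearMap.hasTemperateGrowth _)) φ)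
        (δ.δ (1 / 2) x) = ofSchwartz h φ x) :
    ∃ (S F : 𝓢(N × (Fin n → ℝ), ℂ)) (hF : FlatOp (ofSchwartz F).op),
      P = ofSchwartz S + flatDist δ α m (ofSchwartz F).op hF := by
  obtain ⟨χ, hχ, hχ1⟩ := exists_schwartz_eq_one ((0 : Fin n → ℝ), (0 : N))
  -- The symbol of `S` agrees with that of `P` near the origin. Subtracting `S` therefore removes
  -- the obstruction to flatness and keeps essential homogeneity, as rescalings of Schwartz
  -- functions are Schwartz.
  obtain ⟨S, hS⟩ := exists_sym_eq (χ.isSchwartz.mul_OM (sym P.op))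
  have hflat : FlatOp (P - ofSchwartz S).op := by
    refine flatOp_of_sym ?_
    filter_upwards [hχ1] with p hp
    have h1 : sym (P - ofSchwartz S).op p = sym P.op p - sym (ofSchwartz S).op p := rfl
    rw [h1, hS]
    simp only [hp, one_mul, sub_self]
  have h2 : ∀ x, δ.δ 2 (δ.δ (1 / 2) x) = x := fun x => by
    have := δ.inv_apply (s := 1 / 2) (by norm_num) x
    rwa [one_div, inv_inv, ← one_div] at this
  have h3 : ∀ x, α.δ 2 (α.δ (1 / 2) x) = x := fun x => by
    have := α.inv_apply (s := 1 / 2) (by norm_num) x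
    rwa [one_div, inv_inv, ← one_div] at this
  let T : FibredDist N (Fin n → ℝ) →ₗ[ℂ] FibredDist N (Fin n → ℝ) :=
    FibredDist.push (δ.δ 2) (δ.δ (1 / 2)) (α.δ (1 / 2)) (ContinuousLinearMap.hasTemperateGrowth _)
      (ContinuousLinearMap.hasTemperateGrowth _) (ContinuousLinearMap.hasTemperateGrowth _) h2
  have hTS : T (ofSchwartz S) ∈ schwartzDist N (Fin n → ℝ) :=
    push_mem_schwartzDist _ _ _ (α.δ 2) h2 h3 (ofSchwartz_mem S)
  have hw : (P - ofSchwartz S) - (((2 : ℝ) ^ m : ℝ) : ℂ) • T (P - ofSchwartz S)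
      ∈ schwartzDist N (Fin n → ℝ) := by
    have h4 : P - (((2 : ℝ) ^ m : ℝ) : ℂ) • T P = ofSchwartz h := FibredDist.ext hP
    have h5 : (P - ofSchwartz S) - (((2 : ℝ) ^ m : ℝ) : ℂ) • T (P - ofSchwartz S)
        = (P - (((2 : ℝ) ^ m : ℝ) : ℂ) • T P) - (ofSchwartz S
          - (((2 : ℝ) ^ m : ℝ) : ℂ) • T (ofSchwartz S)) := by
      rw [map_sub, smul_sub]
      abel
    rw [h5, h4]
    exact sub_mem (ofSchwartz_mem h) (sub_mem (ofSchwartz_mem S) (Submodule.smul_mem _ _ hTS))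
  obtain ⟨F, hF⟩ := mem_schwartzDist_iff.1 hw
  have hFflat : FlatOp (ofSchwartz F).op := by
    rw [← hF]
    exact hflat.sub ((hflat.zoom _ _ _).const_smul _)
  refine ⟨S, F, hFflat, ?_⟩
  rw [← sub_eq_iff_eq_add']
  refine FibredDist.ext fun φ a => ?_
  -- Telescoping recovers `P - S` from its Schwartz defect `F`. Flatness of `P - S` is what makes
  -- the telescoping remainder tend to zero.
  have h6 := hasSum_dyadic_fam δ α m hflat (w := (ofSchwartz F).op) (fun φ x => by
    rw [← hF]
    rfl) id .id φ a
  rw [(hasSum_flatDist δ α m _ hFflat φ a).unique h6]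
  exact FibredDist.apply_congr _ fun v => rfl

/-- The version with parameters: it presents `a ↦ U(φ(a, ·))(π a)`, with `U` a dyadic series, as the
dyadic sum of one flat function on `ℝ × A`, which can then be integrated over `A`. -/
lemma hasSum_flatDist_slice {A : Type} [NormedAddCommGroup A] [NormedSpace ℝ A]
    [FiniteDimensional ℝ A] (m : ℝ) (v : OM (N × (Fin n → ℝ)) →L[ℂ] OM N) (hv : FlatOp v)
    (π : A → N) (hπ : π.HasTemperateGrowth) (φ : OM (A × (Fin n → ℝ))) (a : A) :
    HasSum (dyadic m (fam δ α v π hπ φ) a) (flatDist δ α m v hv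
      (OM.pullback Prod.snd hasTemperateGrowth_snd (OM.slice a φ)) (π a)) :=
  hasSum_flatDist δ α m v hv (OM.pullback Prod.snd hasTemperateGrowth_snd (OM.slice a φ)) (π a)

lemma fam_ofSchwartz_apply {A : Type} [NormedAddCommGroup A] [NormedSpace ℝ A]
    [FiniteDimensional ℝ A] (F : 𝓢(N × (Fin n → ℝ), ℂ))
    (π : A → N) (hπ : π.HasTemperateGrowth) (φ : OM (A × (Fin n → ℝ))) (ε : ℝ) (a : A) :
    fam δ α (ofSchwartz F).op π hπ φ (ε, a) = ∫ v, F (δ.δ ε (π a), v) * φ (a, α.δ ε v) := rfl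

end Decomposition

/-! ### From `t = 1` to `t = 0`: symbols vanishing at `t = 1`. -/

section SchwartzCriterion

variable {Z : Type} [NormedAddCommGroup Z] [NormedSpace ℝ Z] [FiniteDimensional ℝ Z]

/-- The relation `a(z, t) = 2^{-μ} (a(Γ z, 2 t) + s(z, t))` leads in `k` steps from `t = 2^{-k}` to
`t = 1`, where `a` vanishes. The factor `2^{-μ}` may be large, but `Γ` at least doubles norms. With
the weight `‖z‖ ^ M`, `M` large, each step becomes a contraction, and the bounds are uniform in `k`.
Then `k → ∞`. -/
lemma isBounded_of_zoom {Γ : Z →L[ℝ] Z} (hΓ : ∀ z, 2 * ‖z‖ ≤ ‖Γ z‖) {μ : ℝ} {a : OM (Z × ℝ)}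
    (hs : IsSchwartz fun p : Z × ℝ => (((2 : ℝ) ^ μ : ℝ) : ℂ) * a p - a (Γ p.1, 2 * p.2))
    (h1 : ∀ z, a (z, 1) = 0) : ∃ C, ∀ z, ‖a (z, 0)‖ ≤ C := by
  set s := fun p : Z × ℝ => (((2 : ℝ) ^ μ : ℝ) : ℂ) * a p - a (Γ p.1, 2 * p.2)
  let c : ℝ := ((2 : ℝ) ^ μ)⁻¹
  have hc : 0 < c := by positivity
  -- With this choice of `M` the weighted bound passes from `r` to at most `r / 2 + c * B` in one
  -- step, and `2 * c * B` is the fixed point of this recursion.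
  obtain ⟨M, hM⟩ := exists_pow_lt_of_lt_one (x := (2 * c)⁻¹) (by positivity)
    (show (1 / 2 : ℝ) < 1 by norm_num)
  have hM' : c * (1 / 2) ^ M ≤ 1 / 2 := by
    calc _ ≤ c * (2 * c)⁻¹ := by gcongr
      _ = 1 / 2 := by field_simp
  obtain ⟨B, hB0, hB⟩ := hs.decay M
  have hB' : ∀ z t, ‖z‖ ^ M * ‖s (z, t)‖ ≤ B := fun z t => by
    refine le_trans ?_ (hB (z, t))
    gcongr
    have : ‖z‖ ≤ ‖(z, t)‖ := norm_fst_le (z, t)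
    linarith
  have ha : ∀ z t, a (z, t) = c * (a (Γ z, 2 * t) + s (z, t)) := fun z t => by
    have h2 : (c : ℂ) * (((2 : ℝ) ^ μ : ℝ) : ℂ) = 1 := by
      rw [← Complex.ofReal_mul, inv_mul_cancel₀ (by positivity), Complex.ofReal_one]
    simp only [s, add_sub_cancel, ← mul_assoc, h2, one_mul]
  have hk : ∀ (k : ℕ) z, ‖z‖ ^ M * ‖a (z, (1 / 2) ^ k)‖ ≤ 2 * c * B := by
    intro k
    induction k with
    | zero => intro z; simp only [pow_zero, h1, norm_zero, mul_zero]; positivity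
    | succ k ih =>
      intro z
      have h2 : (2 : ℝ) * (1 / 2) ^ (k + 1) = (1 / 2) ^ k := by rw [pow_succ]; ring
      rw [ha, h2, norm_mul, Complex.norm_real, Real.norm_of_nonneg hc.le]
      have h3 : ‖z‖ ^ M ≤ (1 / 2) ^ M * ‖Γ z‖ ^ M := by
        rw [← mul_pow]
        gcongr
        linarith [hΓ z]
      calc ‖z‖ ^ M * (c * ‖a (Γ z, (1 / 2) ^ k) + s (z, (1 / 2) ^ (k + 1))‖)
          ≤ ‖z‖ ^ M * (c * (‖a (Γ z, (1 / 2) ^ k)‖ + ‖s (z, (1 / 2) ^ (k + 1))‖)) := by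
            gcongr
            exact norm_add_le _ _
        _ = c * (‖z‖ ^ M * ‖a (Γ z, (1 / 2) ^ k)‖ + ‖z‖ ^ M * ‖s (z, (1 / 2) ^ (k + 1))‖) := by ring
        _ ≤ c * ((1 / 2) ^ M * ‖Γ z‖ ^ M * ‖a (Γ z, (1 / 2) ^ k)‖ + B) := by
            gcongr
            exact hB' _ _
        _ = c * (1 / 2) ^ M * (‖Γ z‖ ^ M * ‖a (Γ z, (1 / 2) ^ k)‖) + c * B := by ring
        _ ≤ 1 / 2 * (2 * c * B) + c * B := by
            have := mul_le_mul hM' (ih (Γ z)) (by positivity) (by norm_num)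
            linarith
        _ = 2 * c * B := by ring
  have hlim : ∀ z, ‖z‖ ^ M * ‖a (z, 0)‖ ≤ 2 * c * B := by
    intro z
    have h2 : Filter.Tendsto (fun k : ℕ => (1 / 2 : ℝ) ^ k) Filter.atTop (𝓝 0) :=
      tendsto_pow_atTop_nhds_zero_of_lt_one (by norm_num) (by norm_num)
    have h3 : Continuous fun t : ℝ => ‖z‖ ^ M * ‖a (z, t)‖ :=
      continuous_const.mul (a.continuous.comp (Continuous.prodMk_right z)).norm
    exact le_of_tendsto' ((h3.tendsto 0).comp h2) fun k => hk k z
  -- The weight `‖z‖ ^ M` gives nothing near `z = 0`; there compactness is used.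
  obtain ⟨C, hC⟩ := (isCompact_closedBall (0 : Z) 1).exists_bound_of_continuousOn
    (f := fun z => a (z, 0)) (a.continuous.comp (Continuous.prodMk_left (0 : ℝ))).continuousOn
  refine ⟨max C (2 * c * B), fun z => ?_⟩
  by_cases hz : ‖z‖ ≤ 1
  · exact (hC z (mem_closedBall_zero_iff.2 hz)).trans (le_max_left _ _)
  · refine le_trans ?_ ((hlim z).trans (le_max_right _ _))
    exact le_mul_of_one_le_left (norm_nonneg _) (one_le_pow₀ (not_le.1 hz).le)

/-- The exponent `μ` is allowed to vary: a derivative along the eigenvector `b i` lowers it by `w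
i`, multiplication by the `i`-th coordinate raises it by `w i`. Vanishing at `t = 1` persists in
both cases, so `isBounded_of_zoom` is the only estimate required. -/
lemma isSchwartz_of_zoom {ι : Type} [Fintype ι] (b : Module.Basis ι ℝ Z) (w : ι → ℕ) {Γ : Z →L[ℝ] Z}
    (hb : ∀ i, Γ (b i) = (2 : ℝ) ^ w i • b i) (hΓ : ∀ z, 2 * ‖z‖ ≤ ‖Γ z‖) {μ : ℝ} {a : OM (Z × ℝ)}
    (hs : IsSchwartz fun p : Z × ℝ => (((2 : ℝ) ^ μ : ℝ) : ℂ) * a p - a (Γ p.1, 2 * p.2))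
    (h1 : ∀ z, a (z, 1) = 0) : IsSchwartz fun z => a (z, 0) := by
  refine isSchwartz_of_closed (S := {f | ∃ (a : OM (Z × ℝ)) (μ : ℝ), (IsSchwartz fun p : Z × ℝ =>
    (((2 : ℝ) ^ μ : ℝ) : ℂ) * a p - a (Γ p.1, 2 * p.2)) ∧ (∀ z, a (z, 1) = 0) ∧
      f = fun z => a (z, 0)}) ?_ ?_ ?_ _ ⟨a, μ, hs, h1, rfl⟩
  · rintro _ ⟨a, μ, hs, h1, rfl⟩
    exact isBounded_of_zoom hΓ hs h1
  · rintro _ ⟨a, μ, hs, h1, rfl⟩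
    have hd : ∀ t z, HasFDerivAt (fun z => a (z, t))
        ((fderiv ℝ a (z, t)).comp (ContinuousLinearMap.inl ℝ Z ℝ)) z := fun t z =>
      (a.differentiable (z, t)).hasFDerivAt.comp z (hasFDerivAt_prodMk_left z t)
    refine ⟨_, hd 0, fun e => ?_⟩
    have hmem : ∀ i, (fun z => OM.deriv (b i, (0 : ℝ)) a (z, 0)) ∈ Submodule.span ℂ
        {f | ∃ (a : OM (Z × ℝ)) (μ : ℝ), (IsSchwartz fun p : Z × ℝ =>
          (((2 : ℝ) ^ μ : ℝ) : ℂ) * a p - a (Γ p.1, 2 * p.2)) ∧ (∀ z, a (z, 1) = 0) ∧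
          f = fun z => a (z, 0)} := by
      intro i
      refine Submodule.subset_span ⟨OM.deriv (b i, 0) a, μ - w i, ?_, fun z => ?_, rfl⟩
      · let Λ : Z × ℝ →L[ℝ] Z × ℝ := Γ.prodMap ((2 : ℝ) • ContinuousLinearMap.id ℝ ℝ)
        have h2 := (hs.fderiv_apply (b i, 0)).const_smul (((2 : ℝ) ^ w i : ℝ) : ℂ)⁻¹
        convert h2 using 1
        ext p
        have h3 : HasFDerivAt (fun p : Z × ℝ => a (Γ p.1, 2 * p.2)) _ p :=
          (a.differentiable (Λ p)).hasFDerivAt.comp p Λ.hasFDerivAt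
        have h4 : HasFDerivAt (fun p : Z × ℝ => (((2 : ℝ) ^ μ : ℝ) : ℂ) * a p - a (Γ p.1, 2 * p.2)) _ p :=
          ((a.differentiable p).hasFDerivAt.const_mul (((2 : ℝ) ^ μ : ℝ) : ℂ)).sub h3
        have h5 : Λ (b i, 0) = (2 : ℝ) ^ w i • (b i, 0) := by
          simp [Λ, hb]
        have h6 : ((2 : ℝ) ^ (μ - w i) : ℝ) = ((2 : ℝ) ^ w i)⁻¹ * (2 : ℝ) ^ μ := by
          rw [Real.rpow_sub (by norm_num), Real.rpow_natCast]
          field_simp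
        have h7 : Λ p = (Γ p.1, 2 * p.2) := rfl
        have h8 : (((2 : ℝ) ^ w i : ℝ) : ℂ) ≠ 0 := Complex.ofReal_ne_zero.2 (by positivity)
        rw [Pi.smul_apply, h4.fderiv]
        simp only [_root_.sub_apply, _root_.smul_apply, ContinuousLinearMap.comp_apply, h5,
          map_smul, h7, h6, OM.deriv_apply, smul_eq_mul, Complex.real_smul, Complex.ofReal_mul,
          Complex.ofReal_inv]
        field_simp
      · rw [OM.deriv_apply]
        have h2 : HasFDerivAt (𝕜 := ℝ) (fun _ : Z => (0 : ℂ))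
            ((fderiv ℝ a (z, 1)).comp (ContinuousLinearMap.inl ℝ Z ℝ)) z := by
          refine (hd 1 z).congr_of_eventuallyEq (Filter.Eventually.of_forall fun z => (h1 z).symm)
        exact congrArg (fun L : Z →L[ℝ] ℂ => L (b i)) (h2.unique (hasFDerivAt_const (0 : ℂ) z))
    have he : (fun z => ((fderiv ℝ a (z, 0)).comp (ContinuousLinearMap.inl ℝ Z ℝ)) e)
        = ∑ i, ((b.repr e i : ℝ) : ℂ) • fun z => OM.deriv (b i, (0 : ℝ)) a (z, 0) := by
      ext z
      conv_lhs => rw [← b.sum_repr e, map_sum]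
      rw [Finset.sum_apply]
      refine Finset.sum_congr rfl fun i _ => ?_
      rw [map_smul]
      simp [OM.deriv_apply]
    rw [he]
    exact sum_mem fun i _ => Submodule.smul_mem _ _ (hmem i)
  · rintro _ ⟨a, μ, hs, h1, rfl⟩ ℓ
    have hcoord : ∀ i z, b.repr (Γ z) i = (2 : ℝ) ^ w i * b.repr z i := by
      intro i z
      conv_lhs => rw [← b.sum_repr z, map_sum]
      simp only [map_smul, hb, map_sum, Finsupp.coe_finsetSum, Finset.sum_apply, Finsupp.smul_apply,
        Module.Basis.repr_self, smul_eq_mul]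
      rw [Finset.sum_eq_single i]
      · simp [mul_comm]
      · intro j _ hj
        simp [hj]
      · simp
    have hmem : ∀ i, (fun z => ((b.repr z i : ℝ) : ℂ) * a (z, 0)) ∈ Submodule.span ℂ
        {f | ∃ (a : OM (Z × ℝ)) (μ : ℝ), (IsSchwartz fun p : Z × ℝ =>
          (((2 : ℝ) ^ μ : ℝ) : ℂ) * a p - a (Γ p.1, 2 * p.2)) ∧ (∀ z, a (z, 1) = 0) ∧
          f = fun z => a (z, 0)} := by
      intro i
      let ℓi : Z × ℝ →L[ℝ] ℝ :=
        (LinearMap.toContinuousLinearMap (b.coord i)).comp (ContinuousLinearMap.fst ℝ Z ℝ)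
      have hℓi : ∀ p, ℓi p = b.repr p.1 i := fun p => rfl
      refine Submodule.subset_span ⟨OM.ofClm ℓi * a, μ + w i, ?_, fun z => ?_, rfl⟩
      · have h2 := (hs.temperate_mul (hasTemperateGrowth_ofReal_clm ℓi)).const_smul
          (((2 : ℝ) ^ w i : ℝ) : ℂ)
        convert h2 using 1
        ext p
        have h6 : ((2 : ℝ) ^ (μ + w i) : ℝ) = (2 : ℝ) ^ w i * (2 : ℝ) ^ μ := by
          rw [Real.rpow_add (by norm_num), Real.rpow_natCast, mul_comm]
        simp only [OM.mul_apply, OM.ofClm_apply, hℓi, hcoord, h6, Pi.smul_apply, smul_eq_mul,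
          Complex.ofReal_mul]
        ring
      · rw [OM.mul_apply, h1, mul_zero]
    have he : (fun z => (ℓ z : ℂ) * a (z, 0))
        = ∑ i, ((ℓ (b i) : ℝ) : ℂ) • fun z => ((b.repr z i : ℝ) : ℂ) * a (z, 0) := by
      ext z
      conv_lhs => rw [← b.sum_repr z, map_sum]
      rw [Finset.sum_apply, Complex.ofReal_sum, Finset.sum_mul, b.sum_repr z]
      refine Finset.sum_congr rfl fun i _ => ?_
      rw [map_smul, Pi.smul_apply, smul_eq_mul, smul_eq_mul, Complex.ofReal_mul]
      ring
    rw [he]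
    exact sum_mem fun i _ => Submodule.smul_mem _ _ (hmem i)

end SchwartzCriterion

end Shubin

namespace Shubin

/-! ### Dyadic series with Schwartz symbol are Schwartz. -/

section SymbolCriterion

variable {n : ℕ} {N : Type} [NormedAddCommGroup N] [NormedSpace ℝ N] [FiniteDimensional ℝ N]

lemma IsSchwartz.exists_le_wt {V : Type} [NormedAddCommGroup V] [NormedSpace ℝ V]
    [FiniteDimensional ℝ V] {f : V → ℂ} (hf : IsSchwartz f) (k : ℕ) :
    ∃ C, 0 ≤ C ∧ ∀ v, (1 + ‖v‖) ^ k * ‖f v‖ ≤ C * wt v := by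
  obtain ⟨C, hC0, hC⟩ := hf.decay (wexp V + k)
  refine ⟨C, hC0, fun v => le_wt ?_⟩
  rw [← mul_assoc, ← pow_add]
  exact hC v

/-- Dyadic sums of flat functions may be integrated termwise against Schwartz functions. -/
lemma hasSum_integral_dyadic {V : Type} [NormedAddCommGroup V] [NormedSpace ℝ V]
    [FiniteDimensional ℝ V] [MeasureSpace V] [BorelSpace V] [(volume : Measure V).IsAddHaarMeasure]
    (m : ℝ) {Θ : OM (ℝ × V)} (hΘ : Θ ∈ OM.flat V) {g : V → ℂ} (hg : IsSchwartz g) :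
    HasSum (fun j => ∫ v, g v * dyadic m Θ v j) (∫ v, g v * flatSum m ⟨Θ, hΘ⟩ v) := by
  obtain ⟨k, C, hC0, hC⟩ := OM.exists_dyadic_le m hΘ
  obtain ⟨B, hB0, hB⟩ := hg.exists_le_wt k
  have hs : ∀ v : V, HasSum (fun j : ℕ => C * B * wt v * (1 / 2 : ℝ) ^ j) (C * B * wt v * 2) :=
    fun v => hasSum_geometric_two.mul_left _
  refine hasSum_integral_of_dominated_convergence (bound := fun j v => C * B * wt v * (1 / 2 : ℝ) ^ j)
    (fun j => ?_) (fun j => Filter.Eventually.of_forall fun v => ?_)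
    (Filter.Eventually.of_forall fun v => (hs v).summable) ?_
    (Filter.Eventually.of_forall fun v => (hasSum_flatSum m ⟨Θ, hΘ⟩ v).mul_left (g v))
  · refine Continuous.aestronglyMeasurable (hg.continuous.mul (continuous_const.mul ?_))
    exact Θ.continuous.comp (Continuous.prodMk_right _)
  · rw [norm_mul]
    calc _ ≤ ‖g v‖ * (C * (1 + ‖v‖) ^ k * (1 / 2 : ℝ) ^ j) := by
          gcongr
          exact hC v j
      _ = C * ((1 + ‖v‖) ^ k * ‖g v‖) * (1 / 2 : ℝ) ^ j := by ring
      _ ≤ C * (B * wt v) * (1 / 2 : ℝ) ^ j :=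
          mul_le_mul_of_nonneg_right (mul_le_mul_of_nonneg_left (hB v) hC0) (by positivity)
      _ = _ := by ring
  · simp only [fun v => (hs v).tsum_eq]
    exact ((integrable_wt volume).const_mul (C * B)).mul_const 2

lemma exists_fourier_eq {g : (Fin n → ℝ) → ℂ} (hg : IsSchwartz g) :
    ∃ g' : 𝓢(Fin n → ℝ, ℂ), ∀ v, g v = ∫ ξ, g' ξ * expi (ξ ⬝ᵥ v) := by
  -- A zero-dimensional base turns the partial Fourier transform into the full one.
  obtain ⟨f, hf⟩ := hg.comp (h := fun p : (Fin 0 → ℝ) × (Fin n → ℝ) => p.2) hasTemperateGrowth_snd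
    (g := fun v => (0, v)) (HasTemperateGrowth.prodMk (.const 0) .id')
    (fun p => Prod.ext (Subsingleton.elim _ _) rfl)
  obtain ⟨g', hg'⟩ := (isSchwartz_sym_ofSchwartz f).comp (h := fun ξ => (-ξ, (0 : Fin 0 → ℝ)))
    (HasTemperateGrowth.prodMk Function.HasTemperateGrowth.id'.neg (.const 0)) (g := fun p => -p.1)
    hasTemperateGrowth_fst.neg (by simp)
  refine ⟨g', fun v => ?_⟩
  rw [← fourier_inversion hg v]
  refine integral_congr_ae (Filter.Eventually.of_forall fun ξ => ?_)
  simp only [hg', sym_ofSchwartz_apply, hf, neg_dotProduct]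
  rw [dotProduct_comm v]
  congr 1
  refine integral_congr_ae (Filter.Eventually.of_forall fun w => ?_)
  simp only [dotProduct_comm w]

lemma integral_fourier_swap {f g : (Fin n → ℝ) → ℂ} (hf : Integrable f) (hg : Integrable g)
    {β : (Fin n → ℝ) → Fin n → ℝ} (hβ : Continuous β) :
    ∫ v, f v * ∫ ξ, g ξ * expi (ξ ⬝ᵥ β v) = ∫ ξ, g ξ * ∫ v, f v * expi (ξ ⬝ᵥ β v) := by
  have hc : Continuous fun p : (Fin n → ℝ) × (Fin n → ℝ) => expi (p.2 ⬝ᵥ β p.1) :=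
    hasTemperateGrowth_expi.1.continuous.comp (hasTemperateGrowth_dot.1.continuous.comp
      (continuous_snd.prodMk (hβ.comp continuous_fst)))
  have hi : Integrable (Function.uncurry fun v ξ => f v * (g ξ * expi (ξ ⬝ᵥ β v)))
      (volume.prod volume) := by
    have h := (hf.mul_prod hg).bdd_mul hc.aestronglyMeasurable (c := 1)
      (Filter.Eventually.of_forall fun p => (norm_expi _).le)
    refine h.congr (Filter.Eventually.of_forall fun p => ?_)
    simp only [Function.uncurry]
    ring
  simp only [← integral_const_mul]
  rw [integral_integral_swap hi]
  refine integral_congr_ae (Filter.Eventually.of_forall fun ξ =>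
    integral_congr_ae (Filter.Eventually.of_forall fun v => ?_))
  simp only
  ring

variable (δ : Dilations N) (α : Dilations (Fin n → ℝ))

/-- Let `f` be the Schwartz function with the same symbol as the series `U`. A test function `ψ` of
compact support is a Fourier integral of characters, and `U` may be applied under this integral: as
a family in `ξ`, the terms of the series come from a flat function, so sum and `ξ`-integral commute.
Hence `U` and `f` agree on `ψ`, and by locality everywhere. -/
lemma flatDist_mem_schwartzDist (m : ℝ) {F : 𝓢(N × (Fin n → ℝ), ℂ)}
    (hF : FlatOp (ofSchwartz F).op)
    (h : IsSchwartz (sym (flatDist δ α m (ofSchwartz F).op hF).op)) :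
    flatDist δ α m (ofSchwartz F).op hF ∈ schwartzDist N (Fin n → ℝ) := by
  obtain ⟨f, hf⟩ := exists_sym_eq h
  set U := flatDist δ α m (ofSchwartz F).op hF
  suffices hU : U = ofSchwartz f by rw [hU]; exact ofSchwartz_mem f
  refine FibredDist.ext_compact fun ψ hψ x => ?_
  obtain ⟨g, hg⟩ := exists_fourier_eq (IsSchwartz.of_hasCompactSupport hψ ψ.contDiff)
  have hgi : Integrable (g : (Fin n → ℝ) → ℂ) := g.isSchwartz.integrable volume
  have hconst : Function.HasTemperateGrowth fun _ : Fin n → ℝ => x := .const x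
  let E : OM ((Fin n → ℝ) × (Fin n → ℝ)) := OM.mk _
    (hasTemperateGrowth_echar hasTemperateGrowth_fst hasTemperateGrowth_snd)
  let Θ := fam δ α (ofSchwartz F).op (fun _ => x) hconst E
  have hΘ : Θ ∈ OM.flat (Fin n → ℝ) := fam_mem_flat δ α hF _ hconst E
  -- Here `ξ` plays the role of the parameter, while the base point `x` is constant.
  have h1 : ∀ ξ, flatSum m ⟨Θ, hΘ⟩ ξ = sym U.op (ξ, x) := fun ξ =>
    (hasSum_flatSum m ⟨Θ, hΘ⟩ ξ).unique (hasSum_flatDist_slice δ α m _ hF (fun _ => x) hconst E ξ)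
  have h2 := hasSum_integral_dyadic m hΘ g.isSchwartz
  have h3 := hasSum_flatDist δ α m _ hF (OM.pullback Prod.snd hasTemperateGrowth_snd ψ) x
  have h4 : ∀ j, dyadic m (fam δ α (ofSchwartz F).op id .id
      (OM.pullback Prod.snd hasTemperateGrowth_snd ψ)) x j = ∫ ξ, g ξ * dyadic m Θ ξ j := by
    intro j
    have h5 : ∀ ε, ∫ v, F (δ.δ ε x, v) * ψ (α.δ ε v)
        = ∫ ξ, g ξ * ∫ v, F (δ.δ ε x, v) * expi (ξ ⬝ᵥ α.δ ε v) := by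
      intro ε
      simp only [hg]
      exact integral_fourier_swap (F.isSchwartz.integrable_snd _) hgi (α.δ ε).continuous
    have h6 : ∀ ξ ε, Θ (ε, ξ) = ∫ v, F (δ.δ ε x, v) * expi (ξ ⬝ᵥ α.δ ε v) := fun ξ ε => rfl
    simp only [dyadic, fam_ofSchwartz_apply, OM.pullback_apply, id, h5, h6, mul_left_comm (g _)]
    rw [integral_const_mul]
  rw [funext h4] at h3
  rw [h3.unique h2, ofSchwartz_apply]
  simp only [h1, ← hf, sym_ofSchwartz_apply, OM.pullback_apply, hg]
  exact (integral_fourier_swap (β := id) (f.isSchwartz.integrable_snd x) hgi continuous_id).symm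

end SymbolCriterion

/-! ### The weighted dilations, and well-definedness of the cosymbol. -/

section Concrete

/-- Dilations with positive integer weights. -/
noncomputable def Dilations.ofWeight {n : ℕ} (q : Fin n → ℕ) (hq : ∀ i, 0 < q i) :
    Dilations (Fin n → ℝ) where
  δ := dilation q
  temperate := by
    have h : dilation q = fun s => ∑ i, s ^ q i • (ContinuousLinearMap.single ℝ (fun _ : Fin n => ℝ) i).comp
        (ContinuousLinearMap.proj (R := ℝ) (φ := fun _ : Fin n => ℝ) i) := by
      ext s v j
      simp [_root_.sum_apply, Pi.single_apply]
    rw [h]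
    refine Function.HasTemperateGrowth.sum (s := Finset.univ) fun i _ => ?_
    exact (Function.HasTemperateGrowth.pow .id' (q i)).smul (.const _)
  zero := by
    ext v i
    simp [(hq i).ne']
  one := by
    ext v i
    simp
  mul s t := by
    ext v i
    simp [mul_pow, mul_assoc]

/-- Dilations of a product with a line of weight one. -/
noncomputable def Dilations.prodLine {X : Type} [NormedAddCommGroup X] [NormedSpace ℝ X]
    (δ : Dilations X) : Dilations (X × ℝ) where
  δ s := (δ.δ s).prodMap (s • ContinuousLinearMap.id ℝ ℝ)
  temperate := by
    have h : (fun s => (δ.δ s).prodMap (s • ContinuousLinearMap.id ℝ ℝ)) = fun s =>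
        (ContinuousLinearMap.compL ℝ (X × ℝ) X (X × ℝ) (ContinuousLinearMap.inl ℝ X ℝ))
          ((ContinuousLinearMap.compL ℝ (X × ℝ) X X).flip (ContinuousLinearMap.fst ℝ X ℝ) (δ.δ s))
        + s • (ContinuousLinearMap.inr ℝ X ℝ).comp (ContinuousLinearMap.snd ℝ X ℝ) := by
      funext s
      ext p <;> simp
    rw [h]
    exact ((ContinuousLinearMap.hasTemperateGrowth _).comp
      ((ContinuousLinearMap.hasTemperateGrowth _).comp δ.temperate)).add
        (Function.HasTemperateGrowth.id'.smul (.const _))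
  zero := by
    ext p <;> simp [δ.zero]
  one := by
    ext p <;> simp [δ.one]
  mul s t := by
    ext p <;> simp [δ.mul]

variable {d n : ℕ} {G : GradedLieGroup n} (A : ShubinAction d G)

/-- The dilations of the group. -/
noncomputable def GradedLieGroup.dilations (G : GradedLieGroup n) : Dilations (Fin n → ℝ) :=
  .ofWeight G.weight G.weight_pos

namespace ShubinAction

/-- The dilations of `X`. -/
noncomputable def dilX : Dilations (Fin d → ℝ) := .ofWeight A.weight A.weight_pos

/-- The dilations of `X × ℝ`. -/
noncomputable def dilN : Dilations ((Fin d → ℝ) × ℝ) := A.dilX.prodLine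

lemma exists_decomposition_tangent {m : ℝ} {P : TangentDist d n} (hP : P ∈ A.EssTangent m) :
    ∃ (S F : 𝓢(((Fin d → ℝ) × ℝ) × (Fin n → ℝ), ℂ)) (hF : FlatOp (ofSchwartz F).op),
      P = ofSchwartz S + flatDist A.dilN G.dilations m (ofSchwartz F).op hF := by
  -- Homogeneity at `s = 1 / 2`, multiplied by `2 ^ m`: the coefficient of `P` becomes `1`.
  have h1 := A.mem_EssTangent.1 hP (1 / 2) (by norm_num)
  obtain ⟨h, hh⟩ := mem_schwartzDist_iff.1 (Submodule.smul_mem _ (((2 : ℝ) ^ m : ℝ) : ℂ) h1)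
  refine exists_decomposition A.dilN G.dilations m (h := h) fun φ x => ?_
  rw [← hh, smul_sub, smul_smul, ← Complex.ofReal_mul, ← Real.mul_rpow (by norm_num) (by norm_num)]
  have h2 : (2 : ℝ) * (1 / 2) = 1 := by norm_num
  have h3 : (1 / 2 : ℝ)⁻¹ = 2 := by norm_num
  rw [h2, Real.one_rpow, Complex.ofReal_one, one_smul, FibredDist.sub_apply, OM.sub_apply,
    FibredDist.smul_apply, OM.smul_apply, zoom, FibredDist.push_apply]
  simp only [h3]
  rfl

lemma exists_decomposition_zero {m : ℝ} {u : Dist d n} (hu : u ∈ A.Ess m) :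
    ∃ (S F : 𝓢((Fin d → ℝ) × (Fin n → ℝ), ℂ)) (hF : FlatOp (ofSchwartz F).op),
      u = ofSchwartz S + flatDist A.dilX G.dilations m (ofSchwartz F).op hF := by
  have h1 := A.mem_Ess.1 hu (1 / 2) (by norm_num)
  obtain ⟨h, hh⟩ := mem_schwartzDist_iff.1 (Submodule.smul_mem _ (((2 : ℝ) ^ m : ℝ) : ℂ) h1)
  refine exists_decomposition A.dilX G.dilations m (h := h) fun φ x => ?_
  rw [← hh, smul_sub, smul_smul, ← Complex.ofReal_mul, ← Real.mul_rpow (by norm_num) (by norm_num)]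
  have h2 : (2 : ℝ) * (1 / 2) = 1 := by norm_num
  have h3 : (1 / 2 : ℝ)⁻¹ = 2 := by norm_num
  rw [h2, Real.one_rpow, Complex.ofReal_one, one_smul, FibredDist.sub_apply, OM.sub_apply,
    FibredDist.smul_apply, OM.smul_apply, zoomZero, FibredDist.push_apply]
  simp only [h3]
  rfl

/-- Rescaling preserves Schwartz functions, so these have every order, and extensions may be
modified by them freely. -/
lemma schwartz_mem_EssTangent {m : ℝ} {P : TangentDist d n}
    (hP : P ∈ schwartzDist ((Fin d → ℝ) × ℝ) (Fin n → ℝ)) : P ∈ A.EssTangent m := by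
  refine A.mem_EssTangent.2 fun s hs => sub_mem (Submodule.smul_mem _ _ hP) ?_
  exact push_mem_schwartzDist (A.dilN.δ s⁻¹) (A.dilN.δ s) (G.dilations.δ s) (G.dilations.δ s⁻¹)
    (A.dilN.inv_apply hs.ne') (G.dilations.inv_apply hs.ne') hP

lemma ofSchwartz_mem_EssTangent (m : ℝ) (f : 𝓢(((Fin d → ℝ) × ℝ) × (Fin n → ℝ), ℂ)) :
    ofSchwartz f ∈ A.EssTangent m := A.schwartz_mem_EssTangent (ofSchwartz_mem f)

lemma dotProduct_dilation (q : Fin n → ℕ) (s : ℝ) (ξ v : Fin n → ℝ) :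
    ξ ⬝ᵥ dilation q s v = dilation q s ξ ⬝ᵥ v := by
  simp only [dotProduct, dilation_apply]
  exact Finset.sum_congr rfl fun i _ => by ring

lemma two_mul_norm_le_norm_dilation (q : Fin n → ℕ) (hq : ∀ i, 0 < q i) (v : Fin n → ℝ) :
    2 * ‖v‖ ≤ ‖dilation q 2 v‖ := by
  rw [← le_div_iff₀' (by norm_num)]
  refine (pi_norm_le_iff_of_nonneg (by positivity)).2 fun i => ?_
  rw [le_div_iff₀' (by norm_num)]
  refine le_trans ?_ (norm_le_pi_norm (dilation q 2 v) i)
  rw [dilation_apply, norm_mul, norm_pow, Real.norm_ofNat]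
  gcongr
  exact le_self_pow₀ (by norm_num) (hq i).ne'

lemma dilation_single (q : Fin n → ℕ) (s : ℝ) (i : Fin n) :
    dilation q s (Pi.single i 1) = s ^ q i • Pi.single i (1 : ℝ) := by
  ext j
  by_cases h : j = i
  · subst h; simp
  · simp [h]

/-- A fibred distribution which vanishes at `t = 1` and is essentially homogeneous is Schwartz at
`t = 0`. -/
theorem ev_zero_mem_schwartzDist {m : ℝ} {P : TangentDist d n} (hP : P ∈ A.EssTangent m)
    (h1 : ev 1 P = 0) : ev 0 P ∈ schwartzDist (Fin d → ℝ) (Fin n → ℝ) := by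
  obtain ⟨S, F, hF, hdec⟩ := A.exists_decomposition_zero (A.ev_mem_Ess hP)
  obtain ⟨f, hf⟩ := mem_schwartzDist_iff.1 (A.mem_EssTangent.1 hP 2 (by norm_num))
  have hc : Function.HasTemperateGrowth fun p : ((Fin n → ℝ) × (Fin d → ℝ)) × ℝ =>
      (p.1.1, (p.1.2, p.2)) :=
    HasTemperateGrowth.prodMk (hasTemperateGrowth_fst.comp hasTemperateGrowth_fst)
      (HasTemperateGrowth.prodMk (hasTemperateGrowth_snd.comp hasTemperateGrowth_fst)
        hasTemperateGrowth_snd)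
  have hc' : Function.HasTemperateGrowth fun p : (Fin n → ℝ) × ((Fin d → ℝ) × ℝ) =>
      ((p.1, p.2.1), p.2.2) :=
    HasTemperateGrowth.prodMk (HasTemperateGrowth.prodMk hasTemperateGrowth_fst
      (hasTemperateGrowth_fst.comp hasTemperateGrowth_snd))
      (hasTemperateGrowth_snd.comp hasTemperateGrowth_snd)
  -- The symbol of `P`, with variables regrouped so that `(ξ, x)` is dilated with weights and `t`
  -- stands alone.
  let a : OM (((Fin n → ℝ) × (Fin d → ℝ)) × ℝ) := OM.pullback _ hc (sym P.op)
  have hat : ∀ t z, a (z, t) = sym (ev t P).op z := fun t z => rfl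
  -- Dilations are symmetric for the dot product, so dilating `v` in a character is the same as
  -- dilating `ξ`. Thus the zoom by `2` dilates all variables of the symbol by `2`.
  have hzoom : ∀ p : ((Fin n → ℝ) × (Fin d → ℝ)) × ℝ,
      sym (A.zoom 2 (by norm_num) P).op (p.1.1, (p.1.2, p.2))
        = a ((G.dil 2 p.1.1, A.dil 2 p.1.2), 2 * p.2) := by
    rintro ⟨⟨ξ, x⟩, t⟩
    have h2 : OM.pullback _ (hasTemperateGrowth_prodMap
        (ContinuousLinearMap.hasTemperateGrowth ((A.dil 2⁻¹).prodMap
          ((2 : ℝ)⁻¹ • ContinuousLinearMap.id ℝ ℝ)))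
        (ContinuousLinearMap.hasTemperateGrowth (G.dil 2)))
        (OM.slice ξ (echar n ((Fin d → ℝ) × ℝ)))
        = OM.slice (G.dil 2 ξ) (echar n ((Fin d → ℝ) × ℝ)) := by
      ext p
      exact congrArg expi (dotProduct_dilation G.weight 2 ξ p.2)
    exact congrArg (fun φ => P φ (A.dil 2 x, 2 * t)) h2
  have hs : IsSchwartz fun p : ((Fin n → ℝ) × (Fin d → ℝ)) × ℝ => (((2 : ℝ) ^ m : ℝ) : ℂ) * a p
      - a ((G.dil 2).prodMap (A.dil 2) p.1, 2 * p.2) := by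
    have h3 := (isSchwartz_sym_ofSchwartz f).comp hc hc' fun p => rfl
    convert h3 using 1
    ext p
    rw [← hf]
    have h4 : sym ((((2 : ℝ) ^ m : ℝ) : ℂ) • P - A.zoom 2 (by norm_num) P).op
        (p.1.1, (p.1.2, p.2)) = (((2 : ℝ) ^ m : ℝ) : ℂ) * a p
          - sym (A.zoom 2 (by norm_num) P).op (p.1.1, (p.1.2, p.2)) := rfl
    rw [h4, hzoom]
    rfl
  have hsch := isSchwartz_of_zoom ((Pi.basisFun ℝ (Fin n)).prod (Pi.basisFun ℝ (Fin d)))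
    (Sum.elim G.weight A.weight) (Γ := (G.dil 2).prodMap (A.dil 2)) (by
      rintro (i | i)
      · simp [dilation_single]
      · simp [dilation_single]) (by
      rintro ⟨ξ, x⟩
      change 2 * max ‖ξ‖ ‖x‖ ≤ max ‖G.dil 2 ξ‖ ‖A.dil 2 x‖
      rw [mul_max_of_nonneg _ _ (by norm_num)]
      exact max_le_max (two_mul_norm_le_norm_dilation _ G.weight_pos ξ)
        (two_mul_norm_le_norm_dilation _ A.weight_pos x)) hs (fun z => by
      rw [hat, h1]
      rfl)
  rw [hdec]
  refine add_mem (ofSchwartz_mem S) (flatDist_mem_schwartzDist _ _ m hF ?_)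
  -- Up to the Schwartz symbol of `S`, the dyadic part of `P_0` has the symbol of `P_0` itself,
  -- which was just shown to be Schwartz.
  have h5 : ⇑(sym (flatDist A.dilX G.dilations m (ofSchwartz F).op hF).op)
      = (fun z => a (z, 0)) - ⇑(sym (ofSchwartz S).op) := by
    ext z
    rw [Pi.sub_apply, hat, hdec]
    exact (add_sub_cancel_left (sym (ofSchwartz S).op z) _).symm
  rw [h5]
  exact hsch.sub (isSchwartz_sym_ofSchwartz S)

/-- Two extensions of the same element differ by an essentially homogeneous distribution vanishing
at `t = 1`, which is Schwartz at `t = 0` by `ev_zero_mem_schwartzDist`. -/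
lemma sigma_eq {m : ℝ} (P : A.Psi m) {Q : TangentDist d n} (hQ : Q ∈ A.EssTangent m)
    (h : ev 1 Q = P.1) : A.sigma m P = A.cls ⟨ev 0 Q, A.ev_mem_Ess hQ⟩ := by
  refine (Submodule.Quotient.eq _).2 ?_
  change ev 0 P.2.choose - ev 0 Q ∈ schwartzDist (Fin d → ℝ) (Fin n → ℝ)
  rw [← map_sub]
  refine A.ev_zero_mem_schwartzDist (m := m) (sub_mem P.2.choose_spec.1 hQ) ?_
  rw [map_sub, h, sub_eq_zero]
  exact P.2.choose_spec.2

end ShubinAction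

end Concrete

end Shubin

namespace Shubin

/-! ### Polynomial functions and maps. -/

section Polynomial

variable {E F H : Type} [NormedAddCommGroup E] [NormedSpace ℝ E] [NormedAddCommGroup F]
  [NormedSpace ℝ F] [NormedAddCommGroup H] [NormedSpace ℝ H]

variable (E) in
/-- The polynomial functions on `E`. -/
def Poly : Subalgebra ℝ (E → ℝ) := Algebra.adjoin ℝ (Set.range fun ℓ : E →L[ℝ] ℝ => (ℓ : E → ℝ))

lemma clm_mem_Poly (ℓ : E →L[ℝ] ℝ) : (fun x => ℓ x) ∈ Poly E := Algebra.subset_adjoin ⟨ℓ, rfl⟩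

lemma const_mem_Poly (c : ℝ) : (fun _ => c) ∈ Poly E := (Poly E).algebraMap_mem c

lemma Poly.induction {p : (f : E → ℝ) → f ∈ Poly E → Prop}
    (clm : ∀ ℓ : E →L[ℝ] ℝ, p (fun x => ℓ x) (clm_mem_Poly ℓ))
    (const : ∀ c, p (fun _ => c) (const_mem_Poly c))
    (add : ∀ f g hf hg, p f hf → p g hg → p (fun x => f x + g x) (add_mem hf hg))
    (mul : ∀ f g hf hg, p f hf → p g hg → p (fun x => f x * g x) (mul_mem hf hg))
    {f : E → ℝ} (hf : f ∈ Poly E) : p f hf := by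
  refine Algebra.adjoin_induction (p := p) ?_ const
    (fun f g hf hg h h' => add f g hf hg h h') (fun f g hf hg h h' => mul f g hf hg h h') hf
  rintro _ ⟨ℓ, rfl⟩
  exact clm ℓ

lemma snd_fst_mem_Poly : (fun p : (E × ℝ) × F => p.1.2) ∈ Poly ((E × ℝ) × F) :=
  clm_mem_Poly ((ContinuousLinearMap.snd ℝ E ℝ).comp (ContinuousLinearMap.fst ℝ (E × ℝ) F))

lemma Poly.hasTemperateGrowth {f : E → ℝ} (hf : f ∈ Poly E) : f.HasTemperateGrowth := by
  induction hf using Poly.induction with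
  | clm ℓ => exact ℓ.hasTemperateGrowth
  | const c => exact .const c
  | add f g _ _ h h' => exact h.add h'
  | mul f g _ _ h h' => exact h.mul h'

lemma Poly.differentiable {f : E → ℝ} (hf : f ∈ Poly E) : Differentiable ℝ f :=
  (Poly.hasTemperateGrowth hf).1.differentiable (by simp)

lemma Poly.fderiv_apply {f : E → ℝ} (hf : f ∈ Poly E) (e : E) :
    (fun x => fderiv ℝ f x e) ∈ Poly E := by
  induction hf using Poly.induction with
  | clm ℓ => simpa using const_mem_Poly (ℓ e)
  | const c => simpa using const_mem_Poly 0
  | add f g hf hg h h' =>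
    convert add_mem h h' using 1
    ext x
    rw [fderiv_fun_add (Poly.differentiable hf x) (Poly.differentiable hg x)]
    rfl
  | mul f g hf hg h h' =>
    convert add_mem (mul_mem hf h') (mul_mem hg h) using 1
    ext x
    rw [fderiv_fun_mul (Poly.differentiable hf x) (Poly.differentiable hg x)]
    rfl

lemma Poly.exists_polynomial {f : E → ℝ} (hf : f ∈ Poly E) (x y : E) :
    ∃ P : Polynomial ℝ, ∀ s : ℝ, f (x + s • y) = P.eval s := by
  induction hf using Poly.induction with
  | clm ℓ => exact ⟨.C (ℓ x) + .C (ℓ y) * .X, fun s => by simp; ring⟩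
  | const c => exact ⟨.C c, by simp⟩
  | add f g _ _ h h' =>
    obtain ⟨P, hP⟩ := h
    obtain ⟨Q, hQ⟩ := h'
    exact ⟨P + Q, by simp [hP, hQ]⟩
  | mul f g _ _ h h' =>
    obtain ⟨P, hP⟩ := h
    obtain ⟨Q, hQ⟩ := h'
    exact ⟨P * Q, by simp [hP, hQ]⟩

/-- A polynomial with polynomial inverse is constant. -/
lemma Poly.eq_of_mul_eq_one {f g : E → ℝ} (hf : f ∈ Poly E) (hg : g ∈ Poly E)
    (h : ∀ x, f x * g x = 1) (x y : E) : f x = f y := by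
  obtain ⟨P, hP⟩ := Poly.exists_polynomial hf y (x - y)
  obtain ⟨Q, hQ⟩ := Poly.exists_polynomial hg y (x - y)
  have h1 : P * Q = 1 := Polynomial.funext fun s => by
    rw [Polynomial.eval_mul, ← hP, ← hQ, h, Polynomial.eval_one]
  -- On the line through `y` and `x` the product of two one-variable polynomials is `1`, so they are
  -- constants.
  obtain ⟨c, -, hc⟩ := Polynomial.isUnit_iff.1 (IsUnit.of_mul_eq_one Q h1)
  have h2 := hP 0
  have h3 := hP 1
  rw [← hc, Polynomial.eval_C] at h2 h3
  rw [zero_smul, add_zero] at h2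
  rw [one_smul, add_sub_cancel] at h3
  rw [h2, h3]

/-- The map `g` is polynomial. -/
def PolyMap (g : E → F) : Prop := ∀ ℓ : F →L[ℝ] ℝ, (fun x => ℓ (g x)) ∈ Poly E

lemma PolyMap.clm (L : E →L[ℝ] F) : PolyMap L := fun ℓ => clm_mem_Poly (ℓ.comp L)

lemma PolyMap.const (c : F) : PolyMap fun _ : E => c := fun ℓ => const_mem_Poly (ℓ c)

lemma PolyMap.mem_comp {g : E → F} (hg : PolyMap g) {f : F → ℝ} (hf : f ∈ Poly F) :
    (fun x => f (g x)) ∈ Poly E := by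
  induction hf using Poly.induction with
  | clm ℓ => exact hg ℓ
  | const c => exact const_mem_Poly c
  | add f g _ _ h h' => exact add_mem h h'
  | mul f g _ _ h h' => exact mul_mem h h'

lemma PolyMap.prodMk {f : E → F} {g : E → H} (hf : PolyMap f) (hg : PolyMap g) :
    PolyMap fun x => (f x, g x) := fun ℓ => by
  convert add_mem (hf (ℓ.comp (.inl ℝ F H))) (hg (ℓ.comp (.inr ℝ F H))) using 1
  ext x
  simp [← map_add]

lemma PolyMap.pi {d : ℕ} {f : E → Fin d → ℝ} (hf : ∀ i, (fun x => f x i) ∈ Poly E) :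
    PolyMap f := fun ℓ => by
  have h : (fun x => ℓ (f x)) = ∑ i, (fun x => f x i) * fun _ => ℓ (Pi.single i 1) := by
    ext x
    conv_lhs => rw [pi_eq_sum_univ' (f x)]
    simp [map_sum]
  rw [h]
  exact sum_mem fun i _ => mul_mem (hf i) (const_mem_Poly _)

lemma PolyMap.hasTemperateGrowth [FiniteDimensional ℝ F] {g : E → F} (hg : PolyMap g) :
    g.HasTemperateGrowth := by
  let b := Module.finBasis ℝ F
  have h : g = fun x => ∑ i, (LinearMap.toContinuousLinearMap (b.coord i)) (g x) • b i := by
    ext x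
    exact (b.sum_repr (g x)).symm
  rw [h]
  exact Function.HasTemperateGrowth.sum (s := Finset.univ) fun i _ =>
    (Poly.hasTemperateGrowth (hg _)).smul (.const _)

lemma PolyMap.fderiv_apply [FiniteDimensional ℝ F] {g : E → F} (hg : PolyMap g) (e : E) :
    PolyMap fun x => fderiv ℝ g x e := fun ℓ => by
  convert Poly.fderiv_apply (hg ℓ) e using 1
  ext x
  have h : HasFDerivAt (fun x => ℓ (g x)) (ℓ.comp (fderiv ℝ g x)) x :=
    ℓ.hasFDerivAt.comp x ((hg.hasTemperateGrowth.1.differentiable (by simp)) x).hasFDerivAt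
  rw [h.fderiv]
  rfl

/-- Division of a polynomial by a linear form with kernel the image of a projection. -/
lemma Poly.exists_eq_add_mul (c : E →L[ℝ] ℝ) (π : E →L[ℝ] E) (e : E)
    (h : ∀ x, x = π x + c x • e) {f : E → ℝ} (hf : f ∈ Poly E) :
    ∃ f' ∈ Poly E, ∀ x, f x = f (π x) + c x * f' x := by
  induction hf using Poly.induction with
  | clm ℓ =>
    refine ⟨_, const_mem_Poly (ℓ e), fun x => ?_⟩
    conv_lhs => rw [h x]
    simp
  | const a => exact ⟨_, const_mem_Poly 0, by simp⟩
  | add f g hf hg h1 h2 =>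
    obtain ⟨f', hf', h1⟩ := h1
    obtain ⟨g', hg', h2⟩ := h2
    refine ⟨_, add_mem hf' hg', fun x => ?_⟩
    simp only
    rw [h1, h2, Pi.add_apply]
    ring
  | mul f g hf hg h1 h2 =>
    obtain ⟨f', hf', h1⟩ := h1
    obtain ⟨g', hg', h2⟩ := h2
    refine ⟨_, add_mem (mul_mem ((PolyMap.clm π).mem_comp hf) hg') (mul_mem hf' hg), fun x => ?_⟩
    simp only [Pi.add_apply, Pi.mul_apply]
    rw [h1 x]
    linear_combination f (π x) * h2 x

lemma Poly.det_mem {ι : Type} [Fintype ι] [DecidableEq ι] {M : E → Matrix ι ι ℝ}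
    (hM : ∀ i j, (fun x => M x i j) ∈ Poly E) : (fun x => (M x).det) ∈ Poly E := by
  have h : (fun x => (M x).det) = ∑ σ : Equiv.Perm ι, (fun _ => ((σ.sign : ℤ) : ℝ)) *
      ∏ i, fun x => M x (σ i) i := by
    ext x
    simp [Matrix.det_apply']
  rw [h]
  exact sum_mem fun σ _ => mul_mem (const_mem_Poly _) (prod_mem fun i _ => hM _ _)

end Polynomial

/-- Used to extend to `t = 0` the identities that hold for `t ≠ 0` by the definition of `θᵗ`. -/
lemma eq_of_continuous_of_ne_zero {Y : Type} [TopologicalSpace Y] [T2Space Y] {f g : ℝ → Y}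
    (hf : Continuous f) (hg : Continuous g) (h : ∀ s, s ≠ 0 → f s = g s) (s : ℝ) : f s = g s :=
  congrFun (Continuous.ext_on (dense_compl_singleton (0 : ℝ)) hf hg fun s hs => h s hs) s

/-- A smooth function which is a multiple of `s ^ q` on each half line is a multiple of `s ^ q`. -/
lemma eq_of_contDiff_of_eq_pow (q : ℕ) : ∀ {g : ℝ → ℝ} {c c' : ℝ}, ContDiff ℝ ∞ g →
    (∀ s, 0 < s → g s = c * s ^ q) → (∀ s, s < 0 → g s = c' * s ^ q) → c = c' := by
  induction q with
  | zero =>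
    intro g c c' hg h1 h2
    have hc : Filter.Tendsto g (𝓝 0) (𝓝 (g 0)) := hg.continuous.tendsto 0
    have h3 : Filter.Tendsto g (𝓝[>] 0) (𝓝 c) := by
      refine tendsto_const_nhds.congr' ?_
      filter_upwards [self_mem_nhdsWithin] with s hs
      simp [h1 s hs]
    have h4 : Filter.Tendsto g (𝓝[<] 0) (𝓝 c') := by
      refine tendsto_const_nhds.congr' ?_
      filter_upwards [self_mem_nhdsWithin] with s hs
      simp [h2 s hs]
    exact (tendsto_nhds_unique h3 (hc.mono_left nhdsWithin_le_nhds)).trans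
      (tendsto_nhds_unique h4 (hc.mono_left nhdsWithin_le_nhds)).symm
  | succ q ih =>
    intro g c c' hg h1 h2
    -- Differentiation lowers the exponent and multiplies both constants by `q + 1`, so the claim
    -- descends to exponent `0`, where the constants are the one-sided limits at `0`.
    have hd : ∀ c s : ℝ, (∀ᶠ s in 𝓝 s, g s = c * s ^ (q + 1)) →
        deriv g s = c * (q + 1 : ℝ) * s ^ q := by
      intro c s h
      rw [Filter.EventuallyEq.deriv_eq (f := fun s => c * s ^ (q + 1)) h]
      simp
      ring
    have hc := ih (g := deriv g) (c := c * (q + 1)) (c' := c' * (q + 1))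
      ((contDiff_infty_iff_deriv.1 hg).2)
      (fun s hs => hd c s ((eventually_gt_nhds hs).mono h1))
      (fun s hs => hd c' s ((eventually_lt_nhds hs).mono h2))
    exact mul_right_cancel₀ (by positivity) hc

/-- Maps with Jacobian determinant one preserve the volume. -/
lemma measurePreserving_of_det_eq_one {d : ℕ} {f : (Fin d → ℝ) → Fin d → ℝ}
    (hf : Differentiable ℝ f) (hi : Function.Bijective f) (h : ∀ x, (fderiv ℝ f x).det = 1) :
    MeasurePreserving f := by
  refine ⟨hf.continuous.measurable, ?_⟩
  have h1 := map_withDensity_abs_det_fderiv_eq_addHaar (volume : Measure (Fin d → ℝ))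
    (s := Set.univ) (f' := fderiv ℝ f) MeasurableSet.univ
    (fun x _ => (hf x).hasFDerivAt.hasFDerivWithinAt) hi.1.injOn
  rw [Set.image_univ, hi.2.range_eq, Measure.restrict_univ] at h1
  have h2 : (volume : Measure (Fin d → ℝ)).withDensity
      (fun x => ENNReal.ofReal |(fderiv ℝ f x).det|) = volume := by
    simp [h]
  rwa [h2] at h1

lemma dilation_one {n : ℕ} (q : Fin n → ℕ) (v : Fin n → ℝ) : dilation q 1 v = v := by
  ext i; simp

lemma dilation_mul_apply {n : ℕ} (q : Fin n → ℕ) (s t : ℝ) (v : Fin n → ℝ) :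
    dilation q (s * t) v = dilation q s (dilation q t v) := by
  ext i; simp [mul_pow, mul_assoc]

lemma dilation_zero {n : ℕ} (q : Fin n → ℕ) (hq : ∀ i, 0 < q i) (v : Fin n → ℝ) :
    dilation q 0 v = 0 := by
  ext i; simp [(hq i).ne']

lemma contDiff_dilation {n : ℕ} (q : Fin n → ℕ) :
    ContDiff ℝ ∞ fun p : ℝ × (Fin n → ℝ) => dilation q p.1 p.2 := by
  refine contDiff_pi.2 fun i => ?_
  simp only [dilation_apply]
  fun_prop

lemma dilation_inv_dilation {n : ℕ} (q : Fin n → ℕ) {s : ℝ} (hs : s ≠ 0) (v : Fin n → ℝ) :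
    dilation q s⁻¹ (dilation q s v) = v := by
  rw [← dilation_mul_apply, inv_mul_cancel₀ hs, dilation_one]

lemma det_dilation_ne_zero {n : ℕ} (q : Fin n → ℕ) {s : ℝ} (hs : s ≠ 0) :
    (dilation q s).det ≠ 0 := by
  have h : (dilation q s).comp (dilation q s⁻¹) = ContinuousLinearMap.id ℝ _ :=
    ContinuousLinearMap.ext (dilation_dilation_inv q hs)
  have h1 := congrArg ContinuousLinearMap.det h
  intro h0
  have h2 : ((dilation q s).comp (dilation q s⁻¹)).det
      = (dilation q s).det * (dilation q s⁻¹).det := LinearMap.det_comp _ _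
  rw [h2, h0, zero_mul] at h1
  simp [ContinuousLinearMap.det] at h1

/-! ### Negative dilations and invariance of the volume under left translations. -/

namespace GradedLieGroup

variable {n : ℕ} (G : GradedLieGroup n)

lemma mul_neg (v : Fin n → ℝ) : G.mul v (-v) = 0 := by
  simpa using G.smul_mul_smul 1 (-1) v

lemma neg_mul (v : Fin n → ℝ) : G.mul (-v) v = 0 := by
  simpa using G.smul_mul_smul (-1) 1 v

lemma mul_neg_mul (v w : Fin n → ℝ) : G.mul v (G.mul (-v) w) = w := by
  rw [← G.mul_assoc, G.mul_neg, G.zero_mul]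

lemma neg_mul_mul (v w : Fin n → ℝ) : G.mul (-v) (G.mul v w) = w := by
  rw [← G.mul_assoc, G.neg_mul, G.zero_mul]

/-- All dilations, also those with negative parameter, are compatible with the group law. -/
lemma dil_mul (s : ℝ) (v w : Fin n → ℝ) :
    G.dil s (G.mul v w) = G.mul (G.dil s v) (G.dil s w) := by
  rcases lt_trichotomy s 0 with hs | rfl | hs
  · ext i
    -- Each component of the right-hand side is smooth in `s` and a multiple of `s ^ q` on each half
    -- line. Smoothness at `0` forces both multiples to coincide, which carries homogeneity over to
    -- `s < 0`.
    have hg : ContDiff ℝ ∞ fun s => G.mul (G.dil s v) (G.dil s w) i :=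
      (contDiff_pi.1 (G.contDiff_mul.comp
        (((contDiff_dilation G.weight).comp (contDiff_id.prodMk contDiff_const)).prodMk
          ((contDiff_dilation G.weight).comp (contDiff_id.prodMk contDiff_const))))) i
    have hneg : ∀ s : ℝ, s < 0 → G.mul (G.dil s v) (G.dil s w) i
        = (G.mul (G.dil (-1) v) (G.dil (-1) w) i * (-1) ^ G.weight i) * s ^ G.weight i := by
      intro s hs
      have h := congrFun (G.dilation_mul (-s) (by linarith) (G.dil (-1) v) (G.dil (-1) w)) i
      rw [← dilation_mul_apply, ← dilation_mul_apply, neg_mul_neg, mul_one, dilation_apply] at h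
      rw [← h, neg_pow]
      ring
    have h := eq_of_contDiff_of_eq_pow (G.weight i) hg (fun s hs => by
      rw [← G.dilation_mul s hs, dilation_apply, mul_comm]) hneg
    rw [hneg s hs, ← h, dilation_apply, mul_comm]
  · simp only [dilation_zero _ G.weight_pos, G.mul_zero]
  · exact G.dilation_mul s hs v w

/-- The Jacobian of left translation by `a` at `w` is unchanged when `a` and `w` are dilated by `s ≠
0`. As `s → 0` both tend to the unit, and left translation by the unit is the identity; so the
Jacobian is `1`. -/
lemma measurePreserving_mul_left (a : Fin n → ℝ) : MeasurePreserving (G.mul a) := by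
  have hd : ∀ a, Differentiable ℝ (G.mul a) := fun a =>
    (G.contDiff_mul.comp (contDiff_const.prodMk contDiff_id)).differentiable (by simp)
  refine measurePreserving_of_det_eq_one (hd a) ⟨fun v w h => ?_, fun w => ⟨_, G.mul_neg_mul a w⟩⟩
    fun w => ?_
  · rw [← G.neg_mul_mul a v, h, G.neg_mul_mul]
  have hhom : ∀ s : ℝ, s ≠ 0 →
      (fderiv ℝ (G.mul (G.dil s a)) (G.dil s w)).det = (fderiv ℝ (G.mul a) w).det := by
    intro s hs
    have h1 : (fun w => G.mul (G.dil s a) (G.dil s w)) = fun w => G.dil s (G.mul a w) :=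
      funext fun w => (G.dil_mul s a w).symm
    have h2 : HasFDerivAt (fun w => G.mul (G.dil s a) (G.dil s w))
        ((fderiv ℝ (G.mul (G.dil s a)) (G.dil s w)).comp (G.dil s)) w :=
      (hd _ _).hasFDerivAt.comp w (G.dil s).hasFDerivAt
    have h3 : HasFDerivAt (fun w => G.dil s (G.mul a w))
        ((G.dil s).comp (fderiv ℝ (G.mul a) w)) w :=
      (G.dil s).hasFDerivAt.comp w (hd a w).hasFDerivAt
    rw [h1] at h2
    have h4 := congrArg ContinuousLinearMap.det (h2.unique h3)
    have h5 : ∀ S T : (Fin n → ℝ) →L[ℝ] (Fin n → ℝ), (S.comp T).det = S.det * T.det :=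
      fun S T => LinearMap.det_comp _ _
    rw [h5, h5, mul_comm] at h4
    exact mul_left_cancel₀ (det_dilation_ne_zero _ hs) h4
  have hc : Continuous fun s : ℝ => (fderiv ℝ (G.mul (G.dil s a)) (G.dil s w)).det := by
    have h1 : ContDiff ℝ ∞ fun p : ℝ × (Fin n → ℝ) => fderiv ℝ (G.mul (G.dil p.1 a)) p.2 := by
      refine ContDiff.fderiv (m := ∞) (n := ∞) (f := fun (p : ℝ × (Fin n → ℝ)) w => G.mul (G.dil p.1 a) w)
        (g := fun p => p.2) ?_ contDiff_snd (by simp)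
      exact G.contDiff_mul.comp (((contDiff_dilation G.weight).comp
        ((contDiff_fst.comp contDiff_fst).prodMk contDiff_const)).prodMk contDiff_snd)
    have h2 : Continuous fun s : ℝ => (s, G.dil s w) :=
      continuous_id.prodMk (((contDiff_dilation G.weight).comp
        (contDiff_id.prodMk contDiff_const)).continuous)
    exact ContinuousLinearMap.continuous_det.comp (h1.continuous.comp h2)
  have h := eq_of_continuous_of_ne_zero hc continuous_const hhom 0
  simp only [dilation_zero _ G.weight_pos] at h
  rw [← h, show G.mul 0 = id from funext G.zero_mul, fderiv_id]
  simp [ContinuousLinearMap.det]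

end GradedLieGroup

/-! ### The deformed actions are polynomial, equivariant and volume preserving. -/

namespace ShubinAction

variable {d n : ℕ} {G : GradedLieGroup n} (A : ShubinAction d G)

lemma continuous_act : Continuous fun p : ((Fin d → ℝ) × ℝ) × (Fin n → ℝ) => A.act p.1.2 p.1.1 p.2 :=
  A.contDiff_act.continuous

/-- Substituting `β_{t⁻¹}(x)` into a polynomial creates only finitely many negative powers of `t`,
which a power `t ^ K` clears. -/
lemma exists_pow_mul_eval (p : MvPolynomial (Fin d ⊕ Fin n) ℝ) :
    ∃ (K : ℕ) (f : ((Fin d → ℝ) × ℝ) × (Fin n → ℝ) → ℝ), f ∈ Poly _ ∧ ∀ t : ℝ, t ≠ 0 → ∀ x v,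
      t ^ K * MvPolynomial.eval (Sum.elim (A.dil t⁻¹ x) (G.dil t v)) p = f ((x, t), v) := by
  have ht := snd_fst_mem_Poly (E := Fin d → ℝ) (F := Fin n → ℝ)
  induction p using MvPolynomial.induction_on with
  | C a => exact ⟨0, _, const_mem_Poly a, by simp⟩
  | add p q hp hq =>
    obtain ⟨K, f, hf, h⟩ := hp
    obtain ⟨L, g, hg, h'⟩ := hq
    refine ⟨K + L, _, add_mem (mul_mem (pow_mem ht L) hf) (mul_mem (pow_mem ht K) hg),
      fun t h0 x v => ?_⟩
    simp only [map_add, Pi.add_apply, Pi.mul_apply, Pi.pow_apply, ← h t h0, ← h' t h0]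
    ring
  | mul_X p i hp =>
    obtain ⟨K, f, hf, h⟩ := hp
    rcases i with i | i
    · have hx : (fun p : ((Fin d → ℝ) × ℝ) × (Fin n → ℝ) => p.1.1 i) ∈ Poly _ :=
        clm_mem_Poly (((ContinuousLinearMap.proj (R := ℝ) (φ := fun _ : Fin d => ℝ) i).comp
          (ContinuousLinearMap.fst ℝ _ ℝ)).comp
          (ContinuousLinearMap.fst ℝ ((Fin d → ℝ) × ℝ) (Fin n → ℝ)))
      refine ⟨K + A.weight i, _, mul_mem hf hx, fun t h0 x v => ?_⟩
      simp only [map_mul, Pi.mul_apply, ← h t h0, MvPolynomial.eval_X, Sum.elim_inl,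
        dilation_apply, pow_add]
      generalize MvPolynomial.eval _ p = c
      rw [inv_pow]
      field_simp
    · have hx : (fun p : ((Fin d → ℝ) × ℝ) × (Fin n → ℝ) => p.2 i) ∈ Poly _ :=
        clm_mem_Poly ((ContinuousLinearMap.proj (R := ℝ) (φ := fun _ : Fin n => ℝ) i).comp
          (ContinuousLinearMap.snd ℝ ((Fin d → ℝ) × ℝ) (Fin n → ℝ)))
      refine ⟨K, _, mul_mem hf (mul_mem (pow_mem ht (G.weight i)) hx), fun t h0 x v => ?_⟩
      simp only [map_mul, Pi.mul_apply, Pi.pow_apply, ← h t h0, MvPolynomial.eval_X, Sum.elim_inr,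
        dilation_apply]
      ring

/-- One power of `t` is divided out at a time: by continuity the identity extends to `t = 0`, so the
polynomial `f` vanishes there and is divisible by `t`. -/
lemma mem_Poly_of_pow_mul (K : ℕ) {θ : ((Fin d → ℝ) × ℝ) × (Fin n → ℝ) → ℝ} (hθ : Continuous θ) :
    ∀ {f : ((Fin d → ℝ) × ℝ) × (Fin n → ℝ) → ℝ}, f ∈ Poly _ →
      (∀ t : ℝ, t ≠ 0 → ∀ x v, t ^ K * θ ((x, t), v) = f ((x, t), v)) → θ ∈ Poly _ := by
  have hl : ∀ (x : Fin d → ℝ) (v : Fin n → ℝ), Continuous fun t : ℝ => ((x, t), v) := fun x v => by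
    fun_prop
  induction K with
  | zero =>
    intro f hf h
    have h1 : θ = f := by
      ext ⟨⟨x, t⟩, v⟩
      exact eq_of_continuous_of_ne_zero (hθ.comp (hl x v))
        ((Poly.hasTemperateGrowth hf).1.continuous.comp (hl x v))
        (fun t ht => by simpa using h t ht x v) t
    exact h1 ▸ hf
  | succ K ih =>
    intro f hf h
    have h1 : ∀ x v t, t ^ (K + 1) * θ ((x, t), v) = f ((x, t), v) := fun x v t =>
      eq_of_continuous_of_ne_zero ((continuous_pow _).mul (hθ.comp (hl x v)))
        ((Poly.hasTemperateGrowth hf).1.continuous.comp (hl x v)) (fun t ht => h t ht x v) t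
    let c : (((Fin d → ℝ) × ℝ) × (Fin n → ℝ)) →L[ℝ] ℝ :=
      (ContinuousLinearMap.snd ℝ _ ℝ).comp (ContinuousLinearMap.fst ℝ _ _)
    let π : (((Fin d → ℝ) × ℝ) × (Fin n → ℝ)) →L[ℝ] (((Fin d → ℝ) × ℝ) × (Fin n → ℝ)) :=
      ((ContinuousLinearMap.id ℝ (Fin d → ℝ)).prodMap (0 : ℝ →L[ℝ] ℝ)).prodMap
        (ContinuousLinearMap.id ℝ _)
    obtain ⟨f', hf', h2⟩ := Poly.exists_eq_add_mul c π ((0, 1), 0) (by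
      rintro ⟨⟨x, t⟩, v⟩
      simp [c, π]) hf
    refine ih hf' fun t ht x v => ?_
    have h3 := h2 ((x, t), v)
    have h4 : f (π ((x, t), v)) = 0 := by
      have := h1 x v 0
      rw [zero_pow (by omega), zero_mul] at this
      exact this.symm
    rw [h4, zero_add, ← h1 x v t] at h3
    refine mul_left_cancel₀ ht (Eq.trans ?_ h3)
    ring

/-- Polynomiality of `θ¹` gives a polynomial after multiplication by a power of `t`, and continuity
of the extension at `t = 0` permits dividing this power out. -/
lemma polyMap_act : PolyMap fun p : ((Fin d → ℝ) × ℝ) × (Fin n → ℝ) => A.act p.1.2 p.1.1 p.2 := by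
  refine PolyMap.pi fun i => ?_
  obtain ⟨p, hp⟩ := A.polynomial i
  obtain ⟨K, f, hf, h⟩ := A.exists_pow_mul_eval p
  have ht := snd_fst_mem_Poly (E := Fin d → ℝ) (F := Fin n → ℝ)
  refine mem_Poly_of_pow_mul K ((continuous_apply i).comp A.continuous_act)
    (mul_mem (pow_mem ht (A.weight i)) hf) fun t h0 x v => ?_
  simp only [Pi.mul_apply, Pi.pow_apply]
  rw [A.act_deform t h0, dilation_apply, hp, ← h t h0]
  ring

lemma continuous_act_left {v : Fin n → ℝ} {x : Fin d → ℝ} : Continuous fun t => A.act t x v :=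
  A.continuous_act.comp (by fun_prop : Continuous fun t : ℝ => ((x, t), v))

lemma act_zero' (t : ℝ) (x : Fin d → ℝ) : A.act t x 0 = x := by
  refine eq_of_continuous_of_ne_zero A.continuous_act_left continuous_const (fun t ht => ?_) t
  rw [A.act_deform t ht, map_zero, A.act_zero, dilation_dilation_inv _ ht]

lemma act_mul' (t : ℝ) (x : Fin d → ℝ) (v w : Fin n → ℝ) :
    A.act t x (G.mul v w) = A.act t (A.act t x v) w := by
  refine eq_of_continuous_of_ne_zero A.continuous_act_left
    (A.continuous_act.comp ((A.continuous_act_left.prodMk continuous_id).prodMk continuous_const))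
    (fun t ht => ?_) t
  simp only [id, Function.comp]
  rw [A.act_deform t ht, A.act_deform t ht, A.act_deform t ht x, dilation_inv_dilation _ ht,
    G.dil_mul, A.act_mul]

/-- For `ε, t ≠ 0` both sides unfold to the same expression in `θ¹`; continuity in `t` and then in
`ε` covers the remaining cases. This equivariance makes the zoom compatible with the groupoid
structure. -/
lemma act_dil (ε t : ℝ) (x : Fin d → ℝ) (v : Fin n → ℝ) :
    A.act (ε * t) (A.dil ε x) v = A.dil ε (A.act t x (G.dil ε v)) := by
  have hx : Continuous fun ε : ℝ => A.dil ε x :=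
    (contDiff_dilation A.weight).continuous.comp (by fun_prop : Continuous fun ε : ℝ => (ε, x))
  have hv : Continuous fun ε : ℝ => G.dil ε v :=
    (contDiff_dilation G.weight).continuous.comp (by fun_prop : Continuous fun ε : ℝ => (ε, v))
  refine eq_of_continuous_of_ne_zero (f := fun ε => A.act (ε * t) (A.dil ε x) v)
    (g := fun ε => A.dil ε (A.act t x (G.dil ε v)))
    (A.continuous_act.comp ((hx.prodMk (by fun_prop)).prodMk continuous_const))
    ((contDiff_dilation A.weight).continuous.comp (continuous_id.prodMk
      (A.continuous_act.comp ((continuous_const (y := (x, t))).prodMk hv)))) (fun ε hε => ?_) ε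
  refine eq_of_continuous_of_ne_zero (f := fun t => A.act (ε * t) (A.dil ε x) v)
    (g := fun t => A.dil ε (A.act t x (G.dil ε v)))
    (A.continuous_act_left.comp (by fun_prop : Continuous fun t => ε * t))
    ((A.dil ε).continuous.comp A.continuous_act_left) (fun t ht => ?_) t
  rw [A.act_deform _ (mul_ne_zero hε ht), A.act_deform t ht, dilation_mul_apply, mul_inv, mul_comm ε⁻¹,
    dilation_mul_apply, dilation_inv_dilation _ hε, mul_comm, dilation_mul_apply G.weight]

lemma act_neg_act (t : ℝ) (x : Fin d → ℝ) (v : Fin n → ℝ) : A.act t (A.act t x v) (-v) = x := by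
  rw [← A.act_mul', G.mul_neg, A.act_zero']

lemma act_act_neg (t : ℝ) (x : Fin d → ℝ) (v : Fin n → ℝ) : A.act t (A.act t x (-v)) v = x := by
  rw [← A.act_mul', G.neg_mul, A.act_zero']

/-- The case `ε = 0` of equivariance, where the dilation of `X` contracts everything to the origin.
-/
lemma act_zero_zero (v : Fin n → ℝ) : A.act 0 0 v = 0 := by
  have h := A.act_dil 0 0 0 v
  rwa [zero_mul, map_zero, dilation_zero _ A.weight_pos] at h

/-- The transformations `θᵗ_v` preserve the volume. -/
lemma measurePreserving_act (t : ℝ) (v : Fin n → ℝ) : MeasurePreserving fun x => A.act t x v := by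
  let Θ : ((Fin d → ℝ) × ℝ) × (Fin n → ℝ) → Fin d → ℝ := fun p => A.act p.1.2 p.1.1 p.2
  have hΘ : PolyMap Θ := A.polyMap_act
  have hΘd : Differentiable ℝ Θ := hΘ.hasTemperateGrowth.1.differentiable (by simp)
  have hd : ∀ t v, Differentiable ℝ fun x => A.act t x v := fun t v =>
    hΘd.comp (by fun_prop : Differentiable ℝ fun x : Fin d → ℝ => ((x, t), v))
  let J : ((Fin d → ℝ) × ℝ) × (Fin n → ℝ) → ℝ := fun p =>
    (fderiv ℝ (fun x => A.act p.1.2 x p.2) p.1.1).det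
  have hJ : J ∈ Poly _ := by
    have h : J = fun p => (LinearMap.toMatrix' (fderiv ℝ (fun x => A.act p.1.2 x p.2) p.1.1 :
        (Fin d → ℝ) →ₗ[ℝ] Fin d → ℝ)).det := by
      ext p
      exact (LinearMap.det_toMatrix' _).symm
    rw [h]
    refine Poly.det_mem fun i j => ?_
    convert hΘ.fderiv_apply ((Pi.single j 1, 0), 0)
      (ContinuousLinearMap.proj (R := ℝ) (φ := fun _ : Fin d => ℝ) i) using 1
    ext ⟨⟨x, t⟩, v⟩
    rw [LinearMap.toMatrix'_apply]
    have h1 : HasFDerivAt (fun x : Fin d → ℝ => ((x, t), v))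
        ((ContinuousLinearMap.inl ℝ ((Fin d → ℝ) × ℝ) (Fin n → ℝ)).comp
          (ContinuousLinearMap.inl ℝ (Fin d → ℝ) ℝ)) x := by
      have h := ((hasFDerivAt_id (𝕜 := ℝ) x).prodMk (hasFDerivAt_const t x)).prodMk
        (hasFDerivAt_const v x)
      exact h
    have h2 := ((hΘd ((x, t), v)).hasFDerivAt.comp x h1).fderiv
    rw [show (fun x => A.act t x v) = Θ ∘ fun x => ((x, t), v) from rfl, h2]
    rfl
  have hI : PolyMap fun p : ((Fin d → ℝ) × ℝ) × (Fin n → ℝ) => ((Θ p, p.1.2), -p.2) :=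
    PolyMap.prodMk (hΘ.prodMk (.clm ((ContinuousLinearMap.snd ℝ (Fin d → ℝ) ℝ).comp
      (ContinuousLinearMap.fst ℝ ((Fin d → ℝ) × ℝ) (Fin n → ℝ)))))
      (.clm (-ContinuousLinearMap.snd ℝ ((Fin d → ℝ) × ℝ) (Fin n → ℝ)))
  -- The Jacobian at the inverse arrow is the reciprocal of the Jacobian. As the inversion is
  -- polynomial, `J` has a polynomial reciprocal and is constant; at `v = 0` it equals `1`.
  have h1 : ∀ p, J p * J ((Θ p, p.1.2), -p.2) = 1 := by
    rintro ⟨⟨x, t⟩, v⟩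
    have h2 := (hd t (-v) (A.act t x v)).hasFDerivAt.comp x (hd t v x).hasFDerivAt
    rw [show (fun x => A.act t x (-v)) ∘ (fun x => A.act t x v) = id from
      funext fun x => A.act_neg_act t x v] at h2
    have h3 := congrArg ContinuousLinearMap.det (h2.unique (hasFDerivAt_id x))
    have h5 : ∀ S T : (Fin d → ℝ) →L[ℝ] (Fin d → ℝ), (S.comp T).det = S.det * T.det :=
      fun S T => LinearMap.det_comp _ _
    rw [h5, mul_comm] at h3
    refine h3.trans ?_
    simp [ContinuousLinearMap.det]
  refine measurePreserving_of_det_eq_one (hd t v) ⟨fun x y h => ?_, fun y => ⟨_, A.act_act_neg t y v⟩⟩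
    fun x => ?_
  · have h : A.act t x v = A.act t y v := h
    rw [← A.act_neg_act t x v, h, A.act_neg_act]
  · refine (Poly.eq_of_mul_eq_one hJ (hI.mem_comp hJ) h1 ((x, t), v) ((x, t), 0)).trans ?_
    have h2 : (fun x => A.act t x 0) = id := funext fun x => A.act_zero' t x
    simp only [J, h2, fderiv_id]
    simp [ContinuousLinearMap.det]

end ShubinAction

end Shubin

namespace Shubin

/-! ### Flatness under transposition. -/

section FlatTranspose

variable {n : ℕ} {N : Type} [NormedAddCommGroup N] [NormedSpace ℝ N] [FiniteDimensional ℝ N]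

/-- A real polynomial as an element of `𝓞_M`. -/
noncomputable def OM.ofPoly {E : Type} [NormedAddCommGroup E] [NormedSpace ℝ E] (p : E → ℝ)
    (hp : p ∈ Poly E) : OM E :=
  OM.mk (fun x => (p x : ℂ)) ((hasTemperateGrowth_ofReal_clm (ContinuousLinearMap.id ℝ ℝ)).comp
    (Poly.hasTemperateGrowth hp))

@[simp] lemma OM.ofPoly_apply {E : Type} [NormedAddCommGroup E] [NormedSpace ℝ E] (p : E → ℝ)
    (hp : p ∈ Poly E) (x : E) : OM.ofPoly p hp x = (p x : ℂ) := rfl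

lemma OM.deriv_ofPoly {E : Type} [NormedAddCommGroup E] [NormedSpace ℝ E] (p : E → ℝ)
    (hp : p ∈ Poly E) (e : E) : OM.deriv e (OM.ofPoly p hp)
      = OM.ofPoly _ (Poly.fderiv_apply hp e) := by
  ext x
  have h : HasFDerivAt (⇑(OM.ofPoly p hp)) (Complex.ofRealCLM.comp (fderiv ℝ p x)) x :=
    Complex.ofRealCLM.hasFDerivAt.comp x (Poly.differentiable hp x).hasFDerivAt
  rw [OM.deriv_apply, h.fderiv]
  rfl

lemma mono_append {G : Type} [NormedAddCommGroup G] [NormedSpace ℝ G] [FiniteDimensional ℝ G]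
    (L L' : List (G →L[ℝ] ℝ)) : mono N (L ++ L') = mono N L * mono N L' := by
  simp [mono]

lemma pullback_ofPoly_mem_span {G : Type} [NormedAddCommGroup G] [NormedSpace ℝ G]
    [FiniteDimensional ℝ G] {p : G → ℝ} (hp : p ∈ Poly G) :
    OM.pullback (Prod.snd : N × G → G) hasTemperateGrowth_snd (OM.ofPoly p hp)
      ∈ Submodule.span ℂ (Set.range (mono N (G := G))) := by
  induction hp using Poly.induction with
  | clm ℓ =>
    refine Submodule.subset_span ⟨[ℓ], ?_⟩
    ext x
    simp [mono]
  | const c =>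
    have h : mono N ([] : List (G →L[ℝ] ℝ)) ∈ Submodule.span ℂ (Set.range (mono N (G := G))) :=
      Submodule.subset_span ⟨[], rfl⟩
    convert Submodule.smul_mem _ (c : ℂ) h using 1
    ext x
    exact (mul_one _).symm
  | add f g hf hg h h' =>
    convert add_mem h h' using 1
    ext x
    simp
  | mul f g hf hg h h' =>
    have h1 := Submodule.mul_mem_mul h h'
    rw [Submodule.span_mul_span] at h1
    convert Submodule.span_mono (Set.mul_subset_iff.2 ?_) h1 using 1
    · ext x
      simp
    · rintro _ ⟨L, rfl⟩ _ ⟨L', rfl⟩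
      exact ⟨L ++ L', mono_append L L'⟩

lemma OM.deriv_left_mono {G : Type} [NormedAddCommGroup G] [NormedSpace ℝ G]
    [FiniteDimensional ℝ G] (e : N) (L : List (G →L[ℝ] ℝ)) :
    OM.deriv (e, (0 : G)) (mono N L) = 0 := by
  induction L with
  | nil =>
    ext x
    have h : ⇑(mono N ([] : List (G →L[ℝ] ℝ))) = fun _ => 1 := rfl
    rw [OM.deriv_apply, h]
    simp
  | cons ℓ L ih =>
    have h : mono N (ℓ :: L) = OM.ofClm (ℓ.comp (ContinuousLinearMap.snd ℝ N G)) * mono N L := rfl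
    have h1 : OM.deriv (e, (0 : G)) (OM.ofClm (ℓ.comp (ContinuousLinearMap.snd ℝ N G))) = 0 := by
      ext x
      have h : HasFDerivAt (⇑(OM.ofClm (ℓ.comp (ContinuousLinearMap.snd ℝ N G))))
          (Complex.ofRealCLM.comp (ℓ.comp (ContinuousLinearMap.snd ℝ N G))) x :=
        Complex.ofRealCLM.hasFDerivAt.comp x (ℓ.comp (ContinuousLinearMap.snd ℝ N G)).hasFDerivAt
      rw [OM.deriv_apply, h.fderiv]
      simp
    rw [h, OM.deriv_mul, ih, h1, zero_mul, mul_zero, add_zero]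

lemma FlatOp.apply_ofPoly {G : Type} [NormedAddCommGroup G] [NormedSpace ℝ G]
    [FiniteDimensional ℝ G] {v : OM (N × G) →L[ℂ] OM N} (hv : FlatOp v) {p : G → ℝ}
    (hp : p ∈ Poly G) : v (OM.pullback Prod.snd hasTemperateGrowth_snd (OM.ofPoly p hp)) 0 = 0 := by
  have h : Submodule.span ℂ (Set.range (mono N (G := G)))
      ≤ LinearMap.ker ((OM.eval (0 : N)).comp v).toLinearMap := by
    rw [Submodule.span_le]
    rintro _ ⟨L, rfl⟩
    exact hv [] L
  exact h (pullback_ofPoly_mem_span hp)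

lemma deriv_ofSchwartz_op (F : 𝓢(N × (Fin n → ℝ), ℂ)) (e : N) (φ : OM (N × (Fin n → ℝ))) :
    OM.deriv e ((ofSchwartz F).op φ) = (ofSchwartz (LineDeriv.lineDerivOp (e, (0 : Fin n → ℝ)) F)).op φ
      + (ofSchwartz F).op (OM.deriv (e, 0) φ) := deriv_schwartzLin F φ e

/-- Monomials in `v` do not depend on the base, so differentiating `F` along the base amounts to
differentiating the output. -/
lemma FlatOp.lineDerivOp {F : 𝓢(N × (Fin n → ℝ), ℂ)} (hF : FlatOp (ofSchwartz F).op) (e : N) :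
    FlatOp (ofSchwartz (LineDeriv.lineDerivOp (e, (0 : Fin n → ℝ)) F)).op := fun D L => by
  have h := deriv_ofSchwartz_op F e (mono N L)
  rw [OM.deriv_left_mono, map_zero, add_zero] at h
  rw [← h]
  exact hF (e :: D) L

/-- Flatness is preserved by transposition along a polynomial involution `(x, v) ↦ (θ(x, v), -v)`. -/
lemma FlatOp.transpose {θ : N × (Fin n → ℝ) → N} (hθ : PolyMap θ) (h0 : ∀ v, θ (0, v) = 0)
    (hinv : ∀ p, θ (θ p, -p.2) = p.1) {F F' : 𝓢(N × (Fin n → ℝ), ℂ)}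
    (hF : FlatOp (ofSchwartz F).op) (h : ∀ p, F' p = F (θ p, -p.2)) :
    FlatOp (ofSchwartz F').op := by
  have hI : PolyMap fun p : N × (Fin n → ℝ) => (θ p, -p.2) :=
    hθ.prodMk (.clm (-ContinuousLinearMap.snd ℝ N (Fin n → ℝ)))
  -- The induction is over polynomials in both variables, because the chain rule through `θ`
  -- produces coefficients depending on base and fibre.
  suffices hs : ∀ (D : List N) (F F' : 𝓢(N × (Fin n → ℝ), ℂ)) (p : N × (Fin n → ℝ) → ℝ)
      (hp : p ∈ Poly _), FlatOp (ofSchwartz F).op → (∀ q, F' q = F (θ q, -q.2)) →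
      OM.derivs D ((ofSchwartz F').op (OM.ofPoly p hp)) 0 = 0 by
    intro D L
    have h1 : ∃ (p : N × (Fin n → ℝ) → ℝ) (hp : p ∈ Poly _), mono N L = OM.ofPoly p hp := by
      induction L with
      | nil => exact ⟨_, const_mem_Poly 1, by ext x; simp [mono]⟩
      | cons ℓ L ih =>
        obtain ⟨p, hp, h⟩ := ih
        refine ⟨_, mul_mem (clm_mem_Poly (ℓ.comp (ContinuousLinearMap.snd ℝ N (Fin n → ℝ)))) hp, ?_⟩
        ext x
        rw [mono_cons, mulSnd_apply, h]
        simp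
    obtain ⟨p, hp, h1⟩ := h1
    rw [h1]
    exact hs D F F' p hp hF h
  intro D
  induction D with
  | nil =>
    intro F F' p hp hF h
    -- No derivatives remain, and `θ` fixes the base point `0`; so the substitution `v ↦ -v` reduces
    -- to the flatness of `F` on a polynomial in `v`.
    have hq : PolyMap fun v : Fin n → ℝ => ((0 : N), -v) :=
      PolyMap.prodMk (.const 0) (.clm (-ContinuousLinearMap.id ℝ (Fin n → ℝ)))
    have h1 := hF.apply_ofPoly (hq.mem_comp hp)
    change ofSchwartz F _ 0 = 0 at h1
    change ofSchwartz F' _ 0 = 0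
    rw [ofSchwartz_apply] at h1 ⊢
    rw [← h1, ← integral_neg_eq_self]
    simp [h, h0]
  | cons e D ih =>
    intro F F' p hp hF h
    change OM.derivs D (OM.deriv e ((ofSchwartz F').op (OM.ofPoly p hp))) 0 = 0
    rw [deriv_ofSchwartz_op, OM.deriv_ofPoly, map_add, OM.add_apply, ih F F' _ _ hF h, add_zero]
    let b := Module.finBasis ℝ N
    let c : Fin (Module.finrank ℝ N) → N × (Fin n → ℝ) → ℝ := fun i q =>
      LinearMap.toContinuousLinearMap (b.coord i) (fderiv ℝ θ q (e, 0))
    have hc : ∀ i, c i ∈ Poly _ := fun i => hθ.fderiv_apply (e, 0) _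
    have hsch : ∀ i, ∃ g : 𝓢(N × (Fin n → ℝ), ℂ), ∀ q,
        g q = LineDeriv.lineDerivOp (b i, (0 : Fin n → ℝ)) F (θ q, -q.2) := fun i => by
      obtain ⟨g, hg⟩ := (LineDeriv.lineDerivOp (b i, (0 : Fin n → ℝ)) F).isSchwartz.comp
        hI.hasTemperateGrowth hI.hasTemperateGrowth (fun q => by simp [hinv])
      exact ⟨g, congrFun hg⟩
    choose g hg using hsch
    -- Chain rule: `∂_e F'` is a combination, with polynomial coefficients, of the pull-backs of the
    -- `∂_i F`. These are flat, with one derivative less left to take.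
    have hsum : ∀ q, LineDeriv.lineDerivOp (e, (0 : Fin n → ℝ)) F' q = ∑ i, c i q * g i q := by
      intro q
      have hθd := (hθ.hasTemperateGrowth.1.differentiable (by simp)) q
      have h2 : HasFDerivAt (fun q : N × (Fin n → ℝ) => F (θ q, -q.2)) _ q :=
        (F.differentiable (θ q, -q.2)).hasFDerivAt.comp q (f := fun q : N × (Fin n → ℝ) => (θ q, -q.2))
          (hθd.hasFDerivAt.prodMk (-ContinuousLinearMap.snd ℝ N (Fin n → ℝ)).hasFDerivAt)
      have h3 : (F' : N × (Fin n → ℝ) → ℂ) = fun q => F (θ q, -q.2) := funext h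
      rw [SchwartzMap.lineDerivOp_apply_eq_fderiv, h3, h2.fderiv]
      have h4 : (fderiv ℝ θ q (e, 0), (0 : Fin n → ℝ)) = ∑ i, c i q • (b i, (0 : Fin n → ℝ)) := by
        have h5 : ∀ y : N, (y, (0 : Fin n → ℝ)) = ContinuousLinearMap.inl ℝ N (Fin n → ℝ) y :=
          fun y => rfl
        simp only [h5, ← map_smul, ← map_sum]
        exact congrArg _ (b.sum_repr _).symm
      have h6 : (((fderiv ℝ θ q).prod (-ContinuousLinearMap.snd ℝ N (Fin n → ℝ))) (e, 0))
          = (fderiv ℝ θ q (e, 0), (0 : Fin n → ℝ)) := by simp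
      rw [ContinuousLinearMap.comp_apply, h6, h4, map_sum]
      refine Finset.sum_congr rfl fun i _ => ?_
      rw [map_smul, hg, SchwartzMap.lineDerivOp_apply_eq_fderiv, Complex.real_smul]
    have h7 : (ofSchwartz (LineDeriv.lineDerivOp (e, (0 : Fin n → ℝ)) F')).op (OM.ofPoly p hp)
        = ∑ i, (ofSchwartz (g i)).op (OM.ofPoly _ (mul_mem (hc i) hp)) := by
      ext x
      rw [OM.sum_apply]
      change ofSchwartz _ _ x = ∑ i, ofSchwartz (g i) _ x
      simp only [ofSchwartz_apply]
      rw [← integral_finsetSum _ fun i _ => integrable_schwartz_mul (g i) _ x]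
      refine integral_congr_ae (Filter.Eventually.of_forall fun v => ?_)
      simp only [hsum, Finset.sum_mul]
      refine Finset.sum_congr rfl fun i _ => ?_
      simp
      ring
    rw [h7, map_sum, OM.sum_apply]
    exact Finset.sum_eq_zero fun i _ => ih _ _ _ _ (hF.lineDerivOp (b i)) (hg i)

end FlatTranspose

end Shubin

namespace Shubin

/-! ### Supports, and testing by integrals over the base. -/

section Support

variable {N G : Type} [NormedAddCommGroup N] [NormedSpace ℝ N] [FiniteDimensional ℝ N]
  [NormedAddCommGroup G] [NormedSpace ℝ G] [FiniteDimensional ℝ G]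

lemma eq_zero_of_notMem_fst_tsupport {φ : OM (N × G)} {x : N} (hx : x ∉ Prod.fst '' tsupport φ)
    (v : G) : φ (x, v) = 0 := by
  by_contra h
  exact hx ⟨(x, v), subset_tsupport _ h, rfl⟩

lemma FibredDist.hasCompactSupport_apply (u : FibredDist N G) {φ : OM (N × G)}
    (hφ : HasCompactSupport φ) : HasCompactSupport (u φ) := by
  refine HasCompactSupport.intro (hφ.isCompact.image continuous_fst) fun x hx => ?_
  exact u.apply_eq_zero (eq_zero_of_notMem_fst_tsupport hx)

lemma FibredDist.integrable_apply [MeasureSpace N] [BorelSpace N]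
    [(volume : Measure N).IsAddHaarMeasure] (u : FibredDist N G) {φ : OM (N × G)}
    (hφ : HasCompactSupport φ) : Integrable (u φ) :=
  (u φ).continuous.integrable_of_hasCompactSupport (u.hasCompactSupport_apply hφ)

/-- A fibred distribution is determined by its integrals over the base. -/
lemma FibredDist.eq_zero_of_integral [MeasureSpace N] [BorelSpace N]
    [(volume : Measure N).IsAddHaarMeasure] {u : FibredDist N G}
    (h : ∀ φ : OM (N × G), HasCompactSupport φ → ∫ x, u φ x = 0) : u = 0 := by
  refine FibredDist.ext_compact fun ψ hψ x => ?_
  set φ := OM.pullback (Prod.snd : N × G → G) hasTemperateGrowth_snd ψ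
  have h1 : ∀ᵐ x, u φ x = 0 := by
    refine ae_eq_zero_of_integral_contDiff_smul_eq_zero
      ((u φ).continuous.locallyIntegrable) fun g hg hgc => ?_
    have hgs : IsSchwartz fun x => (g x : ℂ) := IsSchwartz.of_hasCompactSupport
      (hgc.comp_left Complex.ofReal_zero) (Complex.ofRealCLM.contDiff.comp hg)
    let g' : OM N := OM.mk _ hgs.temperate
    have h2 := h (OM.pullback Prod.fst hasTemperateGrowth_fst g' * φ) (by
      refine HasCompactSupport.intro (hgc.isCompact.prod hψ.isCompact) fun p hp => ?_
      change (g p.1 : ℂ) * ψ p.2 = 0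
      rw [Set.mem_prod, not_and_or] at hp
      rcases hp with hp | hp
      · rw [image_eq_zero_of_notMem_tsupport hp, Complex.ofReal_zero, zero_mul]
      · rw [image_eq_zero_of_notMem_tsupport hp, mul_zero])
    rw [u.map_mul] at h2
    rw [← h2]
    refine integral_congr_ae (Filter.Eventually.of_forall fun x => ?_)
    exact Complex.real_smul
  have h2 : (u φ : N → ℂ) = fun _ => 0 :=
    (u φ).continuous.ae_eq_iff_eq volume continuous_const |>.1 h1
  exact congrFun h2 x

end Support

/-- The dilation by `s ≠ 0` as a homeomorphism. -/
noncomputable def dilationHomeo {n : ℕ} (q : Fin n → ℕ) {s : ℝ} (hs : s ≠ 0) :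
    (Fin n → ℝ) ≃ₜ (Fin n → ℝ) where
  toFun := dilation q s
  invFun := dilation q s⁻¹
  left_inv := dilation_inv_dilation q hs
  right_inv := dilation_dilation_inv q hs
  continuous_toFun := (dilation q s).continuous
  continuous_invFun := (dilation q s⁻¹).continuous

/-! ### Transposes on the tangent groupoid. -/

namespace ShubinAction

variable {d n : ℕ} {G : GradedLieGroup n} (A : ShubinAction d G)

/-- The action of `G` on `X × ℝ`. -/
def actN (p : (Fin d → ℝ) × ℝ) (v : Fin n → ℝ) : (Fin d → ℝ) × ℝ := (A.act p.2 p.1 v, p.2)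

lemma polyMap_actN : PolyMap fun p : ((Fin d → ℝ) × ℝ) × (Fin n → ℝ) => A.actN p.1 p.2 :=
  A.polyMap_act.prodMk (.clm ((ContinuousLinearMap.snd ℝ (Fin d → ℝ) ℝ).comp
    (ContinuousLinearMap.fst ℝ ((Fin d → ℝ) × ℝ) (Fin n → ℝ))))

lemma hasTemperateGrowth_actN : Function.HasTemperateGrowth
    fun p : ((Fin d → ℝ) × ℝ) × (Fin n → ℝ) => A.actN p.1 p.2 := A.polyMap_actN.hasTemperateGrowth

lemma actN_neg_actN (p : (Fin d → ℝ) × ℝ) (v : Fin n → ℝ) : A.actN (A.actN p v) (-v) = p :=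
  Prod.ext (A.act_neg_act p.2 p.1 v) rfl

lemma actN_mul (p : (Fin d → ℝ) × ℝ) (v w : Fin n → ℝ) :
    A.actN p (G.mul v w) = A.actN (A.actN p v) w :=
  Prod.ext (A.act_mul' p.2 p.1 v w) rfl

lemma actN_dil (ε : ℝ) (p : (Fin d → ℝ) × ℝ) (v : Fin n → ℝ) :
    A.actN (A.dilN.δ ε p) v = A.dilN.δ ε (A.actN p (G.dilations.δ ε v)) :=
  Prod.ext (A.act_dil ε p.2 p.1 v) rfl

lemma actN_zero_zero (v : Fin n → ℝ) : A.actN 0 v = 0 :=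
  Prod.ext (A.act_zero_zero v) rfl

lemma hasTemperateGrowth_inv : Function.HasTemperateGrowth
    fun p : ((Fin d → ℝ) × ℝ) × (Fin n → ℝ) => (A.actN p.1 p.2, -p.2) :=
  HasTemperateGrowth.prodMk A.hasTemperateGrowth_actN hasTemperateGrowth_snd.neg

lemma exists_tr (f : 𝓢(((Fin d → ℝ) × ℝ) × (Fin n → ℝ), ℂ)) :
    ∃ g : 𝓢(((Fin d → ℝ) × ℝ) × (Fin n → ℝ), ℂ), ∀ p v, g (p, v) = f (A.actN p v, -v) := by
  obtain ⟨g, hg⟩ := f.isSchwartz.comp A.hasTemperateGrowth_inv A.hasTemperateGrowth_inv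
    fun p => by simp [A.actN_neg_actN]
  exact ⟨g, fun p v => congrFun hg (p, v)⟩

/-- The pull-back of a Schwartz function along the inversion of the tangent groupoid. -/
noncomputable def tr (f : 𝓢(((Fin d → ℝ) × ℝ) × (Fin n → ℝ), ℂ)) :
    𝓢(((Fin d → ℝ) × ℝ) × (Fin n → ℝ), ℂ) := (A.exists_tr f).choose

lemma tr_apply (f : 𝓢(((Fin d → ℝ) × ℝ) × (Fin n → ℝ), ℂ)) (p : (Fin d → ℝ) × ℝ) (v : Fin n → ℝ) :
    A.tr f (p, v) = f (A.actN p v, -v) := (A.exists_tr f).choose_spec p v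

lemma flatOp_tr {F : 𝓢(((Fin d → ℝ) × ℝ) × (Fin n → ℝ), ℂ)} (hF : FlatOp (ofSchwartz F).op) :
    FlatOp (ofSchwartz (A.tr F)).op :=
  FlatOp.transpose A.polyMap_actN A.actN_zero_zero (fun p => A.actN_neg_actN p.1 p.2) hF
    fun p => A.tr_apply F p.1 p.2

lemma hasTemperateGrowth_act (t : ℝ) :
    Function.HasTemperateGrowth fun p : (Fin d → ℝ) × (Fin n → ℝ) => A.act t p.1 p.2 :=
  A.polyMap_act.hasTemperateGrowth.comp (f := fun p : (Fin d → ℝ) × (Fin n → ℝ) => ((p.1, t), p.2))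
    (HasTemperateGrowth.prodMk (HasTemperateGrowth.prodMk hasTemperateGrowth_fst (.const t))
      hasTemperateGrowth_snd)

lemma hasTemperateGrowth_invAt (t : ℝ) :
    Function.HasTemperateGrowth fun p : (Fin d → ℝ) × (Fin n → ℝ) => (A.act t p.1 p.2, -p.2) :=
  HasTemperateGrowth.prodMk (A.hasTemperateGrowth_act t) hasTemperateGrowth_snd.neg

/-- The pull-back along the inversion of `X ⋊ᵗ G`. -/
noncomputable def invOM (t : ℝ) : OM ((Fin d → ℝ) × (Fin n → ℝ)) →L[ℂ] OM ((Fin d → ℝ) × (Fin n → ℝ)) :=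
  OM.pullback _ (A.hasTemperateGrowth_invAt t)

lemma invOM_apply (t : ℝ) (φ : OM ((Fin d → ℝ) × (Fin n → ℝ))) (x : Fin d → ℝ) (v : Fin n → ℝ) :
    A.invOM t φ (x, v) = φ (A.act t x v, -v) := rfl

lemma isTranspose_iff {t : ℝ} {P R : Dist d n} : IsTranspose (A.act t) P R ↔
    ∀ φ : OM ((Fin d → ℝ) × (Fin n → ℝ)), HasCompactSupport φ →
      ∫ x, R φ x = ∫ x, P (A.invOM t φ) x := by
  refine forall₂_congr fun φ _ => ⟨?_, fun h => ⟨_, fun x v => A.invOM_apply t φ x v, h⟩⟩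
  rintro ⟨ψ, h1, h2⟩
  have h3 : ψ = A.invOM t φ := OM.ext fun p => h1 p.1 p.2
  rw [h2, h3]

/-- The involution `(x, v) ↦ (θᵗ_{α_s v}(x), -v)` of `X × G`. -/
noncomputable def twist (t s : ℝ) : (Fin d → ℝ) × (Fin n → ℝ) ≃ₜ (Fin d → ℝ) × (Fin n → ℝ) where
  toFun p := (A.act t p.1 (G.dil s p.2), -p.2)
  invFun p := (A.act t p.1 (G.dil s p.2), -p.2)
  left_inv p := by simp [A.act_neg_act]
  right_inv p := by simp [A.act_neg_act]
  continuous_toFun := (A.continuous_act.comp ((continuous_fst.prodMk continuous_const).prodMk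
    ((G.dil s).continuous.comp continuous_snd))).prodMk continuous_snd.neg
  continuous_invFun := (A.continuous_act.comp ((continuous_fst.prodMk continuous_const).prodMk
    ((G.dil s).continuous.comp continuous_snd))).prodMk continuous_snd.neg

lemma twist_apply (t s : ℝ) (p : (Fin d → ℝ) × (Fin n → ℝ)) :
    A.twist t s p = (A.act t p.1 (G.dil s p.2), -p.2) := rfl

/-- After swapping the factors this is a skew product of the reflection of `G` with the volume
preserving maps `θᵗ_{α_s v}`. -/
lemma measurePreserving_twist (t s : ℝ) : MeasurePreserving (A.twist t s) := by
  have hc : Continuous fun p : (Fin n → ℝ) × (Fin d → ℝ) => A.act t p.2 (G.dil s p.1) :=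
    A.continuous_act.comp ((continuous_snd.prodMk continuous_const).prodMk
      ((G.dil s).continuous.comp continuous_fst))
  have h := (Measure.measurePreserving_neg (volume : Measure (Fin n → ℝ))).skew_product
    (g := fun v x => A.act t x (G.dil s v)) (μb := volume) (μc := volume) (μd := volume)
    hc.measurable (Filter.Eventually.of_forall fun v => (A.measurePreserving_act t _).map_eq)
  exact (Measure.measurePreserving_swap.comp (h.comp Measure.measurePreserving_swap))

lemma integral_twist (t s : ℝ) {f : (Fin d → ℝ) × (Fin n → ℝ) → ℂ} (hf : Integrable f) :
    ∫ x, ∫ v, f (A.act t x (G.dil s v), -v) = ∫ x, ∫ v, f (x, v) := by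
  have h := A.measurePreserving_twist t s
  have he := (A.twist t s).measurableEmbedding
  rw [← integral_prod (fun p : (Fin d → ℝ) × (Fin n → ℝ) => f (A.act t p.1 (G.dil s p.2), -p.2))
    ((h.integrable_comp_emb he).2 hf), ← integral_prod f hf]
  exact h.integral_comp he f

/-- By equivariance, pulling back along the inversion and then rescaling by `ε` is the same as
rescaling first and substituting by `twist t ε`, which preserves the volume. The condition `ε ≠ 0`
keeps the support of the rescaled test function compact. -/
lemma integral_tr (F : 𝓢(((Fin d → ℝ) × ℝ) × (Fin n → ℝ), ℂ)) (t : ℝ) {ε : ℝ} (hε : ε ≠ 0)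
    {φ : OM ((Fin d → ℝ) × (Fin n → ℝ))} (hφ : HasCompactSupport φ) :
    ∫ x, ∫ v, A.tr F (A.dilN.δ ε (x, t), v) * φ (x, G.dilations.δ ε v)
      = ∫ x, ∫ v, F (A.dilN.δ ε (x, t), v) * A.invOM t φ (x, G.dilations.δ ε v) := by
  let h : (Fin d → ℝ) × (Fin n → ℝ) ≃ₜ (Fin d → ℝ) × (Fin n → ℝ) :=
    ((Homeomorph.refl (Fin d → ℝ)).prodCongr (dilationHomeo G.weight hε)).trans (A.twist t 1)
  have hh : ∀ x v, φ (h (x, v)) = A.invOM t φ (x, G.dilations.δ ε v) := by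
    intro x v
    change φ (A.act t x (G.dil 1 (G.dil ε v)), -G.dil ε v) = φ (A.act t x (G.dil ε v), -G.dil ε v)
    rw [dilation_one]
  have hc := hφ.comp_homeomorph h
  let f : (Fin d → ℝ) × (Fin n → ℝ) → ℂ := fun p => F (A.dilN.δ ε (p.1, t), p.2) * φ (h p)
  have hf : Integrable f := by
    refine Continuous.integrable_of_hasCompactSupport (Continuous.mul ?_ (φ.continuous.comp
      h.continuous)) hc.mul_left
    exact F.continuous.comp (((A.dilN.δ ε).continuous.comp (by fun_prop)).prodMk continuous_snd)
  have h1 := A.integral_twist t ε hf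
  simp only [f, hh] at h1
  rw [← h1]
  refine integral_congr_ae (Filter.Eventually.of_forall fun x =>
    integral_congr_ae (Filter.Eventually.of_forall fun v => ?_))
  simp only [tr_apply, A.actN_dil, map_neg, invOM_apply, neg_neg]
  rw [show A.act t (A.act t x (G.dil ε v)) (-(G.dilations.δ ε v)) = x from A.act_neg_act t x _]
  rfl

lemma isTranspose_ofSchwartz (F : 𝓢(((Fin d → ℝ) × ℝ) × (Fin n → ℝ), ℂ)) (t : ℝ) :
    IsTranspose (A.act t) (ev t (ofSchwartz F)) (ev t (ofSchwartz (A.tr F))) := by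
  refine A.isTranspose_iff.2 fun φ hφ => ?_
  have h := A.integral_tr F t one_ne_zero hφ
  simp only [A.dilN.one, G.dilations.one] at h
  exact h

/-- All terms vanish off the compact projection of the support of `φ`, and on it they are dominated
by a geometric series; so the series may be integrated over `X` termwise. -/
lemma hasSum_integral_ev_flatDist (m : ℝ) {F : 𝓢(((Fin d → ℝ) × ℝ) × (Fin n → ℝ), ℂ)}
    (hF : FlatOp (ofSchwartz F).op) (t : ℝ) {φ : OM ((Fin d → ℝ) × (Fin n → ℝ))}
    (hφ : HasCompactSupport φ) :
    HasSum (fun j : ℕ => ((2 : ℝ) ^ m : ℝ) ^ j * ∫ x, ∫ v, F (A.dilN.δ ((1 / 2) ^ j) (x, t), v)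
        * φ (x, G.dilations.δ ((1 / 2) ^ j) v))
      (∫ x, ev t (flatDist A.dilN G.dilations m (ofSchwartz F).op hF) φ x) := by
  let φ' := OM.pullback (Prod.map (Prod.fst : (Fin d → ℝ) × ℝ → _) (id : (Fin n → ℝ) → _))
    (hasTemperateGrowth_prodMap hasTemperateGrowth_fst .id) φ
  let Θ := fam A.dilN G.dilations (ofSchwartz F).op id .id φ'
  have hΘ : ∀ ε x, Θ (ε, (x, t)) = ∫ v, F (A.dilN.δ ε (x, t), v) * φ (x, G.dilations.δ ε v) :=
    fun ε x => fam_ofSchwartz_apply A.dilN G.dilations F id .id φ' ε (x, t)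
  have hflat : Θ ∈ OM.flat _ := fam_mem_flat A.dilN G.dilations hF id .id φ'
  obtain ⟨k, C, hC0, hC⟩ := OM.exists_dyadic_le m hflat
  let K := Prod.fst '' tsupport φ
  have hK : IsCompact K := hφ.isCompact.image continuous_fst
  let B : (Fin d → ℝ) → ℝ := fun x => C * (1 + ‖(x, t)‖) ^ k
  have hB : Continuous B := by fun_prop
  have hs : ∀ x, HasSum (fun j : ℕ => K.indicator B x * (1 / 2 : ℝ) ^ j) (K.indicator B x * 2) :=
    fun x => hasSum_geometric_two.mul_left _
  have h1 : ∀ j : ℕ, ((2 : ℝ) ^ m : ℝ) ^ j * ∫ x, ∫ v, F (A.dilN.δ ((1 / 2) ^ j) (x, t), v)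
        * φ (x, G.dilations.δ ((1 / 2) ^ j) v) = ∫ x, dyadic m Θ (x, t) j := by
    intro j
    simp only [dyadic, hΘ]
    rw [integral_const_mul]
    push_cast
    rfl
  simp only [h1]
  refine hasSum_integral_of_dominated_convergence
    (bound := fun j x => K.indicator B x * (1 / 2 : ℝ) ^ j)
    (fun j => ?_) (fun j => Filter.Eventually.of_forall fun x => ?_)
    (Filter.Eventually.of_forall fun x => (hs x).summable) ?_
    (Filter.Eventually.of_forall fun x => hasSum_flatDist A.dilN G.dilations m _ hF φ' (x, t))
  · exact (continuous_const.mul (Θ.continuous.comp (by fun_prop))).aestronglyMeasurable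
  · by_cases hx : x ∈ K
    · rw [Set.indicator_of_mem hx]
      exact hC _ _
    · rw [Set.indicator_of_notMem hx, zero_mul]
      simp [dyadic, hΘ, eq_zero_of_notMem_fst_tsupport hx]
  · simp only [fun x => (hs x).tsum_eq]
    exact ((hB.continuousOn.integrableOn_compact hK).integrable_indicator hK.measurableSet).mul_const 2

lemma hasCompactSupport_invOM (t : ℝ) {φ : OM ((Fin d → ℝ) × (Fin n → ℝ))}
    (hφ : HasCompactSupport φ) : HasCompactSupport (A.invOM t φ) := by
  convert hφ.comp_homeomorph (A.twist t 1) using 1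
  ext p
  rw [Function.comp, twist_apply, dilation_one]
  rfl

/-- `integral_tr` transposes the rescaled terms one by one, with the same function `A.tr F` in each
of them. -/
lemma isTranspose_flatDist (m : ℝ) {F : 𝓢(((Fin d → ℝ) × ℝ) × (Fin n → ℝ), ℂ)}
    (hF : FlatOp (ofSchwartz F).op) (t : ℝ) : IsTranspose (A.act t)
      (ev t (flatDist A.dilN G.dilations m (ofSchwartz F).op hF))
      (ev t (flatDist A.dilN G.dilations m (ofSchwartz (A.tr F)).op (A.flatOp_tr hF))) := by
  refine A.isTranspose_iff.2 fun φ hφ => ?_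
  have h1 := A.hasSum_integral_ev_flatDist m (A.flatOp_tr hF) t hφ
  have h2 := A.hasSum_integral_ev_flatDist m hF t (A.hasCompactSupport_invOM t hφ)
  have h3 := fun j : ℕ => A.integral_tr F t (ε := (1 / 2) ^ j) (by positivity) hφ
  simp only [h3] at h1
  exact h1.unique h2

lemma IsTranspose.add' {t : ℝ} {P R P' R' : Dist d n} (h : IsTranspose (A.act t) P R)
    (h' : IsTranspose (A.act t) P' R') : IsTranspose (A.act t) (P + P') (R + R') := by
  rw [isTranspose_iff] at *
  intro φ hφ
  have hφ' := A.hasCompactSupport_invOM t hφ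
  simp only [FibredDist.add_apply, OM.add_apply]
  rw [integral_add (R.integrable_apply hφ) (R'.integrable_apply hφ),
    integral_add (P.integrable_apply hφ') (P'.integrable_apply hφ'), h φ hφ, h' φ hφ]

lemma IsTranspose.smul' {t : ℝ} {P R : Dist d n} (h : IsTranspose (A.act t) P R) (c : ℂ) :
    IsTranspose (A.act t) (c • P) (c • R) := by
  rw [isTranspose_iff] at *
  intro φ hφ
  simp only [FibredDist.smul_apply, OM.smul_apply, integral_const_mul, h φ hφ]

lemma IsTranspose.sub' {t : ℝ} {P R P' R' : Dist d n} (h : IsTranspose (A.act t) P R)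
    (h' : IsTranspose (A.act t) P' R') : IsTranspose (A.act t) (P - P') (R - R') := by
  have h1 := IsTranspose.add' A h (IsTranspose.smul' A h' (-1))
  simpa [sub_eq_add_neg] using h1

lemma IsTranspose.unique' {t : ℝ} {P R R' : Dist d n} (h : IsTranspose (A.act t) P R)
    (h' : IsTranspose (A.act t) P R') : R = R' := by
  refine sub_eq_zero.1 (FibredDist.eq_zero_of_integral fun φ hφ => ?_)
  have h1 := A.isTranspose_iff.1 (IsTranspose.sub' A h h') φ hφ
  rw [sub_self] at h1
  simpa using h1

/-- By locality, the value at `(x, t)` depends only on the restriction of the test function to the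
slice over `t`. -/
lemma ev_ext {P Q : TangentDist d n} (h : ∀ t, (ev t P : Dist d n) = ev t Q) : P = Q := by
  refine FibredDist.ext fun φ p => ?_
  obtain ⟨x, t⟩ := p
  let φ' : OM ((Fin d → ℝ) × (Fin n → ℝ)) :=
    OM.pullback (Prod.map (fun x => (x, t)) id) (hasTemperateGrowth_prodMap
      (hasTemperateGrowth_slice t) .id) φ
  have h1 : ∀ P : TangentDist d n, P φ (x, t) = ev t P φ' x := fun P =>
    P.apply_congr fun v => rfl
  rw [h1, h1, h]

/-- The zoom maps the slice over `s * t` to the one over `t` and intertwines the inversions. The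
Jacobian of the dilation of `X` enters both integrals as the same factor. -/
lemma isTranspose_zoom {s : ℝ} (hs : 0 < s) {P R : TangentDist d n}
    (h : ∀ t, IsTranspose (A.act t) (ev t P) (ev t R)) (t : ℝ) :
    IsTranspose (A.act t) (ev t (A.zoom s hs P)) (ev t (A.zoom s hs R)) := by
  refine A.isTranspose_iff.2 fun φ hφ => ?_
  obtain ⟨c, hc⟩ := exists_integral_comp_eq (A.dil s⁻¹) (A.dil s) (A.dilX.inv_apply hs.ne')
  let T : OM ((Fin d → ℝ) × (Fin n → ℝ)) →L[ℂ] OM ((Fin d → ℝ) × (Fin n → ℝ)) :=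
    OM.pullback (Prod.map (A.dil s⁻¹) (G.dil s)) (hasTemperateGrowth_prodMap
      (ContinuousLinearMap.hasTemperateGrowth _) (ContinuousLinearMap.hasTemperateGrowth _))
  have h1 : ∀ (Q : TangentDist d n) (ψ : OM ((Fin d → ℝ) × (Fin n → ℝ))),
      ∫ x, ev t (A.zoom s hs Q) ψ x = c * ∫ x, ev (s * t) Q (T ψ) x := by
    intro Q ψ
    have h2 : ∀ x, ev t (A.zoom s hs Q) ψ x = ev (s * t) Q (T ψ) (A.dil s x) := fun x => rfl
    rw [hc]
    simp only [h2, dilation_dilation_inv A.weight hs.ne']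
  have hcs : HasCompactSupport (T φ) := hφ.comp_homeomorph
    ((dilationHomeo A.weight (inv_ne_zero hs.ne')).prodCongr (dilationHomeo G.weight hs.ne'))
  rw [h1, h1, A.isTranspose_iff.1 (h (s * t)) (T φ) hcs]
  have h3 : A.invOM (s * t) (T φ) = T (A.invOM t φ) := OM.ext fun p => by
    change φ (A.dil s⁻¹ (A.act (s * t) p.1 p.2), G.dil s (-p.2))
      = φ (A.act t (A.dil s⁻¹ p.1) (G.dil s p.2), -G.dil s p.2)
    have h4 := A.act_dil s⁻¹ (s * t) p.1 (G.dil s p.2)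
    rw [inv_mul_cancel_left₀ hs.ne', dilation_inv_dilation _ hs.ne'] at h4
    rw [h4, map_neg]
  rw [h3]

/-- Essentially homogeneous fibred distributions on the tangent groupoid have transposes. -/
theorem exists_transpose {m : ℝ} {P : TangentDist d n} (hP : P ∈ A.EssTangent m) :
    ∃ R ∈ A.EssTangent m, ∀ t, IsTranspose (A.act t) (ev t P) (ev t R) := by
  obtain ⟨S, F, hF, hdec⟩ := A.exists_decomposition_tangent hP
  let R := ofSchwartz (A.tr S)
    + flatDist A.dilN G.dilations m (ofSchwartz (A.tr F)).op (A.flatOp_tr hF)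
  have hR : ∀ t, IsTranspose (A.act t) (ev t P) (ev t R) := fun t => by
    rw [hdec, map_add, map_add]
    exact IsTranspose.add' A (A.isTranspose_ofSchwartz S t) (A.isTranspose_flatDist m hF t)
  refine ⟨R, A.mem_EssTangent.2 fun s hs => ?_, hR⟩
  obtain ⟨h, hh⟩ := mem_schwartzDist_iff.1 (A.mem_EssTangent.1 hP s hs)
  -- At each `t`, the defect of homogeneity of `R` and `A.tr h` are both transposes of the defect of
  -- `P`; uniqueness of transposes identifies them.
  suffices h1 : ((s ^ m : ℝ) : ℂ) • R - A.zoom s hs R = ofSchwartz (A.tr h) by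
    rw [h1]
    exact ofSchwartz_mem _
  refine ev_ext fun t => ?_
  have h2 := IsTranspose.sub' A (IsTranspose.smul' A (hR t) ((s ^ m : ℝ) : ℂ))
    (A.isTranspose_zoom hs hR t)
  rw [← map_smul, ← map_sub, hh, ← map_smul, ← map_sub] at h2
  exact IsTranspose.unique' A h2 (A.isTranspose_ofSchwartz h t)

end ShubinAction

end Shubin

namespace Shubin

/-! ### Complex conjugation of fibred distributions. -/

section Conj

variable {E : Type} [NormedAddCommGroup E] [NormedSpace ℝ E]

/-- Complex conjugation on `𝓞_M`. -/
noncomputable def OM.conj : OM E →ₗ⋆[ℂ] OM E where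
  toFun φ := OM.mk (fun x => (starRingEnd ℂ) (φ x))
    ((Complex.conjCLE : ℂ →L[ℝ] ℂ).hasTemperateGrowth.comp φ.hasTemperateGrowth)
  map_add' φ ψ := OM.ext fun x => map_add (starRingEnd ℂ) (φ x) (ψ x)
  map_smul' c φ := OM.ext fun x => map_mul (starRingEnd ℂ) c (φ x)

@[simp] lemma OM.conj_apply (φ : OM E) (x : E) : OM.conj φ x = (starRingEnd ℂ) (φ x) := rfl

lemma OM.seminorm_conj (p : 𝓢(E, ℂ) × ℕ) (φ : OM E) :
    OM.seminormFamily E p (OM.conj φ) = OM.seminormFamily E p φ := by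
  have h : ∀ x, ‖iteratedFDeriv ℝ p.2 (OM.conj φ) x‖ = ‖iteratedFDeriv ℝ p.2 φ x‖ := fun x =>
    Complex.conjLIE.norm_iteratedFDeriv_comp_left (f := φ) x p.2
  change (⨆ x, ‖p.1 x‖ * ‖iteratedFDeriv ℝ p.2 (OM.conj φ) x‖) = _
  simp only [h]
  rfl

lemma OM.continuous_conj : Continuous (OM.conj : OM E → OM E) := by
  refine WithSeminorms.continuous_of_isBounded OM.withSeminorms OM.withSeminorms OM.conj
    fun p => ⟨{p}, 1, fun φ => ?_⟩
  simpa using (OM.seminorm_conj p φ).le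

variable {N G : Type} [NormedAddCommGroup N] [NormedSpace ℝ N] [FiniteDimensional ℝ N]
  [NormedAddCommGroup G] [NormedSpace ℝ G] [FiniteDimensional ℝ G]

/-- The complex conjugate of a fibred distribution. -/
noncomputable def FibredDist.conj (u : FibredDist N G) : FibredDist N G :=
  ⟨{ toFun := fun φ => OM.conj (u (OM.conj φ))
     map_add' := fun φ ψ => by
       change OM.conj (u.op _) = OM.conj (u.op _) + OM.conj (u.op _)
       rw [map_add, map_add, map_add]
     map_smul' := fun c φ => by
       change OM.conj (u.op _) = c • OM.conj (u.op _)
       rw [map_smulₛₗ, map_smul, map_smulₛₗ]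
       simp
     cont := OM.continuous_conj.comp (u.op.continuous.comp OM.continuous_conj) }, fun f φ => by
    have h : OM.conj (OM.pullback Prod.fst hasTemperateGrowth_fst f * φ)
        = OM.pullback Prod.fst hasTemperateGrowth_fst (OM.conj f) * OM.conj φ := by
      ext p; simp
    change OM.conj (u (OM.conj _)) = f * OM.conj (u (OM.conj φ))
    rw [h, u.map_mul]
    ext x
    simp⟩

lemma FibredDist.conj_apply (u : FibredDist N G) (φ : OM (N × G)) (x : N) :
    u.conj φ x = (starRingEnd ℂ) (u (OM.conj φ) x) := rfl

lemma FibredDist.conj_sub (u w : FibredDist N G) : (u - w).conj = u.conj - w.conj :=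
  FibredDist.ext fun φ x => map_sub (starRingEnd ℂ) (u (OM.conj φ) x) (w (OM.conj φ) x)

lemma FibredDist.conj_smul (c : ℂ) (u : FibredDist N G) :
    (c • u).conj = (starRingEnd ℂ) c • u.conj :=
  FibredDist.ext fun φ x => _root_.map_mul (starRingEnd ℂ) c (u (OM.conj φ) x)

lemma FibredDist.conj_mem_schwartzDist [MeasureSpace G] [BorelSpace G]
    [(volume : Measure G).IsAddHaarMeasure] {u : FibredDist N G} (hu : u ∈ schwartzDist N G) :
    u.conj ∈ schwartzDist N G := by
  obtain ⟨f, hf⟩ := hu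
  obtain ⟨g, hg⟩ := f.isSchwartz.conj
  refine ⟨g, fun φ x => ?_⟩
  rw [conj_apply, hf, ← integral_conj]
  simp [hg]

end Conj

/-! ### Transposes and adjoints of operators and cosymbols. -/

section AdjointTheory

variable {d n : ℕ} {G : GradedLieGroup n} (A : ShubinAction d G)

lemma IsTranspose.isAdjoint_conj {N : Type} [NormedAddCommGroup N] [NormedSpace ℝ N]
    [FiniteDimensional ℝ N] [MeasureSpace N] {act : N → (Fin n → ℝ) → N}
    {P R : FibredDist N (Fin n → ℝ)} (h : IsTranspose act P R) : IsAdjoint act P R.conj := by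
  intro φ hφ
  obtain ⟨ψ, h1, h2⟩ := h (OM.conj φ) (hφ.comp_left (map_zero (starRingEnd ℂ)))
  refine ⟨ψ, h1, ?_⟩
  rw [← h2, ← integral_conj]
  rfl

namespace ShubinAction

lemma conj_mem_EssTangent {m : ℝ} {P : TangentDist d n} (hP : P ∈ A.EssTangent m) :
    P.conj ∈ A.EssTangent m := by
  refine A.mem_EssTangent.2 fun s hs => ?_
  have h := FibredDist.conj_mem_schwartzDist (A.mem_EssTangent.1 hP s hs)
  rw [FibredDist.conj_sub, FibredDist.conj_smul, Complex.conj_ofReal] at h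
  exact h

/-- Representatives of the principal cosymbol extend to the tangent groupoid. -/
lemma exists_extension {m : ℝ} {P : TangentDist d n} (hP : P ∈ A.EssTangent m) {u : A.Ess m}
    (hu : A.cls u = A.cls ⟨ev 0 P, A.ev_mem_Ess hP⟩) :
    ∃ S : 𝓢(((Fin d → ℝ) × ℝ) × (Fin n → ℝ), ℂ), u.1 = ev 0 (P + ofSchwartz S) := by
  have h0 : u - ⟨ev 0 P, A.ev_mem_Ess hP⟩
      ∈ (schwartzDist (Fin d → ℝ) (Fin n → ℝ)).submoduleOf (A.Ess m) :=
    (Submodule.Quotient.eq _).1 hu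
  have h1 : u.1 - ev 0 P ∈ schwartzDist (Fin d → ℝ) (Fin n → ℝ) := h0
  obtain ⟨f, hf⟩ := mem_schwartzDist_iff.1 h1
  obtain ⟨χ, -, hχ⟩ := exists_schwartz_eq_one_of_abs_le
  -- `f(x, v) χ(t)` is Schwartz and restricts to `f` at `t = 0`, since `χ(0) = 1`.
  obtain ⟨S, hS⟩ := (f.isSchwartz.tensor χ.isSchwartz).comp
    (h := fun p : ((Fin d → ℝ) × ℝ) × (Fin n → ℝ) => ((p.1.1, p.2), p.1.2))
    (HasTemperateGrowth.prodMk (HasTemperateGrowth.prodMk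
      (hasTemperateGrowth_fst.comp hasTemperateGrowth_fst) hasTemperateGrowth_snd)
      (hasTemperateGrowth_snd.comp hasTemperateGrowth_fst))
    (g := fun p => ((p.1.1, p.2), p.1.2))
    (HasTemperateGrowth.prodMk (HasTemperateGrowth.prodMk
      (hasTemperateGrowth_fst.comp hasTemperateGrowth_fst) hasTemperateGrowth_snd)
      (hasTemperateGrowth_snd.comp hasTemperateGrowth_fst)) fun p => rfl
  refine ⟨S, ?_⟩
  have h2 : (ev 0 (ofSchwartz S) : Dist d n) = ofSchwartz f := FibredDist.ext fun φ x => by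
    have h3 : (ev 0 (ofSchwartz S) : Dist d n) φ x = ∫ v, S ((x, 0), v) * φ (x, v) := rfl
    rw [h3, ofSchwartz_apply]
    simp [hS, hχ 0]
  rw [map_add, h2, ← hf, add_sub_cancel]

lemma cls_eq_of_sub_mem {m : ℝ} {u w : A.Ess m}
    (h : u.1 - w.1 ∈ schwartzDist (Fin d → ℝ) (Fin n → ℝ)) : A.cls u = A.cls w :=
  (Submodule.Quotient.eq _).2 h

/-- Transposes of pseudodifferential fibred distributions and of their cosymbols. -/
theorem exists_transpose_psi (m : ℝ) (P : A.Psi m) : ∃ R : A.Psi m,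
    IsTranspose (A.act 1) P.1 R.1 ∧ A.IsCosymbolTranspose (A.sigma m P) (A.sigma m R) := by
  obtain ⟨Q, hQ, hQP⟩ := P.2
  obtain ⟨R, hR, hRQ⟩ := A.exists_transpose hQ
  refine ⟨⟨ev 1 R, R, hR, rfl⟩, hQP ▸ hRQ 1, fun u hu => ?_⟩
  rw [A.sigma_eq P hQ hQP] at hu
  obtain ⟨S, hS⟩ := A.exists_extension hQ hu
  have hQ' := add_mem hQ (A.ofSchwartz_mem_EssTangent m S)
  have hR' := add_mem hR (A.ofSchwartz_mem_EssTangent m (A.tr S))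
  -- The representative is `(Q + S)_0`; its transpose is that of `Q_0` changed by a Schwartz
  -- function, hence of the same class.
  refine ⟨⟨ev 0 (R + ofSchwartz (A.tr S)), A.ev_mem_Ess hR'⟩, ?_, ?_⟩
  · have h := IsTranspose.add' A (hRQ 0) (A.isTranspose_ofSchwartz S 0)
    rw [← map_add, ← map_add, ← hS] at h
    exact h
  · rw [A.sigma_eq _ hR rfl]
    refine A.cls_eq_of_sub_mem ?_
    change ev 0 (R + ofSchwartz (A.tr S)) - ev 0 R ∈ _
    rw [map_add, add_sub_cancel_left]
    exact ev_mem_schwartzDist 0 (ofSchwartz_mem _)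

/-- Adjoints of pseudodifferential fibred distributions and of their cosymbols. -/
theorem exists_adjoint_psi (m : ℝ) (P : A.Psi m) : ∃ R : A.Psi m,
    IsAdjoint (A.act 1) P.1 R.1 ∧ A.IsCosymbolAdjoint (A.sigma m P) (A.sigma m R) := by
  obtain ⟨R, hR, hσ⟩ := A.exists_transpose_psi m P
  obtain ⟨Q, hQ, hQR⟩ := R.2
  have hQ' := A.conj_mem_EssTangent hQ
  refine ⟨⟨ev 1 Q.conj, _, hQ', rfl⟩, ?_, fun u hu => ?_⟩
  · have h := hR.isAdjoint_conj
    rw [← hQR] at h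
    exact h
  · obtain ⟨w, hw, hwR⟩ := hσ u hu
    rw [A.sigma_eq R hQ hQR] at hwR
    -- The transpose `w` of the representative is itself some representative of the transposed
    -- cosymbol. It is extended to the tangent groupoid, so that conjugation can be carried out
    -- there.
    obtain ⟨S, hS⟩ := A.exists_extension hQ hwR
    have hQS := A.conj_mem_EssTangent (add_mem hQ (A.ofSchwartz_mem_EssTangent m S))
    refine ⟨⟨ev 0 (Q + ofSchwartz S).conj, A.ev_mem_Ess hQS⟩, ?_, ?_⟩
    · have h := hw.isAdjoint_conj
      rw [hS] at h
      exact h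
    · rw [A.sigma_eq _ hQ' rfl]
      refine A.cls_eq_of_sub_mem ?_
      change ev 0 (Q + ofSchwartz S).conj - ev 0 Q.conj ∈ _
      rw [← map_sub, ← FibredDist.conj_sub, add_sub_cancel_left]
      exact ev_mem_schwartzDist 0 (FibredDist.conj_mem_schwartzDist (ofSchwartz_mem S))

end ShubinAction

end AdjointTheory

end Shubin

namespace Shubin

/-! ### Schwartz kernels of products with one rescaled factor. -/

section Kernels

variable {n : ℕ} {N Z Y : Type} [NormedAddCommGroup N] [NormedSpace ℝ N] [FiniteDimensional ℝ N]
  [NormedAddCommGroup Z] [NormedSpace ℝ Z] [FiniteDimensional ℝ Z]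
  [NormedAddCommGroup Y] [NormedSpace ℝ Y] [FiniteDimensional ℝ Y]
  (δ : Dilations N) (α : Dilations (Fin n → ℝ))

/-- The kernel is a triple tensor product composed with a map from which `ε` and `v` can be read off
and `z` is recovered by `Ξ'`. This left inverse uses only `α_ε`, never an inverse dilation, so it
stays temperate across `ε = 0`. The cutoff `χ` provides decay in `ε`. -/
lemma isSchwartz_kernel (χ : 𝓢(ℝ, ℂ)) (F : 𝓢(N × (Fin n → ℝ), ℂ)) (f : 𝓢(Y, ℂ))
    {Ξ : Z × (Fin n → ℝ) → Y} {Ξ' : Y × (Fin n → ℝ) → Z} (hΞ : Ξ.HasTemperateGrowth)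
    (hΞ' : Ξ'.HasTemperateGrowth) (hinv : ∀ z a, Ξ' (Ξ (z, a), a) = z) {π : Z → N}
    (hπ : π.HasTemperateGrowth) :
    IsSchwartz fun p : (ℝ × Z) × (Fin n → ℝ) =>
      χ p.1.1 * (F (δ.δ p.1.1 (π p.1.2), p.2) * f (Ξ (p.1.2, α.δ p.1.1 p.2))) := by
  have hε : Function.HasTemperateGrowth fun p : (ℝ × Z) × (Fin n → ℝ) => p.1.1 :=
    hasTemperateGrowth_fst.comp hasTemperateGrowth_fst
  have hz : Function.HasTemperateGrowth fun p : (ℝ × Z) × (Fin n → ℝ) => p.1.2 :=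
    hasTemperateGrowth_snd.comp hasTemperateGrowth_fst
  have hv : Function.HasTemperateGrowth fun q : ℝ × ((N × (Fin n → ℝ)) × Y) => q.2.1.2 :=
    hasTemperateGrowth_snd.comp (hasTemperateGrowth_fst.comp hasTemperateGrowth_snd)
  exact (χ.isSchwartz.tensor (F.isSchwartz.tensor f.isSchwartz)).comp
    (h := fun p : (ℝ × Z) × (Fin n → ℝ) =>
      (p.1.1, ((δ.δ p.1.1 (π p.1.2), p.2), Ξ (p.1.2, α.δ p.1.1 p.2))))
    (HasTemperateGrowth.prodMk hε (HasTemperateGrowth.prodMk (HasTemperateGrowth.prodMk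
      (hasTemperateGrowth_clm_apply (δ.temperate.comp hε) (hπ.comp hz)) hasTemperateGrowth_snd)
      (hΞ.comp (HasTemperateGrowth.prodMk hz
        (hasTemperateGrowth_clm_apply (α.temperate.comp hε) hasTemperateGrowth_snd)))))
    (g := fun q => ((q.1, Ξ' (q.2.2, α.δ q.1 q.2.1.2)), q.2.1.2))
    (HasTemperateGrowth.prodMk (HasTemperateGrowth.prodMk hasTemperateGrowth_fst
      (hΞ'.comp (HasTemperateGrowth.prodMk (hasTemperateGrowth_snd.comp hasTemperateGrowth_snd)
        (hasTemperateGrowth_clm_apply (α.temperate.comp hasTemperateGrowth_fst) hv)))) hv)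
    fun p => by simp [hinv]

lemma isSchwartz_integral_kernel (χ : 𝓢(ℝ, ℂ)) (F : 𝓢(N × (Fin n → ℝ), ℂ)) (f : 𝓢(Y, ℂ))
    {Ξ : Z × (Fin n → ℝ) → Y} {Ξ' : Y × (Fin n → ℝ) → Z} (hΞ : Ξ.HasTemperateGrowth)
    (hΞ' : Ξ'.HasTemperateGrowth) (hinv : ∀ z a, Ξ' (Ξ (z, a), a) = z) {π : Z → N}
    (hπ : π.HasTemperateGrowth) :
    IsSchwartz fun q : ℝ × Z =>
      χ q.1 * ∫ a, F (δ.δ q.1 (π q.2), a) * f (Ξ (q.2, α.δ q.1 a)) := by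
  convert (isSchwartz_kernel δ α χ F f hΞ hΞ' hinv hπ).integral_right using 2 with q
  rw [← integral_const_mul]

lemma exists_schwartz_eq_integral_kernel (F : 𝓢(N × (Fin n → ℝ), ℂ)) (f : 𝓢(Y, ℂ))
    {Ξ : Z × (Fin n → ℝ) → Y} {Ξ' : Y × (Fin n → ℝ) → Z} (hΞ : Ξ.HasTemperateGrowth)
    (hΞ' : Ξ'.HasTemperateGrowth) (hinv : ∀ z a, Ξ' (Ξ (z, a), a) = z) {π : Z → N}
    (hπ : π.HasTemperateGrowth) :
    ∃ h : 𝓢(Z, ℂ), ∀ z, h z = ∫ a, F (δ.δ 1 (π z), a) * f (Ξ (z, α.δ 1 a)) := by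
  obtain ⟨χ, -, hχ⟩ := exists_schwartz_eq_one_of_abs_le
  obtain ⟨h, hh⟩ := (isSchwartz_integral_kernel δ α χ F f hΞ hΞ' hinv hπ).comp
    (h := fun z => ((1 : ℝ), z)) (hasTemperateGrowth_mk_left 1) hasTemperateGrowth_snd fun z => rfl
  exact ⟨h, fun z => by rw [congrFun hh z, hχ 1 (by simp), one_mul]⟩

/-- Dyadic sums of flat Schwartz functions may be integrated termwise. -/
lemma hasSum_integral_dyadic_snd (m : ℝ) {Θ : OM (ℝ × (N × (Fin n → ℝ)))} (hΘ : Θ ∈ OM.flat _)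
    (hS : IsSchwartz Θ) (x : N) :
    HasSum (fun j => ∫ v, dyadic m Θ (x, v) j) (∫ v, flatSum m ⟨Θ, hΘ⟩ (x, v)) := by
  obtain ⟨C, hC0, hC⟩ := hS.exists_dyadic_le m hΘ (wexp (Fin n → ℝ))
  have hs : ∀ v : Fin n → ℝ, HasSum (fun j : ℕ => C * wt v * (1 / 2 : ℝ) ^ j) (C * wt v * 2) :=
    fun v => hasSum_geometric_two.mul_left _
  refine hasSum_integral_of_dominated_convergence (bound := fun j v => C * wt v * (1 / 2 : ℝ) ^ j)
    (fun j => ?_) (fun j => Filter.Eventually.of_forall fun v => ?_)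
    (Filter.Eventually.of_forall fun v => (hs v).summable) ?_
    (Filter.Eventually.of_forall fun v => hasSum_flatSum m ⟨Θ, hΘ⟩ (x, v))
  · exact (continuous_const.mul (Θ.continuous.comp (by fun_prop))).aestronglyMeasurable
  · have h1 : ‖dyadic m Θ (x, v) j‖ ≤ (C * (1 / 2 : ℝ) ^ j) * wt v := le_wt (le_trans
      (mul_le_mul_of_nonneg_right (one_add_norm_snd_pow_le _ (x, v)) (norm_nonneg _)) (hC (x, v) j))
    linarith
  · simp only [fun v => (hs v).tsum_eq]
    exact ((integrable_wt volume).const_mul C).mul_const 2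

/-- The integrated kernels form a flat family in `ε`, because `F` is flat, and a Schwartz family
after a cutoff equal to one at all `ε = 2^{-j}`. The dyadic sum of the family is the Schwartz
function `h`, and the same domination allows termwise integration against `φ`. -/
lemma exists_schwartz_hasSum_kernel (m : ℝ) {F : 𝓢(N × (Fin n → ℝ), ℂ)}
    (hF : FlatOp (ofSchwartz F).op) (f : 𝓢(Y, ℂ))
    {Ξ : (N × (Fin n → ℝ)) × (Fin n → ℝ) → Y} {Ξ' : Y × (Fin n → ℝ) → N × (Fin n → ℝ)}
    (hΞ : Ξ.HasTemperateGrowth) (hΞ' : Ξ'.HasTemperateGrowth)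
    (hinv : ∀ z a, Ξ' (Ξ (z, a), a) = z) {π : N × (Fin n → ℝ) → N} (hπ : π.HasTemperateGrowth) :
    ∃ h : 𝓢(N × (Fin n → ℝ), ℂ), ∀ (φ : OM (N × (Fin n → ℝ))) (x : N),
      HasSum (fun j : ℕ => ((2 : ℝ) ^ m : ℝ) ^ j * ∫ b, (∫ a, F (δ.δ ((1 / 2) ^ j) (π (x, b)), a)
        * f (Ξ ((x, b), α.δ ((1 / 2) ^ j) a))) * φ (x, b)) (∫ b, h (x, b) * φ (x, b)) := by
  obtain ⟨χ, -, hχ⟩ := exists_schwartz_eq_one_of_abs_le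
  let H := fam δ α (ofSchwartz F).op π hπ
    (OM.pullback Ξ hΞ (OM.mk f f.isSchwartz.temperate))
  have hH : ∀ ε z, H (ε, z) = ∫ a, F (δ.δ ε (π z), a) * f (Ξ (z, α.δ ε a)) := fun ε z =>
    fam_ofSchwartz_apply δ α F π hπ _ ε z
  let Θ := OM.pullback Prod.fst hasTemperateGrowth_fst (OM.mk χ χ.isSchwartz.temperate) * H
  have hflat : Θ ∈ OM.flat _ := OM.mul_mem_flat _ (fam_mem_flat δ α hF π hπ _)
  have hS : IsSchwartz Θ := by
    convert isSchwartz_integral_kernel δ α χ F f hΞ hΞ' hinv hπ using 1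
    ext q
    change χ q.1 * H (q.1, q.2) = _
    rw [hH]
  obtain ⟨h, hh⟩ := IsSchwartz.flatSum m (Θ := ⟨Θ, hflat⟩) hS
  refine ⟨h, fun φ x => ?_⟩
  let Θφ := OM.pullback (Prod.snd : ℝ × (N × (Fin n → ℝ)) → _) hasTemperateGrowth_snd φ * Θ
  have hflat' : Θφ ∈ OM.flat _ := OM.mul_mem_flat _ hflat
  have hS' : IsSchwartz Θφ := by
    convert hS.mul_OM (OM.pullback Prod.snd hasTemperateGrowth_snd φ) using 1
    ext q
    exact mul_comm _ _
  have hd : ∀ z j, dyadic m Θφ z j = dyadic m Θ z j * φ z := fun z j => by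
    exact (mul_left_comm _ _ _).trans (mul_comm _ _)
  have h1 := hasSum_integral_dyadic_snd m hflat' hS' x
  have h2 : ∀ z, flatSum m ⟨Θφ, hflat'⟩ z = h z * φ z := fun z => by
    have h3 := (hasSum_flatSum m ⟨Θ, hflat⟩ z).mul_right (φ z)
    rw [← hh] at h3
    refine (hasSum_flatSum m ⟨Θφ, hflat'⟩ z).unique ?_
    rwa [← funext (hd z)] at h3
  simp only [h2, hd] at h1
  convert h1 using 2 with j
  rw [← integral_const_mul]
  congr 1
  ext b
  have h4 : χ ((1 / 2) ^ j) = 1 := hχ _ (by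
    rw [abs_of_nonneg (by positivity)]
    exact pow_le_one₀ (by norm_num) (by norm_num))
  have h5 : dyadic m Θ (x, b) j
      = (((2 : ℝ) ^ m) ^ j : ℝ) * (χ ((1 / 2) ^ j) * H ((1 / 2) ^ j, (x, b))) := rfl
  rw [h5, h4, one_mul, hH]
  push_cast
  ring

/-- The kernels may be integrated in either order. -/
lemma integrable_kernel {ε : ℝ} (hε : |ε| ≤ 1) (F : 𝓢(N × (Fin n → ℝ), ℂ)) (f : 𝓢(Y, ℂ))
    {Ξ : (N × (Fin n → ℝ)) × (Fin n → ℝ) → Y} {Ξ' : Y × (Fin n → ℝ) → N × (Fin n → ℝ)}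
    (hΞ : Ξ.HasTemperateGrowth) (hΞ' : Ξ'.HasTemperateGrowth)
    (hinv : ∀ z a, Ξ' (Ξ (z, a), a) = z) {π : N × (Fin n → ℝ) → N} (hπ : π.HasTemperateGrowth)
    (φ : OM (N × (Fin n → ℝ))) (x : N) :
    Integrable (fun p : (Fin n → ℝ) × (Fin n → ℝ) =>
      F (δ.δ ε (π (x, p.1)), p.2) * f (Ξ ((x, p.1), α.δ ε p.2)) * φ (x, p.1)) := by
  obtain ⟨χ, -, hχ⟩ := exists_schwartz_eq_one_of_abs_le
  have h := (isSchwartz_kernel δ α χ F f hΞ hΞ' hinv hπ).comp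
    (h := fun p : (Fin n → ℝ) × (Fin n → ℝ) => ((ε, (x, p.1)), p.2))
    (HasTemperateGrowth.prodMk (HasTemperateGrowth.prodMk (.const ε)
      (HasTemperateGrowth.prodMk (.const x) hasTemperateGrowth_fst)) hasTemperateGrowth_snd)
    (g := fun q => (q.1.2.2, q.2))
    (HasTemperateGrowth.prodMk (hasTemperateGrowth_snd.comp (hasTemperateGrowth_snd.comp
      hasTemperateGrowth_fst)) hasTemperateGrowth_snd) fun p => rfl
  have h1 := h.mul_OM (OM.pullback (fun p : (Fin n → ℝ) × (Fin n → ℝ) => (x, p.1))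
    (HasTemperateGrowth.prodMk (.const x) hasTemperateGrowth_fst) φ)
  simp only [hχ ε hε, one_mul] at h1
  have : (volume : Measure ((Fin n → ℝ) × (Fin n → ℝ))).IsAddHaarMeasure :=
    Measure.prod.instIsAddHaarMeasure volume volume
  exact h1.integrable volume

end Kernels

end Shubin

namespace Shubin

/-! ### Invariant integration on the group. -/

namespace GradedLieGroup

variable {n : ℕ} (G : GradedLieGroup n)

lemma hasTemperateGrowth_mul_comp {E : Type} [NormedAddCommGroup E] [NormedSpace ℝ E]
    {f g : E → Fin n → ℝ} (hf : f.HasTemperateGrowth) (hg : g.HasTemperateGrowth) :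
    Function.HasTemperateGrowth fun x => G.mul (f x) (g x) :=
  G.hasTemperateGrowth_mul.comp (HasTemperateGrowth.prodMk hf hg)

lemma neg_mul_rev (v w : Fin n → ℝ) : -(G.mul v w) = G.mul (-w) (-v) := by
  have h : G.mul (G.mul v w) (G.mul (-w) (-v)) = 0 := by
    rw [G.mul_assoc, G.mul_neg_mul, G.mul_neg]
  rw [← G.neg_mul_mul (G.mul v w) (G.mul (-w) (-v)), h, G.mul_zero]

lemma mul_mul_neg (v w : Fin n → ℝ) : G.mul (G.mul v w) (-w) = v := by
  rw [G.mul_assoc, G.mul_neg, G.mul_zero]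

lemma continuous_mul_left (a : Fin n → ℝ) : Continuous (G.mul a) :=
  G.contDiff_mul.continuous.comp (by fun_prop : Continuous fun v => (a, v))

/-- Left translation as a homeomorphism. -/
def mulLeft (a : Fin n → ℝ) : (Fin n → ℝ) ≃ₜ (Fin n → ℝ) where
  toFun := G.mul a
  invFun := G.mul (-a)
  left_inv := G.neg_mul_mul a
  right_inv := G.mul_neg_mul a
  continuous_toFun := G.continuous_mul_left a
  continuous_invFun := G.continuous_mul_left (-a)

lemma integral_mul_left (a : Fin n → ℝ) (g : (Fin n → ℝ) → ℂ) :
    ∫ v, g (G.mul a v) = ∫ v, g v :=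
  (G.measurePreserving_mul_left a).integral_comp (G.mulLeft a).measurableEmbedding g

lemma integral_mul_right (a : Fin n → ℝ) (g : (Fin n → ℝ) → ℂ) :
    ∫ v, g (G.mul v a) = ∫ v, g v := by
  -- The inversion `v ↦ -v` preserves the volume and exchanges right with left translations.
  rw [← integral_neg_eq_self, ← integral_neg_eq_self (fun v => g v),
    ← G.integral_mul_left (-a) (fun v => g (-v))]
  simp only [G.neg_mul_rev, neg_neg]

end GradedLieGroup

/-! ### Convolution on the tangent groupoid. -/

namespace ShubinAction

variable {d n : ℕ} {G : GradedLieGroup n} (A : ShubinAction d G)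

lemma hasTemperateGrowth_convMap : Function.HasTemperateGrowth
    fun p : ((((Fin d → ℝ) × ℝ) × (Fin n → ℝ)) × (((Fin d → ℝ) × ℝ) × (Fin n → ℝ))) =>
      (p.1.1, G.mul p.1.2 p.2.2) :=
  HasTemperateGrowth.prodMk (hasTemperateGrowth_fst.comp hasTemperateGrowth_fst)
    (G.hasTemperateGrowth_mul_comp (hasTemperateGrowth_snd.comp hasTemperateGrowth_fst)
      (hasTemperateGrowth_snd.comp hasTemperateGrowth_snd))

lemma hasTemperateGrowth_graph : Function.HasTemperateGrowth
    fun p : ((Fin d → ℝ) × ℝ) × (Fin n → ℝ) => (p, A.actN p.1 p.2) :=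
  HasTemperateGrowth.prodMk .id' A.hasTemperateGrowth_actN

/-- The operator `φ ↦ ((p, w) ↦ ⟨Q_{p·w}(v), φ(p, w v)⟩)`. -/
noncomputable def convOp (Q : TangentDist d n) :
    OM (((Fin d → ℝ) × ℝ) × (Fin n → ℝ)) →L[ℂ] OM (((Fin d → ℝ) × ℝ) × (Fin n → ℝ)) :=
  (OM.pullback _ A.hasTemperateGrowth_graph).comp
    ((bc (((Fin d → ℝ) × ℝ) × (Fin n → ℝ)) Q.op).comp
      (OM.pullback _ (hasTemperateGrowth_convMap (G := G))))

lemma convOp_apply (Q : TangentDist d n) (φ : OM (((Fin d → ℝ) × ℝ) × (Fin n → ℝ)))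
    (p : (Fin d → ℝ) × ℝ) (w : Fin n → ℝ) : A.convOp Q φ (p, w)
      = Q (OM.pullback (fun q : ((Fin d → ℝ) × ℝ) × (Fin n → ℝ) => (p, G.mul w q.2))
          (G.hasTemperateGrowth_translate p w) φ) (A.actN p w) := rfl

lemma convOp_mul (Q : TangentDist d n) (f : OM ((Fin d → ℝ) × ℝ))
    (φ : OM (((Fin d → ℝ) × ℝ) × (Fin n → ℝ))) :
    A.convOp Q (OM.pullback Prod.fst hasTemperateGrowth_fst f * φ)
      = OM.pullback Prod.fst hasTemperateGrowth_fst f * A.convOp Q φ := by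
  ext ⟨p, w⟩
  rw [OM.mul_apply, convOp_apply, convOp_apply, OM.pullback_apply]
  have h : OM.pullback (fun q : ((Fin d → ℝ) × ℝ) × (Fin n → ℝ) => (p, G.mul w q.2))
      (G.hasTemperateGrowth_translate p w) (OM.pullback Prod.fst hasTemperateGrowth_fst f * φ)
      = f p • OM.pullback (fun q : ((Fin d → ℝ) × ℝ) × (Fin n → ℝ) => (p, G.mul w q.2))
      (G.hasTemperateGrowth_translate p w) φ := rfl
  rw [h]
  exact congrArg (fun g : OM ((Fin d → ℝ) × ℝ) => g (A.actN p w)) (map_smul Q.op _ _)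

/-- The convolution of fibred distributions on the tangent groupoid. -/
noncomputable def conv (P Q : TangentDist d n) : TangentDist d n :=
  ⟨P.op.comp (A.convOp Q), fun f φ => by
    change P (A.convOp Q _) = f * P (A.convOp Q φ)
    rw [convOp_mul, P.map_mul]⟩

lemma conv_apply (P Q : TangentDist d n) (φ : OM (((Fin d → ℝ) × ℝ) × (Fin n → ℝ))) :
    A.conv P Q φ = P (A.convOp Q φ) := rfl

lemma conv_sub_left (P P' Q : TangentDist d n) :
    A.conv (P - P') Q = A.conv P Q - A.conv P' Q := rfl

lemma conv_add_left (P P' Q : TangentDist d n) :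
    A.conv (P + P') Q = A.conv P Q + A.conv P' Q := rfl

lemma conv_smul_left (c : ℂ) (P Q : TangentDist d n) :
    A.conv (c • P) Q = c • A.conv P Q := rfl

lemma conv_add_right (P Q Q' : TangentDist d n) :
    A.conv P (Q + Q') = A.conv P Q + A.conv P Q' := by
  refine FibredDist.ext fun φ x => ?_
  have h : A.convOp (Q + Q') φ = A.convOp Q φ + A.convOp Q' φ := OM.ext fun p => rfl
  rw [conv_apply, h]
  exact congrArg (fun g : OM ((Fin d → ℝ) × ℝ) => g x) (map_add P.op _ _)

lemma conv_smul_right (c : ℂ) (P Q : TangentDist d n) :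
    A.conv P (c • Q) = c • A.conv P Q := by
  refine FibredDist.ext fun φ x => ?_
  have h : A.convOp (c • Q) φ = c • A.convOp Q φ := OM.ext fun p => rfl
  rw [conv_apply, h]
  exact congrArg (fun g : OM ((Fin d → ℝ) × ℝ) => g x) (map_smul P.op _ _)

lemma conv_sub_right (P Q Q' : TangentDist d n) :
    A.conv P (Q - Q') = A.conv P Q - A.conv P Q' := by
  refine FibredDist.ext fun φ x => ?_
  have h : A.convOp (Q - Q') φ = A.convOp Q φ - A.convOp Q' φ := OM.ext fun p => rfl
  rw [conv_apply, h]
  exact congrArg (fun g : OM ((Fin d → ℝ) × ℝ) => g x) (map_sub P.op _ _)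

/-- The action preserves `t`, and by locality `P` at `(x, t)` sees only the slice over `t`; so
convolution is computed slice by slice. -/
lemma isConvolution_ev (t : ℝ) (P Q : TangentDist d n) :
    G.IsConvolution (A.act t) (ev t P) (ev t Q) (ev t (A.conv P Q)) := by
  intro φ
  let φ' := OM.pullback (Prod.map (Prod.fst : (Fin d → ℝ) × ℝ → _) (id : (Fin n → ℝ) → _))
    (hasTemperateGrowth_prodMap hasTemperateGrowth_fst .id) φ
  refine ⟨OM.pullback (Prod.map (fun x => (x, t)) id) (hasTemperateGrowth_prodMap
      (hasTemperateGrowth_slice t) .id) (A.convOp Q φ'), fun y w => rfl, OM.ext fun x => ?_⟩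
  exact P.apply_congr fun v => rfl

/-- Equivariance of the action and multiplicativity of the dilations make the zoom a groupoid
automorphism; locality discards the discrepancy off the range fibre. -/
lemma zoom_conv {s : ℝ} (hs : 0 < s) (P Q : TangentDist d n) :
    A.zoom s hs (A.conv P Q) = A.conv (A.zoom s hs P) (A.zoom s hs Q) := by
  refine FibredDist.ext fun φ p => ?_
  let T : OM (((Fin d → ℝ) × ℝ) × (Fin n → ℝ)) →L[ℂ] OM (((Fin d → ℝ) × ℝ) × (Fin n → ℝ)) :=
    OM.pullback (Prod.map (A.dilN.δ s⁻¹) (G.dilations.δ s)) (hasTemperateGrowth_prodMap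
      (ContinuousLinearMap.hasTemperateGrowth _) (ContinuousLinearMap.hasTemperateGrowth _))
  have hz : ∀ (R : TangentDist d n) (ψ : OM (((Fin d → ℝ) × ℝ) × (Fin n → ℝ)))
      (q : (Fin d → ℝ) × ℝ), A.zoom s hs R ψ q = R (T ψ) (A.dilN.δ s q) := fun R ψ q => rfl
  rw [hz, conv_apply, conv_apply, hz]
  congr 2
  refine OM.ext fun q => ?_
  obtain ⟨q, w⟩ := q
  have h1 : T (A.convOp (A.zoom s hs Q) φ) (q, w)
      = A.convOp (A.zoom s hs Q) φ (A.dilN.δ s⁻¹ q, G.dilations.δ s w) := rfl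
  have h2 := A.actN_dil s (A.dilN.δ s⁻¹ q) w
  have h3 : A.dilN.δ s (A.dilN.δ s⁻¹ q) = q := by
    have := A.dilN.inv_apply (inv_ne_zero hs.ne') q
    rwa [inv_inv] at this
  rw [h3] at h2
  rw [h1, convOp_apply, convOp_apply, hz, ← h2]
  refine Q.apply_congr fun v => ?_
  change φ (A.dilN.δ s⁻¹ q, G.dil s (G.mul w v))
    = φ (A.dilN.δ s⁻¹ q, G.mul (G.dil s w) (G.dil s v))
  rw [G.dil_mul]

/-- The map occurring in the kernel `∫ F(p, a) f(p·a, a⁻¹ b) da` of a product whose right factor `f`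
is Schwartz. -/
lemma hasTemperateGrowth_leftKernel : Function.HasTemperateGrowth
    fun p : (((Fin d → ℝ) × ℝ) × (Fin n → ℝ)) × (Fin n → ℝ) =>
      (A.actN p.1.1 p.2, G.mul (-p.2) p.1.2) :=
  HasTemperateGrowth.prodMk (A.hasTemperateGrowth_actN.comp (HasTemperateGrowth.prodMk
    (hasTemperateGrowth_fst.comp hasTemperateGrowth_fst) hasTemperateGrowth_snd))
    (G.hasTemperateGrowth_mul_comp hasTemperateGrowth_snd.neg
      (hasTemperateGrowth_snd.comp hasTemperateGrowth_fst))

lemma hasTemperateGrowth_leftKernel' : Function.HasTemperateGrowth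
    fun p : (((Fin d → ℝ) × ℝ) × (Fin n → ℝ)) × (Fin n → ℝ) =>
      (A.actN p.1.1 (-p.2), G.mul p.2 p.1.2) :=
  HasTemperateGrowth.prodMk (A.hasTemperateGrowth_actN.comp (HasTemperateGrowth.prodMk
    (hasTemperateGrowth_fst.comp hasTemperateGrowth_fst) hasTemperateGrowth_snd.neg))
    (G.hasTemperateGrowth_mul_comp hasTemperateGrowth_snd
      (hasTemperateGrowth_snd.comp hasTemperateGrowth_fst))

lemma leftKernel_inv (z : ((Fin d → ℝ) × ℝ) × (Fin n → ℝ)) (a : Fin n → ℝ) :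
    (A.actN (A.actN z.1 a) (-a), G.mul a (G.mul (-a) z.2)) = z := by
  rw [A.actN_neg_actN, G.mul_neg_mul]

/-- The map occurring in the kernel `∫ (tr F)(p·b, v) f(p, b v) dv` of a product whose left factor
`f` is Schwartz. -/
lemma hasTemperateGrowth_rightKernel : Function.HasTemperateGrowth
    fun p : (((Fin d → ℝ) × ℝ) × (Fin n → ℝ)) × (Fin n → ℝ) =>
      (p.1.1, G.mul p.1.2 p.2) :=
  HasTemperateGrowth.prodMk (hasTemperateGrowth_fst.comp hasTemperateGrowth_fst)
    (G.hasTemperateGrowth_mul_comp (hasTemperateGrowth_snd.comp hasTemperateGrowth_fst)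
      hasTemperateGrowth_snd)

lemma hasTemperateGrowth_rightKernel' : Function.HasTemperateGrowth
    fun p : (((Fin d → ℝ) × ℝ) × (Fin n → ℝ)) × (Fin n → ℝ) =>
      (p.1.1, G.mul p.1.2 (-p.2)) :=
  HasTemperateGrowth.prodMk (hasTemperateGrowth_fst.comp hasTemperateGrowth_fst)
    (G.hasTemperateGrowth_mul_comp (hasTemperateGrowth_snd.comp hasTemperateGrowth_fst)
      hasTemperateGrowth_snd.neg)

lemma rightKernel_inv (z : ((Fin d → ℝ) × ℝ) × (Fin n → ℝ)) (a : Fin n → ℝ) :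
    (z.1, G.mul (G.mul z.2 a) (-a)) = z := by
  rw [G.mul_mul_neg]

lemma convOp_ofSchwartz (f : 𝓢(((Fin d → ℝ) × ℝ) × (Fin n → ℝ), ℂ))
    (φ : OM (((Fin d → ℝ) × ℝ) × (Fin n → ℝ))) (p : (Fin d → ℝ) × ℝ) (w : Fin n → ℝ) :
    A.convOp (ofSchwartz f) φ (p, w) = ∫ b, f (A.actN p w, G.mul (-w) b) * φ (p, b) := by
  rw [convOp_apply, ofSchwartz_apply,
    ← G.integral_mul_left w (fun b => f (A.actN p w, G.mul (-w) b) * φ (p, b))]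
  simp only [G.neg_mul_mul]
  rfl

lemma integral_left (F f : 𝓢(((Fin d → ℝ) × ℝ) × (Fin n → ℝ), ℂ))
    (φ : OM (((Fin d → ℝ) × ℝ) × (Fin n → ℝ))) (p : (Fin d → ℝ) × ℝ) {ε : ℝ} (hε : |ε| ≤ 1) :
    ∫ a, F (A.dilN.δ ε p, a) * A.convOp (ofSchwartz f) φ (p, G.dilations.δ ε a)
      = ∫ b, (∫ a, F (A.dilN.δ ε p, a) * f (A.actN p (G.dilations.δ ε a),
          G.mul (-(G.dilations.δ ε a)) b)) * φ (p, b) := by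
  have h := integrable_kernel A.dilN G.dilations hε F f A.hasTemperateGrowth_leftKernel
    A.hasTemperateGrowth_leftKernel' A.leftKernel_inv hasTemperateGrowth_fst φ p
  simp only [convOp_ofSchwartz, ← integral_const_mul, ← integral_mul_const, ← _root_.mul_assoc]
  exact (integral_integral_swap (f := fun b a => F (A.dilN.δ ε p, a)
    * f (A.actN p (G.dilations.δ ε a), G.mul (-(G.dilations.δ ε a)) b) * φ (p, b)) h).symm

/-- In the decomposition of `P`, the Schwartz summand and the dyadic series both have product
kernels of the type treated above. Together with `ofSchwartz_conv_mem` this makes the Schwartz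
functions behave as a two-sided ideal. -/
lemma conv_ofSchwartz_mem (P : TangentDist d n) {m : ℝ} (hP : P ∈ A.EssTangent m)
    (f : 𝓢(((Fin d → ℝ) × ℝ) × (Fin n → ℝ), ℂ)) :
    A.conv P (ofSchwartz f) ∈ schwartzDist ((Fin d → ℝ) × ℝ) (Fin n → ℝ) := by
  obtain ⟨S, F, hF, hdec⟩ := A.exists_decomposition_tangent hP
  rw [hdec, conv_add_left]
  refine add_mem ?_ ?_
  · obtain ⟨h, hh⟩ := exists_schwartz_eq_integral_kernel A.dilN G.dilations S f
      A.hasTemperateGrowth_leftKernel A.hasTemperateGrowth_leftKernel' A.leftKernel_inv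
      hasTemperateGrowth_fst
    refine ⟨h, fun φ x => ?_⟩
    have h1 := A.integral_left S f φ x (ε := 1) (by simp)
    simp only [hh]
    rw [← h1, conv_apply, ofSchwartz_apply]
    simp [A.dilN.one, G.dilations.one]
  · obtain ⟨h, hh⟩ := exists_schwartz_hasSum_kernel A.dilN G.dilations m hF f
      A.hasTemperateGrowth_leftKernel A.hasTemperateGrowth_leftKernel' A.leftKernel_inv
      hasTemperateGrowth_fst
    refine ⟨h, fun φ x => ?_⟩
    refine (hasSum_flatDist A.dilN G.dilations m _ hF (A.convOp (ofSchwartz f) φ) x).unique ?_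
    convert hh φ x using 2 with j
    have hε : |(1 / 2 : ℝ) ^ j| ≤ 1 := by
      rw [abs_of_nonneg (by positivity)]
      exact pow_le_one₀ (by norm_num) (by norm_num)
    rw [← A.integral_left F f φ x hε]
    simp only [dyadic]
    rw [fam_ofSchwartz_apply]
    push_cast
    rfl

/-- Fubini, the reflection `v ↦ -v` and a right translation in the variable of `f` by `α_ε v`. The
kernel of the second factor, based at `p·a`, becomes its transpose based at `p·b`. -/
lemma integral_right (F f : 𝓢(((Fin d → ℝ) × ℝ) × (Fin n → ℝ), ℂ))
    (φ : OM (((Fin d → ℝ) × ℝ) × (Fin n → ℝ))) (p : (Fin d → ℝ) × ℝ) {ε : ℝ} (hε : |ε| ≤ 1) :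
    ∫ a, f (p, a) * ∫ v, F (A.dilN.δ ε (A.actN p a), v) * φ (p, G.mul a (G.dilations.δ ε v))
      = ∫ b, (∫ v, A.tr F (A.dilN.δ ε (A.actN p b), v) * f (p, G.mul b (G.dilations.δ ε v)))
          * φ (p, b) := by
  have h := integrable_kernel A.dilN G.dilations hε (A.tr F) f
    (hasTemperateGrowth_rightKernel (G := G))
    (hasTemperateGrowth_rightKernel' (G := G)) rightKernel_inv A.hasTemperateGrowth_actN φ p
  have ht : Function.HasTemperateGrowth fun q : (Fin n → ℝ) × (Fin n → ℝ) =>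
      (p, G.mul q.1 (G.dilations.δ ε q.2)) :=
    HasTemperateGrowth.prodMk (.const p) (G.hasTemperateGrowth_mul_comp hasTemperateGrowth_fst
      ((ContinuousLinearMap.hasTemperateGrowth _).comp hasTemperateGrowth_snd))
  have h' : Integrable (fun q : (Fin n → ℝ) × (Fin n → ℝ) => f (p, q.1)
      * F (A.dilN.δ ε (A.actN p q.1), q.2) * φ (p, G.mul q.1 (G.dilations.δ ε q.2))) := by
    have h1 := ((f.isSchwartz.tensor F.isSchwartz).comp
      (h := fun q : (Fin n → ℝ) × (Fin n → ℝ) => ((p, q.1), (A.dilN.δ ε (A.actN p q.1), q.2)))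
      (HasTemperateGrowth.prodMk (HasTemperateGrowth.prodMk (.const p) hasTemperateGrowth_fst)
        (HasTemperateGrowth.prodMk ((ContinuousLinearMap.hasTemperateGrowth _).comp
          (A.hasTemperateGrowth_actN.comp (HasTemperateGrowth.prodMk (.const p)
            hasTemperateGrowth_fst))) hasTemperateGrowth_snd))
      (g := fun q => (q.1.2, q.2.2)) (HasTemperateGrowth.prodMk
        (hasTemperateGrowth_snd.comp hasTemperateGrowth_fst)
        (hasTemperateGrowth_snd.comp hasTemperateGrowth_snd)) fun q => rfl).mul_OM
      (OM.pullback _ ht φ)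
    have : (volume : Measure ((Fin n → ℝ) × (Fin n → ℝ))).IsAddHaarMeasure :=
      Measure.prod.instIsAddHaarMeasure volume volume
    exact h1.integrable volume
  simp only [← integral_const_mul, ← integral_mul_const, ← _root_.mul_assoc]
  rw [integral_integral_swap (f := fun a v => f (p, a)
    * F (A.dilN.δ ε (A.actN p a), v) * φ (p, G.mul a (G.dilations.δ ε v))) h',
    integral_integral_swap (f := fun b v => A.tr F (A.dilN.δ ε (A.actN p b), v)
      * f (p, G.mul b (G.dilations.δ ε v)) * φ (p, b)) h, ← integral_neg_eq_self]
  refine integral_congr_ae (Filter.Eventually.of_forall fun v => ?_)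
  simp only
  rw [← G.integral_mul_right (G.dilations.δ ε v)]
  refine integral_congr_ae (Filter.Eventually.of_forall fun b => ?_)
  simp only [tr_apply, A.actN_dil, map_neg, G.mul_mul_neg, A.actN_mul]
  ring

/-- Here the dyadic series of the second factor stands under the integral over `a`. Its terms form a
flat family in `a` with moving base point `x·a`, which is why the integral against `f` may be taken
termwise. -/
lemma ofSchwartz_conv_mem {m : ℝ} {Q : TangentDist d n} (hQ : Q ∈ A.EssTangent m)
    (f : 𝓢(((Fin d → ℝ) × ℝ) × (Fin n → ℝ), ℂ)) :
    A.conv (ofSchwartz f) Q ∈ schwartzDist ((Fin d → ℝ) × ℝ) (Fin n → ℝ) := by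
  obtain ⟨S, F, hF, hdec⟩ := A.exists_decomposition_tangent hQ
  rw [hdec, conv_add_right]
  refine add_mem ?_ ?_
  · obtain ⟨h, hh⟩ := exists_schwartz_eq_integral_kernel A.dilN G.dilations (A.tr S) f
      (hasTemperateGrowth_rightKernel (G := G)) (hasTemperateGrowth_rightKernel' (G := G))
      rightKernel_inv A.hasTemperateGrowth_actN
    refine ⟨h, fun φ x => ?_⟩
    have h1 := A.integral_right S f φ x (ε := 1) (by simp)
    simp only [hh]
    rw [← h1, conv_apply, ofSchwartz_apply]
    simp only [A.dilN.one, G.dilations.one]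
    rfl
  · obtain ⟨h, hh⟩ := exists_schwartz_hasSum_kernel A.dilN G.dilations m (A.flatOp_tr hF) f
      (hasTemperateGrowth_rightKernel (G := G)) (hasTemperateGrowth_rightKernel' (G := G))
      rightKernel_inv A.hasTemperateGrowth_actN
    refine ⟨h, fun φ x => ?_⟩
    have h1 := hh φ x
    have h2 : ∀ j : ℕ, |(1 / 2 : ℝ) ^ j| ≤ 1 := fun j => by
      rw [abs_of_nonneg (by positivity)]
      exact pow_le_one₀ (by norm_num) (by norm_num)
    simp only [← fun j => A.integral_right F f φ x (h2 j)] at h1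
    have hx : Function.HasTemperateGrowth fun a : Fin n → ℝ => A.actN x a :=
      A.hasTemperateGrowth_actN.comp (hasTemperateGrowth_mk_left x)
    let φ' : OM ((Fin n → ℝ) × (Fin n → ℝ)) := OM.pullback (fun q => (x, G.mul q.1 q.2))
      (HasTemperateGrowth.prodMk (.const x) G.hasTemperateGrowth_mul) φ
    let Θ := fam A.dilN G.dilations (ofSchwartz F).op _ hx φ'
    have hΘ : ∀ ε a, Θ (ε, a) = ∫ v, F (A.dilN.δ ε (A.actN x a), v)
        * φ (x, G.mul a (G.dilations.δ ε v)) := fun ε a =>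
      fam_ofSchwartz_apply A.dilN G.dilations F _ hx φ' ε a
    have hflat : Θ ∈ OM.flat _ := fam_mem_flat A.dilN G.dilations hF _ hx φ'
    set U := flatDist A.dilN G.dilations m (ofSchwartz F).op hF
    have h3 : ∀ a, flatSum m ⟨Θ, hflat⟩ a = A.convOp U φ (x, a) := fun a =>
      (hasSum_flatSum m ⟨Θ, hflat⟩ a).unique
        (hasSum_flatDist_slice A.dilN G.dilations m _ hF _ hx φ' a)
    obtain ⟨g, hg⟩ := f.isSchwartz.comp (hasTemperateGrowth_mk_left x) hasTemperateGrowth_snd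
      fun a => rfl
    have h4 := hasSum_integral_dyadic m hflat g.isSchwartz
    simp only [h3, hg] at h4
    rw [conv_apply, ofSchwartz_apply]
    refine h4.unique ?_
    convert h1 using 2 with j
    simp only [dyadic, hΘ, mul_left_comm (f _)]
    rw [integral_const_mul]
    push_cast
    rfl

/-- Essentially homogeneous fibred distributions on the tangent groupoid form an algebra. -/
theorem conv_mem_EssTangent {l m : ℝ} {P Q : TangentDist d n} (hP : P ∈ A.EssTangent l)
    (hQ : Q ∈ A.EssTangent m) : A.conv P Q ∈ A.EssTangent (l + m) := by
  refine A.mem_EssTangent.2 fun s hs => ?_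
  have hPs := A.mem_EssTangent.1 hP s hs
  have hQs := A.mem_EssTangent.1 hQ s hs
  -- The rescaling of `P` differs from a multiple of `P` by a Schwartz distribution, so the ideal
  -- property applies to it.
  have hzP : A.zoom s hs P ∈ A.EssTangent l := by
    have h := sub_mem (Submodule.smul_mem _ ((s ^ l : ℝ) : ℂ) hP)
      (A.schwartz_mem_EssTangent (m := l) hPs)
    rwa [sub_sub_cancel] at h
  obtain ⟨f, hf⟩ := mem_schwartzDist_iff.1 hPs
  obtain ⟨g, hg⟩ := mem_schwartzDist_iff.1 hQs
  have h1 := A.ofSchwartz_conv_mem hQ f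
  have h2 := A.conv_ofSchwartz_mem _ hzP g
  rw [← hf] at h1
  rw [← hg] at h2
  -- As the zoom is multiplicative, the defect of `P * Q` is `s^m (s^l P - τ_*P) * Q + τ_*P * (s^m Q
  -- - τ_*Q)`.
  have h3 := add_mem (Submodule.smul_mem _ ((s ^ m : ℝ) : ℂ) h1) h2
  convert h3 using 1
  rw [zoom_conv, conv_sub_left, conv_smul_left, conv_sub_right, conv_smul_right, smul_sub,
    smul_smul, Real.rpow_add hs, mul_comm, Complex.ofReal_mul]
  abel

/-- Convolutions of pseudodifferential fibred distributions and of their cosymbols. -/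
theorem exists_conv_psi (l m : ℝ) (P : A.Psi l) (Q : A.Psi m) : ∃ R : A.Psi (l + m),
    G.IsConvolution (A.act 1) P.1 Q.1 R.1 ∧
      A.IsCosymbolProduct (A.sigma l P) (A.sigma m Q) (A.sigma (l + m) R) := by
  obtain ⟨P', hP, hPP⟩ := P.2
  obtain ⟨Q', hQ, hQQ⟩ := Q.2
  have hR := A.conv_mem_EssTangent hP hQ
  refine ⟨⟨ev 1 (A.conv P' Q'), _, hR, rfl⟩, ?_, fun u w hu hw => ?_⟩
  · have h := A.isConvolution_ev 1 P' Q'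
    rw [hPP, hQQ] at h
    exact h
  · rw [A.sigma_eq P hP hPP] at hu
    rw [A.sigma_eq Q hQ hQQ] at hw
    obtain ⟨S, hS⟩ := A.exists_extension hP hu
    obtain ⟨T, hT⟩ := A.exists_extension hQ hw
    have hP' := add_mem hP (A.ofSchwartz_mem_EssTangent l S)
    have hQ' := add_mem hQ (A.ofSchwartz_mem_EssTangent m T)
    refine ⟨⟨ev 0 (A.conv (P' + ofSchwartz S) (Q' + ofSchwartz T)),
      A.ev_mem_Ess (A.conv_mem_EssTangent hP' hQ')⟩, ?_, ?_⟩
    · have h := A.isConvolution_ev 0 (P' + ofSchwartz S) (Q' + ofSchwartz T)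
      rw [← hS, ← hT] at h
      exact h
    · rw [A.sigma_eq _ hR rfl]
      refine A.cls_eq_of_sub_mem ?_
      change ev 0 (A.conv (P' + ofSchwartz S) (Q' + ofSchwartz T)) - ev 0 (A.conv P' Q') ∈ _
      rw [← map_sub]
      refine ev_mem_schwartzDist 0 ?_
      -- `(P' + S) * (Q' + T) - P' * Q' = P' * T + S * (Q' + T)`, and both summands are Schwartz.
      have h := add_mem (A.conv_ofSchwartz_mem P' hP T) (A.ofSchwartz_conv_mem hQ' S)
      convert h using 1
      rw [conv_add_left, conv_add_right]
      abel

end ShubinAction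

end Shubin

/-! ### The theorem. -/

theorem mainTheorem1 {d n : ℕ} (G : Shubin.GradedLieGroup n) (A : Shubin.ShubinAction d G) :
    -- the principal cosymbol does not depend on the chosen extension
    (∀ (m : ℝ) (P : Shubin.TangentDist d n) (hP : P ∈ A.EssTangent m),
      A.sigma m ⟨Shubin.ev 1 P, P, hP, rfl⟩ = A.cls ⟨Shubin.ev 0 P, A.ev_mem_Ess hP⟩) ∧
    -- convolution
    (∀ (l m : ℝ) (P : A.Psi l) (Q : A.Psi m), ∃ R : A.Psi (l + m),
      G.IsConvolution (A.act 1) P.1 Q.1 R.1 ∧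
      A.IsCosymbolProduct (A.sigma l P) (A.sigma m Q) (A.sigma (l + m) R)) ∧
    -- adjoint and transpose
    (∀ (m : ℝ) (P : A.Psi m),
      (∃ R : A.Psi m, Shubin.IsAdjoint (A.act 1) P.1 R.1 ∧
        A.IsCosymbolAdjoint (A.sigma m P) (A.sigma m R)) ∧
      (∃ R : A.Psi m, Shubin.IsTranspose (A.act 1) P.1 R.1 ∧
        A.IsCosymbolTranspose (A.sigma m P) (A.sigma m R))) := by
  exact ⟨fun m P hP => A.sigma_eq _ hP rfl, A.exists_conv_psi,
    fun m P => ⟨A.exists_adjoint_psi m P, A.exists_transpose_psi m P⟩⟩
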